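/- **Computads.** A (strict) $\omega$-category $\mathbf A$ has sets $A_n$ of $n$-cells, iterated domains and codomains $d^{(k)},c^{(k)}:A_n\to A_k$ ($k\le n$; $d,c$ for $k=n-1$), identities $1_a^{(m)}\in A_m$ ($a\in A_n$, $n\le m$) and compositions $u\bullet_k v$ of $n$-cells ($k<n$), defined iff $d^{(k)}u=c^{(k)}v$, subject to the usual axioms. A *computad* is an $\omega$-category in which, for every $n$, the $(n+1)$-truncation is freely generated over the $n$-truncation by a set of $(n+1)$-cells, the *$(n+1)$-indets* (every functor from the $n$-truncation to an $\omega$-category, with a compatible choice of images of the $(n+1)$-indets, extends uniquely to the $(n+1)$-truncation); all $0$-cells are $0$-indets. A *computad functor* is an $\omega$-functor mapping indets to indets. A computad is *many-to-one* if the codomain of every $(n+1)$-indet is an $n$-indet. $m/1Comp$ is the category of (small) many-to-one computads and computad functors. A cell of such a computad is *many-to-one* if it is a $0$-cell or its codomain is an indet. **Occurrences and replacement.** A *parametrization* of a many-to-one computad assigns to every $n$-cell $u$ a finite indexed set $\langle u\rangle:|u|\to\{n\text{-indets}\}$ of occurrences of $n$-indets in $u$ (one occurrence, of $x$ itself, if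 $u=x$ is an indet; none if $u$ is an identity $1_a$), with coprojections exhibiting $|u\bullet_k v|$ as the disjoint union of $|u|$ and $|v|$ over the set of indets, and compatible with the associativity, exchange and identity axioms; and it has the *replacement* operations: for an $n$-cell $u$, $r\in|u|$, $x=\langle u\rangle(r)$, and an $m$-cell $v$, $m\ge n$, with $d^{(n-1)}v=dx$, $c^{(n-1)}v=cx$ (no condition if $n=0$), an $m$-cell $u\,\square_r v$ with the same $k$-dimensional domain and codomain as $u$ for $k<n$, such that $x\,\square_r v=v$ and $(u'\bullet_k u'')\,\square_r v$ is $(u'\,\square_r v)\bullet_k 1^{(m)}_{u''}$ or $1^{(m)}_{u'}\bullet_k(u''\,\square_r v)$ according to where $r$ occurs, with the coprojections induced by this (which exhibit $|u\,\square_r v|$ as the disjoint union of $|u|\setminus\{r\}$ and $|v|$ if $m=n$, and as $|v|$ if $m>n$). For $(n+1)$-cells $u,v$ and $r\in|du|$ with $cv=\langle du\rangle(r)$, the *placed composition* is $u\circ_r v=u\bullet_n(du\,\square_r v)$. **Multitopic sets.** A *multicategory* has a set of objects, a set of arrows, for each arrow $u$ a source $Su:|Su|\to\{\text{objects}\}$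 with $|Su|$ finite and a target object $Tu$, identities $1_x$ (with source $\langle x\rangle$ and target $x$), and operations $u\odot_r v$, defined iff $r\in|Su|$ and $Tv=Su(r)$, with $T(u\odot_r v)=Tu$ and with specified coprojections exhibiting $|S(u\odot_r v)|$ as the disjoint union of $|Su|\setminus\{r\}$ and $|Sv|$ over the objects, satisfying the identity, associativity and commutativity laws, the equalities of arrows including those of the coprojections. (More generally objects may have types in a further set, $Tu$ being a type.) Morphisms are maps of objects, types and arrows, with bijections of the index sets of sources, that preserve this structure. $\mathbb C$ is *freely generated* by a set $J$ of its arrows if every morphism from its objects and types to those of a multicategory $\mathbb D$ and every consistent map from $J$ to the arrows of $\mathbb D$ (with bijections of the sources) extend to a unique morphism $\mathbb C\to\mathbb D$. A *multitopic set* consists of sets $P_n$ ($n$-pasting diagrams) with subsets $C_n\subseteq P_n$ ($n$-indets), $C_0=P_0$, maps $d:P_{n+1}\to P_n$, $c:P_{n+1}\to C_n$, and, for each $n$, a multicategory $\mathbb C_{n+1}$ with objects $C_n$ and arrows $P_{n+1}$, freely generated by $C_{n+1}$, with $Su=\langle du\rangle$ and $Tu=cu$. Here $\langle u\rangle:|u|\to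 C_n$ is the finite indexed set of occurrences of indets in $u\in P_n$: one occurrence, of $u$ itself, if $u$ is an indet; none if $u$ is an identity; $|u\odot_r v|$ is the disjoint union of $|u|$ and $|v|$, by coprojections compatible with the multicategory laws. It is required that $d1_x=c1_x=x$; $ddu=dcu$ and $cdu=ccu$; $c(u\odot_r v)=cu$; and that $d(u\odot_r v)$ is the result $du\,\square_r\,dv$ of replacing the $r$-occurrence of $cv$ in $du$ by the parallel arrow $dv$, with the same coprojections. (Replacement of an occurrence of an indet $f$ by an arrow parallel to $f$ is determined by: $u\,\square_r v$ is parallel to $u$, $f\,\square_r v=v$, and $(u\odot_j w)\,\square_r v$ is $(u\,\square_r v)\odot_j w$ or $u\odot_j(w\,\square_r v)$ according to where $r$ occurs.) A *morphism* of multitopic sets is a sequence of maps $\varphi_n:P_n\to P'_n$ that map indets to indets, commute with $d$ and $c$, and are such that $(\varphi_n|_{C_n},\varphi_{n+1})$ is a morphism of multicategories $\mathbb C_{n+1}\to\mathbb C'_{n+1}$, the bijections between the sources $\langle du\rangle$ and $\langle d\varphi_{n+1}u\rangle$ being those that follow the occurrences (i.e. belonging to a family of bijections $|u|\to|\varphi_n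 u|$ over $\varphi_n|_{C_n}$ compatible with the coprojections). This gives the category $mltSet$. **Theorem.** Every many-to-one computad has a parametrization. Fix one for each many-to-one computad. For a many-to-one computad $\mathbf A$ let $S_{\mathbf A}$ be the structure whose $n$-pasting diagrams are the many-to-one $n$-cells of $\mathbf A$ and whose $n$-indets are the $n$-indets of $\mathbf A$, with the domains, codomains, identities $1_x$ on indets $x$ and indexed sets $\langle u\rangle$ of $\mathbf A$, and with placed composition $u\circ_r v$ as multicomposition. Then $S_{\mathbf A}$ is a multitopic set; the restriction $S_F$ to many-to-one cells of a computad functor $F:\mathbf A\to\mathbf A'$ is a morphism $S_{\mathbf A}\to S_{\mathbf A'}$; and the functor $S_-:m/1Comp\to mltSet$, $\mathbf A\mapsto S_{\mathbf A}$, $F\mapsto S_F$, is full and faithful. -/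

import Mathlib

open CategoryTheory

set_option linter.unusedVariables false

universe u

/-! ### Strict omega-categories -/

/-- A (small, strict) `ω`-category.  `d k`, `c k` are the iterated domain and codomain maps
`d^{(k)}`, `c^{(k)}` from `n`-cells to `k`-cells (`k ≤ n`), `one m a` is the `m`-dimensional identity
cell `1_a^{(m)}` on the cell `a`, and `comp k` is the partial composition `u •_k v`, which is defined
iff `d^{(k)} u = c^{(k)} v`. -/
structure OmegaCat where
  C : ℕ → Type u
  d : ∀ {n : ℕ} (k : ℕ), k ≤ n → C n → C k
  c : ∀ {n : ℕ} (k : ℕ), k ≤ n → C n → C k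
  one : ∀ {n : ℕ} (m : ℕ), n ≤ m → C n → C m
  comp : ∀ {n : ℕ} (k : ℕ) (hk : k < n) (u v : C n), d k hk.le u = c k hk.le v → C n
  d_self : ∀ {n : ℕ} (u : C n), d n le_rfl u = u
  c_self : ∀ {n : ℕ} (u : C n), c n le_rfl u = u
  one_self : ∀ {n : ℕ} (u : C n), one n le_rfl u = u
  -- iteration and globularity
  d_d : ∀ {n k m : ℕ} (hk : k ≤ m) (hm : m ≤ n) (u : C n),
    d k hk (d m hm u) = d k (hk.trans hm) u
  c_c : ∀ {n k m : ℕ} (hk : k ≤ m) (hm : m ≤ n) (u : C n),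
    c k hk (c m hm u) = c k (hk.trans hm) u
  d_c : ∀ {n k m : ℕ} (hk : k < m) (hm : m ≤ n) (u : C n),
    d k hk.le (c m hm u) = d k (hk.le.trans hm) u
  c_d : ∀ {n k m : ℕ} (hk : k < m) (hm : m ≤ n) (u : C n),
    c k hk.le (d m hm u) = c k (hk.le.trans hm) u
  -- boundaries of identities, iterated identities
  one_one : ∀ {n m l : ℕ} (h : n ≤ m) (h' : m ≤ l) (u : C n),
    one l h' (one m h u) = one l (h.trans h') u
  d_one : ∀ {n m : ℕ} (h : n ≤ m) (u : C n), d n h (one m h u) = u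
  c_one : ∀ {n m : ℕ} (h : n ≤ m) (u : C n), c n h (one m h u) = u
  -- boundaries of composites
  d_comp : ∀ {n k : ℕ} (hk : k < n) (u v : C n) (h : d k hk.le u = c k hk.le v),
    d k hk.le (comp k hk u v h) = d k hk.le v
  c_comp : ∀ {n k : ℕ} (hk : k < n) (u v : C n) (h : d k hk.le u = c k hk.le v),
    c k hk.le (comp k hk u v h) = c k hk.le u
  d_comp_of_lt : ∀ {n k m : ℕ} (hk : k < n) (hkm : k < m) (hm : m ≤ n) (u v : C n)
    (h : d k hk.le u = c k hk.le v) (h' : d k hkm.le (d m hm u) = c k hkm.le (d m hm v)),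
    d m hm (comp k hk u v h) = comp k hkm (d m hm u) (d m hm v) h'
  c_comp_of_lt : ∀ {n k m : ℕ} (hk : k < n) (hkm : k < m) (hm : m ≤ n) (u v : C n)
    (h : d k hk.le u = c k hk.le v) (h' : d k hkm.le (c m hm u) = c k hkm.le (c m hm v)),
    c m hm (comp k hk u v h) = comp k hkm (c m hm u) (c m hm v) h'
  -- associativity, exchange and identity axioms
  assoc : ∀ {n k : ℕ} (hk : k < n) (t s w : C n) (h₁ : d k hk.le t = c k hk.le s)
    (h₂ : d k hk.le (comp k hk t s h₁) = c k hk.le w) (h₃ : d k hk.le s = c k hk.le w)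
    (h₄ : d k hk.le t = c k hk.le (comp k hk s w h₃)),
    comp k hk (comp k hk t s h₁) w h₂ = comp k hk t (comp k hk s w h₃) h₄
  exchange : ∀ {n k l : ℕ} (hl : l < n) (hk : k < n) (_ : l < k) (t t' s s' : C n)
    (h₁ : d k hk.le t = c k hk.le t') (h₂ : d k hk.le s = c k hk.le s')
    (h₃ : d l hl.le (comp k hk t t' h₁) = c l hl.le (comp k hk s s' h₂))
    (h₄ : d l hl.le t = c l hl.le s) (h₅ : d l hl.le t' = c l hl.le s')
    (h₆ : d k hk.le (comp l hl t s h₄) = c k hk.le (comp l hl t' s' h₅)),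
    comp l hl (comp k hk t t' h₁) (comp k hk s s' h₂) h₃ =
      comp k hk (comp l hl t s h₄) (comp l hl t' s' h₅) h₆
  one_comp : ∀ {n k : ℕ} (hk : k < n) (b : C k) (t : C n)
    (h : d k hk.le (one n hk.le b) = c k hk.le t), comp k hk (one n hk.le b) t h = t
  comp_one : ∀ {n k : ℕ} (hk : k < n) (a : C k) (t : C n)
    (h : d k hk.le t = c k hk.le (one n hk.le a)), comp k hk t (one n hk.le a) h = t
  one_comp_one : ∀ {n m k : ℕ} (hk : k < n) (hm : n ≤ m) (a b : C n)
    (h : d k hk.le a = c k hk.le b)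
    (h' : d k (hk.le.trans hm) (one m hm a) = c k (hk.le.trans hm) (one m hm b)),
    comp k (hk.trans_le hm) (one m hm a) (one m hm b) h' = one m hm (comp k hk a b h)

namespace OmegaCat

theorem comp_congr (A : OmegaCat.{u}) {n k : ℕ} (hk : k < n) {u u' v v' : A.C n}
    (hu : u = u') (hv : v = v') (h : A.d k hk.le u = A.c k hk.le v)
    (h' : A.d k hk.le u' = A.c k hk.le v') : A.comp k hk u v h = A.comp k hk u' v' h' := by
  subst hu hv; rfl

theorem d_one_of_le (A : OmegaCat.{u}) {n m k : ℕ} (hk : k ≤ n) (h : n ≤ m) (u : A.C n) :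
    A.d k (hk.trans h) (A.one m h u) = A.d k hk u := by
  rw [← A.d_d hk h, A.d_one]

theorem c_one_of_le (A : OmegaCat.{u}) {n m k : ℕ} (hk : k ≤ n) (h : n ≤ m) (u : A.C n) :
    A.c k (hk.trans h) (A.one m h u) = A.c k hk u := by
  rw [← A.c_c hk h, A.c_one]

/-- `ω`-functors. -/
@[ext]
structure Functor (A B : OmegaCat.{u}) where
  map : ∀ {n : ℕ}, A.C n → B.C n
  map_d : ∀ {n k : ℕ} (hk : k ≤ n) (u : A.C n), map (A.d k hk u) = B.d k hk (map u)
  map_c : ∀ {n k : ℕ} (hk : k ≤ n) (u : A.C n), map (A.c k hk u) = B.c k hk (map u)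
  map_one : ∀ {n m : ℕ} (hm : n ≤ m) (u : A.C n), map (A.one m hm u) = B.one m hm (map u)
  map_comp : ∀ {n k : ℕ} (hk : k < n) (u v : A.C n) (h : A.d k hk.le u = A.c k hk.le v)
    (h' : B.d k hk.le (map u) = B.c k hk.le (map v)),
    map (A.comp k hk u v h) = B.comp k hk (map u) (map v) h'

/-- `ω`-functors from the `N`-th truncation `A_N` of `A` to `B`: structure preserving maps defined on
the cells of `A` of dimension at most `N`. -/
@[ext]
structure TruncFunctor (A B : OmegaCat.{u}) (N : ℕ) where
  map : ∀ {n : ℕ}, n ≤ N → A.C n → B.C n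
  map_d : ∀ {n k : ℕ} (hn : n ≤ N) (hk : k ≤ n) (u : A.C n),
    map (hk.trans hn) (A.d k hk u) = B.d k hk (map hn u)
  map_c : ∀ {n k : ℕ} (hn : n ≤ N) (hk : k ≤ n) (u : A.C n),
    map (hk.trans hn) (A.c k hk u) = B.c k hk (map hn u)
  map_one : ∀ {n m : ℕ} (hm : m ≤ N) (h : n ≤ m) (u : A.C n),
    map hm (A.one m h u) = B.one m h (map (h.trans hm) u)
  map_comp : ∀ {n k : ℕ} (hn : n ≤ N) (hk : k < n) (u v : A.C n)
    (h : A.d k hk.le u = A.c k hk.le v)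
    (h' : B.d k hk.le (map hn u) = B.c k hk.le (map hn v)),
    map hn (A.comp k hk u v h) = B.comp k hk (map hn u) (map hn v) h'

/-- The `(n+1)`-st truncation of `A` is a free extension of the `n`-th one, freely generated by the
set `I` of `(n+1)`-cells: a functor `F` on `A_n` and a map `φ` on `I` that is consistent with `F`
extend uniquely to a functor on `A_{n+1}`. -/
def IsFreeExtension (A : OmegaCat.{u}) (n : ℕ) (I : Set (A.C (n + 1))) : Prop :=
  ∀ (X : OmegaCat.{u}) (F : TruncFunctor A X n) (φ : I → X.C (n + 1)),
    (∀ x : I, X.d n n.le_succ (φ x) = F.map le_rfl (A.d n n.le_succ x.1)) →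
    (∀ x : I, X.c n n.le_succ (φ x) = F.map le_rfl (A.c n n.le_succ x.1)) →
    ∃! G : TruncFunctor A X (n + 1),
      (∀ {k : ℕ} (hk : k ≤ n) (a : A.C k), G.map (hk.trans n.le_succ) a = F.map hk a) ∧
        ∀ x : I, G.map le_rfl x.1 = φ x

/-- The sub-`ω`-category carried by a family of sets of cells that is closed under the operations. -/
def sub (A : OmegaCat.{u}) (S : ∀ n, Set (A.C n))
    (hd : ∀ {n k : ℕ} (hk : k ≤ n) (u : A.C n), u ∈ S n → A.d k hk u ∈ S k)
    (hc : ∀ {n k : ℕ} (hk : k ≤ n) (u : A.C n), u ∈ S n → A.c k hk u ∈ S k)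
    (ho : ∀ {n m : ℕ} (hm : n ≤ m) (u : A.C n), u ∈ S n → A.one m hm u ∈ S m)
    (hcomp : ∀ {n k : ℕ} (hk : k < n) (u v : A.C n) (h : A.d k hk.le u = A.c k hk.le v),
      u ∈ S n → v ∈ S n → A.comp k hk u v h ∈ S n) : OmegaCat.{u} where
  C n := {u : A.C n // u ∈ S n}
  d k hk u := ⟨A.d k hk u.1, hd hk _ u.2⟩
  c k hk u := ⟨A.c k hk u.1, hc hk _ u.2⟩
  one m hm u := ⟨A.one m hm u.1, ho hm _ u.2⟩
  comp k hk u v h := ⟨A.comp k hk u.1 v.1 (congrArg Subtype.val h), hcomp hk _ _ _ u.2 v.2⟩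
  d_self u := Subtype.ext (A.d_self _)
  c_self u := Subtype.ext (A.c_self _)
  one_self u := Subtype.ext (A.one_self _)
  d_d hk hm u := Subtype.ext (A.d_d hk hm _)
  c_c hk hm u := Subtype.ext (A.c_c hk hm _)
  d_c hk hm u := Subtype.ext (A.d_c hk hm _)
  c_d hk hm u := Subtype.ext (A.c_d hk hm _)
  one_one h h' u := Subtype.ext (A.one_one h h' _)
  d_one h u := Subtype.ext (A.d_one h _)
  c_one h u := Subtype.ext (A.c_one h _)
  d_comp hk u v h := Subtype.ext (A.d_comp hk _ _ _)
  c_comp hk u v h := Subtype.ext (A.c_comp hk _ _ _)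
  d_comp_of_lt hk hkm hm u v h h' := Subtype.ext (A.d_comp_of_lt hk hkm hm _ _ _ _)
  c_comp_of_lt hk hkm hm u v h h' := Subtype.ext (A.c_comp_of_lt hk hkm hm _ _ _ _)
  assoc hk t s w h₁ h₂ h₃ h₄ := Subtype.ext (A.assoc hk _ _ _ _ _ _ _)
  exchange hl hk hlk t t' s s' h₁ h₂ h₃ h₄ h₅ h₆ :=
    Subtype.ext (A.exchange hl hk hlk _ _ _ _ _ _ _ _ _ _)
  one_comp hk b t h := Subtype.ext (A.one_comp hk _ _ _)
  comp_one hk a t h := Subtype.ext (A.comp_one hk _ _ _)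
  one_comp_one hk hm a b h h' := Subtype.ext (A.one_comp_one hk hm _ _ _ _)

/-- Induction on the cells of a free extension. -/
theorem IsFreeExtension.induction {A : OmegaCat.{u}} {n : ℕ} {I : Set (A.C (n + 1))}
    (hI : A.IsFreeExtension n I) (p : A.C (n + 1) → Prop) (hx : ∀ x ∈ I, p x)
    (ho : ∀ a : A.C n, p (A.one (n + 1) n.le_succ a))
    (hcomp : ∀ (k : ℕ) (hk : k < n + 1) (u v : A.C (n + 1)) (h : A.d k hk.le u = A.c k hk.le v),
      p u → p v → p (A.comp k hk u v h)) (u : A.C (n + 1)) : p u := by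
  let S : ∀ k, Set (A.C k) := fun k =>
    {u | ∀ h : n + 1 ≤ k, p (A.d (n + 1) h u) ∧ p (A.c (n + 1) h u)}
  have S_low : ∀ {k : ℕ} (_ : k ≤ n) (a : A.C k), a ∈ S k := fun hk a h => by omega
  have S_top : ∀ a : A.C (n + 1), a ∈ S (n + 1) ↔ p a := fun a =>
    ⟨fun h => A.d_self a ▸ (h le_rfl).1, fun h _ => by
      rw [A.d_self, A.c_self]; exact ⟨h, h⟩⟩
  let X : OmegaCat.{u} := A.sub S
    (fun {m k} hk a ha h => by
      have := ha (h.trans hk)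
      rw [A.d_d]
      rcases h.lt_or_eq with h' | h'
      · rw [A.c_d h']; exact this
      · subst h'; rw [A.c_self]; exact ⟨this.1, this.1⟩)
    (fun {m k} hk a ha h => by
      have := ha (h.trans hk)
      rw [A.c_c]
      rcases h.lt_or_eq with h' | h'
      · rw [A.d_c h']; exact this
      · subst h'; rw [A.d_self]; exact ⟨this.2, this.2⟩)
    (fun {k m} hm a ha h => by
      rcases Nat.lt_or_ge k (n + 1) with hk | hk
      · have e : A.one m hm a =
            A.one m h (A.one (n + 1) n.le_succ (A.one n (Nat.lt_succ_iff.1 hk) a)) := by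
          rw [A.one_one, A.one_one]
        rw [e, A.d_one, A.c_one]; exact ⟨ho _, ho _⟩
      · have := ha hk
        rw [← A.d_d hk hm, ← A.c_c hk hm, A.d_one, A.c_one]; exact this)
    (fun {m k} hk a b hab ha hb h => by
      have ha' := ha h
      have hb' := hb h
      rcases lt_trichotomy k (n + 1) with h' | h' | h'
      · have e₁ : A.d k h'.le (A.d (n + 1) h a) = A.c k h'.le (A.d (n + 1) h b) := by
          rw [A.d_d, A.c_d h', hab]
        have e₂ : A.d k h'.le (A.c (n + 1) h a) = A.c k h'.le (A.c (n + 1) h b) := by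
          rw [A.c_c, A.d_c h', hab]
        rw [A.d_comp_of_lt hk h' h a b hab e₁, A.c_comp_of_lt hk h' h a b hab e₂]
        exact ⟨hcomp _ _ _ _ _ ha'.1 hb'.1, hcomp _ _ _ _ _ ha'.2 hb'.2⟩
      · subst h'
        rw [A.d_comp, A.c_comp]; exact ⟨hb'.1, ha'.2⟩
      · rw [← A.d_d h'.le hk.le, ← A.c_c h'.le hk.le, A.d_comp, A.c_comp, A.d_d, A.c_c]
        exact ⟨hb'.1, ha'.2⟩)
  let F : TruncFunctor A X n :=
    { map := fun hk a => ⟨a, S_low hk a⟩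
      map_d := fun _ _ _ => rfl
      map_c := fun _ _ _ => rfl
      map_one := fun _ _ _ => rfl
      map_comp := fun _ _ _ _ _ _ => rfl }
  obtain ⟨G, ⟨hG₁, hG₂⟩, -⟩ := hI X F (fun x => ⟨x.1, (S_top _).2 (hx _ x.2)⟩)
    (fun _ => rfl) (fun _ => rfl)
  let E : TruncFunctor A A n :=
    { map := fun _ a => a
      map_d := fun _ _ _ => rfl
      map_c := fun _ _ _ => rfl
      map_one := fun _ _ _ => rfl
      map_comp := fun _ _ _ _ _ _ => rfl }
  let E' : TruncFunctor A A (n + 1) :=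
    { map := fun _ a => a
      map_d := fun _ _ _ => rfl
      map_c := fun _ _ _ => rfl
      map_one := fun _ _ _ => rfl
      map_comp := fun _ _ _ _ _ _ => rfl }
  let G' : TruncFunctor A A (n + 1) :=
    { map := fun hk a => (G.map hk a).1
      map_d := fun hn hk a => congrArg Subtype.val (G.map_d hn hk a)
      map_c := fun hn hk a => congrArg Subtype.val (G.map_c hn hk a)
      map_one := fun hn hk a => congrArg Subtype.val (G.map_one hn hk a)
      map_comp := fun hn hk a b h h' =>
        congrArg Subtype.val (G.map_comp hn hk a b h (Subtype.ext h')) }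
  have key : G' = E' := (hI A E (fun x => x.1) (fun _ => rfl) (fun _ => rfl)).unique
    ⟨fun hk a => congrArg Subtype.val (hG₁ hk a), fun x => congrArg Subtype.val (hG₂ x)⟩
    ⟨fun _ _ => rfl, fun _ => rfl⟩
  have h₁ : (G.map le_rfl u).1 = u := by
    have h := congrArg (fun H : TruncFunctor A A (n + 1) => H.map le_rfl u) key
    exact h
  rw [← h₁]
  exact (S_top _).1 (G.map le_rfl u).2

end OmegaCat

/-! ### Computads -/

/-- A computad: an `ω`-category in which every `A_{n+1}` is a free extension of `A_n`.  `indet n` is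
the set of `n`-indeterminates; it is uniquely determined by the `ω`-category, and it consists of all
the cells when `n = 0`. -/
structure Computad extends OmegaCat.{u} where
  indet : ∀ n, Set (C n)
  indet_zero : indet 0 = Set.univ
  free : ∀ n, toOmegaCat.IsFreeExtension n (indet (n + 1))

/-- Computad functors: `ω`-functors that map indeterminates to indeterminates. -/
@[ext]
structure ComputadFunctor (A B : Computad.{u}) extends
    OmegaCat.Functor A.toOmegaCat B.toOmegaCat where
  map_indet : ∀ {n : ℕ} (x : A.C n), x ∈ A.indet n → map x ∈ B.indet n

/-- A many-to-one computad: the codomain of an `(n+1)`-indeterminate is an `n`-indeterminate. -/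
structure ManyToOneComputad extends Computad.{u} where
  cod_indet : ∀ (n : ℕ) (x : C (n + 1)), x ∈ indet (n + 1) → c n n.le_succ x ∈ indet n

/-- The category of many-to-one computads and computad functors. -/
instance : Category ManyToOneComputad.{u} where
  Hom A B := ComputadFunctor A.toComputad B.toComputad
  id A :=
    { map := fun u => u
      map_d := fun _ _ => rfl
      map_c := fun _ _ => rfl
      map_one := fun _ _ => rfl
      map_comp := fun _ _ _ _ _ => rfl
      map_indet := fun _ h => h }
  comp {A B D} F G :=
    { map := fun u => G.map (F.map u)
      map_d := fun hk u => by rw [F.map_d, G.map_d]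
      map_c := fun hk u => by rw [F.map_c, G.map_c]
      map_one := fun hk u => by rw [F.map_one, G.map_one]
      map_comp := fun hk u v h h' => by
        have e : B.d _ hk.le (F.map u) = B.c _ hk.le (F.map v) := by
          rw [← F.map_d, ← F.map_c, h]
        rw [F.map_comp hk u v h e, G.map_comp hk _ _ e h']
      map_indet := fun x h => G.map_indet _ (F.map_indet x h) }

/-! ### Occurrences of indeterminates, replacement and placed composition -/

/-- Elements `p` and `q` of members of a family of types are the same element (of the same member). -/
def Same {α : Type*} (T : α → Type*) {a b : α} (p : T a) (q : T b) : Prop :=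
  (⟨a, p⟩ : Sigma T) = ⟨b, q⟩

namespace Computad

/-- Indexed sets `⟨u⟩ : |u| → indet n` of indet occurrences, for all cells `u` of a computad.
`Occ u` is the index set `|u|`, and `lab u : |u| → indet n` is the indexed set `⟨u⟩`.  The maps `occL`,
`occR` are the specified coprojections which exhibit `|u •_k v|` as the disjoint union of `|u|` and
`|v|`; the laws say that they follow every occurrence through the axioms of `ω`-categories. -/
structure OccSystem (A : Computad.{u}) where
  Occ : ∀ {n : ℕ}, A.C n → Type
  finite_occ : ∀ {n : ℕ} (u : A.C n), Finite (Occ u)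
  lab : ∀ {n : ℕ} (u : A.C n), Occ u → A.C n
  lab_mem : ∀ {n : ℕ} (u : A.C n) (r : Occ u), lab u r ∈ A.indet n
  occL : ∀ {n k : ℕ} (hk : k < n) (u v : A.C n) (h : A.d k hk.le u = A.c k hk.le v),
    Occ u → Occ (A.comp k hk u v h)
  occR : ∀ {n k : ℕ} (hk : k < n) (u v : A.C n) (h : A.d k hk.le u = A.c k hk.le v),
    Occ v → Occ (A.comp k hk u v h)
  bijective : ∀ {n k : ℕ} (hk : k < n) (u v : A.C n) (h : A.d k hk.le u = A.c k hk.le v),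
    Function.Bijective (Sum.elim (occL hk u v h) (occR hk u v h))
  lab_occL : ∀ {n k : ℕ} (hk : k < n) (u v : A.C n) (h : A.d k hk.le u = A.c k hk.le v)
    (r : Occ u), lab _ (occL hk u v h r) = lab u r
  lab_occR : ∀ {n k : ℕ} (hk : k < n) (u v : A.C n) (h : A.d k hk.le u = A.c k hk.le v)
    (r : Occ v), lab _ (occR hk u v h r) = lab v r
  occ_indet : ∀ {n : ℕ} (x : A.C n), x ∈ A.indet n →
    (∃! _ : Occ x, True) ∧ ∀ r : Occ x, lab x r = x
  occ_one : ∀ {n : ℕ} (a : A.C n), IsEmpty (Occ (A.one (n + 1) n.le_succ a))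
  assoc : ∀ {n k : ℕ} (hk : k < n) (t s w : A.C n) (h₁ : A.d k hk.le t = A.c k hk.le s)
    (h₂ : A.d k hk.le (A.comp k hk t s h₁) = A.c k hk.le w) (h₃ : A.d k hk.le s = A.c k hk.le w)
    (h₄ : A.d k hk.le t = A.c k hk.le (A.comp k hk s w h₃)),
    (∀ p : Occ t, Same Occ (occL hk _ w h₂ (occL hk t s h₁ p)) (occL hk t _ h₄ p)) ∧
    (∀ p : Occ s, Same Occ (occL hk _ w h₂ (occR hk t s h₁ p))
      (occR hk t _ h₄ (occL hk s w h₃ p))) ∧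
    (∀ p : Occ w, Same Occ (occR hk _ w h₂ p) (occR hk t _ h₄ (occR hk s w h₃ p)))
  exchange : ∀ {n k l : ℕ} (hl : l < n) (hk : k < n) (_ : l < k) (t t' s s' : A.C n)
    (h₁ : A.d k hk.le t = A.c k hk.le t') (h₂ : A.d k hk.le s = A.c k hk.le s')
    (h₃ : A.d l hl.le (A.comp k hk t t' h₁) = A.c l hl.le (A.comp k hk s s' h₂))
    (h₄ : A.d l hl.le t = A.c l hl.le s) (h₅ : A.d l hl.le t' = A.c l hl.le s')
    (h₆ : A.d k hk.le (A.comp l hl t s h₄) = A.c k hk.le (A.comp l hl t' s' h₅)),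
    (∀ p : Occ t, Same Occ (occL hl _ _ h₃ (occL hk t t' h₁ p))
      (occL hk _ _ h₆ (occL hl t s h₄ p))) ∧
    (∀ p : Occ t', Same Occ (occL hl _ _ h₃ (occR hk t t' h₁ p))
      (occR hk _ _ h₆ (occL hl t' s' h₅ p))) ∧
    (∀ p : Occ s, Same Occ (occR hl _ _ h₃ (occL hk s s' h₂ p))
      (occL hk _ _ h₆ (occR hl t s h₄ p))) ∧
    (∀ p : Occ s', Same Occ (occR hl _ _ h₃ (occR hk s s' h₂ p))
      (occR hk _ _ h₆ (occR hl t' s' h₅ p)))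
  one_comp : ∀ {n k : ℕ} (hk : k < n) (b : A.C k) (t : A.C n)
    (h : A.d k hk.le (A.one n hk.le b) = A.c k hk.le t) (p : Occ t),
    Same Occ (occR hk _ t h p) p
  comp_one : ∀ {n k : ℕ} (hk : k < n) (a : A.C k) (t : A.C n)
    (h : A.d k hk.le t = A.c k hk.le (A.one n hk.le a)) (p : Occ t),
    Same Occ (occL hk t _ h p) p

/-- The `m`-cell `v`, `m ≥ n`, may replace an occurrence of the `n`-indeterminate `x`: if `n > 0`,
`d^{(n-1)} v = d x` and `c^{(n-1)} v = c x` (equivalently, the same in all dimensions below `n`). -/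
def Fits (A : Computad.{u}) {n m : ℕ} (h : n ≤ m) (v : A.C m) (x : A.C n) : Prop :=
  ∀ (k : ℕ) (hk : k < n), A.d k (hk.le.trans h) v = A.d k hk.le x ∧
    A.c k (hk.le.trans h) v = A.c k hk.le x

/-- The generalized whiskering operations: `rep h u r v` is the `m`-cell `u □_r v` obtained from the
`n`-cell `u` by replacing the `r`-occurrence of `x = ⟨u⟩(r)` by the `m`-cell `v`.  They are determined
by three conditions: the boundary of `u □_r v` of dimension `< n` is that of `u`; `x □_r v = v` when `x`
is an indeterminate; and `(u' •_k u'') □_r v` is `(u' □_r v) •_k u''` or `u' •_k (u'' □_r v)`, depending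
on where `r` occurs (`•_k` being a whiskering if `m > n`).  `repL` and `repR` are the coprojections
induced by those of `•_k`: they exhibit `|u □_r v|` as the disjoint union of `|u| \ {r}` and `|v|`
for `m = n`, and as `|v|` for `m > n`. -/
structure OccSystem.Replacement {A : Computad.{u}} (O : A.OccSystem) where
  rep : ∀ {n m : ℕ} (h : n ≤ m) (u : A.C n) (r : O.Occ u) (v : A.C m),
    A.Fits h v (O.lab u r) → A.C m
  repL : ∀ {n : ℕ} (u : A.C n) (r : O.Occ u) (v : A.C n) (hv : A.Fits le_rfl v (O.lab u r))
    (q : O.Occ u), q ≠ r → O.Occ (rep le_rfl u r v hv)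
  repR : ∀ {n m : ℕ} (h : n ≤ m) (u : A.C n) (r : O.Occ u) (v : A.C m)
    (hv : A.Fits h v (O.lab u r)), O.Occ v → O.Occ (rep h u r v hv)
  d_rep : ∀ {n m : ℕ} (h : n ≤ m) (u : A.C n) (r : O.Occ u) (v : A.C m)
    (hv : A.Fits h v (O.lab u r)) (k : ℕ) (hk : k < n),
    A.d k (hk.le.trans h) (rep h u r v hv) = A.d k hk.le u
  c_rep : ∀ {n m : ℕ} (h : n ≤ m) (u : A.C n) (r : O.Occ u) (v : A.C m)
    (hv : A.Fits h v (O.lab u r)) (k : ℕ) (hk : k < n),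
    A.c k (hk.le.trans h) (rep h u r v hv) = A.c k hk.le u
  rep_indet : ∀ {n m : ℕ} (h : n ≤ m) (x : A.C n) (r : O.Occ x) (v : A.C m)
    (hv : A.Fits h v (O.lab x r)), x ∈ A.indet n →
    rep h x r v hv = v ∧ ∀ p : O.Occ v, Same O.Occ (repR h x r v hv p) p
  rep_left : ∀ {n m k : ℕ} (h : n ≤ m) (hk : k < n) (u' u'' : A.C n)
    (hu : A.d k hk.le u' = A.c k hk.le u'') (r : O.Occ u') (v : A.C m)
    (hv : A.Fits h v (O.lab u' r)) (hv' : A.Fits h v (O.lab _ (O.occL hk u' u'' hu r)))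
    (hw : A.d k (hk.le.trans h) (rep h u' r v hv) = A.c k (hk.le.trans h) (A.one m h u'')),
    rep h (A.comp k hk u' u'' hu) (O.occL hk u' u'' hu r) v hv' =
      A.comp k (hk.trans_le h) (rep h u' r v hv) (A.one m h u'') hw ∧
    ∀ p : O.Occ v, Same O.Occ (repR h (A.comp k hk u' u'' hu) (O.occL hk u' u'' hu r) v hv' p)
      (O.occL (hk.trans_le h) (rep h u' r v hv) (A.one m h u'') hw (repR h u' r v hv p))
  rep_right : ∀ {n m k : ℕ} (h : n ≤ m) (hk : k < n) (u' u'' : A.C n)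
    (hu : A.d k hk.le u' = A.c k hk.le u'') (r : O.Occ u'') (v : A.C m)
    (hv : A.Fits h v (O.lab u'' r)) (hv' : A.Fits h v (O.lab _ (O.occR hk u' u'' hu r)))
    (hw : A.d k (hk.le.trans h) (A.one m h u') = A.c k (hk.le.trans h) (rep h u'' r v hv)),
    rep h (A.comp k hk u' u'' hu) (O.occR hk u' u'' hu r) v hv' =
      A.comp k (hk.trans_le h) (A.one m h u') (rep h u'' r v hv) hw ∧
    ∀ p : O.Occ v, Same O.Occ (repR h (A.comp k hk u' u'' hu) (O.occR hk u' u'' hu r) v hv' p)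
      (O.occR (hk.trans_le h) (A.one m h u') (rep h u'' r v hv) hw (repR h u'' r v hv p))
  repL_left : ∀ {n k : ℕ} (hk : k < n) (u' u'' : A.C n)
    (hu : A.d k hk.le u' = A.c k hk.le u'') (r : O.Occ u') (v : A.C n)
    (hv : A.Fits le_rfl v (O.lab u' r)) (hv' : A.Fits le_rfl v (O.lab _ (O.occL hk u' u'' hu r)))
    (hw : A.d k hk.le (rep le_rfl u' r v hv) = A.c k hk.le u''),
    (∀ (q : O.Occ u') (hq : q ≠ r) (hq' : O.occL hk u' u'' hu q ≠ O.occL hk u' u'' hu r),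
      Same O.Occ (repL (A.comp k hk u' u'' hu) _ v hv' (O.occL hk u' u'' hu q) hq')
        (O.occL hk (rep le_rfl u' r v hv) u'' hw (repL u' r v hv q hq))) ∧
    (∀ (q : O.Occ u'') (hq' : O.occR hk u' u'' hu q ≠ O.occL hk u' u'' hu r),
      Same O.Occ (repL (A.comp k hk u' u'' hu) _ v hv' (O.occR hk u' u'' hu q) hq')
        (O.occR hk (rep le_rfl u' r v hv) u'' hw q))
  repL_right : ∀ {n k : ℕ} (hk : k < n) (u' u'' : A.C n)
    (hu : A.d k hk.le u' = A.c k hk.le u'') (r : O.Occ u'') (v : A.C n)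
    (hv : A.Fits le_rfl v (O.lab u'' r)) (hv' : A.Fits le_rfl v (O.lab _ (O.occR hk u' u'' hu r)))
    (hw : A.d k hk.le u' = A.c k hk.le (rep le_rfl u'' r v hv)),
    (∀ (q : O.Occ u'') (hq : q ≠ r) (hq' : O.occR hk u' u'' hu q ≠ O.occR hk u' u'' hu r),
      Same O.Occ (repL (A.comp k hk u' u'' hu) _ v hv' (O.occR hk u' u'' hu q) hq')
        (O.occR hk u' (rep le_rfl u'' r v hv) hw (repL u'' r v hv q hq))) ∧
    (∀ (q : O.Occ u') (hq' : O.occL hk u' u'' hu q ≠ O.occR hk u' u'' hu r),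
      Same O.Occ (repL (A.comp k hk u' u'' hu) _ v hv' (O.occL hk u' u'' hu q) hq')
        (O.occL hk u' (rep le_rfl u'' r v hv) hw q))

/-- Induction on the cells of a computad, in every dimension. -/
theorem cell_induction (A : Computad.{u}) {n : ℕ} (p : A.C n → Prop) (hx : ∀ x ∈ A.indet n, p x)
    (ho : ∀ (m : ℕ) (e : m + 1 = n) (a : A.C m), p (e ▸ A.one (m + 1) m.le_succ a))
    (hcomp : ∀ (k : ℕ) (hk : k < n) (u v : A.C n) (h : A.d k hk.le u = A.c k hk.le v),
      p u → p v → p (A.comp k hk u v h)) (u : A.C n) : p u := by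
  cases n with
  | zero => exact hx u (by rw [A.indet_zero]; trivial)
  | succ n => exact (A.free n).induction p hx (fun a => ho n rfl a) hcomp u

theorem OccSystem.cell_induction {A : Computad.{u}} (O : A.OccSystem) {n : ℕ}
    (p : ∀ u : A.C n, O.Occ u → Prop) (hx : ∀ x ∈ A.indet n, ∀ r, p x r)
    (hL : ∀ (k : ℕ) (hk : k < n) (u v : A.C n) (h : A.d k hk.le u = A.c k hk.le v) (r : O.Occ u),
      p u r → p (A.comp k hk u v h) (O.occL hk u v h r))
    (hR : ∀ (k : ℕ) (hk : k < n) (u v : A.C n) (h : A.d k hk.le u = A.c k hk.le v) (r : O.Occ v),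
      p v r → p (A.comp k hk u v h) (O.occR hk u v h r))
    (u : A.C n) (r : O.Occ u) : p u r := by
  revert r
  refine A.cell_induction (fun u => ∀ r, p u r) hx ?_ ?_ u
  · rintro m rfl a r
    exact ((O.occ_one a).false r).elim
  · intro k hk u v h hu hv r
    obtain ⟨s, rfl⟩ := (O.bijective hk u v h).2 r
    rcases s with s | s
    · exact hL k hk u v h s (hu s)
    · exact hR k hk u v h s (hv s)

theorem Fits.d {A : Computad.{u}} {n : ℕ} {v : A.C (n + 1)} {x : A.C n}
    (h : A.Fits n.le_succ v x) : A.Fits le_rfl (A.d n n.le_succ v) x := fun k hk =>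
  ⟨(A.d_d hk.le n.le_succ v).trans (h k hk).1, (A.c_d hk n.le_succ v).trans (h k hk).2⟩

theorem Fits.c {A : Computad.{u}} {n : ℕ} {v : A.C (n + 1)} {x : A.C n}
    (h : A.Fits n.le_succ v x) : A.Fits le_rfl (A.c n n.le_succ v) x := fun k hk =>
  ⟨(A.d_c hk n.le_succ v).trans (h k hk).1, (A.c_c hk.le n.le_succ v).trans (h k hk).2⟩

theorem fits_of_c_eq {A : Computad.{u}} {n : ℕ} {v : A.C (n + 1)} {x : A.C n}
    (h : A.c n n.le_succ v = x) : A.Fits n.le_succ v x := fun k hk => by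
  subst h
  exact ⟨(A.d_c hk n.le_succ v).symm, (A.c_c hk.le n.le_succ v).symm⟩

theorem fits_self {A : Computad.{u}} {n : ℕ} (x : A.C n) : A.Fits le_rfl x x :=
  fun _ _ => ⟨rfl, rfl⟩

namespace OccSystem.Replacement

variable {A : Computad.{u}} {O : A.OccSystem} (R : O.Replacement)

theorem rep_congr {n m : ℕ} (h : n ≤ m) (u : A.C n) (r : O.Occ u) {v v' : A.C m} (e : v = v')
    (hv : A.Fits h v (O.lab u r)) (hv' : A.Fits h v' (O.lab u r)) :
    R.rep h u r v hv = R.rep h u r v' hv' := by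
  subst e; rfl

theorem d_rep_succ {n : ℕ} (u : A.C n) (r : O.Occ u) (v : A.C (n + 1))
    (hv : A.Fits n.le_succ v (O.lab u r)) :
    A.d n n.le_succ (R.rep n.le_succ u r v hv) =
      R.rep le_rfl u r (A.d n n.le_succ v) hv.d := by
  revert v
  refine O.cell_induction (fun u r => ∀ v hv, A.d n n.le_succ (R.rep n.le_succ u r v hv) =
      R.rep le_rfl u r (A.d n n.le_succ v) (Fits.d hv)) ?_ ?_ ?_ u r
  · intro x hx r v hv
    rw [(R.rep_indet n.le_succ x r v hv hx).1, (R.rep_indet le_rfl x r _ hv.d hx).1]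
  · intro k hk u w h r ih v hv
    have hv₀ : A.Fits n.le_succ v (O.lab u r) := by rw [← O.lab_occL hk u w h r]; exact hv
    have h₁ : A.d k (hk.le.trans n.le_succ) (R.rep n.le_succ u r v hv₀) =
        A.c k (hk.le.trans n.le_succ) (A.one (n + 1) n.le_succ w) := by
      rw [R.d_rep _ _ _ _ _ k hk, A.c_one_of_le, h]
    have h₂ : A.d k hk.le (R.rep le_rfl u r (A.d n n.le_succ v) hv₀.d) =
        A.c k hk.le (A.one n le_rfl w) := by
      rw [R.d_rep _ _ _ _ _ k hk, A.one_self, h]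
    have h₃ : A.d k hk.le (A.d n n.le_succ (R.rep n.le_succ u r v hv₀)) =
        A.c k hk.le (A.d n n.le_succ (A.one (n + 1) n.le_succ w)) := by
      rw [A.d_d, A.c_d hk, h₁]
    rw [(R.rep_left n.le_succ hk u w h r v hv₀ hv h₁).1,
      (R.rep_left le_rfl hk u w h r _ hv₀.d hv.d h₂).1,
      A.d_comp_of_lt _ hk n.le_succ _ _ h₁ h₃]
    exact A.comp_congr hk (ih v hv₀) (by rw [A.d_one, A.one_self]) _ _
  · intro k hk u w h r ih v hv
    have hv₀ : A.Fits n.le_succ v (O.lab w r) := by rw [← O.lab_occR hk u w h r]; exact hv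
    have h₁ : A.d k (hk.le.trans n.le_succ) (A.one (n + 1) n.le_succ u) =
        A.c k (hk.le.trans n.le_succ) (R.rep n.le_succ w r v hv₀) := by
      rw [R.c_rep _ _ _ _ _ k hk, A.d_one_of_le hk.le, h]
    have h₂ : A.d k hk.le (A.one n le_rfl u) =
        A.c k hk.le (R.rep le_rfl w r (A.d n n.le_succ v) hv₀.d) := by
      rw [R.c_rep _ _ _ _ _ k hk, A.one_self, h]
    have h₃ : A.d k hk.le (A.d n n.le_succ (A.one (n + 1) n.le_succ u)) =
        A.c k hk.le (A.d n n.le_succ (R.rep n.le_succ w r v hv₀)) := by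
      rw [A.d_d, A.c_d hk, h₁]
    rw [(R.rep_right n.le_succ hk u w h r v hv₀ hv h₁).1,
      (R.rep_right le_rfl hk u w h r _ hv₀.d hv.d h₂).1,
      A.d_comp_of_lt _ hk n.le_succ _ _ h₁ h₃]
    exact A.comp_congr hk (by rw [A.d_one, A.one_self]) (ih v hv₀) _ _

theorem c_rep_succ {n : ℕ} (u : A.C n) (r : O.Occ u) (v : A.C (n + 1))
    (hv : A.Fits n.le_succ v (O.lab u r)) :
    A.c n n.le_succ (R.rep n.le_succ u r v hv) =
      R.rep le_rfl u r (A.c n n.le_succ v) hv.c := by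
  revert v
  refine O.cell_induction (fun u r => ∀ v hv, A.c n n.le_succ (R.rep n.le_succ u r v hv) =
      R.rep le_rfl u r (A.c n n.le_succ v) (Fits.c hv)) ?_ ?_ ?_ u r
  · intro x hx r v hv
    rw [(R.rep_indet n.le_succ x r v hv hx).1, (R.rep_indet le_rfl x r _ hv.c hx).1]
  · intro k hk u w h r ih v hv
    have hv₀ : A.Fits n.le_succ v (O.lab u r) := by rw [← O.lab_occL hk u w h r]; exact hv
    have h₁ : A.d k (hk.le.trans n.le_succ) (R.rep n.le_succ u r v hv₀) =
        A.c k (hk.le.trans n.le_succ) (A.one (n + 1) n.le_succ w) := by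
      rw [R.d_rep _ _ _ _ _ k hk, A.c_one_of_le, h]
    have h₂ : A.d k hk.le (R.rep le_rfl u r (A.c n n.le_succ v) hv₀.c) =
        A.c k hk.le (A.one n le_rfl w) := by
      rw [R.d_rep _ _ _ _ _ k hk, A.one_self, h]
    have h₃ : A.d k hk.le (A.c n n.le_succ (R.rep n.le_succ u r v hv₀)) =
        A.c k hk.le (A.c n n.le_succ (A.one (n + 1) n.le_succ w)) := by
      rw [A.c_c, A.d_c hk, h₁]
    rw [(R.rep_left n.le_succ hk u w h r v hv₀ hv h₁).1,
      (R.rep_left le_rfl hk u w h r _ hv₀.c hv.c h₂).1,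
      A.c_comp_of_lt _ hk n.le_succ _ _ h₁ h₃]
    exact A.comp_congr hk (ih v hv₀) (by rw [A.c_one, A.one_self]) _ _
  · intro k hk u w h r ih v hv
    have hv₀ : A.Fits n.le_succ v (O.lab w r) := by rw [← O.lab_occR hk u w h r]; exact hv
    have h₁ : A.d k (hk.le.trans n.le_succ) (A.one (n + 1) n.le_succ u) =
        A.c k (hk.le.trans n.le_succ) (R.rep n.le_succ w r v hv₀) := by
      rw [R.c_rep _ _ _ _ _ k hk, A.d_one_of_le hk.le, h]
    have h₂ : A.d k hk.le (A.one n le_rfl u) =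
        A.c k hk.le (R.rep le_rfl w r (A.c n n.le_succ v) hv₀.c) := by
      rw [R.c_rep _ _ _ _ _ k hk, A.one_self, h]
    have h₃ : A.d k hk.le (A.c n n.le_succ (A.one (n + 1) n.le_succ u)) =
        A.c k hk.le (A.c n n.le_succ (R.rep n.le_succ w r v hv₀)) := by
      rw [A.c_c, A.d_c hk, h₁]
    rw [(R.rep_right n.le_succ hk u w h r v hv₀ hv h₁).1,
      (R.rep_right le_rfl hk u w h r _ hv₀.c hv.c h₂).1,
      A.c_comp_of_lt _ hk n.le_succ _ _ h₁ h₃]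
    exact A.comp_congr hk (by rw [A.c_one, A.one_self]) (ih v hv₀) _ _

theorem rep_lab {n : ℕ} (u : A.C n) (r : O.Occ u) (v : A.C n) (e : v = O.lab u r)
    (hv : A.Fits le_rfl v (O.lab u r)) : R.rep le_rfl u r v hv = u := by
  revert v
  refine O.cell_induction (fun u r => ∀ v (_ : v = O.lab u r) hv, R.rep le_rfl u r v hv = u)
    ?_ ?_ ?_ u r
  · intro x hx r v e hv
    rw [(R.rep_indet le_rfl x r v hv hx).1, e, (O.occ_indet x hx).2 r]
  · intro k hk u w h r ih v e hv
    have e' : v = O.lab u r := e.trans (O.lab_occL hk u w h r)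
    have hv₀ : A.Fits le_rfl v (O.lab u r) := e' ▸ fits_self _
    have h₂ : A.d k hk.le (R.rep le_rfl u r v hv₀) = A.c k hk.le (A.one n le_rfl w) := by
      rw [R.d_rep _ _ _ _ _ k hk, A.one_self, h]
    rw [(R.rep_left le_rfl hk u w h r v hv₀ hv h₂).1]
    exact A.comp_congr hk (ih v e' hv₀) (A.one_self w) _ _
  · intro k hk u w h r ih v e hv
    have e' : v = O.lab w r := e.trans (O.lab_occR hk u w h r)
    have hv₀ : A.Fits le_rfl v (O.lab w r) := e' ▸ fits_self _
    have h₂ : A.d k hk.le (A.one n le_rfl u) = A.c k hk.le (R.rep le_rfl w r v hv₀) := by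
      rw [R.c_rep _ _ _ _ _ k hk, A.one_self, h]
    rw [(R.rep_right le_rfl hk u w h r v hv₀ hv h₂).1]
    exact A.comp_congr hk (A.one_self u) (ih v e' hv₀) _ _

theorem placed_aux {n : ℕ} (u : A.C (n + 1)) (r : O.Occ (A.d n n.le_succ u)) (v : A.C (n + 1))
    (hv : A.c n n.le_succ v = O.lab _ r) :
    A.d n n.le_succ u =
      A.c n n.le_succ (R.rep n.le_succ (A.d n n.le_succ u) r v (fits_of_c_eq hv)) := by
  rw [c_rep_succ, R.rep_lab _ _ _ hv]

/-- The placed composition `u ∘_r v = u •_n (du □_r v)` of the `(n+1)`-cells `u` and `v`, where `r` is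
an occurrence of the `n`-indeterminate `c v` in `d u`. -/
def placed {n : ℕ} (u : A.C (n + 1)) (r : O.Occ (A.d n n.le_succ u)) (v : A.C (n + 1))
    (hv : A.c n n.le_succ v = O.lab _ r) : A.C (n + 1) :=
  A.comp n n.lt_succ_self u
    (R.rep n.le_succ (A.d n n.le_succ u) r v (fits_of_c_eq hv)) (R.placed_aux u r v hv)

theorem d_placed {n : ℕ} (u : A.C (n + 1)) (r : O.Occ (A.d n n.le_succ u)) (v : A.C (n + 1))
    (hv : A.c n n.le_succ v = O.lab _ r) :
    R.rep le_rfl (A.d n n.le_succ u) r (A.d n n.le_succ v) (fits_of_c_eq hv).d =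
      A.d n n.le_succ (R.placed u r v hv) := by
  rw [placed, A.d_comp n.lt_succ_self, d_rep_succ]

theorem c_placed {n : ℕ} (u : A.C (n + 1)) (r : O.Occ (A.d n n.le_succ u)) (v : A.C (n + 1))
    (hv : A.c n n.le_succ v = O.lab _ r) :
    A.c n n.le_succ (R.placed u r v hv) = A.c n n.le_succ u :=
  A.c_comp n.lt_succ_self _ _ _

end OccSystem.Replacement

end Computad

/-! ### Multicategories -/

/-- The data of a multicategory: objects, object types and the map `x ↦ ẋ` (the object system), arrows
`u` with a source `Su : |Su| → Obj` (`|Su|` is `Pos u`, `Su` is `src u`) and a target in the object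
types, identities, and the partial operations of multicomposition `u ⊙_r v`, defined iff the target of
`v` is the type of `Su(r)`, together with the specified coprojections `inl`, `inr` which exhibit
`|S(u ⊙_r v)|` as the disjoint union of `|Su| \ {r}` and `|Sv|`. -/
structure MultiCatData where
  Obj : Type u
  Ty : Type u
  ty : Obj → Ty
  Arr : Type u
  Pos : Arr → Type
  src : ∀ u : Arr, Pos u → Obj
  tgt : Arr → Ty
  one : Obj → Arr
  comp : ∀ (u : Arr) (r : Pos u) (v : Arr), tgt v = ty (src u r) → Arr
  inl : ∀ (u : Arr) (r : Pos u) (v : Arr) (h : tgt v = ty (src u r)) (q : Pos u), q ≠ r →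
    Pos (comp u r v h)
  inr : ∀ (u : Arr) (r : Pos u) (v : Arr) (h : tgt v = ty (src u r)), Pos v → Pos (comp u r v h)

namespace MultiCatData

/-- The laws of multicategories.  As usual, equalities of arrows include the equality of their sources,
with their coprojections. -/
structure IsMulticategory (M : MultiCatData.{u}) : Prop where
  finite_pos : ∀ u, Finite (M.Pos u)
  bijective : ∀ u r v h, Function.Bijective
    (Sum.elim (fun q : {q : M.Pos u // q ≠ r} => M.inl u r v h q.1 q.2) (M.inr u r v h))
  src_inl : ∀ u r v h q hq, M.src _ (M.inl u r v h q hq) = M.src u q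
  src_inr : ∀ u r v h p, M.src _ (M.inr u r v h p) = M.src v p
  tgt_comp : ∀ u r v h, M.tgt (M.comp u r v h) = M.tgt u
  pos_one : ∀ x, ∃! _ : M.Pos (M.one x), True
  src_one : ∀ x p, M.src (M.one x) p = x
  tgt_one : ∀ x, M.tgt (M.one x) = M.ty x
  one_comp : ∀ x r u h, M.comp (M.one x) r u h = u ∧
    ∀ p, Same M.Pos (M.inr (M.one x) r u h p) p
  comp_one : ∀ u r h, M.comp u r (M.one (M.src u r)) h = u ∧
    (∀ p hp, Same M.Pos (M.inl u r (M.one (M.src u r)) h p hp) p) ∧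
    (∀ p, Same M.Pos (M.inr u r (M.one (M.src u r)) h p) r)
  comm : ∀ (u : M.Arr) (r q : M.Pos u) (hqr : q ≠ r) (hrq : r ≠ q) (v w : M.Arr)
    (hv : M.tgt v = M.ty (M.src u r)) (hw : M.tgt w = M.ty (M.src u q))
    (hw' : M.tgt w = M.ty (M.src (M.comp u r v hv) (M.inl u r v hv q hqr)))
    (hv' : M.tgt v = M.ty (M.src (M.comp u q w hw) (M.inl u q w hw r hrq))),
    M.comp (M.comp u r v hv) (M.inl u r v hv q hqr) w hw' =
      M.comp (M.comp u q w hw) (M.inl u q w hw r hrq) v hv' ∧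
    (∀ (p : M.Pos u) (hp : p ≠ r) (hp' : p ≠ q) hp₁ hp₂, Same M.Pos
      (M.inl (M.comp u r v hv) (M.inl u r v hv q hqr) w hw' (M.inl u r v hv p hp) hp₁)
      (M.inl (M.comp u q w hw) (M.inl u q w hw r hrq) v hv' (M.inl u q w hw p hp') hp₂)) ∧
    (∀ (p : M.Pos v) hp₁, Same M.Pos
      (M.inl (M.comp u r v hv) (M.inl u r v hv q hqr) w hw' (M.inr u r v hv p) hp₁)
      (M.inr (M.comp u q w hw) (M.inl u q w hw r hrq) v hv' p)) ∧
    (∀ (p : M.Pos w) hp₂, Same M.Pos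
      (M.inr (M.comp u r v hv) (M.inl u r v hv q hqr) w hw' p)
      (M.inl (M.comp u q w hw) (M.inl u q w hw r hrq) v hv' (M.inr u q w hw p) hp₂))
  assoc : ∀ (u : M.Arr) (r : M.Pos u) (v : M.Arr) (q : M.Pos v) (w : M.Arr)
    (hv : M.tgt v = M.ty (M.src u r)) (hw : M.tgt w = M.ty (M.src v q))
    (hw' : M.tgt w = M.ty (M.src (M.comp u r v hv) (M.inr u r v hv q)))
    (hv' : M.tgt (M.comp v q w hw) = M.ty (M.src u r)),
    M.comp (M.comp u r v hv) (M.inr u r v hv q) w hw' = M.comp u r (M.comp v q w hw) hv' ∧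
    (∀ (p : M.Pos u) (hp : p ≠ r) hp₁, Same M.Pos
      (M.inl (M.comp u r v hv) (M.inr u r v hv q) w hw' (M.inl u r v hv p hp) hp₁)
      (M.inl u r (M.comp v q w hw) hv' p hp)) ∧
    (∀ (p : M.Pos v) (hp : p ≠ q) hp₁, Same M.Pos
      (M.inl (M.comp u r v hv) (M.inr u r v hv q) w hw' (M.inr u r v hv p) hp₁)
      (M.inr u r (M.comp v q w hw) hv' (M.inl v q w hw p hp))) ∧
    (∀ p : M.Pos w, Same M.Pos
      (M.inr (M.comp u r v hv) (M.inr u r v hv q) w hw' p)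
      (M.inr u r (M.comp v q w hw) hv' (M.inr v q w hw p)))

/-- `obj`, `tyMap`, `arr` are the components of a morphism of multicategories, for the bijections
`pos u : |Su| → |S(arr u)|` between the index sets of sources. -/
structure IsHom {M N : MultiCatData.{u}} (obj : M.Obj → N.Obj) (tyMap : M.Ty → N.Ty)
    (arr : M.Arr → N.Arr) (pos : ∀ u, M.Pos u → N.Pos (arr u)) : Prop where
  ty_obj : ∀ x, N.ty (obj x) = tyMap (M.ty x)
  bijective : ∀ u, Function.Bijective (pos u)
  src_pos : ∀ u p, N.src (arr u) (pos u p) = obj (M.src u p)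
  tgt_arr : ∀ u, N.tgt (arr u) = tyMap (M.tgt u)
  map_one : ∀ x, arr (M.one x) = N.one (obj x)
  map_comp : ∀ u r v h h', arr (M.comp u r v h) = N.comp (arr u) (pos u r) (arr v) h'
  pos_inl : ∀ u r v h h' q hq hq', Same N.Pos (pos _ (M.inl u r v h q hq))
    (N.inl (arr u) (pos u r) (arr v) h' (pos u q) hq')
  pos_inr : ∀ u r v h h' p, Same N.Pos (pos _ (M.inr u r v h p))
    (N.inr (arr u) (pos u r) (arr v) h' (pos v p))

/-- Morphisms of multicategories. -/
structure Hom (M N : MultiCatData.{u}) where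
  obj : M.Obj → N.Obj
  tyMap : M.Ty → N.Ty
  arr : M.Arr → N.Arr
  pos : ∀ u, M.Pos u → N.Pos (arr u)
  isHom : IsHom obj tyMap arr pos

/-- `M` is freely generated by the set `J` of arrows over its object system: a morphism `(go, gt)` of
object systems into that of a multicategory `N`, and a map `φ` from `J` to the arrows of `N` which is
consistent with it (`θ f` being the identification of `|Sf|` with `|Sφ(f)|`) extend to a unique
morphism. -/
def IsFreeOn (M : MultiCatData.{u}) (J : Set M.Arr) : Prop :=
  ∀ (N : MultiCatData.{u}), N.IsMulticategory →
    ∀ (go : M.Obj → N.Obj) (gt : M.Ty → N.Ty), (∀ x, N.ty (go x) = gt (M.ty x)) →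
    ∀ (φ : J → N.Arr) (θ : ∀ f : J, M.Pos f.1 → N.Pos (φ f)),
    (∀ f, Function.Bijective (θ f)) →
    (∀ f p, N.src (φ f) (θ f p) = go (M.src f.1 p)) →
    (∀ f, N.tgt (φ f) = gt (M.tgt f.1)) →
    ∃! χ : Hom M N, χ.obj = go ∧ χ.tyMap = gt ∧
      ∀ f : J, χ.arr f.1 = φ f ∧ ∀ p, Same N.Pos (χ.pos f.1 p) (θ f p)

end MultiCatData

/-! ### Multitopic sets -/

/-- The data of a multitopic set.  `P n` is the set of `n`-pasting diagrams and `indet n ⊆ P n` the set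
of `n`-indeterminates.  `Occ u`, `lab u` form the indexed set `⟨u⟩ : |u| → indet n` of occurrences of
indeterminates in `u`.  `P (n+1)` is the set of arrows of a multicategory `ℂ_{n+1}` whose objects (and
object types) are the `n`-indeterminates, where `u` has source `⟨d u⟩` and target `c u`; `one`, `comp`,
`inl`, `inr` are the identities, multicompositions and specified coprojections of `ℂ_{n+1}`, and `occL`,
`occR` are the coprojections which exhibit `|u ⊙_r v|` as the disjoint union of `|u|` and `|v|`. -/
structure MultitopicData where
  P : ℕ → Type u
  indet : ∀ n, Set (P n)
  Occ : ∀ {n : ℕ}, P n → Type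
  lab : ∀ {n : ℕ} (u : P n), Occ u → indet n
  d : ∀ {n : ℕ}, P (n + 1) → P n
  c : ∀ {n : ℕ}, P (n + 1) → indet n
  one : ∀ {n : ℕ}, indet n → P (n + 1)
  comp : ∀ {n : ℕ} (u : P (n + 1)) (r : Occ (d u)) (v : P (n + 1)), c v = lab (d u) r → P (n + 1)
  inl : ∀ {n : ℕ} (u : P (n + 1)) (r : Occ (d u)) (v : P (n + 1)) (h : c v = lab (d u) r)
    (q : Occ (d u)), q ≠ r → Occ (d (comp u r v h))
  inr : ∀ {n : ℕ} (u : P (n + 1)) (r : Occ (d u)) (v : P (n + 1)) (h : c v = lab (d u) r),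
    Occ (d v) → Occ (d (comp u r v h))
  occL : ∀ {n : ℕ} (u : P (n + 1)) (r : Occ (d u)) (v : P (n + 1)) (h : c v = lab (d u) r),
    Occ u → Occ (comp u r v h)
  occR : ∀ {n : ℕ} (u : P (n + 1)) (r : Occ (d u)) (v : P (n + 1)) (h : c v = lab (d u) r),
    Occ v → Occ (comp u r v h)

namespace MultitopicData

/-- The multicategory `ℂ_{n+1}`. -/
def mc (S : MultitopicData.{u}) (n : ℕ) : MultiCatData.{u} where
  Obj := S.indet n
  Ty := S.indet n
  ty := id
  Arr := S.P (n + 1)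
  Pos u := S.Occ (S.d u)
  src u := S.lab (S.d u)
  tgt := S.c
  one := S.one
  comp := S.comp
  inl := S.inl
  inr := S.inr

/-- Parallel pasting diagrams; any two `0`-dimensional ones are parallel. -/
def Par (S : MultitopicData.{u}) : ∀ {n : ℕ}, S.P n → S.P n → Prop
  | 0, _, _ => True
  | _ + 1, u, v => S.d u = S.d v ∧ S.c u = S.c v

/-- The indexed sets `⟨u⟩` of occurrences of indeterminates, in the free multicategories `ℂ_n`; in
dimension `0` every element is an indeterminate, which is its own unique occurrence. -/
structure IsOccSystem (S : MultitopicData.{u}) : Prop where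
  finite_occ : ∀ {n : ℕ} (u : S.P n), Finite (S.Occ u)
  occ_indet : ∀ {n : ℕ} (x : S.P n), x ∈ S.indet n →
    (∃! _ : S.Occ x, True) ∧ ∀ r : S.Occ x, (S.lab x r : S.P n) = x
  occ_one : ∀ {n : ℕ} (x : S.indet n), IsEmpty (S.Occ (S.one x))
  bijective : ∀ {n : ℕ} (u : S.P (n + 1)) r v h,
    Function.Bijective (Sum.elim (S.occL u r v h) (S.occR u r v h))
  lab_occL : ∀ {n : ℕ} (u : S.P (n + 1)) r v h p, S.lab _ (S.occL u r v h p) = S.lab u p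
  lab_occR : ∀ {n : ℕ} (u : S.P (n + 1)) r v h p, S.lab _ (S.occR u r v h p) = S.lab v p
  one_comp : ∀ {n : ℕ} (x : S.indet n) r u h p, Same S.Occ (S.occR (S.one x) r u h p) p
  comp_one : ∀ {n : ℕ} (u : S.P (n + 1)) r h p,
    Same S.Occ (S.occL u r (S.one (S.lab (S.d u) r)) h p) p
  comm : ∀ {n : ℕ} (u : S.P (n + 1)) (r q : S.Occ (S.d u)) (hqr : q ≠ r) (hrq : r ≠ q)
    (v w : S.P (n + 1)) (hv : S.c v = S.lab (S.d u) r) (hw : S.c w = S.lab (S.d u) q)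
    (hw' : S.c w = S.lab _ (S.inl u r v hv q hqr)) (hv' : S.c v = S.lab _ (S.inl u q w hw r hrq)),
    (∀ p, Same S.Occ (S.occL (S.comp u r v hv) (S.inl u r v hv q hqr) w hw' (S.occL u r v hv p))
      (S.occL (S.comp u q w hw) (S.inl u q w hw r hrq) v hv' (S.occL u q w hw p))) ∧
    (∀ p, Same S.Occ (S.occL (S.comp u r v hv) (S.inl u r v hv q hqr) w hw' (S.occR u r v hv p))
      (S.occR (S.comp u q w hw) (S.inl u q w hw r hrq) v hv' p)) ∧
    (∀ p, Same S.Occ (S.occR (S.comp u r v hv) (S.inl u r v hv q hqr) w hw' p)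
      (S.occL (S.comp u q w hw) (S.inl u q w hw r hrq) v hv' (S.occR u q w hw p)))
  assoc : ∀ {n : ℕ} (u : S.P (n + 1)) (r : S.Occ (S.d u)) (v : S.P (n + 1)) (q : S.Occ (S.d v))
    (w : S.P (n + 1)) (hv : S.c v = S.lab (S.d u) r) (hw : S.c w = S.lab (S.d v) q)
    (hw' : S.c w = S.lab _ (S.inr u r v hv q)) (hv' : S.c (S.comp v q w hw) = S.lab (S.d u) r),
    (∀ p, Same S.Occ (S.occL (S.comp u r v hv) (S.inr u r v hv q) w hw' (S.occL u r v hv p))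
      (S.occL u r (S.comp v q w hw) hv' p)) ∧
    (∀ p, Same S.Occ (S.occL (S.comp u r v hv) (S.inr u r v hv q) w hw' (S.occR u r v hv p))
      (S.occR u r (S.comp v q w hw) hv' (S.occL v q w hw p))) ∧
    (∀ p, Same S.Occ (S.occR (S.comp u r v hv) (S.inr u r v hv q) w hw' p)
      (S.occR u r (S.comp v q w hw) hv' (S.occR v q w hw p)))

/-- The operations of arrow replacement: `rep u r v` is obtained from the arrow `u` of `ℂ_n` by replacing
the `r`-occurrence of the indeterminate `f = ⟨u⟩(r)` by an arrow `v` parallel to `f`.  They are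
determined by three conditions: the result is parallel to `u`; replacing `f` in `f` by `v` gives `v`; and
replacement in `u ⊙_j w` is replacement in `u` or in `w`, depending on where `r` occurs.  `repL`, `repR`
are the induced coprojections, which exhibit `|rep u r v|` as the disjoint union of `|u| \ {r}` and
`|v|`.  For `n = 0`, `rep u r v = v`. -/
structure Replacement (S : MultitopicData.{u}) where
  rep : ∀ {n : ℕ} (u : S.P n) (r : S.Occ u) (v : S.P n), S.Par v (S.lab u r).1 → S.P n
  repL : ∀ {n : ℕ} (u : S.P n) (r : S.Occ u) (v : S.P n) (h : S.Par v (S.lab u r).1)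
    (q : S.Occ u), q ≠ r → S.Occ (rep u r v h)
  repR : ∀ {n : ℕ} (u : S.P n) (r : S.Occ u) (v : S.P n) (h : S.Par v (S.lab u r).1),
    S.Occ v → S.Occ (rep u r v h)
  par_rep : ∀ {n : ℕ} (u : S.P n) r v h, S.Par (rep u r v h) u
  rep_indet : ∀ {n : ℕ} (x : S.P n) r v h, x ∈ S.indet n →
    rep x r v h = v ∧ ∀ p, Same S.Occ (repR x r v h p) p
  rep_left : ∀ {n : ℕ} (u : S.P (n + 1)) (j : S.Occ (S.d u)) (w : S.P (n + 1))
    (hj : S.c w = S.lab (S.d u) j) (r : S.Occ u) (v : S.P (n + 1)) (hv : S.Par v (S.lab u r).1)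
    (hv' : S.Par v (S.lab _ (S.occL u j w hj r)).1) (j' : S.Occ (S.d (rep u r v hv)))
    (_ : Same S.Occ j' j) (hj' : S.c w = S.lab _ j'),
    rep (S.comp u j w hj) (S.occL u j w hj r) v hv' = S.comp (rep u r v hv) j' w hj' ∧
    (∀ q hq hq', Same S.Occ (repL (S.comp u j w hj) (S.occL u j w hj r) v hv' (S.occL u j w hj q) hq')
      (S.occL (rep u r v hv) j' w hj' (repL u r v hv q hq))) ∧
    (∀ q hq', Same S.Occ (repL (S.comp u j w hj) (S.occL u j w hj r) v hv' (S.occR u j w hj q) hq')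
      (S.occR (rep u r v hv) j' w hj' q)) ∧
    (∀ p, Same S.Occ (repR (S.comp u j w hj) (S.occL u j w hj r) v hv' p)
      (S.occL (rep u r v hv) j' w hj' (repR u r v hv p)))
  rep_right : ∀ {n : ℕ} (u : S.P (n + 1)) (j : S.Occ (S.d u)) (w : S.P (n + 1))
    (hj : S.c w = S.lab (S.d u) j) (r : S.Occ w) (v : S.P (n + 1)) (hv : S.Par v (S.lab w r).1)
    (hv' : S.Par v (S.lab _ (S.occR u j w hj r)).1) (hj' : S.c (rep w r v hv) = S.lab (S.d u) j),
    rep (S.comp u j w hj) (S.occR u j w hj r) v hv' = S.comp u j (rep w r v hv) hj' ∧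
    (∀ q hq hq', Same S.Occ (repL (S.comp u j w hj) (S.occR u j w hj r) v hv' (S.occR u j w hj q) hq')
      (S.occR u j (rep w r v hv) hj' (repL w r v hv q hq))) ∧
    (∀ q hq', Same S.Occ (repL (S.comp u j w hj) (S.occR u j w hj r) v hv' (S.occL u j w hj q) hq')
      (S.occL u j (rep w r v hv) hj' q)) ∧
    (∀ p, Same S.Occ (repR (S.comp u j w hj) (S.occR u j w hj r) v hv' p)
      (S.occR u j (rep w r v hv) hj' (repR w r v hv p)))

/-- The axioms of multitopic sets: `ℂ_0` is a barren set, every `ℂ_{n+1}` is a free multicategory which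
is a free extension of `ℂ_n` via `d` and `c`, and the globularity conditions hold. -/
structure IsMultitopicSet (S : MultitopicData.{u}) : Prop where
  indet_zero : S.indet 0 = Set.univ
  isMulticategory : ∀ n, (S.mc n).IsMulticategory
  isFreeOn : ∀ n, (S.mc n).IsFreeOn (S.indet (n + 1))
  isOccSystem : S.IsOccSystem
  d_one : ∀ {n : ℕ} (x : S.indet n), S.d (S.one x) = x
  c_one : ∀ {n : ℕ} (x : S.indet n), S.c (S.one x) = x
  d_d : ∀ {n : ℕ} (u : S.P (n + 2)), S.d (S.d u) = S.d (S.c u).1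
  c_d : ∀ {n : ℕ} (u : S.P (n + 2)), S.c (S.d u) = S.c (S.c u).1
  /-- `d (u ⊙_r v)` is the result of replacing the `r`-occurrence of `c v` in `d u` by `d v`, with the
  same coprojections, and `c (u ⊙_r v) = c u` -/
  d_comp : ∃ R : S.Replacement, ∀ {n : ℕ} (u : S.P (n + 1)) (r : S.Occ (S.d u)) (v : S.P (n + 1))
    (h : S.c v = S.lab (S.d u) r) (h' : S.Par (S.d v) (S.lab (S.d u) r).1),
    S.d (S.comp u r v h) = R.rep (S.d u) r (S.d v) h' ∧
    (∀ q hq, Same S.Occ (S.inl u r v h q hq) (R.repL (S.d u) r (S.d v) h' q hq)) ∧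
    (∀ p, Same S.Occ (S.inr u r v h p) (R.repR (S.d u) r (S.d v) h' p))
  c_comp : ∀ {n : ℕ} (u : S.P (n + 1)) r v h, S.c (S.comp u r v h) = S.c u

/-- `φ` is a morphism of multitopic sets, for the bijections `ω u : |u| → |φ u|`, and the same bijections
`θ u : |Su| = |d u| → |d (φ u)| = |S(φ u)|` between the index sets of sources. -/
structure IsMorphismWith {S T : MultitopicData.{u}} (φ : ∀ n, S.P n → T.P n)
    (ω : ∀ {n : ℕ} (u : S.P n), S.Occ u → T.Occ (φ n u))
    (θ : ∀ {n : ℕ} (u : S.P (n + 1)), S.Occ (S.d u) → T.Occ (T.d (φ (n + 1) u))) : Prop where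
  map_indet : ∀ n (x : S.P n), x ∈ S.indet n → φ n x ∈ T.indet n
  isHom : ∀ n, MultiCatData.IsHom (M := S.mc n) (N := T.mc n)
    (fun x : S.indet n => (⟨φ n x.1, map_indet n x.1 x.2⟩ : T.indet n))
    (fun x : S.indet n => (⟨φ n x.1, map_indet n x.1 x.2⟩ : T.indet n)) (φ (n + 1)) θ
  map_d : ∀ {n : ℕ} (u : S.P (n + 1)), T.d (φ (n + 1) u) = φ n (S.d u)
  map_c : ∀ {n : ℕ} (u : S.P (n + 1)), (T.c (φ (n + 1) u) : T.P n) = φ n (S.c u).1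
  theta_eq : ∀ {n : ℕ} (u : S.P (n + 1)) (r : S.Occ (S.d u)), Same T.Occ (θ u r) (ω (S.d u) r)
  bijective : ∀ {n : ℕ} (u : S.P n), Function.Bijective (ω u)
  lab_map : ∀ {n : ℕ} (u : S.P n) (r : S.Occ u), (T.lab _ (ω u r) : T.P n) = φ n (S.lab u r).1
  map_occL : ∀ {n : ℕ} (u : S.P (n + 1)) (r : S.Occ (S.d u)) (v : S.P (n + 1))
    (h : S.c v = S.lab (S.d u) r) (h' : T.c (φ (n + 1) v) = T.lab _ (θ u r)) (p : S.Occ u),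
    Same T.Occ (ω _ (S.occL u r v h p)) (T.occL (φ (n + 1) u) (θ u r) (φ (n + 1) v) h' (ω u p))
  map_occR : ∀ {n : ℕ} (u : S.P (n + 1)) (r : S.Occ (S.d u)) (v : S.P (n + 1))
    (h : S.c v = S.lab (S.d u) r) (h' : T.c (φ (n + 1) v) = T.lab _ (θ u r)) (p : S.Occ v),
    Same T.Occ (ω _ (S.occR u r v h p)) (T.occR (φ (n + 1) u) (θ u r) (φ (n + 1) v) h' (ω v p))

/-- Morphisms of multitopic sets: sequences of maps `φ_n : P_n → P'_n` that preserve the structure. -/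
def IsMorphism {S T : MultitopicData.{u}} (φ : ∀ n, S.P n → T.P n) : Prop :=
  ∃ (ω : ∀ {n : ℕ} (u : S.P n), S.Occ u → T.Occ (φ n u))
    (θ : ∀ {n : ℕ} (u : S.P (n + 1)), S.Occ (S.d u) → T.Occ (T.d (φ (n + 1) u))),
    IsMorphismWith φ ω θ

end MultitopicData

theorem Same.map {α β : Type*} {T : α → Type*} {T' : β → Type*} (f : α → β)
    (g : ∀ a, T a → T' (f a)) {a b : α} {p : T a} {q : T b} (h : Same T p q) :
    Same T' (g a p) (g b q) :=
  congrArg (fun s : Sigma T => (⟨f s.1, g s.1 s.2⟩ : Sigma T')) h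

theorem Same.trans {α : Type*} {T : α → Type*} {a b c : α} {p : T a} {q : T b} {r : T c}
    (h : Same T p q) (h' : Same T q r) : Same T p r :=
  Eq.trans h h'

theorem MultiCatData.IsHom.id (M : MultiCatData.{u}) :
    MultiCatData.IsHom (M := M) (N := M) (fun x => x) (fun x => x) (fun u => u) (fun _ p => p) where
  ty_obj _ := rfl
  bijective _ := Function.bijective_id
  src_pos _ _ := rfl
  tgt_arr _ := rfl
  map_one _ := rfl
  map_comp _ _ _ _ _ := rfl
  pos_inl _ _ _ _ _ _ _ _ := rfl
  pos_inr _ _ _ _ _ _ := rfl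

theorem MultiCatData.IsHom.comp {M N K : MultiCatData.{u}} {o : M.Obj → N.Obj} {t : M.Ty → N.Ty}
    {a : M.Arr → N.Arr} {p : ∀ u, M.Pos u → N.Pos (a u)} {o' : N.Obj → K.Obj} {t' : N.Ty → K.Ty}
    {a' : N.Arr → K.Arr} {p' : ∀ u, N.Pos u → K.Pos (a' u)} (H : IsHom o t a p)
    (H' : IsHom o' t' a' p') :
    MultiCatData.IsHom (M := M) (N := K) (fun x => o' (o x)) (fun x => t' (t x))
      (fun u => a' (a u)) (fun u r => p' (a u) (p u r)) := by
  have key : ∀ u r v, M.tgt v = M.ty (M.src u r) → N.tgt (a v) = N.ty (N.src (a u) (p u r)) :=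
    fun u r v h => by rw [H.tgt_arr, h, H.src_pos, H.ty_obj]
  exact
  { ty_obj := fun x => by rw [H'.ty_obj, H.ty_obj]
    bijective := fun u => (H'.bijective _).comp (H.bijective u)
    src_pos := fun u r => by rw [H'.src_pos, H.src_pos]
    tgt_arr := fun u => by rw [H'.tgt_arr, H.tgt_arr]
    map_one := fun x => by rw [H.map_one, H'.map_one]
    map_comp := fun u r v h h' => by
      rw [H.map_comp u r v h (key u r v h), H'.map_comp _ _ _ (key u r v h) h']
    pos_inl := fun u r v h h' q hq hq' =>
      ((H.pos_inl u r v h (key u r v h) q hq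
        ((H.bijective u).1.ne hq)).map a' p').trans (H'.pos_inl _ _ _ _ _ _ _ _)
    pos_inr := fun u r v h h' q =>
      ((H.pos_inr u r v h (key u r v h) q).map a' p').trans (H'.pos_inr _ _ _ _ _ _) }

theorem MultitopicData.IsMorphism.id (S : MultitopicData.{u}) :
    MultitopicData.IsMorphism (S := S) (T := S) (fun _ u => u) :=
  ⟨fun _ p => p, fun _ p => p,
    { map_indet := fun _ _ h => h
      isHom := fun n => MultiCatData.IsHom.id (S.mc n)
      map_d := fun _ => rfl
      map_c := fun _ => rfl
      theta_eq := fun _ _ => rfl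
      bijective := fun _ => Function.bijective_id
      lab_map := fun _ _ => rfl
      map_occL := fun _ _ _ _ _ _ => rfl
      map_occR := fun _ _ _ _ _ _ => rfl }⟩

theorem MultitopicData.IsMorphism.comp {S T U : MultitopicData.{u}} {φ : ∀ n, S.P n → T.P n}
    {ψ : ∀ n, T.P n → U.P n} (hφ : IsMorphism φ) (hψ : IsMorphism ψ) :
    IsMorphism (fun n u => ψ n (φ n u)) := by
  obtain ⟨ω, θ, h⟩ := hφ
  obtain ⟨ω', θ', h'⟩ := hψ
  have key : ∀ {n : ℕ} (u : S.P (n + 1)) (r : S.Occ (S.d u)) (v : S.P (n + 1)),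
      S.c v = S.lab (S.d u) r → T.c (φ (n + 1) v) = T.lab _ (θ u r) := fun {n} u r v e =>
    Subtype.ext (by rw [h.map_c, e]; exact congrArg Subtype.val ((h.isHom n).src_pos u r).symm)
  exact ⟨fun u p => ω' _ (ω u p), fun u p => θ' _ (θ u p),
    { map_indet := fun n x hx => h'.map_indet n _ (h.map_indet n x hx)
      isHom := fun n => (h.isHom n).comp (h'.isHom n)
      map_d := fun u => by rw [h'.map_d, h.map_d]
      map_c := fun u => by rw [h'.map_c, h.map_c]
      theta_eq := fun {n} u r => (h'.theta_eq _ _).trans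
        ((h.theta_eq u r).map (ψ n) (fun w => ω' w))
      bijective := fun u => (h'.bijective _).comp (h.bijective u)
      lab_map := fun u r => by rw [h'.lab_map, h.lab_map]
      map_occL := fun {n} u r v e e' p =>
        ((h.map_occL u r v e (key u r v e) p).map (ψ (n + 1)) (fun w => ω' w)).trans
          (h'.map_occL _ _ _ _ _ _)
      map_occR := fun {n} u r v e e' p =>
        ((h.map_occR u r v e (key u r v e) p).map (ψ (n + 1)) (fun w => ω' w)).trans
          (h'.map_occR _ _ _ _ _ _) }⟩

/-- Multitopic sets. -/
structure MultitopicSet where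
  data : MultitopicData.{u}
  isMultitopicSet : data.IsMultitopicSet

/-- The category of multitopic sets. -/
instance : Category MultitopicSet.{u} where
  Hom S T := {φ : ∀ n, S.data.P n → T.data.P n // MultitopicData.IsMorphism φ}
  id S := ⟨fun _ u => u, MultitopicData.IsMorphism.id S.data⟩
  comp φ ψ := ⟨fun n u => ψ.1 n (φ.1 n u), φ.2.comp ψ.2⟩

/-! ### The multitopic set of a many-to-one computad -/

namespace ManyToOneComputad

/-- Many-to-one cells: all the `0`-cells, and the `(n+1)`-cells whose codomain is an indeterminate. -/
def IsManyToOne (A : ManyToOneComputad.{u}) : ∀ {n : ℕ}, A.C n → Prop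
  | 0, _ => True
  | n + 1, u => A.c n n.le_succ u ∈ A.indet n

theorem isManyToOne_of_indet (A : ManyToOneComputad.{u}) : ∀ {n : ℕ} (x : A.C n), x ∈ A.indet n →
    A.IsManyToOne x
  | 0, _, _ => trivial
  | n + 1, x, h => A.cod_indet n x h

theorem IsManyToOne.d {A : ManyToOneComputad.{u}} : ∀ {n : ℕ} {u : A.C (n + 1)}, A.IsManyToOne u →
    A.IsManyToOne (A.d n n.le_succ u)
  | 0, _, _ => trivial
  | n + 1, u, h => by
    change A.c n _ (A.d (n + 1) _ u) ∈ A.indet n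
    rw [A.c_d (Nat.lt_succ_self n), ← A.c_c n.le_succ (n + 1).le_succ]
    exact A.cod_indet n _ h

/-- A parametrization of the indet occurrences in the cells of `A`, with the resulting replacement
operations. -/
structure Parametrization (A : ManyToOneComputad.{u}) where
  occ : A.toComputad.OccSystem
  repl : occ.Replacement

/-- The structure `S_A`: its `n`-pasting diagrams are the many-to-one `n`-cells of `A`, with the domains,
codomains, identities and indet occurrences of `A`, and with placed composition as multicomposition. -/
def multitopicData (A : ManyToOneComputad.{u}) (Q : A.Parametrization) : MultitopicData.{u} where
  P n := {u : A.C n // A.IsManyToOne u}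
  indet n := {u | u.1 ∈ A.indet n}
  Occ u := Q.occ.Occ u.1
  lab u r := ⟨⟨Q.occ.lab u.1 r, A.isManyToOne_of_indet _ (Q.occ.lab_mem u.1 r)⟩, Q.occ.lab_mem u.1 r⟩
  d {n} u := ⟨A.d n n.le_succ u.1, u.2.d⟩
  c {n} u := ⟨⟨A.c n n.le_succ u.1, A.isManyToOne_of_indet _ u.2⟩, u.2⟩
  one {n} x := ⟨A.one (n + 1) n.le_succ x.1.1, by
    change A.c n _ _ ∈ A.indet n
    rw [A.c_one]; exact x.2⟩
  comp {n} u r v h := ⟨Q.repl.placed u.1 r v.1 (congrArg (fun x => x.1.1) h), by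
    change A.c n _ _ ∈ A.indet n
    rw [Q.repl.c_placed]; exact u.2⟩
  inl u r v h q hq :=
    cast (congrArg Q.occ.Occ (Q.repl.d_placed u.1 r v.1 (congrArg (fun x => x.1.1) h)))
      (Q.repl.repL _ r _ _ q hq)
  inr u r v h p :=
    cast (congrArg Q.occ.Occ (Q.repl.d_placed u.1 r v.1 (congrArg (fun x => x.1.1) h)))
      (Q.repl.repR le_rfl _ r _ _ p)
  occL u r v h p := Q.occ.occL _ _ _ _ p
  occR u r v h p := Q.occ.occR _ _ _ _ (Q.repl.repR _ _ r v.1 _ p)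

/-- The restriction of a computad functor to the many-to-one cells. -/
def restrict {A B : ManyToOneComputad.{u}} (F : A ⟶ B) (n : ℕ)
    (u : {u : A.C n // A.IsManyToOne u}) : {u : B.C n // B.IsManyToOne u} :=
  ⟨(ComputadFunctor.toFunctor F).map u.1, by
    obtain ⟨u, hu⟩ := u
    cases n with
    | zero => trivial
    | succ n =>
      change B.c n _ ((ComputadFunctor.toFunctor F).map u) ∈ B.indet n
      rw [← (ComputadFunctor.toFunctor F).map_c]
      exact ComputadFunctor.map_indet F _ hu⟩

end ManyToOneComputad

/-- The functor `S_-`: it sends `A` to `S_A`, and `F` to its restriction to the many-to-one cells. -/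
def multitopicFunctor (Q : ∀ A : ManyToOneComputad.{u}, A.Parametrization)
    (hobj : ∀ A : ManyToOneComputad.{u}, (A.multitopicData (Q A)).IsMultitopicSet)
    (hmap : ∀ {A B : ManyToOneComputad.{u}} (F : A ⟶ B), MultitopicData.IsMorphism
      (S := A.multitopicData (Q A)) (T := B.multitopicData (Q B)) (ManyToOneComputad.restrict F)) :
    ManyToOneComputad.{u} ⥤ MultitopicSet.{u} where
  obj A := ⟨A.multitopicData (Q A), hobj A⟩
  map F := ⟨ManyToOneComputad.restrict F, hmap F⟩

namespace OmegaCat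

theorem d_one_of_ge (A : OmegaCat.{u}) {n m k : ℕ} (h : n ≤ k) (hk : k ≤ m) (a : A.C n) :
    A.d k hk (A.one m (h.trans hk) a) = A.one k h a := by
  rw [← A.one_one h hk, A.d_one]

theorem c_one_of_ge (A : OmegaCat.{u}) {n m k : ℕ} (h : n ≤ k) (hk : k ≤ m) (a : A.C n) :
    A.c k hk (A.one m (h.trans hk) a) = A.one k h a := by
  rw [← A.one_one h hk, A.c_one]

/-- `(n+1)`-cells displayed over those of `A`: a type over `A.C (n+1)` with identities and
compositions that satisfy the laws of `ω`-categories. -/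
structure Layer (A : OmegaCat.{u}) (n : ℕ) where
  H : Type u
  π : H → A.C (n + 1)
  one : A.C n → H
  comp : ∀ {k : ℕ} (hk : k < n + 1) (p q : H), A.d k hk.le (π p) = A.c k hk.le (π q) → H
  π_one : ∀ a, π (one a) = A.one (n + 1) n.le_succ a
  π_comp : ∀ {k : ℕ} (hk : k < n + 1) (p q : H) (h), π (comp hk p q h) = A.comp k hk (π p) (π q) h
  assoc : ∀ {k : ℕ} (hk : k < n + 1) (t s w : H) (h₁ : A.d k hk.le (π t) = A.c k hk.le (π s))
    (h₂ : A.d k hk.le (π (comp hk t s h₁)) = A.c k hk.le (π w))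
    (h₃ : A.d k hk.le (π s) = A.c k hk.le (π w))
    (h₄ : A.d k hk.le (π t) = A.c k hk.le (π (comp hk s w h₃))),
    comp hk (comp hk t s h₁) w h₂ = comp hk t (comp hk s w h₃) h₄
  exchange : ∀ {k l : ℕ} (hl : l < n + 1) (hk : k < n + 1) (_ : l < k) (t t' s s' : H)
    (h₁ : A.d k hk.le (π t) = A.c k hk.le (π t')) (h₂ : A.d k hk.le (π s) = A.c k hk.le (π s'))
    (h₃ : A.d l hl.le (π (comp hk t t' h₁)) = A.c l hl.le (π (comp hk s s' h₂)))
    (h₄ : A.d l hl.le (π t) = A.c l hl.le (π s)) (h₅ : A.d l hl.le (π t') = A.c l hl.le (π s'))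
    (h₆ : A.d k hk.le (π (comp hl t s h₄)) = A.c k hk.le (π (comp hl t' s' h₅))),
    comp hl (comp hk t t' h₁) (comp hk s s' h₂) h₃ =
      comp hk (comp hl t s h₄) (comp hl t' s' h₅) h₆
  one_comp : ∀ {k : ℕ} (hk : k < n + 1) (b : A.C k) (t : H)
    (h : A.d k hk.le (π (one (A.one n (Nat.lt_succ_iff.1 hk) b))) = A.c k hk.le (π t)),
    comp hk (one (A.one n (Nat.lt_succ_iff.1 hk) b)) t h = t
  comp_one : ∀ {k : ℕ} (hk : k < n + 1) (b : A.C k) (t : H)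
    (h : A.d k hk.le (π t) = A.c k hk.le (π (one (A.one n (Nat.lt_succ_iff.1 hk) b)))),
    comp hk t (one (A.one n (Nat.lt_succ_iff.1 hk) b)) h = t
  one_comp_one : ∀ {k : ℕ} (hk : k < n) (a b : A.C n) (h : A.d k hk.le a = A.c k hk.le b)
    (h' : A.d k (hk.le.trans n.le_succ) (π (one a)) = A.c k (hk.le.trans n.le_succ) (π (one b))),
    comp (hk.trans n.lt_succ_self) (one a) (one b) h' = one (A.comp k hk a b h)

namespace Layer

variable {A : OmegaCat.{u}} {n : ℕ} (L : A.Layer n)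

/-- Cells of the `ω`-category `L.cat`: those of `A` up to dimension `n`, those of `L` in dimension
`n + 1`, and identities on them in higher dimensions. -/
@[ext]
structure Cell (m : ℕ) where
  u : A.C m
  e : n + 1 ≤ m → L.H
  π_e : ∀ h, L.π (e h) = A.d (n + 1) h u
  u_eq : ∀ h, u = A.one m h (L.π (e h))

variable {L}

theorem Cell.ext' {m : ℕ} {x y : L.Cell m} (h : x.u = y.u) (h' : ∀ hm, x.e hm = y.e hm) : x = y :=
  Cell.ext h (funext h')

def Cell.d {m : ℕ} (k : ℕ) (hk : k ≤ m) (x : L.Cell m) : L.Cell k where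
  u := A.d k hk x.u
  e h := x.e (h.trans hk)
  π_e h := by rw [x.π_e, A.d_d]
  u_eq h := by
    conv_lhs => rw [x.u_eq (h.trans hk)]
    rw [A.d_one_of_ge h hk]

def Cell.c {m : ℕ} (k : ℕ) (hk : k ≤ m) (x : L.Cell m) : L.Cell k where
  u := A.c k hk x.u
  e h := x.e (h.trans hk)
  π_e h := by
    conv_rhs => rw [x.u_eq (h.trans hk), A.c_one_of_ge h hk, A.d_one]
  u_eq h := by
    conv_lhs => rw [x.u_eq (h.trans hk)]
    rw [A.c_one_of_ge h hk]

theorem Cell.e_eq_of {m k : ℕ} {hk : k ≤ m} {x y : L.Cell m} (h : x.d k hk = y.c k hk)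
    (hn : n + 1 ≤ k) : x.e (hn.trans hk) = y.e (hn.trans hk) :=
  congrFun (congrArg Cell.e h) hn

theorem Cell.u_eq_of {m k : ℕ} {hk : k ≤ m} {x y : L.Cell m} (h : x.d k hk = y.c k hk) :
    A.d k hk x.u = A.c k hk y.u :=
  congrArg Cell.u h

theorem Cell.c_π {m k : ℕ} (hk : k ≤ n + 1) (x : L.Cell m) (h : n + 1 ≤ m) :
    A.c k hk (L.π (x.e h)) = A.c k (hk.trans h) x.u := by
  conv_rhs => rw [x.u_eq h]
  rw [A.c_one_of_le]

theorem Cell.d_π {m k : ℕ} (hk : k ≤ n + 1) (x : L.Cell m) (h : n + 1 ≤ m) :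
    A.d k hk (L.π (x.e h)) = A.d k (hk.trans h) x.u := by
  rw [x.π_e, A.d_d]

theorem Cell.composable {m k : ℕ} {hk : k ≤ m} {x y : L.Cell m} (h : x.d k hk = y.c k hk)
    (hkn : k ≤ n + 1) (hm : n + 1 ≤ m) :
    A.d k hkn (L.π (x.e hm)) = A.c k hkn (L.π (y.e hm)) := by
  rw [x.d_π, y.c_π]; exact congrArg Cell.u h

open Classical in
def Cell.one {l : ℕ} (m : ℕ) (hm : l ≤ m) (x : L.Cell l) : L.Cell m where
  u := A.one m hm x.u
  e h := if h' : n + 1 ≤ l then x.e h' else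
    L.one (A.one n (by omega) x.u)
  π_e h := by
    split_ifs with h'
    · rw [x.π_e, ← A.d_d h' hm, A.d_one]
    · rw [L.π_one, A.one_one, A.d_one_of_ge]
  u_eq h := by
    split_ifs with h'
    · conv_lhs => rw [x.u_eq h']
      rw [A.one_one]
    · rw [L.π_one, A.one_one, A.one_one]

open Classical in
def Cell.comp {m : ℕ} (k : ℕ) (hk : k < m) (x y : L.Cell m) (h : x.d k hk.le = y.c k hk.le) :
    L.Cell m where
  u := A.comp k hk x.u y.u (Cell.u_eq_of h)
  e hm := if hkn : k < n + 1 then L.comp hkn (x.e hm) (y.e hm) (Cell.composable h hkn.le hm)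
    else x.e hm
  π_e hm := by
    have hu : A.d k hk.le x.u = A.c k hk.le y.u := congrArg Cell.u h
    split_ifs with hkn
    · have e : A.d k hkn.le (A.d (n + 1) hm x.u) = A.c k hkn.le (A.d (n + 1) hm y.u) := by
        rw [A.d_d, A.c_d hkn, hu]
      rw [L.π_comp, A.d_comp_of_lt hk hkn hm _ _ _ e]
      exact A.comp_congr _ (x.π_e hm) (y.π_e hm) _ _
    · have hkn' : n + 1 ≤ k := by omega
      rw [← A.d_d hkn' hk.le, A.d_comp, A.d_d, ← y.π_e hm, Cell.e_eq_of h hkn']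
  u_eq hm := by
    have hu : A.d k hk.le x.u = A.c k hk.le y.u := congrArg Cell.u h
    split_ifs with hkn
    · rw [L.π_comp, ← A.one_comp_one hkn hm _ _ _
        (by rw [← x.u_eq hm, ← y.u_eq hm, hu])]
      exact A.comp_congr _ (x.u_eq hm) (y.u_eq hm) _ _
    · have hkn' : n + 1 ≤ k := by omega
      have hx : x.u = A.one m hk.le (A.one k hkn' (L.π (x.e hm))) := by
        rw [A.one_one]; exact x.u_eq hm
      have hy : y.u = A.one m hk.le (A.one k hkn' (L.π (x.e hm))) := by
        rw [A.one_one, Cell.e_eq_of h hkn']; exact y.u_eq hm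
      have := A.comp_congr hk hx rfl hu (by rw [← hx]; exact hu)
      rw [this, A.one_comp]
      exact hy.trans (A.one_one _ _ _)

/-- The `ω`-category that extends the `n`-truncation of `A` by the cells of a layer. -/
def cat (L : A.Layer n) : OmegaCat.{u} where
  C := L.Cell
  d k hk x := x.d k hk
  c k hk x := x.c k hk
  one m hm x := x.one m hm
  comp k hk x y h := x.comp k hk y h
  d_self x := Cell.ext' (A.d_self _) fun _ => rfl
  c_self x := Cell.ext' (A.c_self _) fun _ => rfl
  one_self x := Cell.ext' (A.one_self _) fun hm => by simp only [Cell.one, dif_pos hm]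
  d_d hk hm x := Cell.ext' (A.d_d _ _ _) fun _ => rfl
  c_c hk hm x := Cell.ext' (A.c_c _ _ _) fun _ => rfl
  d_c hk hm x := Cell.ext' (A.d_c hk _ _) fun _ => rfl
  c_d hk hm x := Cell.ext' (A.c_d hk _ _) fun _ => rfl
  one_one {a b l} h h' x := Cell.ext' (A.one_one _ _ _) fun hm => by
    by_cases ha : n + 1 ≤ a
    · simp only [Cell.one, dif_pos ha, dif_pos (ha.trans h)]
    · by_cases hb : n + 1 ≤ b
      · simp only [Cell.one, dif_neg ha, dif_pos hb]
      · simp only [Cell.one, dif_neg ha, dif_neg hb, A.one_one]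
  d_one h x := Cell.ext' (A.d_one _ _) fun hm => by
    simp only [Cell.d, Cell.one, dif_pos hm]
  c_one h x := Cell.ext' (A.c_one _ _) fun hm => by
    simp only [Cell.c, Cell.one, dif_pos hm]
  d_comp hk x y h := Cell.ext' (A.d_comp _ _ _ _) fun hm => by
    simp only [Cell.d, Cell.comp, dif_neg (not_lt.2 hm)]
    exact Cell.e_eq_of h hm
  c_comp hk x y h := Cell.ext' (A.c_comp _ _ _ _) fun hm => by
    simp only [Cell.c, Cell.comp, dif_neg (not_lt.2 hm)]
  d_comp_of_lt hk hkm hm x y h h' :=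
    Cell.ext' (A.d_comp_of_lt hk hkm hm _ _ _ (Cell.u_eq_of h')) fun _ => rfl
  c_comp_of_lt hk hkm hm x y h h' :=
    Cell.ext' (A.c_comp_of_lt hk hkm hm _ _ _ (Cell.u_eq_of h')) fun _ => rfl
  assoc {m k} hk x y z h₁ h₂ h₃ h₄ := Cell.ext'
    (A.assoc hk _ _ _ _ _ (congrArg Cell.u h₃) (congrArg Cell.u h₄)) fun hm => by
    simp only [Cell.comp]
    split_ifs with hkn
    · apply L.assoc
    · rfl
  exchange {m k l} hl hk hlk t t' s s' h₁ h₂ h₃ h₄ h₅ h₆ := Cell.ext'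
    (A.exchange hl hk hlk _ _ _ _ _ _ _ (congrArg Cell.u h₄) (congrArg Cell.u h₅)
      (congrArg Cell.u h₆)) fun hm => by
    simp only [Cell.comp]
    split_ifs with h h' h'
    · apply L.exchange _ _ hlk
    · rfl
    · omega
    · rfl
  one_comp {m k} hk b t h := Cell.ext' (A.one_comp _ _ _ _) fun hm => by
    by_cases hkn : k < n + 1
    · simp only [Cell.comp, dif_pos hkn, Cell.one, dif_neg (not_le.2 hkn)]
      apply L.one_comp
    · simp only [Cell.comp, dif_neg hkn]
      exact Cell.e_eq_of h (not_lt.1 hkn)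
  comp_one {m k} hk b t h := Cell.ext' (A.comp_one _ _ _ _) fun hm => by
    by_cases hkn : k < n + 1
    · simp only [Cell.comp, dif_pos hkn, Cell.one, dif_neg (not_le.2 hkn)]
      apply L.comp_one
    · simp only [Cell.comp, dif_neg hkn]
  one_comp_one {l m k} hk hm a b h h' := Cell.ext'
    (A.one_comp_one _ _ _ _ (congrArg Cell.u h) (congrArg Cell.u h')) fun hnm => by
    by_cases hl : n + 1 ≤ l
    · simp only [Cell.comp, Cell.one, dif_pos hl]
    · have hkn : k < n + 1 := by omega
      have hu : A.d k hk.le a.u = A.c k hk.le b.u := congrArg Cell.u h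
      simp only [Cell.comp, Cell.one, dif_neg hl, dif_pos hkn]
      have hkn' : k < n := by omega
      rw [L.one_comp_one hkn' _ _ (by
        rw [A.d_one_of_le hk.le (by omega), A.c_one_of_le hk.le (by omega), hu])]
      rw [A.one_comp_one _ _ _ _ hu]

end Layer

/-- Recursion on the cells of a free extension. -/
theorem IsFreeExtension.exists_section {A : OmegaCat.{u}} {n : ℕ} {I : Set (A.C (n + 1))}
    (hI : A.IsFreeExtension n I) (L : A.Layer n) (ex : I → L.H) (hex : ∀ x, L.π (ex x) = x.1) :
    ∃ e : A.C (n + 1) → L.H, (∀ u, L.π (e u) = u) ∧ (∀ x : I, e x.1 = ex x) ∧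
      (∀ a, e (A.one (n + 1) n.le_succ a) = L.one a) ∧
      ∀ {k : ℕ} (hk : k < n + 1) (u v : A.C (n + 1)) (h : A.d k hk.le u = A.c k hk.le v)
        (h' : A.d k hk.le (L.π (e u)) = A.c k hk.le (L.π (e v))),
        e (A.comp k hk u v h) = L.comp hk (e u) (e v) h' := by
  have no : ∀ {k : ℕ}, k ≤ n → n + 1 ≤ k → False := fun h h' => by omega
  let F : TruncFunctor A L.cat n :=
    { map := fun hk a => ⟨a, fun h => (no hk h).elim, fun h => (no hk h).elim,
        fun h => (no hk h).elim⟩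
      map_d := fun hn hk u => Layer.Cell.ext' rfl fun h => (no hn (h.trans hk)).elim
      map_c := fun hn hk u => Layer.Cell.ext' rfl fun h => (no hn (h.trans hk)).elim
      map_one := fun hn hk u => Layer.Cell.ext' rfl fun h => (no hn h).elim
      map_comp := fun hn hk u v h h' => Layer.Cell.ext' rfl fun h => (no hn h).elim }
  obtain ⟨G, ⟨hG₁, hG₂⟩, -⟩ := hI L.cat F
    (fun x => ⟨x.1, fun _ => ex x, fun h => by rw [hex, A.d_self], fun h => by
      rw [hex, A.one_self]⟩)
    (fun x => Layer.Cell.ext' rfl fun h => (no le_rfl h).elim)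
    (fun x => Layer.Cell.ext' rfl fun h => (no le_rfl h).elim)
  let E : TruncFunctor A A n :=
    { map := fun _ a => a
      map_d := fun _ _ _ => rfl
      map_c := fun _ _ _ => rfl
      map_one := fun _ _ _ => rfl
      map_comp := fun _ _ _ _ _ _ => rfl }
  let E' : TruncFunctor A A (n + 1) :=
    { map := fun _ a => a
      map_d := fun _ _ _ => rfl
      map_c := fun _ _ _ => rfl
      map_one := fun _ _ _ => rfl
      map_comp := fun _ _ _ _ _ _ => rfl }
  have lift : ∀ {m k : ℕ} (hm : m ≤ n + 1) (hk : k < m) (a b : A.C m),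
      A.d k hk.le a = A.c k hk.le b → (G.map hm a).d k hk.le = (G.map hm b).c k hk.le :=
    fun {m k} hm hk a b h => (G.map_d hm hk.le a).symm.trans
      ((congrArg (G.map _) h).trans (G.map_c hm hk.le b))
  have key : ∀ {m : ℕ} (hm : m ≤ n + 1) (a : A.C m), (G.map hm a).u = a := by
    intro m hm a
    have main : ∀ u : A.C (n + 1), (G.map le_rfl u).u = u := by
      refine hI.induction _ (fun x hx => ?_) (fun a => ?_) (fun k hk u v h hu hv => ?_)
      · rw [hG₂ ⟨x, hx⟩]
      · rw [G.map_one le_rfl, hG₁ le_rfl]; rfl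
      · rw [G.map_comp le_rfl hk u v h (lift _ hk _ _ h)]
        exact A.comp_congr hk hu hv _ _
    rcases Nat.lt_or_ge n m with h | h
    · obtain rfl : m = n + 1 := by omega
      exact main a
    · rw [hG₁ h]
  refine ⟨fun u => (G.map le_rfl u).e le_rfl, fun u => ?_, fun x => ?_, fun a => ?_, ?_⟩
  · exact ((G.map le_rfl u).π_e le_rfl).trans ((A.d_self _).trans (key le_rfl u))
  · change (G.map le_rfl x.1).e le_rfl = _
    rw [hG₂]
  · change (G.map le_rfl (A.one (n + 1) n.le_succ a)).e le_rfl = _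
    rw [G.map_one le_rfl, hG₁ le_rfl]
    change (Layer.Cell.one (n + 1) n.le_succ _).e _ = _
    simp only [Layer.Cell.one]
    rw [dif_neg (by omega), A.one_self]
  · intro k hk u v h h'
    change (G.map le_rfl (A.comp k hk u v h)).e le_rfl = _
    rw [G.map_comp le_rfl hk u v h (lift _ hk _ _ h)]
    change (Layer.Cell.comp k hk _ _ (lift _ hk _ _ h)).e _ = _
    simp only [Layer.Cell.comp, dif_pos hk]

end OmegaCat

namespace OmegaCat

theorem composable_d (A : OmegaCat.{u}) {n m k : ℕ} (hk : k < m) (hm : m ≤ n) {u v : A.C n}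
    (h : A.d k (hk.le.trans hm) u = A.c k (hk.le.trans hm) v) :
    A.d k hk.le (A.d m hm u) = A.c k hk.le (A.d m hm v) := by
  rw [A.d_d, A.c_d hk, h]

theorem composable_c (A : OmegaCat.{u}) {n m k : ℕ} (hk : k < m) (hm : m ≤ n) {u v : A.C n}
    (h : A.d k (hk.le.trans hm) u = A.c k (hk.le.trans hm) v) :
    A.d k hk.le (A.c m hm u) = A.c k hk.le (A.c m hm v) := by
  rw [A.c_c, A.d_c hk, h]

end OmegaCat

namespace Computad

/-- Occurrences of indeterminates in the `n`-cells of a computad, coded by elements of a fixed type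
`κ`. -/
structure Coding (A : Computad.{u}) (n : ℕ) (κ : Type) where
  occ : A.C n → Set κ
  finite : ∀ u, (occ u).Finite
  lab : A.C n → κ → A.C n
  lab_mem : ∀ u, ∀ a ∈ occ u, lab u a ∈ A.indet n
  inl : ∀ {k : ℕ} (hk : k < n) (u v : A.C n), A.d k hk.le u = A.c k hk.le v → κ → κ
  inr : ∀ {k : ℕ} (hk : k < n) (u v : A.C n), A.d k hk.le u = A.c k hk.le v → κ → κ
  mem_comp : ∀ {k : ℕ} (hk : k < n) (u v : A.C n) (h : A.d k hk.le u = A.c k hk.le v) (a : κ),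
    a ∈ occ (A.comp k hk u v h) ↔
      (∃ b ∈ occ u, inl hk u v h b = a) ∨ ∃ b ∈ occ v, inr hk u v h b = a
  inl_inj : ∀ {k : ℕ} (hk : k < n) (u v : A.C n) (h : A.d k hk.le u = A.c k hk.le v),
    Set.InjOn (inl hk u v h) (occ u)
  inr_inj : ∀ {k : ℕ} (hk : k < n) (u v : A.C n) (h : A.d k hk.le u = A.c k hk.le v),
    Set.InjOn (inr hk u v h) (occ v)
  inl_ne_inr : ∀ {k : ℕ} (hk : k < n) (u v : A.C n) (h : A.d k hk.le u = A.c k hk.le v),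
    ∀ a ∈ occ u, ∀ b ∈ occ v, inl hk u v h a ≠ inr hk u v h b
  lab_inl : ∀ {k : ℕ} (hk : k < n) (u v : A.C n) (h : A.d k hk.le u = A.c k hk.le v),
    ∀ a ∈ occ u, lab (A.comp k hk u v h) (inl hk u v h a) = lab u a
  lab_inr : ∀ {k : ℕ} (hk : k < n) (u v : A.C n) (h : A.d k hk.le u = A.c k hk.le v),
    ∀ a ∈ occ v, lab (A.comp k hk u v h) (inr hk u v h a) = lab v a
  occ_indet : ∀ x ∈ A.indet n, ∃ a, occ x = {a} ∧ lab x a = x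
  occ_one : ∀ {m : ℕ} (hm : m < n) (a : A.C m), occ (A.one n hm.le a) = ∅
  assoc : ∀ {k : ℕ} (hk : k < n) (t s w : A.C n) (h₁ : A.d k hk.le t = A.c k hk.le s)
    (h₂ : A.d k hk.le (A.comp k hk t s h₁) = A.c k hk.le w) (h₃ : A.d k hk.le s = A.c k hk.le w)
    (h₄ : A.d k hk.le t = A.c k hk.le (A.comp k hk s w h₃)),
    (∀ p ∈ occ t, inl hk _ w h₂ (inl hk t s h₁ p) = inl hk t _ h₄ p) ∧
    (∀ p ∈ occ s, inl hk _ w h₂ (inr hk t s h₁ p) = inr hk t _ h₄ (inl hk s w h₃ p)) ∧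
    (∀ p ∈ occ w, inr hk _ w h₂ p = inr hk t _ h₄ (inr hk s w h₃ p))
  exchange : ∀ {k l : ℕ} (hl : l < n) (hk : k < n) (_ : l < k) (t t' s s' : A.C n)
    (h₁ : A.d k hk.le t = A.c k hk.le t') (h₂ : A.d k hk.le s = A.c k hk.le s')
    (h₃ : A.d l hl.le (A.comp k hk t t' h₁) = A.c l hl.le (A.comp k hk s s' h₂))
    (h₄ : A.d l hl.le t = A.c l hl.le s) (h₅ : A.d l hl.le t' = A.c l hl.le s')
    (h₆ : A.d k hk.le (A.comp l hl t s h₄) = A.c k hk.le (A.comp l hl t' s' h₅)),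
    (∀ p ∈ occ t, inl hl _ _ h₃ (inl hk t t' h₁ p) = inl hk _ _ h₆ (inl hl t s h₄ p)) ∧
    (∀ p ∈ occ t', inl hl _ _ h₃ (inr hk t t' h₁ p) = inr hk _ _ h₆ (inl hl t' s' h₅ p)) ∧
    (∀ p ∈ occ s, inr hl _ _ h₃ (inl hk s s' h₂ p) = inl hk _ _ h₆ (inr hl t s h₄ p)) ∧
    (∀ p ∈ occ s', inr hl _ _ h₃ (inr hk s s' h₂ p) = inr hk _ _ h₆ (inr hl t' s' h₅ p))
  one_comp : ∀ {k : ℕ} (hk : k < n) (b : A.C k) (t : A.C n)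
    (h : A.d k hk.le (A.one n hk.le b) = A.c k hk.le t), ∀ p ∈ occ t, inr hk _ t h p = p
  comp_one : ∀ {k : ℕ} (hk : k < n) (a : A.C k) (t : A.C n)
    (h : A.d k hk.le t = A.c k hk.le (A.one n hk.le a)), ∀ p ∈ occ t, inl hk t _ h p = p

namespace Coding

variable {A : Computad.{u}} {n : ℕ} {κ : Type} (C : A.Coding n κ)

theorem inl_congr {k : ℕ} (hk : k < n) {u u' v v' : A.C n} (hu : u = u') (hv : v = v')
    (h : A.d k hk.le u = A.c k hk.le v) (h' : A.d k hk.le u' = A.c k hk.le v') :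
    C.inl hk u v h = C.inl hk u' v' h' := by
  subst hu hv; rfl

theorem inr_congr {k : ℕ} (hk : k < n) {u u' v v' : A.C n} (hu : u = u') (hv : v = v')
    (h : A.d k hk.le u = A.c k hk.le v) (h' : A.d k hk.le u' = A.c k hk.le v') :
    C.inr hk u v h = C.inr hk u' v' h' := by
  subst hu hv; rfl

/-- Forests: sets of leaves (named by elements of `κ`) and nodes (labelled by elements of `X`), each
with an address that consists of a root and a path. -/
abbrev Forest (κ : Type) (X : Type u) := Set ((κ ⊕ X) × κ × List κ)

/-- Renaming of the leaves and roots of a forest. -/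
def push {X : Type u} (i j : κ → κ) (F : Forest κ X) : Forest κ X :=
  (fun z => (Sum.map j id z.1, i z.2.1, z.2.2)) '' F

/-- Grafting of forests. -/
def graft {X : Type u} (F G : Forest κ X) : Forest κ X :=
  {z | (∃ x, z.1 = Sum.inr x ∧ z ∈ F) ∨
    ∃ s p r q, (z.1, (s, p)) ∈ G ∧ (Sum.inl s, (r, q)) ∈ F ∧ z.2 = (r, q ++ p)}

theorem push_push {X : Type u} (i j i' j' : κ → κ) (F : Forest κ X) :
    push i j (push i' j' F) = push (i ∘ i') (j ∘ j') F := by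
  simp only [push, Set.image_image]
  refine Set.image_congr fun z _ => ?_
  rcases z with ⟨_ | _, _⟩ <;> rfl

theorem push_union {X : Type u} (i j : κ → κ) (F G : Forest κ X) :
    push i j (F ∪ G) = push i j F ∪ push i j G :=
  Set.image_union _ _ _

theorem push_empty {X : Type u} (i j : κ → κ) : push i j (∅ : Forest κ X) = ∅ :=
  Set.image_empty _

theorem graft_assoc {X : Type u} (F G K : Forest κ X) :
    graft (graft F G) K = graft F (graft G K) := by
  ext ⟨o, a⟩
  constructor
  · rintro (⟨x, rfl, ⟨y, h, h'⟩ | ⟨s, p, r, q, h, h', h''⟩⟩ | ⟨s, p, r, q, h, h', h''⟩)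
    · exact Or.inl ⟨x, rfl, h'⟩
    · exact Or.inr ⟨s, p, r, q, Or.inl ⟨x, rfl, h⟩, h', h''⟩
    · rcases h' with ⟨y, h₁, h₂⟩ | ⟨s', p', r', q', h₁, h₂, h₃⟩
      · cases h₁
      · obtain ⟨rfl, rfl⟩ := Prod.mk.inj h₃
        exact Or.inr ⟨s', p' ++ p, r, q', Or.inr ⟨s, p, s', p', h, h₁, rfl⟩, h₂, by
          rw [h'', List.append_assoc]⟩
  · rintro (⟨x, rfl, h⟩ | ⟨s, p, r, q, ⟨y, h₁, h₂⟩ | ⟨s', p', r', q', h₁, h₂, h₃⟩, h', h''⟩)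
    · exact Or.inl ⟨x, rfl, Or.inl ⟨x, rfl, h⟩⟩
    · exact Or.inl ⟨y, h₁, Or.inr ⟨s, p, r, q, h₂, h', h''⟩⟩
    · obtain ⟨rfl, rfl⟩ := Prod.mk.inj h₃
      exact Or.inr ⟨s', p', r, q ++ q', h₁, Or.inr ⟨s, q', r, q, h₂, h', rfl⟩, by
        rw [h'', List.append_assoc]⟩

/-- The properties of the forest of a cell `u` whose roots are the occurrences in `c u` and whose leaves
are those in `d u`. -/
structure Good (u : A.C (n + 1)) (F : Forest κ (A.C (n + 1))) : Prop where
  leaf_mem : ∀ {s a}, (Sum.inl s, a) ∈ F → s ∈ C.occ (A.d n n.le_succ u)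
  root_mem : ∀ {o a}, (o, a) ∈ F → a.1 ∈ C.occ (A.c n n.le_succ u)
  leaf_ex : ∀ {s}, s ∈ C.occ (A.d n n.le_succ u) → ∃ a, (Sum.inl s, a) ∈ F
  leaf_pre : ∀ {s o r q p}, (Sum.inl s, (r, q)) ∈ F → (o, (r, q ++ p)) ∈ F → o = Sum.inl s ∧ p = []
  node_unique : ∀ {x y a}, (Sum.inr x, a) ∈ F → (Sum.inr y, a) ∈ F → x = y
  leaf_unique : ∀ {s a b}, (Sum.inl s, a) ∈ F → (Sum.inl s, b) ∈ F → a = b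
  node_indet : ∀ {x a}, (Sum.inr x, a) ∈ F → x ∈ A.indet (n + 1)
  finite : {a | ∃ x, (Sum.inr x, a) ∈ F}.Finite

variable {C}

theorem push_congr {u : A.C (n + 1)} {F : Forest κ (A.C (n + 1))} (hF : C.Good u F)
    {i i' j j' : κ → κ} (hi : ∀ a ∈ C.occ (A.c n n.le_succ u), i a = i' a)
    (hj : ∀ a ∈ C.occ (A.d n n.le_succ u), j a = j' a) : push i j F = push i' j' F := by
  refine Set.image_congr ?_
  rintro ⟨s | x, a⟩ h
  · simp only [Sum.map_inl, hi _ (hF.root_mem h), hj _ (hF.leaf_mem h)]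
  · simp only [Sum.map_inr, hi _ (hF.root_mem h)]

theorem push_id {u : A.C (n + 1)} {F : Forest κ (A.C (n + 1))} (hF : C.Good u F)
    {i j : κ → κ} (hi : ∀ a ∈ C.occ (A.c n n.le_succ u), i a = a)
    (hj : ∀ a ∈ C.occ (A.d n n.le_succ u), j a = a) : push i j F = F := by
  rw [push_congr hF (i' := id) (j' := id) hi hj]
  simp only [push, Sum.map_id_id, id, Set.image_id']

theorem mem_push_inr {X : Type u} {i j : κ → κ} {F : Forest κ X} {x : X} {a : κ × List κ} :
    (Sum.inr x, a) ∈ push i j F ↔ ∃ r p, (Sum.inr x, (r, p)) ∈ F ∧ a = (i r, p) := by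
  constructor
  · rintro ⟨⟨s | y, r, p⟩, h, e⟩
    · cases e
    · obtain ⟨e, rfl⟩ := Prod.mk.inj e
      cases e
      exact ⟨r, p, h, rfl⟩
  · rintro ⟨r, p, h, rfl⟩
    exact ⟨_, h, rfl⟩

theorem mem_push_inl {X : Type u} {i j : κ → κ} {F : Forest κ X} {t : κ} {a : κ × List κ} :
    (Sum.inl t, a) ∈ push i j F ↔ ∃ s r p, (Sum.inl s, (r, p)) ∈ F ∧ t = j s ∧ a = (i r, p) := by
  constructor
  · rintro ⟨⟨s | y, r, p⟩, h, e⟩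
    · obtain ⟨e, rfl⟩ := Prod.mk.inj e
      cases e
      exact ⟨s, r, p, h, rfl, rfl⟩
    · cases e
  · rintro ⟨s, r, p, h, rfl, rfl⟩
    exact ⟨_, h, rfl⟩

theorem good_graft {u v w : A.C (n + 1)} {F G : Forest κ (A.C (n + 1))} (hF : C.Good u F)
    (hG : C.Good v G) (h : A.d n n.le_succ u = A.c n n.le_succ v)
    (hd : A.d n n.le_succ w = A.d n n.le_succ v) (hc : A.c n n.le_succ w = A.c n n.le_succ u) :
    C.Good w (graft F G) where
  leaf_mem := by
    rintro s a (⟨x, h₁, h₂⟩ | ⟨s', p, r, q, h₁, h₂, h₃⟩)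
    · cases h₁
    · rw [hd]; exact hG.leaf_mem h₁
  root_mem := by
    rintro o a (⟨x, h₁, h₂⟩ | ⟨s', p, r, q, h₁, h₂, rfl⟩)
    · rw [hc]; exact hF.root_mem h₂
    · rw [hc]; exact hF.root_mem (a := (r, q)) h₂
  leaf_ex := by
    intro s hs
    rw [hd] at hs
    obtain ⟨⟨s', p⟩, h₁⟩ := hG.leaf_ex hs
    have := hG.root_mem h₁
    rw [← h] at this
    obtain ⟨⟨r, q⟩, h₂⟩ := hF.leaf_ex this
    exact ⟨_, Or.inr ⟨s', p, r, q, h₁, h₂, rfl⟩⟩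
  leaf_pre := by
    rintro s o r q p (⟨x, h₁, h₂⟩ | ⟨s₁, p₁, r₁, q₁, h₁, h₂, h₃⟩)
    · cases h₁
    · obtain ⟨rfl, rfl⟩ := Prod.mk.inj h₃
      rintro (⟨x, h₄, h₅⟩ | ⟨s₂, p₂, r₂, q₂, h₄, h₅, h₆⟩)
      · rw [List.append_assoc] at h₅
        have := (hF.leaf_pre h₂ h₅).1
        change o = _ at h₄
        rw [h₄] at this; cases this
      · obtain ⟨rfl, e⟩ := Prod.mk.inj h₆
        rw [List.append_assoc] at e
        rcases List.append_eq_append_iff.1 e with ⟨l, rfl, e₂⟩ | ⟨l, rfl, e₂⟩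
        · obtain ⟨e₃, rfl⟩ := hF.leaf_pre h₂ h₅
          cases e₃
          obtain rfl : p₂ = p₁ ++ p := by simpa using e₂.symm
          exact hG.leaf_pre h₁ h₄
        · obtain ⟨e₃, rfl⟩ := hF.leaf_pre h₅ h₂
          cases e₃
          obtain rfl : p₂ = p₁ ++ p := by simpa using e₂
          exact hG.leaf_pre h₁ h₄
  node_unique := by
    rintro x y a (⟨x', h₁, h₂⟩ | ⟨s₁, p₁, r₁, q₁, h₁, h₂, rfl⟩)
      (⟨y', h₄, h₅⟩ | ⟨s₂, p₂, r₂, q₂, h₄, h₅, h₆⟩)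
    · exact hF.node_unique h₂ h₅
    · change a = _ at h₆
      subst h₆
      cases (hF.leaf_pre h₅ h₂).1
    · cases (hF.leaf_pre h₂ h₅).1
    · obtain ⟨rfl, e⟩ := Prod.mk.inj h₆
      rcases List.append_eq_append_iff.1 e with ⟨l, rfl, e₂⟩ | ⟨l, rfl, e₂⟩
      · obtain ⟨e₃, rfl⟩ := hF.leaf_pre h₂ h₅
        cases e₃
        obtain rfl : p₁ = p₂ := by simpa using e₂
        exact hG.node_unique h₁ h₄
      · obtain ⟨e₃, rfl⟩ := hF.leaf_pre h₅ h₂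
        cases e₃
        obtain rfl : p₁ = p₂ := by simpa using e₂.symm
        exact hG.node_unique h₁ h₄
  leaf_unique := by
    rintro s a b (⟨x', h₁, h₂⟩ | ⟨s₁, p₁, r₁, q₁, h₁, h₂, h₃⟩)
      (⟨y', h₄, h₅⟩ | ⟨s₂, p₂, r₂, q₂, h₄, h₅, h₆⟩)
    · cases h₁
    · cases h₁
    · cases h₄
    · obtain ⟨rfl, rfl⟩ := Prod.mk.inj (hG.leaf_unique h₁ h₄)
      obtain ⟨rfl, rfl⟩ := Prod.mk.inj (hF.leaf_unique h₂ h₅)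
      exact h₃.trans h₆.symm
  node_indet := by
    rintro x a (⟨x', h₁, h₂⟩ | ⟨s₁, p₁, r₁, q₁, h₁, h₂, h₃⟩)
    · exact hF.node_indet h₂
    · exact hG.node_indet h₁
  finite := by
    classical
    have key : {a | ∃ x, (Sum.inr x, a) ∈ graft F G} ⊆ {a | ∃ x, (Sum.inr x, a) ∈ F} ∪
        (fun a : κ × List κ => if h : ∃ b, (Sum.inl a.1, b) ∈ F then (h.choose.1, h.choose.2 ++ a.2)
          else a) '' {a | ∃ x, (Sum.inr x, a) ∈ G} := by
      rintro a ⟨x, ⟨x', h₁, h₂⟩ | ⟨s₁, p₁, r₁, q₁, h₁, h₂, h₃⟩⟩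
      · exact Or.inl ⟨x, h₂⟩
      · refine Or.inr ⟨_, ⟨x, h₁⟩, ?_⟩
        have hex : ∃ b, (Sum.inl s₁, b) ∈ F := ⟨_, h₂⟩
        simp only [dif_pos hex]
        rw [hF.leaf_unique hex.choose_spec h₂]
        exact h₃.symm
    exact (hF.finite.union (hG.finite.image _)).subset key

theorem good_one (a : A.C n) :
    C.Good (A.one (n + 1) n.le_succ a) ((fun s => (Sum.inl s, (s, []))) '' C.occ a) where
  leaf_mem := by
    rintro s b ⟨s', h, e⟩
    cases e
    rwa [A.d_one]
  root_mem := by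
    rintro o b ⟨s', h, e⟩
    cases e
    rwa [A.c_one]
  leaf_ex := by
    intro s hs
    rw [A.d_one] at hs
    exact ⟨_, s, hs, rfl⟩
  leaf_pre := by
    rintro s o r q p ⟨s', h, e⟩ ⟨s'', h', e'⟩
    cases e
    simp only [List.nil_append, Prod.mk.injEq] at e'
    obtain ⟨rfl, rfl, rfl⟩ := e'
    exact ⟨rfl, rfl⟩
  node_unique := by
    rintro x y b ⟨s', h, e⟩
    cases e
  leaf_unique := by
    rintro s b b' ⟨s', h, e⟩ ⟨s'', h', e'⟩
    cases e; cases e'; rfl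
  node_indet := by
    rintro x b ⟨s', h, e⟩
    cases e
  finite := by
    convert Set.finite_empty (α := κ × List κ)
    rw [Set.eq_empty_iff_forall_notMem]
    rintro b ⟨x, s', h, e⟩
    cases e

/-- The forest of an indeterminate. -/
def corolla (C : A.Coding n κ) (x : A.C (n + 1)) : Forest κ (A.C (n + 1)) :=
  {z | z.2.1 ∈ C.occ (A.c n n.le_succ x) ∧ ((z.1 = Sum.inr x ∧ z.2.2 = []) ∨
    ∃ s ∈ C.occ (A.d n n.le_succ x), z.1 = Sum.inl s ∧ z.2.2 = [s])}

theorem good_corolla (x : A.C (n + 1)) (hx : x ∈ A.indet (n + 1))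
    (hc : A.c n n.le_succ x ∈ A.indet n) : C.Good x (C.corolla x) := by
  obtain ⟨r₀, hr₀, -⟩ := C.occ_indet _ hc
  have hr : ∀ {r}, r ∈ C.occ (A.c n n.le_succ x) ↔ r = r₀ := fun {r} => by
    rw [hr₀, Set.mem_singleton_iff]
  refine ⟨?_, fun h => h.1, ?_, ?_, ?_, ?_, ?_, ?_⟩
  · rintro s a ⟨-, ⟨h, -⟩ | ⟨s', h, e, -⟩⟩
    · cases h
    · cases e; exact h
  · intro s hs
    exact ⟨(r₀, [s]), hr.2 rfl, Or.inr ⟨s, hs, rfl, rfl⟩⟩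
  · rintro s o r q p ⟨h₁, ⟨h, -⟩ | ⟨s', h, e, h₂⟩⟩ ⟨h₃, ⟨h₄, h₅⟩ | ⟨s'', h₄, h₅, h₆⟩⟩
    · cases h
    · cases h
    · obtain rfl : q = [s'] := h₂
      simp at h₅
    · cases e
      simp only at h₂ h₅ h₆
      subst h₂
      simp only [List.cons_append, List.nil_append, List.cons.injEq] at h₆
      exact ⟨h₅.trans (by rw [h₆.1]), h₆.2⟩
  · rintro y z a ⟨-, ⟨h, -⟩ | ⟨s', h, e, -⟩⟩ ⟨-, ⟨h', -⟩ | ⟨s'', h', e', -⟩⟩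
    · cases h; cases h'; rfl
    · cases e'
    · cases e
    · cases e
  · rintro s a b ⟨h₁, ⟨h, -⟩ | ⟨s', h, e, h₂⟩⟩ ⟨h₃, ⟨h', -⟩ | ⟨s'', h', e', h₄⟩⟩
    · cases h
    · cases h
    · cases h'
    · cases e; cases e'
      exact Prod.ext ((hr.1 h₁).trans (hr.1 h₃).symm) (h₂.trans h₄.symm)
  · rintro y a ⟨-, ⟨h, -⟩ | ⟨s', h, e, -⟩⟩
    · cases h; exact hx
    · cases e
  · refine (Set.finite_singleton (r₀, ([] : List κ))).subset ?_
    rintro a ⟨y, h, ⟨-, h'⟩ | ⟨s', -, e, -⟩⟩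
    · exact Prod.ext (hr.1 h) h'
    · cases e

variable (C)

/-- The juxtaposition of forests that corresponds to the composite of two cells in dimension `k < n`. -/
def juxt {k : ℕ} (hk : k < n) (u v : A.C (n + 1))
    (h : A.d k (hk.le.trans n.le_succ) u = A.c k (hk.le.trans n.le_succ) v)
    (F G : Forest κ (A.C (n + 1))) : Forest κ (A.C (n + 1)) :=
  push (C.inl hk _ _ (A.composable_c hk n.le_succ h)) (C.inl hk _ _ (A.composable_d hk n.le_succ h)) F ∪
  push (C.inr hk _ _ (A.composable_c hk n.le_succ h)) (C.inr hk _ _ (A.composable_d hk n.le_succ h)) G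

variable {C}

theorem mem_juxt_inl {k : ℕ} {hk : k < n} {u v : A.C (n + 1)}
    {h : A.d k (hk.le.trans n.le_succ) u = A.c k (hk.le.trans n.le_succ) v}
    {F G : Forest κ (A.C (n + 1))} {t a} (hm : (Sum.inl t, a) ∈ C.juxt hk u v h F G) :
    (∃ s b, (Sum.inl s, b) ∈ F ∧ t = C.inl hk _ _ (A.composable_d hk n.le_succ h) s ∧
      a = (C.inl hk _ _ (A.composable_c hk n.le_succ h) b.1, b.2)) ∨
    (∃ s b, (Sum.inl s, b) ∈ G ∧ t = C.inr hk _ _ (A.composable_d hk n.le_succ h) s ∧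
      a = (C.inr hk _ _ (A.composable_c hk n.le_succ h) b.1, b.2)) := by
  rcases hm with hm | hm
  · obtain ⟨s, r, p, h₁, h₂, h₃⟩ := mem_push_inl.1 hm
    exact Or.inl ⟨s, (r, p), h₁, h₂, h₃⟩
  · obtain ⟨s, r, p, h₁, h₂, h₃⟩ := mem_push_inl.1 hm
    exact Or.inr ⟨s, (r, p), h₁, h₂, h₃⟩

theorem mem_juxt_inr {k : ℕ} {hk : k < n} {u v : A.C (n + 1)}
    {h : A.d k (hk.le.trans n.le_succ) u = A.c k (hk.le.trans n.le_succ) v}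
    {F G : Forest κ (A.C (n + 1))} {x a} : (Sum.inr x, a) ∈ C.juxt hk u v h F G ↔
    (∃ b, (Sum.inr x, b) ∈ F ∧ a = (C.inl hk _ _ (A.composable_c hk n.le_succ h) b.1, b.2)) ∨
    (∃ b, (Sum.inr x, b) ∈ G ∧ a = (C.inr hk _ _ (A.composable_c hk n.le_succ h) b.1, b.2)) := by
  simp only [juxt, Set.mem_union, mem_push_inr, Prod.exists]

theorem good_juxt {k : ℕ} (hk : k < n) {u v : A.C (n + 1)}
    (h : A.d k (hk.le.trans n.le_succ) u = A.c k (hk.le.trans n.le_succ) v)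
    {F G : Forest κ (A.C (n + 1))} (hF : C.Good u F) (hG : C.Good v G) :
    C.Good (A.comp k (hk.trans n.lt_succ_self) u v h) (C.juxt hk u v h F G) := by
  have hd := A.composable_d hk n.le_succ h
  have hc := A.composable_c hk n.le_succ h
  have ed := A.d_comp_of_lt (hk.trans n.lt_succ_self) hk n.le_succ u v h hd
  have ec := A.c_comp_of_lt (hk.trans n.lt_succ_self) hk n.le_succ u v h hc
  have md := fun a => ed ▸ C.mem_comp hk _ _ hd a
  have mc := fun a => ec ▸ C.mem_comp hk _ _ hc a
  have inlc := C.inl_inj hk _ _ hc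
  have inrc := C.inr_inj hk _ _ hc
  have nec := C.inl_ne_inr hk _ _ hc
  have inld := C.inl_inj hk _ _ hd
  have inrd := C.inr_inj hk _ _ hd
  have ned := C.inl_ne_inr hk _ _ hd
  refine ⟨?_, ?_, ?_, ?_, ?_, ?_, ?_, ?_⟩
  · intro t a hm
    rw [md]
    rcases mem_juxt_inl hm with ⟨s, b, h₁, rfl, rfl⟩ | ⟨s, b, h₁, rfl, rfl⟩
    · exact Or.inl ⟨s, hF.leaf_mem h₁, rfl⟩
    · exact Or.inr ⟨s, hG.leaf_mem h₁, rfl⟩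
  · rintro o a (⟨⟨o', b⟩, h₁, e⟩ | ⟨⟨o', b⟩, h₁, e⟩)
    · obtain ⟨rfl, rfl⟩ := Prod.mk.inj e
      exact (mc _).2 (Or.inl ⟨_, hF.root_mem h₁, rfl⟩)
    · obtain ⟨rfl, rfl⟩ := Prod.mk.inj e
      exact (mc _).2 (Or.inr ⟨_, hG.root_mem h₁, rfl⟩)
  · intro s hs
    rcases (md s).1 hs with ⟨b, hb, rfl⟩ | ⟨b, hb, rfl⟩
    · obtain ⟨⟨r, p⟩, h₁⟩ := hF.leaf_ex hb
      exact ⟨_, Or.inl (mem_push_inl.2 ⟨b, r, p, h₁, rfl, rfl⟩)⟩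
    · obtain ⟨⟨r, p⟩, h₁⟩ := hG.leaf_ex hb
      exact ⟨_, Or.inr (mem_push_inl.2 ⟨b, r, p, h₁, rfl, rfl⟩)⟩
  · rintro s o r q p h₁ (⟨⟨o', b⟩, h₂, e⟩ | ⟨⟨o', b⟩, h₂, e⟩)
    · obtain ⟨rfl, e₀⟩ := Prod.mk.inj e
      obtain ⟨rfl, e'⟩ := Prod.mk.inj e₀
      rcases mem_juxt_inl h₁ with ⟨s', b', h₃, rfl, e₂⟩ | ⟨s', b', h₃, rfl, e₂⟩
      · obtain ⟨e₁, rfl⟩ := Prod.mk.inj e₂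
        have e₃ := inlc (hF.root_mem h₂) (hF.root_mem h₃) e₁
        obtain ⟨r, q'⟩ := b
        obtain ⟨r', q⟩ := b'
        obtain rfl : r = r' := e₃
        obtain rfl : q' = q ++ p := e'
        obtain ⟨rfl, rfl⟩ := hF.leaf_pre h₃ h₂
        exact ⟨rfl, rfl⟩
      · exact (nec _ (hF.root_mem h₂) _ (hG.root_mem h₃) (Prod.mk.inj e₂).1).elim
    · obtain ⟨rfl, e₀⟩ := Prod.mk.inj e
      obtain ⟨rfl, e'⟩ := Prod.mk.inj e₀
      rcases mem_juxt_inl h₁ with ⟨s', b', h₃, rfl, e₂⟩ | ⟨s', b', h₃, rfl, e₂⟩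
      · exact (nec _ (hF.root_mem h₃) _ (hG.root_mem h₂) (Prod.mk.inj e₂).1.symm).elim
      · obtain ⟨e₁, rfl⟩ := Prod.mk.inj e₂
        have e₃ := inrc (hG.root_mem h₂) (hG.root_mem h₃) e₁
        obtain ⟨r, q'⟩ := b
        obtain ⟨r', q⟩ := b'
        obtain rfl : r = r' := e₃
        obtain rfl : q' = q ++ p := e'
        obtain ⟨rfl, rfl⟩ := hG.leaf_pre h₃ h₂
        exact ⟨rfl, rfl⟩
  · intro x y a h₁ h₂
    rcases mem_juxt_inr.1 h₁ with ⟨b, h₃, rfl⟩ | ⟨b, h₃, rfl⟩ <;>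
      rcases mem_juxt_inr.1 h₂ with ⟨b', h₄, e⟩ | ⟨b', h₄, e⟩
    · obtain ⟨e₁, e₂⟩ := Prod.mk.inj e
      obtain rfl : b = b' := Prod.ext (inlc (hF.root_mem h₃) (hF.root_mem h₄) e₁) e₂
      exact hF.node_unique h₃ h₄
    · exact (nec _ (hF.root_mem h₃) _ (hG.root_mem h₄) (Prod.mk.inj e).1).elim
    · exact (nec _ (hF.root_mem h₄) _ (hG.root_mem h₃) (Prod.mk.inj e).1.symm).elim
    · obtain ⟨e₁, e₂⟩ := Prod.mk.inj e
      obtain rfl : b = b' := Prod.ext (inrc (hG.root_mem h₃) (hG.root_mem h₄) e₁) e₂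
      exact hG.node_unique h₃ h₄
  · intro s a b h₁ h₂
    rcases mem_juxt_inl h₁ with ⟨s₁, b₁, h₃, rfl, rfl⟩ | ⟨s₁, b₁, h₃, rfl, rfl⟩ <;>
      rcases mem_juxt_inl h₂ with ⟨s₂, b₂, h₄, e, rfl⟩ | ⟨s₂, b₂, h₄, e, rfl⟩
    · obtain rfl := inld (hF.leaf_mem h₃) (hF.leaf_mem h₄) e
      rw [hF.leaf_unique h₃ h₄]
    · exact (ned _ (hF.leaf_mem h₃) _ (hG.leaf_mem h₄) e).elim
    · exact (ned _ (hF.leaf_mem h₄) _ (hG.leaf_mem h₃) e.symm).elim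
    · obtain rfl := inrd (hG.leaf_mem h₃) (hG.leaf_mem h₄) e
      rw [hG.leaf_unique h₃ h₄]
  · intro x a h₁
    rcases mem_juxt_inr.1 h₁ with ⟨b, h₃, rfl⟩ | ⟨b, h₃, rfl⟩
    · exact hF.node_indet h₃
    · exact hG.node_indet h₃
  · refine ((hF.finite.image (fun b => (C.inl hk _ _ hc b.1, b.2))).union
      (hG.finite.image (fun b => (C.inr hk _ _ hc b.1, b.2)))).subset ?_
    rintro a ⟨x, h₁⟩
    rcases mem_juxt_inr.1 h₁ with ⟨b, h₃, rfl⟩ | ⟨b, h₃, rfl⟩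
    · exact Or.inl ⟨b, ⟨x, h₃⟩, rfl⟩
    · exact Or.inr ⟨b, ⟨x, h₃⟩, rfl⟩

variable (C)

open Classical in
/-- The composition of forests that corresponds to the composition of `(n+1)`-cells. -/
def forestComp {k : ℕ} (hk : k < n + 1) (u v : A.C (n + 1)) (h : A.d k hk.le u = A.c k hk.le v)
    (F G : Forest κ (A.C (n + 1))) : Forest κ (A.C (n + 1)) :=
  if hk' : k < n then C.juxt hk' u v h F G else graft F G

variable {C}

theorem good_forestComp {k : ℕ} (hk : k < n + 1) {u v : A.C (n + 1)}
    (h : A.d k hk.le u = A.c k hk.le v) {F G : Forest κ (A.C (n + 1))} (hF : C.Good u F)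
    (hG : C.Good v G) : C.Good (A.comp k hk u v h) (C.forestComp hk u v h F G) := by
  by_cases hk' : k < n
  · simp only [forestComp, dif_pos hk']
    exact good_juxt hk' h hF hG
  · simp only [forestComp, dif_neg hk']
    obtain rfl : k = n := by omega
    exact good_graft hF hG h (A.d_comp _ _ _ _) (A.c_comp _ _ _ _)

theorem juxt_assoc {k : ℕ} (hk : k < n) {t s w : A.C (n + 1)} (h₁) (h₂) (h₃) (h₄)
    {F G K : Forest κ (A.C (n + 1))} (hF : C.Good t F) (hG : C.Good s G) (hK : C.Good w K) :
    C.juxt hk (A.comp k (hk.trans n.lt_succ_self) t s h₁) w h₂ (C.juxt hk t s h₁ F G) K =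
      C.juxt hk t (A.comp k (hk.trans n.lt_succ_self) s w h₃) h₄ F (C.juxt hk s w h₃ G K) := by
  have ed := A.d_comp_of_lt (hk.trans n.lt_succ_self) hk n.le_succ
  have ec := A.c_comp_of_lt (hk.trans n.lt_succ_self) hk n.le_succ
  have xd := fun {a b} => A.composable_d (u := a) (v := b) hk n.le_succ
  have xc := fun {a b} => A.composable_c (u := a) (v := b) hk n.le_succ
  have ed₁ := ed t s h₁ (xd h₁)
  have ed₂ := ed s w h₃ (xd h₃)
  have ec₁ := ec t s h₁ (xc h₁)
  have ec₂ := ec s w h₃ (xc h₃)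
  obtain ⟨d₁, d₂, d₃⟩ := C.assoc hk _ _ _ (xd h₁) (ed₁ ▸ xd h₂) (xd h₃) (ed₂ ▸ xd h₄)
  obtain ⟨c₁, c₂, c₃⟩ := C.assoc hk _ _ _ (xc h₁) (ec₁ ▸ xc h₂) (xc h₃) (ec₂ ▸ xc h₄)
  simp only [juxt, push_union, push_push, Set.union_assoc]
  rw [C.inl_congr hk ed₁ rfl (xd h₂) (ed₁ ▸ xd h₂), C.inl_congr hk ec₁ rfl (xc h₂) (ec₁ ▸ xc h₂),
    C.inr_congr hk ed₁ rfl (xd h₂) (ed₁ ▸ xd h₂), C.inr_congr hk ec₁ rfl (xc h₂) (ec₁ ▸ xc h₂),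
    C.inl_congr hk rfl ed₂ (xd h₄) (ed₂ ▸ xd h₄), C.inl_congr hk rfl ec₂ (xc h₄) (ec₂ ▸ xc h₄),
    C.inr_congr hk rfl ed₂ (xd h₄) (ed₂ ▸ xd h₄), C.inr_congr hk rfl ec₂ (xc h₄) (ec₂ ▸ xc h₄)]
  exact congrArg₂ _ (push_congr hF c₁ d₁) (congrArg₂ _ (push_congr hG c₂ d₂) (push_congr hK c₃ d₃))

theorem juxt_exchange {k l : ℕ} (hl : l < n) (hk : k < n) (hlk : l < k) {t t' s s' : A.C (n + 1)}
    (h₁) (h₂) (h₃) (h₄) (h₅) (h₆)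
    {F F' G G' : Forest κ (A.C (n + 1))} (hF : C.Good t F) (hF' : C.Good t' F')
    (hG : C.Good s G) (hG' : C.Good s' G') :
    C.juxt hl (A.comp k (hk.trans n.lt_succ_self) t t' h₁)
        (A.comp k (hk.trans n.lt_succ_self) s s' h₂) h₃ (C.juxt hk t t' h₁ F F')
        (C.juxt hk s s' h₂ G G') =
      C.juxt hk (A.comp l (hl.trans n.lt_succ_self) t s h₄)
        (A.comp l (hl.trans n.lt_succ_self) t' s' h₅) h₆ (C.juxt hl t s h₄ F G)
        (C.juxt hl t' s' h₅ F' G') := by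
  have ed := A.d_comp_of_lt (hk.trans n.lt_succ_self) hk n.le_succ
  have ec := A.c_comp_of_lt (hk.trans n.lt_succ_self) hk n.le_succ
  have fd := A.d_comp_of_lt (hl.trans n.lt_succ_self) hl n.le_succ
  have fc := A.c_comp_of_lt (hl.trans n.lt_succ_self) hl n.le_succ
  have xd := fun {a b} => A.composable_d (u := a) (v := b) hk n.le_succ
  have xc := fun {a b} => A.composable_c (u := a) (v := b) hk n.le_succ
  have yd := fun {a b} => A.composable_d (u := a) (v := b) hl n.le_succ
  have yc := fun {a b} => A.composable_c (u := a) (v := b) hl n.le_succ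
  have ed₁ := ed t t' h₁ (xd h₁)
  have ed₂ := ed s s' h₂ (xd h₂)
  have ec₁ := ec t t' h₁ (xc h₁)
  have ec₂ := ec s s' h₂ (xc h₂)
  have fd₁ := fd t s h₄ (yd h₄)
  have fd₂ := fd t' s' h₅ (yd h₅)
  have fc₁ := fc t s h₄ (yc h₄)
  have fc₂ := fc t' s' h₅ (yc h₅)
  have zd₃ := yd h₃
  have zc₃ := yc h₃
  have zd₆ := xd h₆
  have zc₆ := xc h₆
  rw [ed₁, ed₂] at zd₃
  rw [ec₁, ec₂] at zc₃
  rw [fd₁, fd₂] at zd₆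
  rw [fc₁, fc₂] at zc₆
  obtain ⟨d₁, d₂, d₃, d₄⟩ := C.exchange hl hk hlk _ _ _ _ (xd h₁) (xd h₂) zd₃ (yd h₄) (yd h₅) zd₆
  obtain ⟨c₁, c₂, c₃, c₄⟩ := C.exchange hl hk hlk _ _ _ _ (xc h₁) (xc h₂) zc₃ (yc h₄) (yc h₅) zc₆
  simp only [juxt, push_union, push_push]
  rw [Set.union_union_union_comm]
  rw [C.inl_congr hl ed₁ ed₂ (yd h₃) zd₃, C.inl_congr hl ec₁ ec₂ (yc h₃) zc₃,
    C.inr_congr hl ed₁ ed₂ (yd h₃) zd₃, C.inr_congr hl ec₁ ec₂ (yc h₃) zc₃,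
    C.inl_congr hk fd₁ fd₂ (xd h₆) zd₆, C.inl_congr hk fc₁ fc₂ (xc h₆) zc₆,
    C.inr_congr hk fd₁ fd₂ (xd h₆) zd₆, C.inr_congr hk fc₁ fc₂ (xc h₆) zc₆]
  exact congrArg₂ _ (congrArg₂ _ (push_congr hF c₁ d₁) (push_congr hG c₃ d₃))
    (congrArg₂ _ (push_congr hF' c₂ d₂) (push_congr hG' c₄ d₄))

theorem graft_union_push {u v u' v' : A.C (n + 1)} {F F' G G' : Forest κ (A.C (n + 1))}
    (hF : C.Good u F) (hF' : C.Good u' F') (hG : C.Good v G) (hG' : C.Good v' G')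
    (h : A.d n n.le_succ u = A.c n n.le_succ u') (h' : A.d n n.le_succ v = A.c n n.le_succ v')
    {i i' j j' k k' : κ → κ} (hj : Set.InjOn j (C.occ (A.d n n.le_succ u)))
    (hj' : Set.InjOn j' (C.occ (A.d n n.le_succ v)))
    (hjj' : ∀ a ∈ C.occ (A.d n n.le_succ u), ∀ b ∈ C.occ (A.d n n.le_succ v), j a ≠ j' b) :
    graft (push i j F ∪ push i' j' G) (push j k F' ∪ push j' k' G') =
      push i k (graft F F') ∪ push i' k' (graft G G') := by
  ext ⟨o, a⟩
  constructor
  · rintro (⟨x, rfl, h₁ | h₁⟩ | ⟨s, p, r, q, h₁ | h₁, h₂ | h₂, h₃⟩)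
    · obtain ⟨r, p, h₂, rfl⟩ := mem_push_inr.1 h₁
      exact Or.inl (mem_push_inr.2 ⟨r, p, Or.inl ⟨_, rfl, h₂⟩, rfl⟩)
    · obtain ⟨r, p, h₂, rfl⟩ := mem_push_inr.1 h₁
      exact Or.inr (mem_push_inr.2 ⟨r, p, Or.inl ⟨_, rfl, h₂⟩, rfl⟩)
    · obtain ⟨⟨o', s', p'⟩, h₄, e⟩ := h₁
      obtain ⟨s'', r', q', h₅, e', e''⟩ := mem_push_inl.1 h₂
      simp only [Prod.mk.injEq] at e e''
      obtain ⟨rfl, rfl, rfl⟩ := e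
      obtain ⟨rfl, rfl⟩ := e''
      have hs' := hF'.root_mem h₄
      rw [← h] at hs'
      obtain rfl := hj hs' (hF.leaf_mem h₅) e'
      exact Or.inl ⟨(o', r', q ++ p'), Or.inr ⟨_, _, _, _, h₄, h₅, rfl⟩, Prod.ext rfl h₃.symm⟩
    · obtain ⟨⟨o', s', p'⟩, h₄, e⟩ := h₁
      obtain ⟨s'', r', q', h₅, e', e''⟩ := mem_push_inl.1 h₂
      simp only [Prod.mk.injEq] at e e''
      obtain ⟨rfl, rfl, rfl⟩ := e
      have hs' := hF'.root_mem h₄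
      rw [← h] at hs'
      exact (hjj' _ hs' _ (hG.leaf_mem h₅) e').elim
    · obtain ⟨⟨o', s', p'⟩, h₄, e⟩ := h₁
      obtain ⟨s'', r', q', h₅, e', e''⟩ := mem_push_inl.1 h₂
      simp only [Prod.mk.injEq] at e e''
      obtain ⟨rfl, rfl, rfl⟩ := e
      have hs' := hG'.root_mem h₄
      rw [← h'] at hs'
      exact (hjj' _ (hF.leaf_mem h₅) _ hs' e'.symm).elim
    · obtain ⟨⟨o', s', p'⟩, h₄, e⟩ := h₁
      obtain ⟨s'', r', q', h₅, e', e''⟩ := mem_push_inl.1 h₂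
      simp only [Prod.mk.injEq] at e e''
      obtain ⟨rfl, rfl, rfl⟩ := e
      obtain ⟨rfl, rfl⟩ := e''
      have hs' := hG'.root_mem h₄
      rw [← h'] at hs'
      obtain rfl := hj' hs' (hG.leaf_mem h₅) e'
      exact Or.inr ⟨(o', r', q ++ p'), Or.inr ⟨_, _, _, _, h₄, h₅, rfl⟩, Prod.ext rfl h₃.symm⟩
  · rintro (⟨⟨o', r, q⟩, ⟨x, h₂, h₁⟩ | ⟨s, p, r', q', h₁, h₂, h₃⟩, e⟩ |
      ⟨⟨o', r, q⟩, ⟨x, h₂, h₁⟩ | ⟨s, p, r', q', h₁, h₂, h₃⟩, e⟩)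
    · simp only [Prod.mk.injEq] at e h₂
      obtain ⟨rfl, rfl⟩ := e
      subst h₂
      exact Or.inl ⟨x, rfl, Or.inl ⟨_, h₁, rfl⟩⟩
    · simp only [Prod.mk.injEq] at e h₃
      obtain ⟨rfl, rfl⟩ := e
      obtain ⟨rfl, rfl⟩ := h₃
      exact Or.inr ⟨j s, p, i r, q', Or.inl ⟨_, h₁, rfl⟩, Or.inl ⟨_, h₂, rfl⟩, rfl⟩
    · simp only [Prod.mk.injEq] at e h₂
      obtain ⟨rfl, rfl⟩ := e
      subst h₂
      exact Or.inl ⟨x, rfl, Or.inr ⟨_, h₁, rfl⟩⟩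
    · simp only [Prod.mk.injEq] at e h₃
      obtain ⟨rfl, rfl⟩ := e
      obtain ⟨rfl, rfl⟩ := h₃
      exact Or.inr ⟨j' s, p, i' r, q', Or.inr ⟨_, h₁, rfl⟩, Or.inr ⟨_, h₂, rfl⟩, rfl⟩

end Coding

end Computad

namespace Computad

namespace Coding

variable {A : Computad.{u}} {n : ℕ} {κ : Type} (C : A.Coding n κ)

/-- The forest of an identity. -/
def trivialForest (a : A.C n) : Forest κ (A.C (n + 1)) := (fun s => (Sum.inl s, (s, []))) '' C.occ a

theorem graft_trivial {u : A.C (n + 1)} {F : Forest κ (A.C (n + 1))} (hF : C.Good u F) :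
    graft F (C.trivialForest (A.d n n.le_succ u)) = F := by
  ext ⟨o, a⟩
  constructor
  · rintro (⟨x, rfl, h⟩ | ⟨s, p, r, q, ⟨s', h, e⟩, h', h''⟩)
    · exact h
    · simp only [Prod.mk.injEq] at e h''
      obtain ⟨rfl, rfl, rfl⟩ := e
      rw [h'', List.append_nil]; exact h'
  · intro h
    rcases o with s | x
    · exact Or.inr ⟨s, [], a.1, a.2, ⟨s, hF.leaf_mem h, rfl⟩, h, by rw [List.append_nil]⟩
    · exact Or.inl ⟨x, rfl, h⟩

theorem trivial_graft {u : A.C (n + 1)} {F : Forest κ (A.C (n + 1))} (hF : C.Good u F) :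
    graft (C.trivialForest (A.c n n.le_succ u)) F = F := by
  ext ⟨o, a⟩
  constructor
  · rintro (⟨x, rfl, ⟨s, h, e⟩⟩ | ⟨s, p, r, q, h, ⟨s', h', e⟩, h''⟩)
    · cases e
    · simp only [Prod.mk.injEq, Sum.inl.injEq] at e h''
      obtain ⟨rfl, rfl, rfl⟩ := e
      rw [h'', List.nil_append]; exact h
  · intro h
    exact Or.inr ⟨a.1, a.2, a.1, [], h, ⟨_, hF.root_mem h, rfl⟩, rfl⟩

theorem trivialForest_one {k : ℕ} (hk : k < n) (b : A.C k) :
    C.trivialForest (A.one n hk.le b) = ∅ := by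
  simp only [trivialForest, C.occ_one hk, Set.image_empty]

/-- The layer of the pairs of an `(n+1)`-cell and a forest. -/
noncomputable def layer : A.Layer n where
  H := {p : A.C (n + 1) × Forest κ (A.C (n + 1)) // C.Good p.1 p.2}
  π p := p.1.1
  one a := ⟨(A.one (n + 1) n.le_succ a, C.trivialForest a), good_one a⟩
  comp hk p q h := ⟨(A.comp _ hk p.1.1 q.1.1 h, C.forestComp hk _ _ h p.1.2 q.1.2),
    good_forestComp hk h p.2 q.2⟩
  π_one _ := rfl
  π_comp _ _ _ _ := rfl
  assoc {k} hk t s w h₁ h₂ h₃ h₄ := Subtype.ext (Prod.ext (A.assoc hk _ _ _ _ _ _ _) (by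
    simp only [forestComp]
    split_ifs with hk'
    · exact juxt_assoc hk' h₁ h₂ h₃ h₄ t.2 s.2 w.2
    · exact graft_assoc _ _ _))
  exchange {k l} hl hk hlk t t' s s' h₁ h₂ h₃ h₄ h₅ h₆ :=
    Subtype.ext (Prod.ext (A.exchange hl hk hlk _ _ _ _ _ _ _ _ _ _) (by
    have hl' : l < n := by omega
    simp only [forestComp, dif_pos hl']
    split_ifs with hk'
    · exact juxt_exchange hl' hk' hlk h₁ h₂ h₃ h₄ h₅ h₆ t.2 t'.2 s.2 s'.2
    · obtain rfl : k = n := by omega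
      simp only [juxt]
      have e₁ := C.inl_congr hl' h₁.symm h₂.symm (A.composable_c hl' k.le_succ h₅)
        (A.composable_d hl' k.le_succ h₄)
      have e₂ := C.inr_congr hl' h₁.symm h₂.symm (A.composable_c hl' k.le_succ h₅)
        (A.composable_d hl' k.le_succ h₄)
      rw [e₁, e₂, graft_union_push t.2 t'.2 s.2 s'.2 h₁ h₂ (C.inl_inj _ _ _ _) (C.inr_inj _ _ _ _)
        (C.inl_ne_inr _ _ _ _)]
      rw [C.inl_congr hl' (A.c_comp _ _ _ h₁) (A.c_comp _ _ _ h₂) (A.composable_c hl' k.le_succ h₃)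
          (A.composable_c hl' k.le_succ h₄),
        C.inr_congr hl' (A.c_comp _ _ _ h₁) (A.c_comp _ _ _ h₂) (A.composable_c hl' k.le_succ h₃)
          (A.composable_c hl' k.le_succ h₄),
        C.inl_congr hl' (A.d_comp _ _ _ h₁) (A.d_comp _ _ _ h₂) (A.composable_d hl' k.le_succ h₃)
          (A.composable_d hl' k.le_succ h₅),
        C.inr_congr hl' (A.d_comp _ _ _ h₁) (A.d_comp _ _ _ h₂) (A.composable_d hl' k.le_succ h₃)
          (A.composable_d hl' k.le_succ h₅)]))
  one_comp {k} hk b t h := by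
    have e : A.one (n + 1) n.le_succ (A.one n (Nat.lt_succ_iff.1 hk) b) = A.one (n + 1) hk.le b :=
      A.one_one _ _ _
    have h' : A.d k hk.le (A.one (n + 1) hk.le b) = A.c k hk.le t.1.1 := e ▸ h
    refine Subtype.ext (Prod.ext ((A.comp_congr hk e rfl h h').trans (A.one_comp hk _ _ _)) ?_)
    by_cases hk' : k < n
    · simp only [forestComp, dif_pos hk', juxt, trivialForest_one C hk', push_empty, Set.empty_union]
      have ec := A.c_one n.le_succ (A.one n hk'.le b)
      have ed := A.d_one n.le_succ (A.one n hk'.le b)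
      have xc := A.composable_c hk' n.le_succ h
      have xd := A.composable_d hk' n.le_succ h
      refine push_id t.2 (fun a ha => ?_) (fun a ha => ?_)
      · rw [C.inr_congr hk' ec rfl xc (ec ▸ xc)]
        exact C.one_comp hk' _ _ _ a ha
      · rw [C.inr_congr hk' ed rfl xd (ed ▸ xd)]
        exact C.one_comp hk' _ _ _ a ha
    · simp only [forestComp, dif_neg hk']
      obtain rfl : k = n := by omega
      have eb : A.one k le_rfl b = A.c k hk.le t.1.1 := by
        rw [A.one_self]; exact (A.d_one _ _).symm.trans h'
      rw [eb]
      exact trivial_graft C t.2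
  comp_one {k} hk b t h := by
    have e : A.one (n + 1) n.le_succ (A.one n (Nat.lt_succ_iff.1 hk) b) = A.one (n + 1) hk.le b :=
      A.one_one _ _ _
    have h' : A.d k hk.le t.1.1 = A.c k hk.le (A.one (n + 1) hk.le b) := e ▸ h
    refine Subtype.ext (Prod.ext ((A.comp_congr hk rfl e h h').trans (A.comp_one hk _ _ _)) ?_)
    by_cases hk' : k < n
    · simp only [forestComp, dif_pos hk', juxt, trivialForest_one C hk', push_empty, Set.union_empty]
      have ec := A.c_one n.le_succ (A.one n hk'.le b)
      have ed := A.d_one n.le_succ (A.one n hk'.le b)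
      have xc := A.composable_c hk' n.le_succ h
      have xd := A.composable_d hk' n.le_succ h
      refine push_id t.2 (fun a ha => ?_) (fun a ha => ?_)
      · rw [C.inl_congr hk' rfl ec xc (ec ▸ xc)]
        exact C.comp_one hk' _ _ _ a ha
      · rw [C.inl_congr hk' rfl ed xd (ed ▸ xd)]
        exact C.comp_one hk' _ _ _ a ha
    · simp only [forestComp, dif_neg hk']
      obtain rfl : k = n := by omega
      have eb : A.one k le_rfl b = A.d k hk.le t.1.1 := by
        rw [A.one_self]; exact (A.c_one _ _).symm.trans h'.symm
      rw [eb]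
      exact graft_trivial C t.2
  one_comp_one {k} hk a b h h' := by
    refine Subtype.ext (Prod.ext (A.one_comp_one hk n.le_succ a b h h') ?_)
    simp only [forestComp, dif_pos hk, juxt, trivialForest, push, Set.image_image]
    have xc := A.composable_c hk n.le_succ h'
    have xd := A.composable_d hk n.le_succ h'
    rw [C.inl_congr hk (A.c_one _ _) (A.c_one _ _) xc h, C.inl_congr hk (A.d_one _ _) (A.d_one _ _) xd h,
      C.inr_congr hk (A.c_one _ _) (A.c_one _ _) xc h, C.inr_congr hk (A.d_one _ _) (A.d_one _ _) xd h]
    ext ⟨o, r, p⟩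
    simp only [Set.mem_union, Set.mem_image, C.mem_comp hk, Sum.map_inl, Prod.mk.injEq]
    constructor
    · rintro (⟨s, hs, rfl, rfl, rfl⟩ | ⟨s, hs, rfl, rfl, rfl⟩)
      · exact ⟨_, Or.inl ⟨s, hs, rfl⟩, rfl, rfl, rfl⟩
      · exact ⟨_, Or.inr ⟨s, hs, rfl⟩, rfl, rfl, rfl⟩
    · rintro ⟨_, ⟨s, hs, rfl⟩ | ⟨s, hs, rfl⟩, rfl, rfl, rfl⟩
      · exact Or.inl ⟨s, hs, rfl, rfl, rfl⟩
      · exact Or.inr ⟨s, hs, rfl, rfl, rfl⟩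

theorem exists_forest (hA : ∀ x ∈ A.indet (n + 1), A.c n n.le_succ x ∈ A.indet n) :
    ∃ F : A.C (n + 1) → Forest κ (A.C (n + 1)), (∀ u, C.Good u (F u)) ∧
      (∀ x ∈ A.indet (n + 1), F x = C.corolla x) ∧
      (∀ a, F (A.one (n + 1) n.le_succ a) = C.trivialForest a) ∧
      ∀ {k : ℕ} (hk : k < n + 1) (u v) (h), F (A.comp k hk u v h) =
        C.forestComp hk u v h (F u) (F v) := by
  obtain ⟨e, h₁, h₂, h₃, h₄⟩ := (A.free n).exists_section C.layer
    (fun x => ⟨(x.1, C.corolla x.1), good_corolla _ x.2 (hA _ x.2)⟩) (fun _ => rfl)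
  refine ⟨fun u => (e u).1.2, fun u => ?_, fun x hx => ?_, fun a => ?_, fun {k} hk u v h => ?_⟩
  · have := (e u).2
    rwa [show (e u).1.1 = u from h₁ u] at this
  · exact congrArg (fun z => z.1.2) (h₂ ⟨x, hx⟩)
  · exact congrArg (fun z => z.1.2) (h₃ a)
  · have h' : A.d k hk.le (C.layer.π (e u)) = A.c k hk.le (C.layer.π (e v)) := by rw [h₁, h₁, h]
    refine (congrArg (fun z => z.1.2) (h₄ hk u v h h')).trans ?_
    have key : ∀ a b (hab : A.d k hk.le a = A.c k hk.le b), a = u → b = v →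
        C.forestComp hk a b hab (e u).1.2 (e v).1.2 =
          C.forestComp hk u v h (e u).1.2 (e v).1.2 := by
      rintro _ _ _ rfl rfl; rfl
    exact key _ _ h' (h₁ u) (h₁ v)

end Coding

end Computad

namespace Computad

namespace Coding

variable {A : Computad.{u}} {n : ℕ} {κ : Type} (C : A.Coding n κ)

open Classical in
/-- The address of the leaf `s`. -/
noncomputable def leaf {X : Type u} (F : Forest κ X) (s : κ) : κ × List κ :=
  if h : ∃ a, (Sum.inl s, a) ∈ F then h.choose else (s, [])

open Classical in
/-- The label of the node with address `a`. -/
noncomputable def node {X : Type u} (F : Forest κ X) (x₀ : X) (a : κ × List κ) : X :=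
  if h : ∃ x, (Sum.inr x, a) ∈ F then h.choose else x₀

variable {C}

theorem leaf_eq {u : A.C (n + 1)} {F : Forest κ (A.C (n + 1))} (hF : C.Good u F) {s a}
    (h : (Sum.inl s, a) ∈ F) : leaf F s = a := by
  have h' : ∃ a, (Sum.inl s, a) ∈ F := ⟨a, h⟩
  rw [leaf, dif_pos h']
  exact hF.leaf_unique h'.choose_spec h

theorem leaf_mem' {u : A.C (n + 1)} {F : Forest κ (A.C (n + 1))} (hF : C.Good u F) {s}
    (h : s ∈ C.occ (A.d n n.le_succ u)) : (Sum.inl s, leaf F s) ∈ F := by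
  obtain ⟨a, ha⟩ := hF.leaf_ex h
  rwa [leaf_eq hF ha]

theorem node_eq {u : A.C (n + 1)} {F : Forest κ (A.C (n + 1))} (hF : C.Good u F) {x x₀ a}
    (h : (Sum.inr x, a) ∈ F) : node F x₀ a = x := by
  have h' : ∃ x, (Sum.inr x, a) ∈ F := ⟨x, h⟩
  rw [node, dif_pos h']
  exact hF.node_unique h'.choose_spec h

variable (C)

open Classical in
noncomputable def succInl {k : ℕ} (hk : k < n + 1) (u v : A.C (n + 1))
    (h : A.d k hk.le u = A.c k hk.le v) (a : κ × List κ) : κ × List κ :=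
  if hk' : k < n then (C.inl hk' _ _ (A.composable_c hk' n.le_succ h) a.1, a.2) else a

open Classical in
noncomputable def succInr (F : A.C (n + 1) → Forest κ (A.C (n + 1))) {k : ℕ} (hk : k < n + 1)
    (u v : A.C (n + 1)) (h : A.d k hk.le u = A.c k hk.le v) (a : κ × List κ) : κ × List κ :=
  if hk' : k < n then (C.inr hk' _ _ (A.composable_c hk' n.le_succ h) a.1, a.2)
  else ((leaf (F u) a.1).1, (leaf (F u) a.1).2 ++ a.2)

/-- The addresses of nodes in forests are codes for the occurrences of `(n+1)`-indeterminates. -/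
noncomputable def succ (hA : ∀ x ∈ A.indet (n + 1), A.c n n.le_succ x ∈ A.indet n)
    (F : A.C (n + 1) → Forest κ (A.C (n + 1))) (hF : ∀ u, C.Good u (F u))
    (hx : ∀ x ∈ A.indet (n + 1), F x = C.corolla x)
    (ho : ∀ a, F (A.one (n + 1) n.le_succ a) = C.trivialForest a)
    (hcomp : ∀ {k : ℕ} (hk : k < n + 1) (u v) (h), F (A.comp k hk u v h) =
        C.forestComp hk u v h (F u) (F v)) : A.Coding (n + 1) (κ × List κ) := by
  have leafc : ∀ (u v : A.C (n + 1)) (h : A.d n n.le_succ u = A.c n n.le_succ v) (b : κ × List κ)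
      (o : κ ⊕ A.C (n + 1)), (o, b) ∈ F v → (Sum.inl b.1, leaf (F u) b.1) ∈ F u :=
    fun u v h b o hb => leaf_mem' (hF u) (h ▸ (hF v).root_mem hb)
  have mem : ∀ {k : ℕ} (hk : k < n + 1) (u v : A.C (n + 1)) (h : A.d k hk.le u = A.c k hk.le v)
      (x : A.C (n + 1)) (a : κ × List κ), (Sum.inr x, a) ∈ F (A.comp k hk u v h) ↔
      (∃ b, (Sum.inr x, b) ∈ F u ∧ C.succInl hk u v h b = a) ∨
        ∃ b, (Sum.inr x, b) ∈ F v ∧ C.succInr F hk u v h b = a := by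
    intro k hk u v h x a
    rw [hcomp]
    by_cases hk' : k < n
    · simp only [forestComp, succInl, succInr, dif_pos hk', mem_juxt_inr, eq_comm]
    · obtain rfl : k = n := by omega
      simp only [forestComp, succInl, succInr, dif_neg hk']
      constructor
      · rintro (⟨y, e, h₁⟩ | ⟨s, p, r, q, h₁, h₂, h₃⟩)
        · exact Or.inl ⟨a, h₁, rfl⟩
        · refine Or.inr ⟨(s, p), h₁, ?_⟩
          simp only [leaf_eq (hF u) h₂]
          exact h₃.symm
      · rintro (⟨b, h₁, rfl⟩ | ⟨b, h₁, rfl⟩)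
        · exact Or.inl ⟨x, rfl, h₁⟩
        · exact Or.inr ⟨b.1, b.2, _, _, h₁, leafc u v h b _ h₁, rfl⟩
  have memd : ∀ (u v : A.C (n + 1)) (h : A.d n n.le_succ u = A.c n n.le_succ v) (s : κ)
      (a : κ × List κ), (Sum.inl s, a) ∈ F v →
      leaf (F (A.comp n n.lt_succ_self u v h)) s = ((leaf (F u) a.1).1, (leaf (F u) a.1).2 ++ a.2) := by
    intro u v h s a ha
    refine leaf_eq (hF _) ?_
    rw [hcomp]
    simp only [forestComp, dif_neg (lt_irrefl n)]
    exact Or.inr ⟨a.1, a.2, _, _, ha, leafc u v h a _ ha, rfl⟩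
  have leafl : ∀ {k : ℕ} (hk : k < n) (u v : A.C (n + 1)) (h) (hd) (s : κ),
      s ∈ C.occ (A.d n n.le_succ u) →
      leaf (F (A.comp k (hk.trans n.lt_succ_self) u v h)) (C.inl hk (A.d n n.le_succ u)
        (A.d n n.le_succ v) hd s) =
        (C.inl hk _ _ (A.composable_c hk n.le_succ h) (leaf (F u) s).1, (leaf (F u) s).2) := by
    intro k hk u v h hd s hs
    refine leaf_eq (hF _) ?_
    rw [hcomp]
    simp only [forestComp, dif_pos hk]
    exact Or.inl (mem_push_inl.2 ⟨s, _, _, leaf_mem' (hF u) hs, rfl, rfl⟩)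
  have leafr : ∀ {k : ℕ} (hk : k < n) (u v : A.C (n + 1)) (h) (hd) (s : κ),
      s ∈ C.occ (A.d n n.le_succ v) →
      leaf (F (A.comp k (hk.trans n.lt_succ_self) u v h)) (C.inr hk (A.d n n.le_succ u)
        (A.d n n.le_succ v) hd s) =
        (C.inr hk _ _ (A.composable_c hk n.le_succ h) (leaf (F v) s).1, (leaf (F v) s).2) := by
    intro k hk u v h hd s hs
    refine leaf_eq (hF _) ?_
    rw [hcomp]
    simp only [forestComp, dif_pos hk]
    exact Or.inr (mem_push_inl.2 ⟨s, _, _, leaf_mem' (hF v) hs, rfl, rfl⟩)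
  exact
  { occ := fun u => {a | ∃ x, (Sum.inr x, a) ∈ F u}
    finite := fun u => (hF u).finite
    lab := fun u a => node (F u) u a
    lab_mem := by
      rintro u a ⟨x, h⟩
      rw [node_eq (hF u) h]
      exact (hF u).node_indet h
    inl := C.succInl
    inr := C.succInr F
    mem_comp := by
      intro k hk u v h a
      simp only [Set.mem_ofPred_eq, mem]
      constructor
      · rintro ⟨x, ⟨b, h₁, h₂⟩ | ⟨b, h₁, h₂⟩⟩
        · exact Or.inl ⟨b, ⟨x, h₁⟩, h₂⟩
        · exact Or.inr ⟨b, ⟨x, h₁⟩, h₂⟩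
      · rintro (⟨b, ⟨x, h₁⟩, h₂⟩ | ⟨b, ⟨x, h₁⟩, h₂⟩)
        · exact ⟨x, Or.inl ⟨b, h₁, h₂⟩⟩
        · exact ⟨x, Or.inr ⟨b, h₁, h₂⟩⟩
    inl_inj := by
      rintro k hk u v h a ⟨x, ha⟩ b ⟨y, hb⟩ e
      by_cases hk' : k < n
      · simp only [succInl, dif_pos hk', Prod.mk.injEq] at e
        exact Prod.ext (C.inl_inj _ _ _ _ ((hF u).root_mem ha) ((hF u).root_mem hb) e.1) e.2
      · simpa only [succInl, dif_neg hk'] using e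
    inr_inj := by
      rintro k hk u v h a ⟨x, ha⟩ b ⟨y, hb⟩ e
      by_cases hk' : k < n
      · simp only [succInr, dif_pos hk', Prod.mk.injEq] at e
        exact Prod.ext (C.inr_inj _ _ _ _ ((hF v).root_mem ha) ((hF v).root_mem hb) e.1) e.2
      · obtain rfl : k = n := by omega
        simp only [succInr, dif_neg hk', Prod.mk.injEq] at e
        have la := leafc u v h a _ ha
        have lb := leafc u v h b _ hb
        obtain ⟨a, p⟩ := a
        obtain ⟨b, q⟩ := b
        generalize leaf (F u) a = a' at e la
        generalize leaf (F u) b = b' at e lb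
        obtain ⟨r, a'⟩ := a'
        obtain ⟨r', b'⟩ := b'
        obtain ⟨rfl, e⟩ := e
        simp only at e la lb
        rcases List.append_eq_append_iff.1 e with ⟨l, rfl, e₂⟩ | ⟨l, rfl, e₂⟩
        · obtain ⟨e₃, rfl⟩ := (hF u).leaf_pre la lb
          cases e₃
          rw [e₂, List.nil_append]
        · obtain ⟨e₃, rfl⟩ := (hF u).leaf_pre lb la
          cases e₃
          rw [e₂, List.nil_append]
    inl_ne_inr := by
      rintro k hk u v h a ⟨x, ha⟩ b ⟨y, hb⟩ e
      by_cases hk' : k < n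
      · simp only [succInl, succInr, dif_pos hk', Prod.mk.injEq] at e
        exact C.inl_ne_inr _ _ _ _ _ ((hF u).root_mem ha) _ ((hF v).root_mem hb) e.1
      · obtain rfl : k = n := by omega
        simp only [succInl, succInr, dif_neg hk'] at e
        have lb := leafc u v h b _ hb
        rw [e] at ha
        cases ((hF u).leaf_pre lb ha).1
    lab_inl := by
      rintro k hk u v h a ⟨x, ha⟩
      rw [node_eq (hF u) ha, node_eq (hF _) ((mem _ _ _ _ _ _).2 (Or.inl ⟨a, ha, rfl⟩))]
    lab_inr := by
      rintro k hk u v h a ⟨x, ha⟩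
      rw [node_eq (hF v) ha, node_eq (hF _) ((mem _ _ _ _ _ _).2 (Or.inr ⟨a, ha, rfl⟩))]
    occ_indet := by
      intro x hxi
      obtain ⟨r₀, hr₀, -⟩ := C.occ_indet _ (hA x hxi)
      have hm : (Sum.inr x, (r₀, [])) ∈ F x := by
        rw [hx x hxi]
        exact ⟨by rw [hr₀]; rfl, Or.inl ⟨rfl, rfl⟩⟩
      refine ⟨(r₀, []), Set.ext fun a => ⟨?_, ?_⟩, node_eq (hF x) hm⟩
      · rintro ⟨y, h⟩
        rw [hx x hxi] at h
        obtain ⟨h, ⟨-, h'⟩ | ⟨s', -, e, -⟩⟩ := h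
        · rw [hr₀] at h
          exact Prod.ext h h'
        · cases e
      · rintro rfl
        exact ⟨x, hm⟩
    occ_one := by
      intro m hm a
      rw [Set.eq_empty_iff_forall_notMem]
      rintro b ⟨x, h⟩
      rw [← A.one_one (Nat.lt_succ_iff.1 hm) n.le_succ, ho] at h
      obtain ⟨s, -, e⟩ := h
      cases e
    assoc := by
      intro k hk t s w h₁ h₂ h₃ h₄
      by_cases hk' : k < n
      · have ec := A.c_comp_of_lt hk hk' n.le_succ
        have xc := fun {a b} => A.composable_c (u := a) (v := b) hk' n.le_succ
        have ec₁ := ec t s h₁ (xc h₁)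
        have ec₂ := ec s w h₃ (xc h₃)
        obtain ⟨c₁, c₂, c₃⟩ := C.assoc hk' _ _ _ (xc h₁) (ec₁ ▸ xc h₂) (xc h₃) (ec₂ ▸ xc h₄)
        simp only [succInl, succInr, dif_pos hk']
        rw [C.inl_congr hk' ec₁ rfl (xc h₂) (ec₁ ▸ xc h₂), C.inr_congr hk' ec₁ rfl (xc h₂) (ec₁ ▸ xc h₂),
          C.inl_congr hk' rfl ec₂ (xc h₄) (ec₂ ▸ xc h₄), C.inr_congr hk' rfl ec₂ (xc h₄) (ec₂ ▸ xc h₄)]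
        refine ⟨?_, ?_, ?_⟩
        · rintro p ⟨x, hp⟩
          rw [c₁ _ ((hF _).root_mem hp)]
        · rintro p ⟨x, hp⟩
          rw [c₂ _ ((hF _).root_mem hp)]
        · rintro p ⟨x, hp⟩
          rw [c₃ _ ((hF _).root_mem hp)]
      · obtain rfl : k = n := by omega
        simp only [succInl, succInr, dif_neg hk']
        refine ⟨fun _ _ => trivial, fun _ _ => trivial, ?_⟩
        rintro p ⟨x, hp⟩
        rw [memd t s h₁ p.1 _ (leafc s w h₃ p _ hp), List.append_assoc]
    exchange := by
      intro k l hl hk hlk t t' s s' h₁ h₂ h₃ h₄ h₅ h₆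
      have hl' : l < n := by omega
      have yd := fun {a b} => A.composable_d (u := a) (v := b) hl' n.le_succ
      have yc := fun {a b} => A.composable_c (u := a) (v := b) hl' n.le_succ
      by_cases hk' : k < n
      · have ec := A.c_comp_of_lt hk hk' n.le_succ
        have fc := A.c_comp_of_lt hl hl' n.le_succ
        have xc := fun {a b} => A.composable_c (u := a) (v := b) hk' n.le_succ
        have ec₁ := ec t t' h₁ (xc h₁)
        have ec₂ := ec s s' h₂ (xc h₂)
        have fc₁ := fc t s h₄ (yc h₄)
        have fc₂ := fc t' s' h₅ (yc h₅)
        have zc₃ := yc h₃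
        have zc₆ := xc h₆
        rw [ec₁, ec₂] at zc₃
        rw [fc₁, fc₂] at zc₆
        obtain ⟨c₁, c₂, c₃, c₄⟩ :=
          C.exchange hl' hk' hlk _ _ _ _ (xc h₁) (xc h₂) zc₃ (yc h₄) (yc h₅) zc₆
        simp only [succInl, succInr, dif_pos hk', dif_pos hl']
        rw [C.inl_congr hl' ec₁ ec₂ (yc h₃) zc₃, C.inr_congr hl' ec₁ ec₂ (yc h₃) zc₃,
          C.inl_congr hk' fc₁ fc₂ (xc h₆) zc₆, C.inr_congr hk' fc₁ fc₂ (xc h₆) zc₆]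
        refine ⟨?_, ?_, ?_, ?_⟩
        · rintro p ⟨x, hp⟩
          rw [c₁ _ ((hF _).root_mem hp)]
        · rintro p ⟨x, hp⟩
          rw [c₂ _ ((hF _).root_mem hp)]
        · rintro p ⟨x, hp⟩
          rw [c₃ _ ((hF _).root_mem hp)]
        · rintro p ⟨x, hp⟩
          rw [c₄ _ ((hF _).root_mem hp)]
      · obtain rfl : k = n := by omega
        have e₁ := C.inl_congr hl' (A.c_comp _ _ _ h₁) (A.c_comp _ _ _ h₂) (yc h₃) (yc h₄)
        have e₂ := C.inr_congr hl' (A.c_comp _ _ _ h₁) (A.c_comp _ _ _ h₂) (yc h₃) (yc h₄)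
        have e₃ := C.inl_congr hl' h₁.symm h₂.symm (yc h₅) (yd h₄)
        have e₄ := C.inr_congr hl' h₁.symm h₂.symm (yc h₅) (yd h₄)
        simp only [succInl, succInr, dif_neg hk', dif_pos hl', e₁, e₂, e₃, e₄]
        refine ⟨fun _ _ => trivial, ?_, fun _ _ => trivial, ?_⟩
        · rintro p ⟨x, hp⟩
          rw [leafl hl' t s h₄ (yd h₄) p.1 (h₁ ▸ (hF _).root_mem hp)]
        · rintro p ⟨x, hp⟩
          rw [leafr hl' t s h₄ (yd h₄) p.1 (h₂ ▸ (hF _).root_mem hp)]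
    one_comp := by
      rintro k hk b t h p ⟨x, hp⟩
      by_cases hk' : k < n
      · have e : A.c n n.le_succ (A.one (n + 1) hk.le b) = A.one n hk'.le b := A.c_one_of_ge _ _ _
        have xc := A.composable_c hk' n.le_succ h
        simp only [succInr, dif_pos hk']
        rw [C.inr_congr hk' e rfl xc (e ▸ xc), C.one_comp hk' _ _ _ _ ((hF _).root_mem hp)]
      · obtain rfl : k = n := by omega
        have hm : (Sum.inl p.1, (p.1, [])) ∈ F (A.one (k + 1) hk.le b) := by
          rw [ho]
          refine ⟨p.1, ?_, rfl⟩
          rw [A.d_one] at h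
          rw [h]
          exact (hF t).root_mem hp
        simp only [succInr, dif_neg hk', leaf_eq (hF _) hm, List.nil_append]
    comp_one := by
      rintro k hk b t h p ⟨x, hp⟩
      by_cases hk' : k < n
      · have e : A.c n n.le_succ (A.one (n + 1) hk.le b) = A.one n hk'.le b := A.c_one_of_ge _ _ _
        have xc := A.composable_c hk' n.le_succ h
        simp only [succInl, dif_pos hk']
        rw [C.inl_congr hk' rfl e xc (e ▸ xc), C.comp_one hk' _ _ _ _ ((hF _).root_mem hp)]
      · simp only [succInl, dif_neg hk'] }

/-- Every `0`-cell is its own unique occurrence. -/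
def zero (A : Computad.{u}) : A.Coding 0 Unit where
  occ _ := Set.univ
  finite _ := Set.finite_univ
  lab u _ := u
  lab_mem u _ _ := by rw [A.indet_zero]; trivial
  inl hk := (Nat.not_lt_zero _ hk).elim
  inr hk := (Nat.not_lt_zero _ hk).elim
  mem_comp hk := (Nat.not_lt_zero _ hk).elim
  inl_inj hk := (Nat.not_lt_zero _ hk).elim
  inr_inj hk := (Nat.not_lt_zero _ hk).elim
  inl_ne_inr hk := (Nat.not_lt_zero _ hk).elim
  lab_inl hk := (Nat.not_lt_zero _ hk).elim
  lab_inr hk := (Nat.not_lt_zero _ hk).elim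
  occ_indet x _ := ⟨(), Set.ext fun _ => ⟨fun _ => rfl, fun _ => trivial⟩, rfl⟩
  occ_one hm := (Nat.not_lt_zero _ hm).elim
  assoc hk := (Nat.not_lt_zero _ hk).elim
  exchange _ hk := (Nat.not_lt_zero _ hk).elim
  one_comp hk := (Nat.not_lt_zero _ hk).elim
  comp_one hk := (Nat.not_lt_zero _ hk).elim

theorem exists_coding (A : ManyToOneComputad.{u}) (n : ℕ) :
    ∃ κ : Type, Nonempty (A.toComputad.Coding n κ) := by
  induction n with
  | zero => exact ⟨Unit, ⟨zero _⟩⟩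
  | succ n ih =>
    obtain ⟨κ, ⟨C⟩⟩ := ih
    obtain ⟨F, h₁, h₂, h₃, h₄⟩ := C.exists_forest (A.cod_indet n)
    exact ⟨_, ⟨C.succ (A.cod_indet n) F h₁ h₂ h₃ h₄⟩⟩

theorem same_of_eq {u v : A.C n} (h : u = v) {p : C.occ u} {q : C.occ v} (e : p.1 = q.1) :
    Same (fun u => C.occ u) p q := by
  subst h
  obtain rfl : p = q := Subtype.ext e
  rfl

/-- The system of occurrences that results from codings in all dimensions. -/
def occSystem {κ : ℕ → Type} (C : ∀ n, A.Coding n (κ n)) : A.OccSystem where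
  Occ {n} u := (C n).occ u
  finite_occ u := (C _).finite u
  lab u r := (C _).lab u r.1
  lab_mem u r := (C _).lab_mem u r.1 r.2
  occL hk u v h r := ⟨(C _).inl hk u v h r.1, ((C _).mem_comp hk u v h _).2 (Or.inl ⟨_, r.2, rfl⟩)⟩
  occR hk u v h r := ⟨(C _).inr hk u v h r.1, ((C _).mem_comp hk u v h _).2 (Or.inr ⟨_, r.2, rfl⟩)⟩
  bijective hk u v h := by
    constructor
    · rintro (⟨a, ha⟩ | ⟨a, ha⟩) (⟨b, hb⟩ | ⟨b, hb⟩) e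
      · cases (C _).inl_inj hk u v h ha hb (congrArg Subtype.val e); rfl
      · cases (C _).inl_ne_inr hk u v h _ ha _ hb (congrArg Subtype.val e)
      · cases (C _).inl_ne_inr hk u v h _ hb _ ha (congrArg Subtype.val e).symm
      · cases (C _).inr_inj hk u v h ha hb (congrArg Subtype.val e); rfl
    · rintro ⟨a, ha⟩
      rcases ((C _).mem_comp hk u v h _).1 ha with ⟨b, hb, rfl⟩ | ⟨b, hb, rfl⟩
      · exact ⟨Sum.inl ⟨b, hb⟩, rfl⟩
      · exact ⟨Sum.inr ⟨b, hb⟩, rfl⟩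
  lab_occL hk u v h r := (C _).lab_inl hk u v h r.1 r.2
  lab_occR hk u v h r := (C _).lab_inr hk u v h r.1 r.2
  occ_indet x hx := by
    obtain ⟨a, ha, ha'⟩ := (C _).occ_indet x hx
    have hr : ∀ r : (C _).occ x, r.1 = a := fun r => ha.subset r.2
    refine ⟨⟨⟨a, by rw [ha]; rfl⟩, trivial, fun r _ => Subtype.ext (hr r)⟩, fun r => ?_⟩
    rw [hr r, ha']
  occ_one {n} a := by
    exact ⟨fun r => ((C _).occ_one n.lt_succ_self a).subset r.2⟩
  assoc hk t s w h₁ h₂ h₃ h₄ := by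
    obtain ⟨c₁, c₂, c₃⟩ := (C _).assoc hk t s w h₁ h₂ h₃ h₄
    have e := A.assoc hk t s w h₁ h₂ h₃ h₄
    exact ⟨fun p => same_of_eq _ e (c₁ _ p.2), fun p => same_of_eq _ e (c₂ _ p.2),
      fun p => same_of_eq _ e (c₃ _ p.2)⟩
  exchange hl hk hlk t t' s s' h₁ h₂ h₃ h₄ h₅ h₆ := by
    obtain ⟨c₁, c₂, c₃, c₄⟩ := (C _).exchange hl hk hlk t t' s s' h₁ h₂ h₃ h₄ h₅ h₆
    have e := A.exchange hl hk hlk t t' s s' h₁ h₂ h₃ h₄ h₅ h₆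
    exact ⟨fun p => same_of_eq _ e (c₁ _ p.2), fun p => same_of_eq _ e (c₂ _ p.2),
      fun p => same_of_eq _ e (c₃ _ p.2), fun p => same_of_eq _ e (c₄ _ p.2)⟩
  one_comp hk b t h p := same_of_eq _ (A.one_comp hk b t h) ((C _).one_comp hk b t h _ p.2)
  comp_one hk b t h p := same_of_eq _ (A.comp_one hk b t h) ((C _).comp_one hk b t h _ p.2)

end Coding

theorem nonempty_occSystem (A : ManyToOneComputad.{u}) : Nonempty A.toComputad.OccSystem := by
  choose κ hκ using Coding.exists_coding A
  exact ⟨Coding.occSystem fun n => (hκ n).some⟩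

end Computad

namespace Computad

/-- Labels for the occurrences in `(n+1)`-cells, with the effect of composition on the labels. -/
structure LabelData (A : Computad.{u}) (n : ℕ) where
  Y : Type u
  ok : A.C (n + 1) → Y → Prop
  L : ∀ {k : ℕ} (hk : k < n + 1) (u v : A.C (n + 1)), A.d k hk.le u = A.c k hk.le v →
    ∀ y, ok u y → Y
  R : ∀ {k : ℕ} (hk : k < n + 1) (u v : A.C (n + 1)), A.d k hk.le u = A.c k hk.le v →
    ∀ y, ok v y → Y
  ok_L : ∀ {k : ℕ} (hk : k < n + 1) (u v) (h : A.d k hk.le u = A.c k hk.le v) (y) (hy : ok u y),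
    ok (A.comp k hk u v h) (L hk u v h y hy)
  ok_R : ∀ {k : ℕ} (hk : k < n + 1) (u v) (h : A.d k hk.le u = A.c k hk.le v) (y) (hy : ok v y),
    ok (A.comp k hk u v h) (R hk u v h y hy)
  LL : ∀ {k : ℕ} (hk : k < n + 1) (t s w : A.C (n + 1)) (h₁) (h₂) (h₃) (h₄) (y) (hy) (hy'),
    L hk (A.comp k hk t s h₁) w h₂ (L hk t s h₁ y hy) hy' = L hk t (A.comp k hk s w h₃) h₄ y hy
  LR : ∀ {k : ℕ} (hk : k < n + 1) (t s w : A.C (n + 1)) (h₁) (h₂) (h₃) (h₄) (y) (hy) (hy') (hy''),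
    L hk (A.comp k hk t s h₁) w h₂ (R hk t s h₁ y hy) hy' =
      R hk t (A.comp k hk s w h₃) h₄ (L hk s w h₃ y hy) hy''
  RR : ∀ {k : ℕ} (hk : k < n + 1) (t s w : A.C (n + 1)) (h₁) (h₂) (h₃) (h₄) (y) (hy) (hy'),
    R hk (A.comp k hk t s h₁) w h₂ y hy = R hk t (A.comp k hk s w h₃) h₄ (R hk s w h₃ y hy) hy'
  X₁ : ∀ {k l : ℕ} (hl : l < n + 1) (hk : k < n + 1) (_ : l < k) (t t' s s' : A.C (n + 1))
    (h₁) (h₂) (h₃) (h₄) (h₅) (h₆) (y) (hy) (hy') (hy''),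
    L hl (A.comp k hk t t' h₁) (A.comp k hk s s' h₂) h₃ (L hk t t' h₁ y hy) hy' =
      L hk (A.comp l hl t s h₄) (A.comp l hl t' s' h₅) h₆ (L hl t s h₄ y hy) hy''
  X₂ : ∀ {k l : ℕ} (hl : l < n + 1) (hk : k < n + 1) (_ : l < k) (t t' s s' : A.C (n + 1))
    (h₁) (h₂) (h₃) (h₄) (h₅) (h₆) (y) (hy) (hy') (hy''),
    L hl (A.comp k hk t t' h₁) (A.comp k hk s s' h₂) h₃ (R hk t t' h₁ y hy) hy' =
      R hk (A.comp l hl t s h₄) (A.comp l hl t' s' h₅) h₆ (L hl t' s' h₅ y hy) hy''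
  X₃ : ∀ {k l : ℕ} (hl : l < n + 1) (hk : k < n + 1) (_ : l < k) (t t' s s' : A.C (n + 1))
    (h₁) (h₂) (h₃) (h₄) (h₅) (h₆) (y) (hy) (hy') (hy''),
    R hl (A.comp k hk t t' h₁) (A.comp k hk s s' h₂) h₃ (L hk s s' h₂ y hy) hy' =
      L hk (A.comp l hl t s h₄) (A.comp l hl t' s' h₅) h₆ (R hl t s h₄ y hy) hy''
  X₄ : ∀ {k l : ℕ} (hl : l < n + 1) (hk : k < n + 1) (_ : l < k) (t t' s s' : A.C (n + 1))
    (h₁) (h₂) (h₃) (h₄) (h₅) (h₆) (y) (hy) (hy') (hy''),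
    R hl (A.comp k hk t t' h₁) (A.comp k hk s s' h₂) h₃ (R hk s s' h₂ y hy) hy' =
      R hk (A.comp l hl t s h₄) (A.comp l hl t' s' h₅) h₆ (R hl t' s' h₅ y hy) hy''
  one_R : ∀ {k : ℕ} (hk : k < n + 1) (b : A.C k) (t : A.C (n + 1)) (h) (y) (hy),
    R hk (A.one (n + 1) hk.le b) t h y hy = y
  L_one : ∀ {k : ℕ} (hk : k < n + 1) (b : A.C k) (t : A.C (n + 1)) (h) (y) (hy),
    L hk t (A.one (n + 1) hk.le b) h y hy = y

namespace OccSystem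

variable {A : Computad.{u}} (O : A.OccSystem)

/-- Cells with a chosen occurrence. -/
abbrev Pt (n : ℕ) : Type u := Σ u : A.C n, O.Occ u

/-- The point of a composite given by a point of the left factor. -/
def cL {n k : ℕ} (hk : k < n) (p : O.Pt n) (v : A.C n) (h : A.d k hk.le p.1 = A.c k hk.le v) :
    O.Pt n := ⟨A.comp k hk p.1 v h, O.occL hk p.1 v h p.2⟩

/-- The point of a composite given by a point of the right factor. -/
def cR {n k : ℕ} (hk : k < n) (u : A.C n) (p : O.Pt n) (h : A.d k hk.le u = A.c k hk.le p.1) :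
    O.Pt n := ⟨A.comp k hk u p.1 h, O.occR hk u p.1 h p.2⟩

variable {O}

theorem cL_congr {n k : ℕ} (hk : k < n) {p p' : O.Pt n} {v v' : A.C n} (hp : p = p') (hv : v = v')
    (h : A.d k hk.le p.1 = A.c k hk.le v) (h' : A.d k hk.le p'.1 = A.c k hk.le v') :
    O.cL hk p v h = O.cL hk p' v' h' := by
  subst hp hv; rfl

theorem cR_congr {n k : ℕ} (hk : k < n) {p p' : O.Pt n} {u u' : A.C n} (hp : p = p') (hu : u = u')
    (h : A.d k hk.le u = A.c k hk.le p.1) (h' : A.d k hk.le u' = A.c k hk.le p'.1) :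
    O.cR hk u p h = O.cR hk u' p' h' := by
  subst hp hu; rfl

theorem occ_cases {n k : ℕ} (hk : k < n) {u v : A.C n} (h : A.d k hk.le u = A.c k hk.le v)
    (r : O.Occ (A.comp k hk u v h)) :
    (∃ s, r = O.occL hk u v h s) ∨ ∃ s, r = O.occR hk u v h s := by
  obtain ⟨s | s, rfl⟩ := (O.bijective hk u v h).2 r
  · exact Or.inl ⟨s, rfl⟩
  · exact Or.inr ⟨s, rfl⟩

theorem occL_injective {n k : ℕ} (hk : k < n) (u v : A.C n) (h : A.d k hk.le u = A.c k hk.le v) :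
    Function.Injective (O.occL hk u v h) := fun a b e =>
  Sum.inl_injective ((O.bijective hk u v h).1 (a₁ := Sum.inl a) (a₂ := Sum.inl b) e)

theorem occR_injective {n k : ℕ} (hk : k < n) (u v : A.C n) (h : A.d k hk.le u = A.c k hk.le v) :
    Function.Injective (O.occR hk u v h) := fun a b e =>
  Sum.inr_injective ((O.bijective hk u v h).1 (a₁ := Sum.inr a) (a₂ := Sum.inr b) e)

theorem occL_ne_occR {n k : ℕ} (hk : k < n) (u v : A.C n) (h : A.d k hk.le u = A.c k hk.le v)
    (a : O.Occ u) (b : O.Occ v) : O.occL hk u v h a ≠ O.occR hk u v h b := fun e =>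
  Sum.inl_ne_inr ((O.bijective hk u v h).1 (a₁ := Sum.inl a) (a₂ := Sum.inr b) e)

theorem occ_indet_subsingleton {n : ℕ} {x : A.C n} (hx : x ∈ A.indet n) (r s : O.Occ x) : r = s :=
  (O.occ_indet x hx).1.unique trivial trivial

theorem occ_one_isEmpty {n m : ℕ} (h : n < m) (a : A.C n) : IsEmpty (O.Occ (A.one m h.le a)) := by
  obtain ⟨m, rfl⟩ : ∃ l, m = l + 1 := ⟨m - 1, by omega⟩
  rw [← A.one_one (Nat.lt_succ_iff.1 h) m.le_succ]
  exact O.occ_one _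

open Classical in
/-- Definition of a function on the occurrences of a composite. -/
noncomputable def occElim {n k : ℕ} (hk : k < n) (u v : A.C n) (h : A.d k hk.le u = A.c k hk.le v)
    {Y : Type*} (f : O.Occ u → Y) (g : O.Occ v → Y) (r : O.Occ (A.comp k hk u v h)) : Y :=
  Sum.elim f g ((Equiv.ofBijective _ (O.bijective hk u v h)).symm r)

theorem occElim_occL {n k : ℕ} (hk : k < n) (u v : A.C n) (h : A.d k hk.le u = A.c k hk.le v)
    {Y : Type*} (f : O.Occ u → Y) (g : O.Occ v → Y) (r : O.Occ u) :
    O.occElim hk u v h f g (O.occL hk u v h r) = f r := by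
  have : (Equiv.ofBijective _ (O.bijective hk u v h)).symm (O.occL hk u v h r) = Sum.inl r := by
    rw [Equiv.symm_apply_eq]; rfl
  rw [occElim, this, Sum.elim_inl]

theorem occElim_occR {n k : ℕ} (hk : k < n) (u v : A.C n) (h : A.d k hk.le u = A.c k hk.le v)
    {Y : Type*} (f : O.Occ u → Y) (g : O.Occ v → Y) (r : O.Occ v) :
    O.occElim hk u v h f g (O.occR hk u v h r) = g r := by
  have : (Equiv.ofBijective _ (O.bijective hk u v h)).symm (O.occR hk u v h r) = Sum.inr r := by
    rw [Equiv.symm_apply_eq]; rfl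
  rw [occElim, this, Sum.elim_inr]

theorem occR_of_eq_one {n k : ℕ} (hk : k < n) {b : A.C k} {i t : A.C n} (e : i = A.one n hk.le b)
    (h : A.d k hk.le i = A.c k hk.le t) (p : O.Occ t) : Same O.Occ (O.occR hk i t h p) p := by
  subst e; exact O.one_comp hk b t h p

theorem occL_of_eq_one {n k : ℕ} (hk : k < n) {b : A.C k} {i t : A.C n} (e : i = A.one n hk.le b)
    (h : A.d k hk.le t = A.c k hk.le i) (p : O.Occ t) : Same O.Occ (O.occL hk t i h p) p := by
  subst e; exact O.comp_one hk b t h p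

end OccSystem

namespace LabelData

open OccSystem

variable {A : Computad.{u}} (O : A.OccSystem) {n : ℕ} (D : A.LabelData n)

theorem R_of_eq_one {k : ℕ} (hk : k < n + 1) {b : A.C k} {i t : A.C (n + 1)}
    (e : i = A.one (n + 1) hk.le b) (h) (y) (hy) : D.R hk i t h y hy = y := by
  subst e; exact D.one_R hk b t h y hy

theorem L_of_eq_one {k : ℕ} (hk : k < n + 1) {b : A.C k} {i t : A.C (n + 1)}
    (e : i = A.one (n + 1) hk.le b) (h) (y) (hy) : D.L hk t i h y hy = y := by
  subst e; exact D.L_one hk b t h y hy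

/-- The labels of the occurrences in a composite. -/
noncomputable def comp {k : ℕ} (hk : k < n + 1) {u v : A.C (n + 1)} (h : A.d k hk.le u = A.c k hk.le v)
    (f : ∀ r : O.Occ u, {y // D.ok u y}) (g : ∀ r : O.Occ v, {y // D.ok v y}) :
    ∀ r : O.Occ (A.comp k hk u v h), {y // D.ok (A.comp k hk u v h) y} :=
  O.occElim hk _ _ h (fun r => ⟨D.L hk _ _ h (f r).1 (f r).2, D.ok_L _ _ _ _ _ _⟩)
    (fun r => ⟨D.R hk _ _ h (g r).1 (g r).2, D.ok_R _ _ _ _ _ _⟩)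

theorem comp_occL {k : ℕ} (hk : k < n + 1) {u v : A.C (n + 1)} (h : A.d k hk.le u = A.c k hk.le v)
    (f : ∀ r : O.Occ u, {y // D.ok u y}) (g : ∀ r : O.Occ v, {y // D.ok v y}) (r : O.Occ u) :
    (D.comp O hk h f g (O.occL hk u v h r)).1 = D.L hk _ _ h (f r).1 (f r).2 := by
  rw [comp, occElim_occL]

theorem comp_occR {k : ℕ} (hk : k < n + 1) {u v : A.C (n + 1)} (h : A.d k hk.le u = A.c k hk.le v)
    (f : ∀ r : O.Occ u, {y // D.ok u y}) (g : ∀ r : O.Occ v, {y // D.ok v y}) (r : O.Occ v) :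
    (D.comp O hk h f g (O.occR hk u v h r)).1 = D.R hk _ _ h (g r).1 (g r).2 := by
  rw [comp, occElim_occR]

theorem comp_assoc {k : ℕ} (hk : k < n + 1) {t s w : A.C (n + 1)} (h₁) (h₂) (h₃) (h₄)
    (f : ∀ r : O.Occ t, {y // D.ok t y}) (g : ∀ r : O.Occ s, {y // D.ok s y})
    (i : ∀ r : O.Occ w, {y // D.ok w y}) (r : O.Occ (A.comp k hk (A.comp k hk t s h₁) w h₂))
    (r' : O.Occ (A.comp k hk t (A.comp k hk s w h₃) h₄)) (e : Same O.Occ r r') :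
    (D.comp O hk h₂ (D.comp O hk h₁ f g) i r).1 = (D.comp O hk h₄ f (D.comp O hk h₃ g i) r').1 := by
  obtain ⟨c₁, c₂, c₃⟩ := O.assoc hk t s w h₁ h₂ h₃ h₄
  rcases occ_cases hk _ r with ⟨p, rfl⟩ | ⟨p, rfl⟩
  · rcases occ_cases hk _ p with ⟨p, rfl⟩ | ⟨p, rfl⟩
    · obtain rfl := eq_of_heq (Sigma.mk.inj (e.symm.trans (c₁ p))).2
      simp only [comp_occL, D.LL _ _ _ _ h₁ h₂ h₃ h₄]
    · obtain rfl := eq_of_heq (Sigma.mk.inj (e.symm.trans (c₂ p))).2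
      simp only [comp_occL, comp_occR, D.LR _ _ _ _ h₁ h₂ h₃ h₄ _ (g p).2 _ (D.ok_L _ _ _ h₃ _ _)]
  · obtain rfl := eq_of_heq (Sigma.mk.inj (e.symm.trans (c₃ p))).2
    simp only [comp_occR, D.RR _ _ _ _ h₁ h₂ h₃ h₄ _ (i p).2 (D.ok_R _ _ _ h₃ _ _)]

theorem comp_exchange {k l : ℕ} (hl : l < n + 1) (hk : k < n + 1) (hlk : l < k)
    {t t' s s' : A.C (n + 1)} (h₁) (h₂) (h₃) (h₄) (h₅) (h₆)
    (f : ∀ r : O.Occ t, {y // D.ok t y}) (f' : ∀ r : O.Occ t', {y // D.ok t' y})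
    (g : ∀ r : O.Occ s, {y // D.ok s y}) (g' : ∀ r : O.Occ s', {y // D.ok s' y})
    (r : O.Occ (A.comp l hl (A.comp k hk t t' h₁) (A.comp k hk s s' h₂) h₃))
    (r' : O.Occ (A.comp k hk (A.comp l hl t s h₄) (A.comp l hl t' s' h₅) h₆))
    (e : Same O.Occ r r') :
    (D.comp O hl h₃ (D.comp O hk h₁ f f') (D.comp O hk h₂ g g') r).1 =
      (D.comp O hk h₆ (D.comp O hl h₄ f g) (D.comp O hl h₅ f' g') r').1 := by
  obtain ⟨c₁, c₂, c₃, c₄⟩ := O.exchange hl hk hlk t t' s s' h₁ h₂ h₃ h₄ h₅ h₆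
  rcases occ_cases hl _ r with ⟨p, rfl⟩ | ⟨p, rfl⟩ <;>
    rcases occ_cases hk _ p with ⟨p, rfl⟩ | ⟨p, rfl⟩
  · obtain rfl := eq_of_heq (Sigma.mk.inj (e.symm.trans (c₁ p))).2
    simp only [comp_occL]
    apply D.X₁ hl hk hlk
  · obtain rfl := eq_of_heq (Sigma.mk.inj (e.symm.trans (c₂ p))).2
    simp only [comp_occL, comp_occR]
    apply D.X₂ hl hk hlk
  · obtain rfl := eq_of_heq (Sigma.mk.inj (e.symm.trans (c₃ p))).2
    simp only [comp_occL, comp_occR]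
    apply D.X₃ hl hk hlk
  · obtain rfl := eq_of_heq (Sigma.mk.inj (e.symm.trans (c₄ p))).2
    simp only [comp_occR]
    apply D.X₄ hl hk hlk

theorem ext_sigma {u v : A.C (n + 1)} (e : u = v) {f : ∀ r : O.Occ u, {y // D.ok u y}}
    {g : ∀ r : O.Occ v, {y // D.ok v y}} (h : ∀ r s, Same O.Occ r s → (f r).1 = (g s).1) :
    (⟨u, f⟩ : Σ u : A.C (n + 1), ∀ r : O.Occ u, {y // D.ok u y}) = ⟨v, g⟩ := by
  subst e
  have : f = g := funext fun r => Subtype.ext (h r r rfl)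
  rw [this]

/-- The layer of `(n+1)`-cells with labelled occurrences. -/
noncomputable def layer : A.Layer n where
  H := Σ u : A.C (n + 1), ∀ r : O.Occ u, {y // D.ok u y}
  π p := p.1
  one a := ⟨A.one (n + 1) n.le_succ a, fun r => ((O.occ_one a).false r).elim⟩
  comp {k} hk p q h := ⟨A.comp k hk p.1 q.1 h, D.comp O hk h p.2 q.2⟩
  π_one _ := rfl
  π_comp _ _ _ _ := rfl
  assoc {k} hk t s w h₁ h₂ h₃ h₄ := ext_sigma O D (A.assoc hk t.1 s.1 w.1 h₁ h₂ h₃ h₄)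
    (comp_assoc O D hk h₁ h₂ h₃ h₄ t.2 s.2 w.2)
  exchange {k l} hl hk hlk t t' s s' h₁ h₂ h₃ h₄ h₅ h₆ :=
    ext_sigma O D (A.exchange hl hk hlk t.1 t'.1 s.1 s'.1 h₁ h₂ h₃ h₄ h₅ h₆)
      (comp_exchange O D hl hk hlk h₁ h₂ h₃ h₄ h₅ h₆ t.2 t'.2 s.2 s'.2)
  one_comp {k} hk b t h := by
    have e : A.one (n + 1) n.le_succ (A.one n (Nat.lt_succ_iff.1 hk) b) = A.one (n + 1) hk.le b :=
      A.one_one _ _ _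
    have h' : A.d k hk.le (A.one (n + 1) hk.le b) = A.c k hk.le t.1 := e ▸ h
    refine ext_sigma O D ((A.comp_congr hk e rfl h h').trans (A.one_comp hk _ _ _)) ?_
    intro r r' er
    rcases occ_cases hk _ r with ⟨p, rfl⟩ | ⟨p, rfl⟩
    · exact ((O.occ_one _).false p).elim
    · obtain rfl := eq_of_heq (Sigma.mk.inj (er.symm.trans (occR_of_eq_one hk e h p))).2
      simp only [comp_occR, D.R_of_eq_one hk e]
  comp_one {k} hk b t h := by
    have e : A.one (n + 1) n.le_succ (A.one n (Nat.lt_succ_iff.1 hk) b) = A.one (n + 1) hk.le b :=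
      A.one_one _ _ _
    have h' : A.d k hk.le t.1 = A.c k hk.le (A.one (n + 1) hk.le b) := e ▸ h
    refine ext_sigma O D ((A.comp_congr hk rfl e h h').trans (A.comp_one hk _ _ _)) ?_
    intro r r' er
    rcases occ_cases hk _ r with ⟨p, rfl⟩ | ⟨p, rfl⟩
    · obtain rfl := eq_of_heq (Sigma.mk.inj (er.symm.trans (occL_of_eq_one hk e h p))).2
      simp only [comp_occL, D.L_of_eq_one hk e]
    · exact ((O.occ_one _).false p).elim
  one_comp_one {k} hk a b h h' :=
    ext_sigma O D (A.one_comp_one hk n.le_succ a b h h') fun r r' _ =>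
      ((O.occ_one _).false r').elim

theorem exists_labelling (ex : ∀ x ∈ A.indet (n + 1), D.Y) (hex : ∀ x hx, D.ok x (ex x hx)) :
    ∃ (e : ∀ u : A.C (n + 1), O.Occ u → D.Y) (he : ∀ (u : A.C (n + 1)) (r : O.Occ u), D.ok u (e u r)),
      (∀ x hx r, e x r = ex x hx) ∧
      (∀ {k : ℕ} (hk : k < n + 1) (u v) (h) (r),
        e (A.comp k hk u v h) (O.occL hk u v h r) = D.L hk u v h (e u r) (he u r)) ∧
      (∀ {k : ℕ} (hk : k < n + 1) (u v) (h) (r),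
        e (A.comp k hk u v h) (O.occR hk u v h r) = D.R hk u v h (e v r) (he v r)) := by
  obtain ⟨E, h₁, h₂, h₃, h₄⟩ := (A.free n).exists_section (D.layer O)
    (fun x => ⟨x.1, fun _ => ⟨ex x.1 x.2, hex _ _⟩⟩) (fun _ => rfl)
  have key : ∀ u, ∃ f : ∀ r : O.Occ u, {y // D.ok u y}, E u = ⟨u, f⟩ := by
    intro u
    generalize hE : E u = Eu
    obtain ⟨u', f⟩ := Eu
    obtain rfl : u' = u := (congrArg (D.layer O).π hE).symm.trans (h₁ u)
    exact ⟨f, rfl⟩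
  choose f hf using key
  have main : ∀ {k : ℕ} (hk : k < n + 1) (u v) (h : A.d k hk.le u = A.c k hk.le v),
      f (A.comp k hk u v h) = D.comp O hk h (f u) (f v) := by
    intro k hk u v h
    have h' : A.d k hk.le ((D.layer O).π (E u)) = A.c k hk.le ((D.layer O).π (E v)) := by
      rw [h₁, h₁, h]
    have e₂ : ∀ (p q : (D.layer O).H) (hp : p = ⟨u, f u⟩) (hq : q = ⟨v, f v⟩)
        (hpq : A.d k hk.le ((D.layer O).π p) = A.c k hk.le ((D.layer O).π q)),
        (D.layer O).comp hk p q hpq = ⟨A.comp k hk u v h, D.comp O hk h (f u) (f v)⟩ := by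
      rintro _ _ rfl rfl _; rfl
    exact eq_of_heq (Sigma.mk.inj
      ((hf _).symm.trans ((h₄ hk u v h h').trans (e₂ _ _ (hf u) (hf v) h')))).2
  refine ⟨fun u r => (f u r).1, fun u r => (f u r).2, fun x hx r => ?_, fun hk u v h r => ?_,
    fun hk u v h r => ?_⟩
  · have e₁ := h₂ ⟨x, hx⟩
    rw [hf] at e₁
    exact congrArg Subtype.val (congrFun (eq_of_heq (Sigma.mk.inj e₁).2) r)
  · simp only [main, comp_occL]
  · simp only [main, comp_occR]

end LabelData

end Computad

namespace Computad

section Fits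

variable {A : Computad.{u}}

theorem Fits.comp {n m k : ℕ} (h : n ≤ m) (hk : k < n) {a b : A.C m} {u v : A.C n}
    (ha : A.Fits h a u) (hb : A.Fits h b v) (hab : A.d k (hk.le.trans h) a = A.c k (hk.le.trans h) b)
    (huv : A.d k hk.le u = A.c k hk.le v) :
    A.Fits h (A.comp k (hk.trans_le h) a b hab) (A.comp k hk u v huv) := by
  intro j hj
  rcases lt_trichotomy j k with hjk | rfl | hjk
  · rw [← A.d_d hjk.le (hk.le.trans h), ← A.d_d hjk.le hk.le, ← A.c_c hjk.le (hk.le.trans h),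
      ← A.c_c hjk.le hk.le, A.d_comp, A.c_comp, A.d_comp, A.c_comp, (hb k hk).1, (ha k hk).2]
    exact ⟨rfl, rfl⟩
  · rw [A.d_comp, A.c_comp, A.d_comp, A.c_comp, (hb j hk).1, (ha j hk).2]
    exact ⟨rfl, rfl⟩
  · rw [A.d_comp_of_lt _ hjk (hj.le.trans h) _ _ _ (A.composable_d hjk _ hab),
      A.c_comp_of_lt _ hjk (hj.le.trans h) _ _ _ (A.composable_c hjk _ hab),
      A.d_comp_of_lt _ hjk hj.le _ _ _ (A.composable_d hjk _ huv),
      A.c_comp_of_lt _ hjk hj.le _ _ _ (A.composable_c hjk _ huv)]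
    exact ⟨A.comp_congr _ (ha j hj).1 (hb j hj).1 _ _, A.comp_congr _ (ha j hj).2 (hb j hj).2 _ _⟩

theorem fits_one {n m : ℕ} (h : n ≤ m) (u : A.C n) : A.Fits h (A.one m h u) u := fun k hk =>
  ⟨A.d_one_of_le hk.le h u, A.c_one_of_le hk.le h u⟩

theorem Fits.composable {n m k : ℕ} {h : n ≤ m} (hk : k < n) {a b : A.C m} {u v : A.C n}
    (ha : A.Fits h a u) (hb : A.Fits h b v) (huv : A.d k hk.le u = A.c k hk.le v) :
    A.d k (hk.le.trans h) a = A.c k (hk.le.trans h) b := by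
  rw [(ha k hk).1, (hb k hk).2, huv]

end Fits

namespace OccSystem

variable {A : Computad.{u}} {O : A.OccSystem}

section PointLaws

variable {n k : ℕ} (hk : k < n)

theorem cL_cL (p : O.Pt n) (s w : A.C n) (h₁) (h₂) (h₃) (h₄) :
    O.cL hk (O.cL hk p s h₁) w h₂ = O.cL hk p (A.comp k hk s w h₃) h₄ :=
  (O.assoc hk p.1 s w h₁ h₂ h₃ h₄).1 p.2

theorem cL_cR (t : A.C n) (p : O.Pt n) (w : A.C n) (h₁) (h₂) (h₃) (h₄) :
    O.cL hk (O.cR hk t p h₁) w h₂ = O.cR hk t (O.cL hk p w h₃) h₄ :=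
  (O.assoc hk t p.1 w h₁ h₂ h₃ h₄).2.1 p.2

theorem cR_comp (t s : A.C n) (p : O.Pt n) (h₁) (h₂) (h₃) (h₄) :
    O.cR hk (A.comp k hk t s h₁) p h₂ = O.cR hk t (O.cR hk s p h₃) h₄ :=
  (O.assoc hk t s p.1 h₁ h₂ h₃ h₄).2.2 p.2

variable {l : ℕ} (hl : l < n) (hlk : l < k)
include hlk

theorem exch_LL (p : O.Pt n) (t' s s' : A.C n) (h₁) (h₂) (h₃) (h₄) (h₅) (h₆) :
    O.cL hl (O.cL hk p t' h₁) (A.comp k hk s s' h₂) h₃ =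
      O.cL hk (O.cL hl p s h₄) (A.comp l hl t' s' h₅) h₆ :=
  (O.exchange hl hk hlk p.1 t' s s' h₁ h₂ h₃ h₄ h₅ h₆).1 p.2

theorem exch_LR (t : A.C n) (p : O.Pt n) (s s' : A.C n) (h₁) (h₂) (h₃) (h₄) (h₅) (h₆) :
    O.cL hl (O.cR hk t p h₁) (A.comp k hk s s' h₂) h₃ =
      O.cR hk (A.comp l hl t s h₄) (O.cL hl p s' h₅) h₆ :=
  (O.exchange hl hk hlk t p.1 s s' h₁ h₂ h₃ h₄ h₅ h₆).2.1 p.2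

theorem exch_RL (t t' : A.C n) (p : O.Pt n) (s' : A.C n) (h₁) (h₂) (h₃) (h₄) (h₅) (h₆) :
    O.cR hl (A.comp k hk t t' h₁) (O.cL hk p s' h₂) h₃ =
      O.cL hk (O.cR hl t p h₄) (A.comp l hl t' s' h₅) h₆ :=
  (O.exchange hl hk hlk t t' p.1 s' h₁ h₂ h₃ h₄ h₅ h₆).2.2.1 p.2

theorem exch_RR (t t' s : A.C n) (p : O.Pt n) (h₁) (h₂) (h₃) (h₄) (h₅) (h₆) :
    O.cR hl (A.comp k hk t t' h₁) (O.cR hk s p h₂) h₃ =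
      O.cR hk (A.comp l hl t s h₄) (O.cR hl t' p h₅) h₆ :=
  (O.exchange hl hk hlk t t' s p.1 h₁ h₂ h₃ h₄ h₅ h₆).2.2.2 p.2

end PointLaws

theorem cR_one {n k : ℕ} (hk : k < n) {b : A.C k} {i : A.C n} (e : i = A.one n hk.le b) (p : O.Pt n)
    (h) : O.cR hk i p h = p :=
  occR_of_eq_one hk e h p.2

theorem cL_one {n k : ℕ} (hk : k < n) {b : A.C k} {i : A.C n} (e : i = A.one n hk.le b) (p : O.Pt n)
    (h) : O.cL hk p i h = p :=
  occL_of_eq_one hk e h p.2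

variable (O)

/-- The possible results of replacing an occurrence by the cell `v`: a cell with a map from the
occurrences in `v` to its occurrences. -/
@[ext]
structure Res {m : ℕ} (v : A.C m) : Type u where
  w : A.C m
  f : O.Occ v → O.Pt m
  f_fst : ∀ p, (f p).1 = w

namespace Res

variable {O} {m : ℕ} {v : A.C m}

def wL {k : ℕ} (hk : k < m) (y : O.Res v) (s : A.C m) (h : A.d k hk.le y.w = A.c k hk.le s) :
    O.Res v where
  w := A.comp k hk y.w s h
  f p := O.cL hk (y.f p) s (by rw [y.f_fst, h])
  f_fst p := A.comp_congr hk (y.f_fst p) rfl _ _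

def wR {k : ℕ} (hk : k < m) (s : A.C m) (y : O.Res v) (h : A.d k hk.le s = A.c k hk.le y.w) :
    O.Res v where
  w := A.comp k hk s y.w h
  f p := O.cR hk s (y.f p) (by rw [y.f_fst, h])
  f_fst p := A.comp_congr hk rfl (y.f_fst p) _ _

theorem wL_congr {k : ℕ} (hk : k < m) {y y' : O.Res v} {s s' : A.C m} (hy : y = y') (hs : s = s')
    (h) (h') : wL hk y s h = wL hk y' s' h' := by
  subst hy hs; rfl

theorem wR_congr {k : ℕ} (hk : k < m) {y y' : O.Res v} {s s' : A.C m} (hy : y = y') (hs : s = s')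
    (h) (h') : wR hk s y h = wR hk s' y' h' := by
  subst hy hs; rfl

theorem f_composable_L {k : ℕ} (hk : k < m) {y : O.Res v} {s : A.C m}
    (h : A.d k hk.le y.w = A.c k hk.le s) (p) : A.d k hk.le (y.f p).1 = A.c k hk.le s := by
  rw [y.f_fst, h]

theorem f_composable_R {k : ℕ} (hk : k < m) {y : O.Res v} {s : A.C m}
    (h : A.d k hk.le s = A.c k hk.le y.w) (p) : A.d k hk.le s = A.c k hk.le (y.f p).1 := by
  rw [y.f_fst, h]

theorem wL_wL {k : ℕ} (hk : k < m) (y : O.Res v) (s w : A.C m) (h₁) (h₂) (h₃) (h₄) :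
    wL hk (wL hk y s h₁) w h₂ = wL hk y (A.comp k hk s w h₃) h₄ :=
  Res.ext (A.assoc hk _ _ _ _ _ _ _) (funext fun p => cL_cL hk _ _ _ _ _ _ _)

theorem wL_wR {k : ℕ} (hk : k < m) (t : A.C m) (y : O.Res v) (w : A.C m) (h₁) (h₂) (h₃) (h₄) :
    wL hk (wR hk t y h₁) w h₂ = wR hk t (wL hk y w h₃) h₄ :=
  Res.ext (A.assoc hk _ _ _ _ _ _ _) (funext fun p => cL_cR hk _ _ _ _ _
    (f_composable_L hk h₃ p) (f_composable_R hk (y := wL hk y w h₃) h₄ p))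

theorem wR_comp {k : ℕ} (hk : k < m) (t s : A.C m) (y : O.Res v) (h₁) (h₂) (h₃) (h₄) :
    wR hk (A.comp k hk t s h₁) y h₂ = wR hk t (wR hk s y h₃) h₄ :=
  Res.ext (A.assoc hk _ _ _ _ _ _ _) (funext fun p => cR_comp hk _ _ _ h₁ _
    (f_composable_R hk h₃ p) (f_composable_R hk (y := wR hk s y h₃) h₄ p))

theorem exch_LL {k l : ℕ} (hl : l < m) (hk : k < m) (hlk : l < k) (y : O.Res v) (t' s s' : A.C m)
    (h₁) (h₂) (h₃) (h₄) (h₅) (h₆) :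
    wL hl (wL hk y t' h₁) (A.comp k hk s s' h₂) h₃ =
      wL hk (wL hl y s h₄) (A.comp l hl t' s' h₅) h₆ :=
  Res.ext (A.exchange hl hk hlk _ _ _ _ _ _ _ _ _ _) (funext fun p => OccSystem.exch_LL hk hl hlk _ _ _ _
    (f_composable_L hk h₁ p) h₂ (f_composable_L hl (y := wL hk y t' h₁) h₃ p) (f_composable_L hl h₄ p) h₅
    (f_composable_L hk (y := wL hl y s h₄) h₆ p))

theorem exch_LR {k l : ℕ} (hl : l < m) (hk : k < m) (hlk : l < k) (t : A.C m) (y : O.Res v)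
    (s s' : A.C m) (h₁) (h₂) (h₃) (h₄) (h₅) (h₆) :
    wL hl (wR hk t y h₁) (A.comp k hk s s' h₂) h₃ =
      wR hk (A.comp l hl t s h₄) (wL hl y s' h₅) h₆ :=
  Res.ext (A.exchange hl hk hlk _ _ _ _ _ _ _ _ _ _) (funext fun p => OccSystem.exch_LR hk hl hlk _ _ _ _
    (f_composable_R hk h₁ p) h₂ (f_composable_L hl (y := wR hk t y h₁) h₃ p) h₄ (f_composable_L hl h₅ p)
    (f_composable_R hk (y := wL hl y s' h₅) h₆ p))

theorem exch_RL {k l : ℕ} (hl : l < m) (hk : k < m) (hlk : l < k) (t t' : A.C m) (y : O.Res v)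
    (s' : A.C m) (h₁) (h₂) (h₃) (h₄) (h₅) (h₆) :
    wR hl (A.comp k hk t t' h₁) (wL hk y s' h₂) h₃ =
      wL hk (wR hl t y h₄) (A.comp l hl t' s' h₅) h₆ :=
  Res.ext (A.exchange hl hk hlk _ _ _ _ _ _ _ _ _ _) (funext fun p => OccSystem.exch_RL hk hl hlk _ _ _ _
    h₁ (f_composable_L hk h₂ p) (f_composable_R hl (y := wL hk y s' h₂) h₃ p) (f_composable_R hl h₄ p) h₅
    (f_composable_L hk (y := wR hl t y h₄) h₆ p))

theorem exch_RR {k l : ℕ} (hl : l < m) (hk : k < m) (hlk : l < k) (t t' s : A.C m) (y : O.Res v)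
    (h₁) (h₂) (h₃) (h₄) (h₅) (h₆) :
    wR hl (A.comp k hk t t' h₁) (wR hk s y h₂) h₃ =
      wR hk (A.comp l hl t s h₄) (wR hl t' y h₅) h₆ :=
  Res.ext (A.exchange hl hk hlk _ _ _ _ _ _ _ _ _ _) (funext fun p => OccSystem.exch_RR hk hl hlk _ _ _ _
    h₁ (f_composable_R hk h₂ p) (f_composable_R hl (y := wR hk s y h₂) h₃ p) h₄ (f_composable_R hl h₅ p)
    (f_composable_R hk (y := wR hl t' y h₅) h₆ p))

theorem wR_one {k : ℕ} (hk : k < m) {b : A.C k} {i : A.C m} (e : i = A.one m hk.le b) (y : O.Res v)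
    (h) : wR hk i y h = y :=
  Res.ext ((A.comp_congr hk e rfl h (e ▸ h)).trans (A.one_comp hk _ _ _))
    (funext fun p => cR_one hk e _ _)

theorem wL_one {k : ℕ} (hk : k < m) {b : A.C k} {i : A.C m} (e : i = A.one m hk.le b) (y : O.Res v)
    (h) : wL hk y i h = y :=
  Res.ext ((A.comp_congr hk rfl e h (e ▸ h)).trans (A.comp_one hk _ _ _))
    (funext fun p => cL_one hk e _ _)

end Res

/-- The label of an occurrence in an `(n+1)`-cell is the result of its replacement by `v`. -/
def repData {n m : ℕ} (hm : n + 1 ≤ m) (v : A.C m) : A.LabelData n where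
  Y := Option (O.Res v)
  ok u y := ∀ z, y = some z → A.Fits hm z.w u
  L {k} hk u s h y hy := match y, hy with
    | none, _ => none
    | some z, hy => some (z.wL (hk.trans_le hm) (A.one m hm s)
        ((hy z rfl).composable hk (fits_one hm s) h))
  R {k} hk u s h y hy := match y, hy with
    | none, _ => none
    | some z, hy => some (z.wR (hk.trans_le hm) (A.one m hm u)
        ((fits_one hm u).composable hk (hy z rfl) h))
  ok_L {k} hk u s h y hy := by
    rcases y with _ | z
    · intro z e; cases e
    · rintro _ ⟨⟩
      exact Fits.comp hm hk (hy z rfl) (fits_one hm s) _ _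
  ok_R {k} hk u s h y hy := by
    rcases y with _ | z
    · intro z e; cases e
    · rintro _ ⟨⟩
      exact Fits.comp hm hk (fits_one hm u) (hy z rfl) _ _
  LL {k} hk t s w h₁ h₂ h₃ h₄ y hy hy' := by
    rcases y with _ | z
    · rfl
    · refine congrArg some ((Res.wL_wL _ z _ _ _ _ (by
        rw [A.d_one_of_le hk.le, A.c_one_of_le hk.le, h₃]) ?_).trans
        (Res.wL_congr _ rfl (A.one_comp_one hk hm s w h₃ _) _ _))
      rw [A.c_comp, A.c_one_of_le hk.le, ((hy z rfl) k hk).1, h₁]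
  LR {k} hk t s w h₁ h₂ h₃ h₄ y hy hy' hy'' := by
    rcases y with _ | z
    · rfl
    · exact congrArg some (Res.wL_wR _ _ z _ _ _ _ _)
  RR {k} hk t s w h₁ h₂ h₃ h₄ y hy hy' := by
    rcases y with _ | z
    · rfl
    · refine congrArg some ((Res.wR_congr _ rfl (A.one_comp_one hk hm t s h₁ (by
        rw [A.d_one_of_le hk.le, A.c_one_of_le hk.le, h₁])).symm _ ?_).trans
        (Res.wR_comp _ _ _ z _ _ _ _))
      rw [A.d_comp, A.d_one_of_le hk.le, ((hy z rfl) k hk).2, h₃]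
  X₁ {k l} hl hk hlk t t' s s' h₁ h₂ h₃ h₄ h₅ h₆ y hy hy' hy'' := by
    rcases y with _ | z
    · rfl
    · have e₂ := A.one_comp_one hk hm s s' h₂ (by rw [A.d_one_of_le hk.le, A.c_one_of_le hk.le, h₂])
      have e₅ := A.one_comp_one hl hm t' s' h₅ (by rw [A.d_one_of_le hl.le, A.c_one_of_le hl.le, h₅])
      refine congrArg some ((Res.wL_congr _ rfl e₂.symm _ ?_).trans
        ((Res.exch_LL _ _ hlk z _ _ _ _ _ _ _ _ ?_).trans (Res.wL_congr _ rfl e₅ _ _)))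
      · rw [e₂]; exact (hy' _ rfl).composable hl (fits_one hm _) h₃
      · rw [e₅]; exact (hy'' _ rfl).composable hk (fits_one hm _) h₆
  X₂ {k l} hl hk hlk t t' s s' h₁ h₂ h₃ h₄ h₅ h₆ y hy hy' hy'' := by
    rcases y with _ | z
    · rfl
    · have e₂ := A.one_comp_one hk hm s s' h₂ (by rw [A.d_one_of_le hk.le, A.c_one_of_le hk.le, h₂])
      have e₄ := A.one_comp_one hl hm t s h₄ (by rw [A.d_one_of_le hl.le, A.c_one_of_le hl.le, h₄])
      refine congrArg some ((Res.wL_congr _ rfl e₂.symm _ ?_).trans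
        ((Res.exch_LR _ _ hlk _ z _ _ _ _ _ _ _ ?_).trans (Res.wR_congr _ rfl e₄ _ _)))
      · rw [e₂]; exact (hy' _ rfl).composable hl (fits_one hm _) h₃
      · rw [e₄]; exact (fits_one hm _).composable hk (hy'' _ rfl) h₆
  X₃ {k l} hl hk hlk t t' s s' h₁ h₂ h₃ h₄ h₅ h₆ y hy hy' hy'' := by
    rcases y with _ | z
    · rfl
    · have e₁ := A.one_comp_one hk hm t t' h₁ (by rw [A.d_one_of_le hk.le, A.c_one_of_le hk.le, h₁])
      have e₅ := A.one_comp_one hl hm t' s' h₅ (by rw [A.d_one_of_le hl.le, A.c_one_of_le hl.le, h₅])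
      refine congrArg some ((Res.wR_congr _ rfl e₁.symm _ ?_).trans
        ((Res.exch_RL _ _ hlk _ _ z _ _ _ _ _ _ ?_).trans (Res.wL_congr _ rfl e₅ _ _)))
      · rw [e₁]; exact (fits_one hm _).composable hl (hy' _ rfl) h₃
      · rw [e₅]; exact (hy'' _ rfl).composable hk (fits_one hm _) h₆
  X₄ {k l} hl hk hlk t t' s s' h₁ h₂ h₃ h₄ h₅ h₆ y hy hy' hy'' := by
    rcases y with _ | z
    · rfl
    · have e₁ := A.one_comp_one hk hm t t' h₁ (by rw [A.d_one_of_le hk.le, A.c_one_of_le hk.le, h₁])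
      have e₄ := A.one_comp_one hl hm t s h₄ (by rw [A.d_one_of_le hl.le, A.c_one_of_le hl.le, h₄])
      refine congrArg some ((Res.wR_congr _ rfl e₁.symm _ ?_).trans
        ((Res.exch_RR _ _ hlk _ _ _ z _ _ _ _ _ ?_).trans (Res.wR_congr _ rfl e₄ _ _)))
      · rw [e₁]; exact (fits_one hm _).composable hl (hy' _ rfl) h₃
      · rw [e₄]; exact (fits_one hm _).composable hk (hy'' _ rfl) h₆
  one_R {k} hk b t h y hy := by
    rcases y with _ | z
    · rfl
    · exact congrArg some (Res.wR_one (hk.trans_le hm) (A.one_one hk.le hm b) z _)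
  L_one {k} hk b t h y hy := by
    rcases y with _ | z
    · rfl
    · exact congrArg some (Res.wL_one (hk.trans_le hm) (A.one_one hk.le hm b) z _)

end OccSystem

end Computad

namespace Computad

namespace OccSystem

variable {A : Computad.{u}} (O : A.OccSystem)

/-- A cell, a cell parallel to it, and a map from the occurrences in the first cell to points of cells
parallel to it. -/
structure Transform (n : ℕ) : Type u where
  u : A.C n
  w : A.C n
  g : O.Occ u → O.Pt n
  fits_w : A.Fits le_rfl w u
  fits_g : ∀ q, A.Fits le_rfl (g q).1 u

namespace Transform

variable {O} {n : ℕ}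

theorem ext' {y z : O.Transform n} (hu : y.u = z.u) (hw : y.w = z.w)
    (hg : ∀ r s, Same O.Occ r s → y.g r = z.g s) : y = z := by
  obtain ⟨u, w, g, _, _⟩ := y
  obtain ⟨u', w', g', _, _⟩ := z
  obtain rfl : u = u' := hu
  obtain rfl : w = w' := hw
  obtain rfl : g = g' := funext fun r => hg r r rfl
  rfl

/-- The identity transformation. -/
def refl (s : A.C n) : O.Transform n := ⟨s, s, fun q => ⟨s, q⟩, fits_self _, fun _ => fits_self _⟩

theorem composable {k : ℕ} (hk : k < n) {y z : O.Transform n} (h : A.d k hk.le y.u = A.c k hk.le z.u) :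
    A.d k hk.le y.w = A.c k hk.le z.w := y.fits_w.composable hk z.fits_w h

theorem composable_left {k : ℕ} (hk : k < n) {y z : O.Transform n}
    (h : A.d k hk.le y.u = A.c k hk.le z.u) (q) : A.d k hk.le (y.g q).1 = A.c k hk.le z.w :=
  (y.fits_g q).composable hk z.fits_w h

theorem composable_right {k : ℕ} (hk : k < n) {y z : O.Transform n}
    (h : A.d k hk.le y.u = A.c k hk.le z.u) (q) : A.d k hk.le y.w = A.c k hk.le (z.g q).1 :=
  y.fits_w.composable hk (z.fits_g q) h

/-- Composition of transformations. -/
noncomputable def comp {k : ℕ} (hk : k < n) (y z : O.Transform n) (h : A.d k hk.le y.u = A.c k hk.le z.u) :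
    O.Transform n where
  u := A.comp k hk y.u z.u h
  w := A.comp k hk y.w z.w (composable hk h)
  g := O.occElim hk y.u z.u h (fun q => O.cL hk (y.g q) z.w (composable_left hk h q))
    (fun q => O.cR hk y.w (z.g q) (composable_right hk h q))
  fits_w := y.fits_w.comp le_rfl hk z.fits_w _ _
  fits_g q := by
    rcases occ_cases hk _ q with ⟨p, rfl⟩ | ⟨p, rfl⟩
    · rw [occElim_occL]
      exact (y.fits_g p).comp le_rfl hk z.fits_w _ _
    · rw [occElim_occR]
      exact y.fits_w.comp le_rfl hk (z.fits_g p) _ _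

theorem comp_g_occL {k : ℕ} (hk : k < n) (y z : O.Transform n) (h) (q : O.Occ y.u) :
    (comp hk y z h).g (O.occL hk y.u z.u h q) = O.cL hk (y.g q) z.w (composable_left hk h q) :=
  occElim_occL _ _ _ _ _ _ _

theorem comp_g_occR {k : ℕ} (hk : k < n) (y z : O.Transform n) (h) (q : O.Occ z.u) :
    (comp hk y z h).g (O.occR hk y.u z.u h q) = O.cR hk y.w (z.g q) (composable_right hk h q) :=
  occElim_occR _ _ _ _ _ _ _

theorem comp_congr {k : ℕ} (hk : k < n) {y y' z z' : O.Transform n} (hy : y = y') (hz : z = z') (h) (h') :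
    comp hk y z h = comp hk y' z' h' := by
  subst hy hz; rfl

theorem comp_assoc {k : ℕ} (hk : k < n) (t s w : O.Transform n) (h₁) (h₂) (h₃) (h₄) :
    comp hk (comp hk t s h₁) w h₂ = comp hk t (comp hk s w h₃) h₄ := by
  refine ext' (A.assoc hk t.u s.u w.u h₁ h₂ h₃ h₄) (A.assoc hk _ _ _ _ _ (composable hk h₃) _) ?_
  intro r r' e
  obtain ⟨c₁, c₂, c₃⟩ := O.assoc hk t.u s.u w.u h₁ h₂ h₃ h₄
  rcases occ_cases hk _ r with ⟨p, rfl⟩ | ⟨p, rfl⟩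
  · rcases occ_cases hk _ p with ⟨p, rfl⟩ | ⟨p, rfl⟩
    · obtain rfl := eq_of_heq (Sigma.mk.inj (e.symm.trans (c₁ p))).2
      refine (comp_g_occL _ _ _ _ _).trans (Eq.trans ?_ (comp_g_occL _ _ _ _ _).symm)
      refine (cL_congr hk (comp_g_occL hk t s h₁ p) rfl _ ?_).trans (cL_cL hk _ _ _ _ _ _ _)
      exact (A.d_comp hk _ _ _).trans (composable hk h₃)
    · obtain rfl := eq_of_heq (Sigma.mk.inj (e.symm.trans (c₂ p))).2
      refine (comp_g_occL _ _ _ _ _).trans (Eq.trans ?_ (comp_g_occR _ _ _ _ _).symm)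
      refine (cL_congr hk (comp_g_occR hk t s h₁ p) rfl _ ?_).trans
        ((cL_cR hk _ _ _ _ _ (composable_left hk h₃ p) ?_).trans
          (cR_congr hk (comp_g_occL hk s w h₃ p).symm rfl _ _))
      · exact (A.d_comp hk _ _ _).trans (composable_left hk h₃ p)
      · exact (composable_right hk h₁ p).trans (A.c_comp hk _ _ _).symm
  · obtain rfl := eq_of_heq (Sigma.mk.inj (e.symm.trans (c₃ p))).2
    refine (comp_g_occR _ _ _ _ _).trans (Eq.trans ?_ (comp_g_occR _ _ _ _ _).symm)
    refine (cR_comp hk _ _ _ _ _ (composable_right hk h₃ p) ?_).trans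
      (cR_congr hk (comp_g_occR hk s w h₃ p).symm rfl _ _)
    exact (composable hk h₁).trans (A.c_comp hk _ _ _).symm

theorem comp_exchange {k l : ℕ} (hl : l < n) (hk : k < n) (hlk : l < k)
    (t t' s s' : O.Transform n) (h₁) (h₂) (h₃) (h₄) (h₅) (h₆) :
    comp hl (comp hk t t' h₁) (comp hk s s' h₂) h₃ =
      comp hk (comp hl t s h₄) (comp hl t' s' h₅) h₆ := by
  refine ext' (A.exchange hl hk hlk _ _ _ _ h₁ h₂ h₃ h₄ h₅ h₆)
    (A.exchange hl hk hlk _ _ _ _ _ _ _ (composable hl h₄) (composable hl h₅) _) ?_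
  intro r r' e
  obtain ⟨c₁, c₂, c₃, c₄⟩ := O.exchange hl hk hlk t.u t'.u s.u s'.u h₁ h₂ h₃ h₄ h₅ h₆
  rcases occ_cases hl _ r with ⟨p, rfl⟩ | ⟨p, rfl⟩ <;>
    rcases occ_cases hk _ p with ⟨p, rfl⟩ | ⟨p, rfl⟩
  · obtain rfl := eq_of_heq (Sigma.mk.inj (e.symm.trans (c₁ p))).2
    refine (comp_g_occL _ _ _ _ _).trans (Eq.trans ?_ (comp_g_occL _ _ _ _ _).symm)
    have a₃ := composable_left hl h₃ (O.occL hk t.u t'.u h₁ p)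
    have a₆ := composable_left hk h₆ (O.occL hl t.u s.u h₄ p)
    have e₁ := comp_g_occL hk t t' h₁ p
    have e₄ := comp_g_occL hl t s h₄ p
    refine (cL_congr hl e₁ rfl _ (e₁ ▸ a₃)).trans ((exch_LL hk hl hlk _ _ _ _ _ _ _ _ _ (e₄ ▸ a₆)).trans
      (cL_congr hk e₄.symm rfl (e₄ ▸ a₆) _))
  · obtain rfl := eq_of_heq (Sigma.mk.inj (e.symm.trans (c₂ p))).2
    refine (comp_g_occL _ _ _ _ _).trans (Eq.trans ?_ (comp_g_occR _ _ _ _ _).symm)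
    have a₃ := composable_left hl h₃ (O.occR hk t.u t'.u h₁ p)
    have a₆ := composable_right hk h₆ (O.occL hl t'.u s'.u h₅ p)
    have e₁ := comp_g_occR hk t t' h₁ p
    have e₄ := comp_g_occL hl t' s' h₅ p
    exact (cL_congr hl e₁ rfl _ (e₁ ▸ a₃)).trans ((exch_LR hk hl hlk _ _ _ _ _ _ _ _ _ _).trans
      (cR_congr hk e₄.symm rfl (e₄ ▸ a₆) _))
  · obtain rfl := eq_of_heq (Sigma.mk.inj (e.symm.trans (c₃ p))).2
    refine (comp_g_occR _ _ _ _ _).trans (Eq.trans ?_ (comp_g_occL _ _ _ _ _).symm)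
    have a₃ := composable_right hl h₃ (O.occL hk s.u s'.u h₂ p)
    have a₆ := composable_left hk h₆ (O.occR hl t.u s.u h₄ p)
    have e₁ := comp_g_occL hk s s' h₂ p
    have e₄ := comp_g_occR hl t s h₄ p
    exact (cR_congr hl e₁ rfl _ (e₁ ▸ a₃)).trans ((exch_RL hk hl hlk _ _ _ _ _ _ _ _ _ _).trans
      (cL_congr hk e₄.symm rfl (e₄ ▸ a₆) _))
  · obtain rfl := eq_of_heq (Sigma.mk.inj (e.symm.trans (c₄ p))).2
    refine (comp_g_occR _ _ _ _ _).trans (Eq.trans ?_ (comp_g_occR _ _ _ _ _).symm)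
    have a₃ := composable_right hl h₃ (O.occR hk s.u s'.u h₂ p)
    have a₆ := composable_right hk h₆ (O.occR hl t'.u s'.u h₅ p)
    have e₁ := comp_g_occR hk s s' h₂ p
    have e₄ := comp_g_occR hl t' s' h₅ p
    exact (cR_congr hl e₁ rfl _ (e₁ ▸ a₃)).trans ((exch_RR hk hl hlk _ _ _ _ _ _ _ _ _ _).trans
      (cR_congr hk e₄.symm rfl (e₄ ▸ a₆) _))

theorem refl_comp_refl {k : ℕ} (hk : k < n) (s t : A.C n) (h : A.d k hk.le s = A.c k hk.le t) :
    comp hk (refl (O := O) s) (refl t) h = refl (A.comp k hk s t h) := by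
  refine ext' rfl rfl ?_
  intro r r' e
  obtain rfl := eq_of_heq (Sigma.mk.inj e).2
  rcases occ_cases hk _ r with ⟨p, rfl⟩ | ⟨p, rfl⟩
  · exact comp_g_occL _ _ _ _ _
  · exact comp_g_occR _ _ _ _ _

theorem refl_one_comp {k : ℕ} (hk : k < n) (b : A.C k) (t : O.Transform n) (h) :
    comp hk (refl (A.one n hk.le b)) t h = t := by
  refine ext' (A.one_comp hk _ _ h) (A.one_comp hk _ _ _) ?_
  intro r r' e
  rcases occ_cases hk _ r with ⟨p, rfl⟩ | ⟨p, rfl⟩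
  · exact ((occ_one_isEmpty hk b).false p).elim
  · obtain rfl := eq_of_heq (Sigma.mk.inj (e.symm.trans (O.one_comp hk b t.u h p))).2
    rw [comp_g_occR]
    exact cR_one hk rfl _ _

theorem comp_refl_one {k : ℕ} (hk : k < n) (b : A.C k) (t : O.Transform n) (h) :
    comp hk t (refl (A.one n hk.le b)) h = t := by
  refine ext' (A.comp_one hk _ _ h) (A.comp_one hk _ _ _) ?_
  intro r r' e
  rcases occ_cases hk _ r with ⟨p, rfl⟩ | ⟨p, rfl⟩
  · obtain rfl := eq_of_heq (Sigma.mk.inj (e.symm.trans (O.comp_one hk b t.u h p))).2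
    rw [comp_g_occL]
    exact cL_one hk rfl _ _
  · exact ((occ_one_isEmpty hk b).false p).elim

end Transform

open Transform in
/-- The label of an occurrence is a transformation of the cell in which it occurs. -/
noncomputable def transformData (n : ℕ) : A.LabelData n where
  Y := O.Transform (n + 1)
  ok u y := y.u = u
  L {k} hk u s h y hy := y.comp hk (refl s) (hy ▸ h)
  R {k} hk u s h y hy := (refl u).comp hk y (hy ▸ h)
  ok_L hk u s h y hy := A.comp_congr hk hy rfl _ _
  ok_R hk u s h y hy := A.comp_congr hk rfl hy _ _
  LL hk t s w h₁ h₂ h₃ h₄ y hy hy' := by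
    subst hy
    exact (comp_assoc hk y (refl s) (refl w) _ _ h₃ (h₁.trans (A.c_comp hk _ _ _).symm)).trans
      (comp_congr hk rfl (refl_comp_refl hk s w h₃) _ _)
  LR hk t s w h₁ h₂ h₃ h₄ y hy hy' hy'' := by
    subst hy
    exact comp_assoc hk (refl t) y (refl w) _ _ _ _
  RR hk t s w h₁ h₂ h₃ h₄ y hy hy' := by
    subst hy
    exact (comp_congr hk (refl_comp_refl hk t s h₁).symm rfl _ ((A.d_comp hk _ _ _).trans h₃)).trans
      (comp_assoc hk (refl t) (refl s) y _ _ _ _)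
  X₁ hl hk hlk t t' s s' h₁ h₂ h₃ h₄ h₅ h₆ y hy hy' hy'' := by
    subst hy
    exact (comp_congr hl rfl (refl_comp_refl hk s s' h₂).symm _ h₃).trans
      ((comp_exchange hl hk hlk y (refl t') (refl s) (refl s') _ _ _ _ _ h₆).trans
        (comp_congr hk rfl (refl_comp_refl hl t' s' h₅) _ _))
  X₂ hl hk hlk t t' s s' h₁ h₂ h₃ h₄ h₅ h₆ y hy hy' hy'' := by
    subst hy
    exact (comp_congr hl rfl (refl_comp_refl hk s s' h₂).symm _ h₃).trans
      ((comp_exchange hl hk hlk (refl t) y (refl s) (refl s') _ _ _ _ _ h₆).trans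
        (comp_congr hk (refl_comp_refl hl t s h₄) rfl _ _))
  X₃ hl hk hlk t t' s s' h₁ h₂ h₃ h₄ h₅ h₆ y hy hy' hy'' := by
    subst hy
    exact (comp_congr hl (z := (y.comp hk (refl s') h₂)) (refl_comp_refl hk t t' h₁).symm rfl _ h₃).trans
      ((comp_exchange hl hk hlk (refl t) (refl t') y (refl s') _ _ _ _ _ h₆).trans
        (comp_congr hk rfl (refl_comp_refl hl t' s' h₅) _ _))
  X₄ hl hk hlk t t' s s' h₁ h₂ h₃ h₄ h₅ h₆ y hy hy' hy'' := by
    subst hy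
    exact (comp_congr hl (z := ((refl s).comp hk y h₂)) (refl_comp_refl hk t t' h₁).symm rfl _ h₃).trans
      ((comp_exchange hl hk hlk (refl t) (refl t') (refl s) y _ _ _ _ _ h₆).trans
        (comp_congr hk (refl_comp_refl hl t s h₄) rfl _ _))
  one_R hk b t h y hy := refl_one_comp hk b y _
  L_one hk b t h y hy := comp_refl_one hk b y _

end OccSystem

end Computad

namespace Computad

namespace OccSystem

variable {A : Computad.{u}} (O : A.OccSystem)

theorem exists_res {n m : ℕ} (hm : n ≤ m) (v : A.C m) :
    ∃ y : ∀ (u : A.C n) (r : O.Occ u), A.Fits hm v (O.lab u r) → O.Res v,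
      (∀ u r hv, A.Fits hm (y u r hv).w u) ∧
      (∀ x ∈ A.indet n, ∀ r hv, y x r hv = ⟨v, fun p => ⟨v, p⟩, fun _ => rfl⟩) ∧
      (∀ {k : ℕ} (hk : k < n) (u s : A.C n) (h : A.d k hk.le u = A.c k hk.le s) (r : O.Occ u) (hv) (hv')
        (hw : A.d k (hk.le.trans hm) (y u r hv).w = A.c k (hk.le.trans hm) (A.one m hm s)),
        y (A.comp k hk u s h) (O.occL hk u s h r) hv' = (y u r hv).wL (hk.trans_le hm) (A.one m hm s) hw) ∧
      (∀ {k : ℕ} (hk : k < n) (u s : A.C n) (h : A.d k hk.le u = A.c k hk.le s) (r : O.Occ s) (hv) (hv')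
        (hw : A.d k (hk.le.trans hm) (A.one m hm u) = A.c k (hk.le.trans hm) (y s r hv).w),
        y (A.comp k hk u s h) (O.occR hk u s h r) hv' = (y s r hv).wR (hk.trans_le hm) (A.one m hm u) hw) := by
  classical
  obtain _ | n := n
  · exact ⟨fun _ _ _ => ⟨v, fun p => ⟨v, p⟩, fun _ => rfl⟩, fun u r hv k hk => by omega,
      fun _ _ _ _ => rfl, fun hk => by omega, fun hk => by omega⟩
  obtain ⟨ex, hex, ex₁⟩ : ∃ ex : A.C (n + 1) → Option (O.Res v),
      (∀ x z, ex x = some z → A.Fits hm z.w x) ∧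
      ∀ x, A.Fits hm v x → ex x = some ⟨v, fun p => ⟨v, p⟩, fun _ => rfl⟩ := by
    refine ⟨fun x => if A.Fits hm v x then some ⟨v, fun p => ⟨v, p⟩, fun _ => rfl⟩ else none,
      fun x z hz => ?_, fun x h => if_pos h⟩
    dsimp only at hz
    by_cases h : A.Fits hm v x
    · rw [if_pos h] at hz
      obtain rfl := Option.some.inj hz
      exact h
    · rw [if_neg h] at hz
      cases hz
  obtain ⟨e, he, e₁, e₂, e₃⟩ := (O.repData hm v).exists_labelling O (fun x _ => ex x)
    (fun x _ => hex x)
  have key : ∀ (u : A.C (n + 1)) (r : O.Occ u), A.Fits hm v (O.lab u r) → ∃ z, e u r = some z := by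
    refine O.cell_induction _ ?_ ?_ ?_
    · intro x hx r hv
      rw [(O.occ_indet x hx).2 r] at hv
      exact ⟨_, (e₁ x hx r).trans (ex₁ x hv)⟩
    · intro k hk u s h r ih hv
      rw [O.lab_occL] at hv
      obtain ⟨z, hz⟩ := ih hv
      rw [e₂]
      have : ∀ (y) (hy), y = some z → ∃ z', (O.repData hm v).L hk u s h y hy = some z' := by
        rintro _ hy rfl
        exact ⟨_, rfl⟩
      exact this _ _ hz
    · intro k hk u s h r ih hv
      rw [O.lab_occR] at hv
      obtain ⟨z, hz⟩ := ih hv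
      rw [e₃]
      have : ∀ (y) (hy), y = some z → ∃ z', (O.repData hm v).R hk u s h y hy = some z' := by
        rintro _ hy rfl
        exact ⟨_, rfl⟩
      exact this _ _ hz
  choose y hy using key
  refine ⟨y, fun u r hv => he u r _ (hy u r hv), ?_, ?_, ?_⟩
  · intro x hx r hv
    refine Option.some.inj ((hy x r hv).symm.trans ((e₁ x hx r).trans (ex₁ x ?_)))
    rwa [(O.occ_indet x hx).2 r] at hv
  · intro k hk u s h r hv hv' hw
    have : ∀ (z) (hz) (z'), z = some z' →
        ∃ hw, (O.repData hm v).L hk u s h z hz = some (z'.wL (hk.trans_le hm) (A.one m hm s) hw) := by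
      rintro _ hz z' rfl
      exact ⟨_, rfl⟩
    obtain ⟨_, h'⟩ := this _ (he u r) _ (hy u r hv)
    exact Option.some.inj ((hy _ _ hv').symm.trans ((e₂ hk u s h r).trans h'))
  · intro k hk u s h r hv hv' hw
    have : ∀ (z) (hz) (z'), z = some z' →
        ∃ hw, (O.repData hm v).R hk u s h z hz = some (z'.wR (hk.trans_le hm) (A.one m hm u) hw) := by
      rintro _ hz z' rfl
      exact ⟨_, rfl⟩
    obtain ⟨_, h'⟩ := this _ (he s r) _ (hy s r hv)
    exact Option.some.inj ((hy _ _ hv').symm.trans ((e₃ hk u s h r).trans h'))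

theorem exists_transform {n : ℕ} (v : A.C n)
    (y : ∀ (u : A.C n) (r : O.Occ u), A.Fits le_rfl v (O.lab u r) → O.Res v)
    (y₀ : ∀ u r hv, A.Fits le_rfl (y u r hv).w u)
    (y₁ : ∀ x ∈ A.indet n, ∀ r hv, y x r hv = ⟨v, fun p => ⟨v, p⟩, fun _ => rfl⟩)
    (y₂ : ∀ {k : ℕ} (hk : k < n) (u s : A.C n) (h : A.d k hk.le u = A.c k hk.le s) (r : O.Occ u) (hv) (hv')
        (hw : A.d k hk.le (y u r hv).w = A.c k hk.le (A.one n le_rfl s)),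
        y (A.comp k hk u s h) (O.occL hk u s h r) hv' = (y u r hv).wL hk (A.one n le_rfl s) hw)
    (y₃ : ∀ {k : ℕ} (hk : k < n) (u s : A.C n) (h : A.d k hk.le u = A.c k hk.le s) (r : O.Occ s) (hv) (hv')
        (hw : A.d k hk.le (A.one n le_rfl u) = A.c k hk.le (y s r hv).w),
        y (A.comp k hk u s h) (O.occR hk u s h r) hv' = (y s r hv).wR hk (A.one n le_rfl u) hw) :
    ∃ g : ∀ (u : A.C n) (r : O.Occ u) (hv : A.Fits le_rfl v (O.lab u r)) (q : O.Occ u), q ≠ r → O.Pt n,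
      (∀ u r hv q hq, (g u r hv q hq).1 = (y u r hv).w) ∧
      (∀ {k : ℕ} (hk : k < n) (u s : A.C n) (h : A.d k hk.le u = A.c k hk.le s) (r : O.Occ u) (hv) (hv'),
        (∀ q hq hq', ∃ hw, g (A.comp k hk u s h) (O.occL hk u s h r) hv' (O.occL hk u s h q) hq' =
          O.cL hk (g u r hv q hq) s hw) ∧
        ∀ q hq', ∃ hw, g (A.comp k hk u s h) (O.occL hk u s h r) hv' (O.occR hk u s h q) hq' =
          O.cR hk (y u r hv).w ⟨s, q⟩ hw) ∧
      (∀ {k : ℕ} (hk : k < n) (u s : A.C n) (h : A.d k hk.le u = A.c k hk.le s) (r : O.Occ s) (hv) (hv'),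
        (∀ q hq hq', ∃ hw, g (A.comp k hk u s h) (O.occR hk u s h r) hv' (O.occR hk u s h q) hq' =
          O.cR hk u (g s r hv q hq) hw) ∧
        ∀ q hq', ∃ hw, g (A.comp k hk u s h) (O.occR hk u s h r) hv' (O.occL hk u s h q) hq' =
          O.cL hk ⟨u, q⟩ (y s r hv).w hw) := by
  classical
  obtain _ | n := n
  · refine ⟨fun u r hv q hq => (hq (occ_indet_subsingleton (by rw [A.indet_zero]; trivial) q r)).elim,
      fun u r hv q hq => (hq (occ_indet_subsingleton (by rw [A.indet_zero]; trivial) q r)).elim,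
      fun hk => by omega, fun hk => by omega⟩
  obtain ⟨ex, hex, ex₁⟩ : ∃ ex : A.C (n + 1) → O.Transform (n + 1), (∀ x, (ex x).u = x) ∧
      ∀ x, A.Fits le_rfl v x → (ex x).w = v := by
    refine ⟨fun x => if h : A.Fits le_rfl v x then
      ⟨x, v, fun q => ⟨x, q⟩, h, fun _ => fits_self _⟩ else Transform.refl x, fun x => ?_,
      fun x h => by dsimp only; rw [dif_pos h]⟩
    dsimp only
    by_cases h : A.Fits le_rfl v x
    · rw [dif_pos h]
    · rw [dif_neg h]; rfl
  obtain ⟨e, he, e₁, e₂, e₃⟩ := (O.transformData n).exists_labelling O (fun x _ => ex x)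
    (fun x _ => hex x)
  have ew : ∀ (u : A.C (n + 1)) (r : O.Occ u) (hv : A.Fits le_rfl v (O.lab u r)),
      (e u r).w = (y u r hv).w := by
    refine O.cell_induction _ ?_ ?_ ?_
    · intro x hx r hv
      have hv' := hv
      rw [(O.occ_indet x hx).2 r] at hv'
      rw [e₁ x hx r, y₁ x hx r]; exact ex₁ x hv'
    · intro k hk u s h r ih hv
      have hv' := hv
      rw [O.lab_occL] at hv'
      rw [e₂, y₂ hk u s h r hv' hv ((y₀ u r hv').composable hk (fits_one le_rfl s) h)]
      exact A.comp_congr hk (ih hv') (A.one_self s).symm _ _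
    · intro k hk u s h r ih hv
      have hv' := hv
      rw [O.lab_occR] at hv'
      rw [e₃, y₃ hk u s h r hv' hv ((fits_one le_rfl u).composable hk (y₀ s r hv') h)]
      exact A.comp_congr hk (A.one_self u).symm (ih hv') _ _
  have gL : ∀ {k : ℕ} (hk : k < n + 1) (u s : A.C (n + 1)) (h) (r : O.Occ u) (q),
      ∃ hw, (e _ (O.occL hk u s h r)).g (cast (congrArg O.Occ (he _ _).symm) (O.occL hk u s h q)) =
        O.cL hk ((e u r).g (cast (congrArg O.Occ (he _ _).symm) q)) s hw := by
    intro k hk u s h r q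
    have : ∀ (T : O.Transform (n + 1)) (hT : T.u = _) (y : O.Transform (n + 1)) (hy : y.u = u),
        T = (O.transformData n).L hk u s h y hy →
        ∃ hw, T.g (cast (congrArg O.Occ hT.symm) (O.occL hk u s h q)) =
          O.cL hk (y.g (cast (congrArg O.Occ hy.symm) q)) s hw := by
      rintro _ hT y rfl rfl
      exact ⟨_, Transform.comp_g_occL hk y (Transform.refl s) h q⟩
    exact this _ (he _ _) _ (he _ _) (e₂ hk u s h r)
  have gL' : ∀ {k : ℕ} (hk : k < n + 1) (u s : A.C (n + 1)) (h) (r : O.Occ u) (q),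
      ∃ hw, (e _ (O.occL hk u s h r)).g (cast (congrArg O.Occ (he _ _).symm) (O.occR hk u s h q)) =
        O.cR hk (e u r).w ⟨s, q⟩ hw := by
    intro k hk u s h r q
    have : ∀ (T : O.Transform (n + 1)) (hT : T.u = _) (y : O.Transform (n + 1)) (hy : y.u = u),
        T = (O.transformData n).L hk u s h y hy →
        ∃ hw, T.g (cast (congrArg O.Occ hT.symm) (O.occR hk u s h q)) =
          O.cR hk y.w ⟨s, q⟩ hw := by
      rintro _ hT y rfl rfl
      exact ⟨_, Transform.comp_g_occR hk y (Transform.refl s) h q⟩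
    exact this _ (he _ _) _ (he _ _) (e₂ hk u s h r)
  have gR : ∀ {k : ℕ} (hk : k < n + 1) (u s : A.C (n + 1)) (h) (r : O.Occ s) (q),
      ∃ hw, (e _ (O.occR hk u s h r)).g (cast (congrArg O.Occ (he _ _).symm) (O.occR hk u s h q)) =
        O.cR hk u ((e s r).g (cast (congrArg O.Occ (he _ _).symm) q)) hw := by
    intro k hk u s h r q
    have : ∀ (T : O.Transform (n + 1)) (hT : T.u = _) (y : O.Transform (n + 1)) (hy : y.u = s),
        T = (O.transformData n).R hk u s h y hy →
        ∃ hw, T.g (cast (congrArg O.Occ hT.symm) (O.occR hk u s h q)) =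
          O.cR hk u (y.g (cast (congrArg O.Occ hy.symm) q)) hw := by
      rintro _ hT y rfl rfl
      exact ⟨_, Transform.comp_g_occR hk (Transform.refl u) y h q⟩
    exact this _ (he _ _) _ (he _ _) (e₃ hk u s h r)
  have gR' : ∀ {k : ℕ} (hk : k < n + 1) (u s : A.C (n + 1)) (h) (r : O.Occ s) (q),
      ∃ hw, (e _ (O.occR hk u s h r)).g (cast (congrArg O.Occ (he _ _).symm) (O.occL hk u s h q)) =
        O.cL hk ⟨u, q⟩ (e s r).w hw := by
    intro k hk u s h r q
    have : ∀ (T : O.Transform (n + 1)) (hT : T.u = _) (y : O.Transform (n + 1)) (hy : y.u = s),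
        T = (O.transformData n).R hk u s h y hy →
        ∃ hw, T.g (cast (congrArg O.Occ hT.symm) (O.occL hk u s h q)) =
          O.cL hk ⟨u, q⟩ y.w hw := by
      rintro _ hT y rfl rfl
      exact ⟨_, Transform.comp_g_occL hk (Transform.refl u) y h q⟩
    exact this _ (he _ _) _ (he _ _) (e₃ hk u s h r)
  refine ⟨fun u r _ q _ => (e u r).g (cast (congrArg O.Occ (he u r).symm) q), ?_, ?_, ?_⟩
  · refine O.cell_induction _ ?_ ?_ ?_
    · intro x hx r hv q hq
      exact (hq (occ_indet_subsingleton hx q r)).elim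
    · intro k hk u s h r ih hv q hq
      have hv' := hv
      rw [O.lab_occL] at hv'
      have hc := (y₀ u r hv').composable hk (fits_one le_rfl s) h
      rw [y₂ hk u s h r hv' hv hc]
      rcases occ_cases hk h q with ⟨q, rfl⟩ | ⟨q, rfl⟩
      · obtain ⟨hw, e'⟩ := gL hk u s h r q
        exact (congrArg Sigma.fst e').trans
          (A.comp_congr hk (ih hv' q (ne_of_apply_ne _ hq)) (A.one_self s).symm _ _)
      · obtain ⟨hw, e'⟩ := gL' hk u s h r q
        exact (congrArg Sigma.fst e').trans (A.comp_congr hk (ew u r hv') (A.one_self s).symm _ _)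
    · intro k hk u s h r ih hv q hq
      have hv' := hv
      rw [O.lab_occR] at hv'
      have hc := (fits_one le_rfl u).composable hk (y₀ s r hv') h
      rw [y₃ hk u s h r hv' hv hc]
      rcases occ_cases hk h q with ⟨q, rfl⟩ | ⟨q, rfl⟩
      · obtain ⟨hw, e'⟩ := gR' hk u s h r q
        exact (congrArg Sigma.fst e').trans (A.comp_congr hk (A.one_self u).symm (ew s r hv') _ _)
      · obtain ⟨hw, e'⟩ := gR hk u s h r q
        exact (congrArg Sigma.fst e').trans
          (A.comp_congr hk (A.one_self u).symm (ih hv' q (ne_of_apply_ne _ hq)) _ _)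
  · intro k hk u s h r hv hv'
    refine ⟨fun q hq hq' => gL hk u s h r q, fun q hq' => ?_⟩
    have := gL' hk u s h r q
    simpa only [ew u r hv] using this
  · intro k hk u s h r hv hv'
    refine ⟨fun q hq hq' => gR hk u s h r q, fun q hq' => ?_⟩
    have := gR' hk u s h r q
    simpa only [ew s r hv] using this

theorem same_cast_pt {O : A.OccSystem} {n : ℕ} {w : A.C n} (P : O.Pt n) (e : P.1 = w) :
    Same O.Occ (cast (congrArg O.Occ e) P.2) P.2 := by
  subst e; rfl

theorem Res.same_cast {O : A.OccSystem} {m : ℕ} {v : A.C m} (z : O.Res v) (p : O.Occ v) :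
    Same O.Occ (cast (congrArg O.Occ (z.f_fst p)) (z.f p).2) (z.f p).2 :=
  same_cast_pt _ (z.f_fst p)

theorem nonempty_replacement : Nonempty O.Replacement := by
  choose y y₀ y₁ y₂ y₃ using fun {n m : ℕ} (h : n ≤ m) (v : A.C m) => O.exists_res h v
  choose g g₀ g₁ g₂ using fun {n : ℕ} (v : A.C n) =>
    O.exists_transform v (y le_rfl v) (y₀ _ v) (y₁ _ v) (y₂ _ v) (y₃ _ v)
  refine ⟨{
    rep := fun h u r v hv => (y h v u r hv).w
    repL := fun u r v hv q hq => cast (congrArg O.Occ (g₀ v u r hv q hq)) (g v u r hv q hq).2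
    repR := fun h u r v hv p => cast (congrArg O.Occ ((y h v u r hv).f_fst p)) ((y h v u r hv).f p).2
    d_rep := fun h u r v hv k hk => (y₀ h v u r hv k hk).1
    c_rep := fun h u r v hv k hk => (y₀ h v u r hv k hk).2
    rep_indet := fun h x r v hv hx => ?_
    rep_left := fun h hk u' u'' hu r v hv hv' hw => ?_
    rep_right := fun h hk u' u'' hu r v hv hv' hw => ?_
    repL_left := fun hk u' u'' hu r v hv hv' hw => ⟨fun q hq hq' => ?_, fun q hq' => ?_⟩
    repL_right := fun hk u' u'' hu r v hv hv' hw => ⟨fun q hq hq' => ?_, fun q hq' => ?_⟩ }⟩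
  · have e := y₁ h v x hx r hv
    exact ⟨congrArg Res.w e, fun p => (Res.same_cast _ p).trans
      (congrArg (fun z => Res.f z p) e)⟩
  · have e := y₂ h v hk u' u'' hu r hv hv' hw
    refine ⟨congrArg Res.w e, fun p => (Res.same_cast _ p).trans
      ((congrArg (fun z => Res.f z p) e).trans (cL_congr _ (Res.same_cast _ p).symm rfl _ _))⟩
  · have e := y₃ h v hk u' u'' hu r hv hv' hw
    refine ⟨congrArg Res.w e, fun p => (Res.same_cast _ p).trans
      ((congrArg (fun z => Res.f z p) e).trans (cR_congr _ (Res.same_cast _ p).symm rfl _ _))⟩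
  · obtain ⟨_, e⟩ := (g₁ v hk u' u'' hu r hv hv').1 q hq hq'
    exact (same_cast_pt _ (g₀ _ _ _ _ _ _)).trans
      (e.trans (cL_congr _ (same_cast_pt _ (g₀ _ _ _ _ _ _)).symm rfl _ _))
  · obtain ⟨_, e⟩ := (g₁ v hk u' u'' hu r hv hv').2 q hq'
    exact (same_cast_pt _ (g₀ _ _ _ _ _ _)).trans e
  · obtain ⟨_, e⟩ := (g₂ v hk u' u'' hu r hv hv').1 q hq hq'
    exact (same_cast_pt _ (g₀ _ _ _ _ _ _)).trans
      (e.trans (cR_congr _ (same_cast_pt _ (g₀ _ _ _ _ _ _)).symm rfl _ _))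
  · obtain ⟨_, e⟩ := (g₂ v hk u' u'' hu r hv hv').2 q hq'
    exact (same_cast_pt _ (g₀ _ _ _ _ _ _)).trans e

end OccSystem

end Computad

theorem ManyToOneComputad.nonempty_parametrization (A : ManyToOneComputad.{u}) :
    Nonempty A.Parametrization := by
  obtain ⟨O⟩ := Computad.nonempty_occSystem A
  obtain ⟨R⟩ := O.nonempty_replacement
  exact ⟨⟨O, R⟩⟩

namespace Computad

namespace OccSystem

variable {A : Computad.{u}} {O : A.OccSystem}

/-- The indeterminate that occurs at a point. -/
def lb {n : ℕ} (P : O.Pt n) : A.C n := O.lab P.1 P.2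

theorem lb_cL {n k : ℕ} (hk : k < n) (P : O.Pt n) (s : A.C n) (h) : lb (O.cL hk P s h) = lb P :=
  O.lab_occL _ _ _ _ _

theorem lb_cR {n k : ℕ} (hk : k < n) (s : A.C n) (P : O.Pt n) (h) : lb (O.cR hk s P h) = lb P :=
  O.lab_occR _ _ _ _ _

theorem lb_of_indet {n : ℕ} {P : O.Pt n} (h : P.1 ∈ A.indet n) : lb P = P.1 := (O.occ_indet _ h).2 _

theorem cL_injective {n k : ℕ} (hk : k < n) {P Q : O.Pt n} (e : Q.1 = P.1) {s : A.C n} {h h'}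
    (hP : O.cL hk Q s h = O.cL hk P s h') : Q = P := by
  obtain ⟨u, r⟩ := P
  obtain ⟨u', q⟩ := Q
  obtain rfl : u' = u := e
  exact congrArg (Sigma.mk u') (occL_injective hk u' s h (eq_of_heq (Sigma.mk.inj hP).2))

theorem cR_injective {n k : ℕ} (hk : k < n) {P Q : O.Pt n} (e : Q.1 = P.1) {s : A.C n} {h h'}
    (hP : O.cR hk s Q h = O.cR hk s P h') : Q = P := by
  obtain ⟨u, r⟩ := P
  obtain ⟨u', q⟩ := Q
  obtain rfl : u' = u := e
  exact congrArg (Sigma.mk u') (occR_injective hk s u' h (eq_of_heq (Sigma.mk.inj hP).2))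

theorem cL_ne_cR {n k : ℕ} (hk : k < n) (P Q : O.Pt n) (h : A.d k hk.le P.1 = A.c k hk.le Q.1) :
    O.cL hk P Q.1 h ≠ O.cR hk P.1 Q h := fun e =>
  occL_ne_occR hk _ _ h _ _ (eq_of_heq (Sigma.mk.inj e).2)

theorem pt_induction {n : ℕ} (p : O.Pt n → Prop) (hx : ∀ P : O.Pt n, P.1 ∈ A.indet n → p P)
    (hL : ∀ (k : ℕ) (hk : k < n) (P : O.Pt n) (s) (h), p P → p (O.cL hk P s h))
    (hR : ∀ (k : ℕ) (hk : k < n) (s) (P : O.Pt n) (h), p P → p (O.cR hk s P h)) (P : O.Pt n) : p P :=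
  O.cell_induction (fun u r => p ⟨u, r⟩) (fun x hx' r => hx ⟨x, r⟩ hx')
    (fun k hk u v h r => hL k hk ⟨u, r⟩ v h) (fun k hk u v h r => hR k hk u ⟨v, r⟩ h) P.1 P.2

/-- Induction for pairs of different occurrences in the same cell. -/
theorem pair_induction {n : ℕ} (p : O.Pt n → O.Pt n → Prop)
    (hLL : ∀ (k : ℕ) (hk : k < n) (P Q : O.Pt n) (s) (h) (h'), Q.1 = P.1 → Q ≠ P → p P Q →
      p (O.cL hk P s h) (O.cL hk Q s h'))
    (hRR : ∀ (k : ℕ) (hk : k < n) (s) (P Q : O.Pt n) (h) (h'), Q.1 = P.1 → Q ≠ P → p P Q →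
      p (O.cR hk s P h) (O.cR hk s Q h'))
    (hLR : ∀ (k : ℕ) (hk : k < n) (P Q : O.Pt n) (h), p (O.cL hk P Q.1 h) (O.cR hk P.1 Q h))
    (hRL : ∀ (k : ℕ) (hk : k < n) (P Q : O.Pt n) (h), p (O.cR hk Q.1 P h) (O.cL hk Q P.1 h))
    (P Q : O.Pt n) (e : Q.1 = P.1) (ne : Q ≠ P) : p P Q := by
  revert Q
  refine pt_induction (fun P => ∀ Q : O.Pt n, Q.1 = P.1 → Q ≠ P → p P Q) ?_ ?_ ?_ P
  · rintro ⟨x, r⟩ hx ⟨x', q⟩ e ne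
    obtain rfl : x' = x := e
    exact (ne (by rw [occ_indet_subsingleton hx q r])).elim
  · rintro k hk P s h ih ⟨w, q⟩ e ne
    obtain rfl : w = A.comp k hk P.1 s h := e
    rcases occ_cases hk h q with ⟨q, rfl⟩ | ⟨q, rfl⟩
    · have ne' : (⟨P.1, q⟩ : O.Pt n) ≠ P := fun e => ne (cL_congr hk (p := ⟨P.1, q⟩) e rfl h h)
      exact hLL k hk P ⟨P.1, q⟩ s h h rfl ne' (ih _ rfl ne')
    · exact hLR k hk P ⟨s, q⟩ h
  · rintro k hk s P h ih ⟨w, q⟩ e ne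
    obtain rfl : w = A.comp k hk s P.1 h := e
    rcases occ_cases hk h q with ⟨q, rfl⟩ | ⟨q, rfl⟩
    · exact hRL k hk P ⟨s, q⟩ h
    · have ne' : (⟨P.1, q⟩ : O.Pt n) ≠ P := fun e => ne (cR_congr hk (p := ⟨P.1, q⟩) e rfl h h)
      exact hRR k hk s P ⟨P.1, q⟩ h h rfl ne' (ih _ rfl ne')

theorem pt_cases {n k : ℕ} (hk : k < n) {u v : A.C n} (h : A.d k hk.le u = A.c k hk.le v)
    (T : O.Pt n) (e : T.1 = A.comp k hk u v h) :
    (∃ S : O.Pt n, ∃ e : S.1 = u, T = O.cL hk S v (e ▸ h)) ∨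
      ∃ S : O.Pt n, ∃ e : S.1 = v, T = O.cR hk u S (e ▸ h) := by
  obtain ⟨w, t⟩ := T
  obtain rfl : w = _ := e
  rcases occ_cases hk h t with ⟨t, rfl⟩ | ⟨t, rfl⟩
  · exact Or.inl ⟨⟨u, t⟩, rfl, rfl⟩
  · exact Or.inr ⟨⟨v, t⟩, rfl, rfl⟩

namespace Replacement

variable (R : O.Replacement)

/-- The replacement of a point by a cell. -/
def rp {n m : ℕ} (h : n ≤ m) (P : O.Pt n) (v : A.C m) (hv : A.Fits h v (lb P)) : A.C m :=
  R.rep h P.1 P.2 v hv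

/-- The image of a point of the replacing cell. -/
def pR {n m : ℕ} (h : n ≤ m) (P : O.Pt n) (p : O.Pt m) (hv : A.Fits h p.1 (lb P)) : O.Pt m :=
  ⟨R.rep h P.1 P.2 p.1 hv, R.repR h P.1 P.2 p.1 hv p.2⟩

theorem ne_of_pt_ne {n : ℕ} {P Q : O.Pt n} (e : Q.1 = P.1) (ne : Q ≠ P) :
    (e ▸ Q.2 : O.Occ P.1) ≠ P.2 := by
  obtain ⟨u, r⟩ := P
  obtain ⟨u', q⟩ := Q
  obtain rfl : u' = u := e
  exact fun e' => ne (congrArg (Sigma.mk u') e')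

/-- The image of a different point. -/
def pL {n : ℕ} (P Q : O.Pt n) (v : A.C n) (hv : A.Fits le_rfl v (lb P)) (e : Q.1 = P.1) (ne : Q ≠ P) :
    O.Pt n :=
  ⟨R.rep le_rfl P.1 P.2 v hv, R.repL P.1 P.2 v hv (e ▸ Q.2) (ne_of_pt_ne e ne)⟩

variable {R}

theorem rp_congr {n m : ℕ} {h : n ≤ m} {P P' : O.Pt n} {v v' : A.C m} (hP : P = P') (hv : v = v')
    (h₁) (h₂) : R.rp h P v h₁ = R.rp h P' v' h₂ := by
  subst hP hv; rfl

theorem pR_congr {n m : ℕ} {h : n ≤ m} {P P' : O.Pt n} {v v' : O.Pt m} (hP : P = P') (hv : v = v')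
    (h₁) (h₂) : R.pR h P v h₁ = R.pR h P' v' h₂ := by
  subst hP hv; rfl

theorem pL_congr {n : ℕ} {P P' Q Q' : O.Pt n} {v v' : A.C n} (hP : P = P') (hQ : Q = Q') (hv : v = v')
    (h₁) (h₂) (e) (e') (ne) (ne') : R.pL P Q v h₁ e ne = R.pL P' Q' v' h₂ e' ne' := by
  subst hP hQ hv; rfl

theorem rp_indet {n m : ℕ} {h : n ≤ m} {P : O.Pt n} (hP : P.1 ∈ A.indet n) (v : A.C m) (hv) :
    R.rp h P v hv = v :=
  (R.rep_indet h _ _ _ hv hP).1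

theorem pR_indet {n m : ℕ} {h : n ≤ m} {P : O.Pt n} (hP : P.1 ∈ A.indet n) (p : O.Pt m) (hv) :
    R.pR h P p hv = p :=
  (R.rep_indet h _ _ _ hv hP).2 _

theorem fits_rp {n m : ℕ} (h : n ≤ m) (P : O.Pt n) (v : A.C m) (hv) : A.Fits h (R.rp h P v hv) P.1 :=
  fun k hk => ⟨R.d_rep h _ _ _ hv k hk, R.c_rep h _ _ _ hv k hk⟩

section

variable {n k : ℕ} (hk : k < n) (P : O.Pt n) (s : A.C n)

theorem fits_cL {m : ℕ} {h : n ≤ m} {P : O.Pt n} {s : A.C n} {hu} {v : A.C m}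
    (hv : A.Fits h v (lb (O.cL hk P s hu))) : A.Fits h v (lb P) :=
  lb_cL hk P s hu ▸ hv

theorem fits_cR {m : ℕ} {h : n ≤ m} {P : O.Pt n} {s : A.C n} {hu} {v : A.C m}
    (hv : A.Fits h v (lb (O.cR hk s P hu))) : A.Fits h v (lb P) :=
  lb_cR hk s P hu ▸ hv

theorem rp_comp_L {m : ℕ} {h : n ≤ m} {P : O.Pt n} {s : A.C n}
    (hu : A.d k hk.le P.1 = A.c k hk.le s) {v : A.C m} (hv) :
    A.d k (hk.le.trans h) (R.rp h P v hv) = A.c k (hk.le.trans h) (A.one m h s) :=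
  (fits_rp h P v hv).composable hk (fits_one h s) hu

theorem rp_comp_R {m : ℕ} {h : n ≤ m} {P : O.Pt n} {s : A.C n}
    (hu : A.d k hk.le s = A.c k hk.le P.1) {v : A.C m} (hv) :
    A.d k (hk.le.trans h) (A.one m h s) = A.c k (hk.le.trans h) (R.rp h P v hv) :=
  (fits_one h s).composable hk (fits_rp h P v hv) hu

theorem rp_cL {m : ℕ} {h : n ≤ m} (v : A.C m) (hu) (hv) (hv' : A.Fits h v (lb P)) (hw) :
    R.rp h (O.cL hk P s hu) v hv = A.comp k (hk.trans_le h) (R.rp h P v hv') (A.one m h s) hw :=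
  (R.rep_left h hk P.1 s hu P.2 v hv' hv hw).1

theorem rp_cR {m : ℕ} {h : n ≤ m} (v : A.C m) (hu) (hv) (hv' : A.Fits h v (lb P)) (hw) :
    R.rp h (O.cR hk s P hu) v hv = A.comp k (hk.trans_le h) (A.one m h s) (R.rp h P v hv') hw :=
  (R.rep_right h hk s P.1 hu P.2 v hv' hv hw).1

theorem pR_cL {m : ℕ} {h : n ≤ m} (p : O.Pt m) (hu) (hv) (hv' : A.Fits h p.1 (lb P)) (hw) :
    R.pR h (O.cL hk P s hu) p hv = O.cL (hk.trans_le h) (R.pR h P p hv') (A.one m h s) hw :=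
  (R.rep_left h hk P.1 s hu P.2 p.1 hv' hv hw).2 p.2

theorem pR_cR {m : ℕ} {h : n ≤ m} (p : O.Pt m) (hu) (hv) (hv' : A.Fits h p.1 (lb P)) (hw) :
    R.pR h (O.cR hk s P hu) p hv = O.cR (hk.trans_le h) (A.one m h s) (R.pR h P p hv') hw :=
  (R.rep_right h hk s P.1 hu P.2 p.1 hv' hv hw).2 p.2

theorem pL_cL_cL (Q : O.Pt n) (v : A.C n) (hu) (hu') (hv) (hv') (e) (e') (ne) (ne') (hw) :
    R.pL (O.cL hk P s hu) (O.cL hk Q s hu') v hv e ne =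
      O.cL hk (R.pL P Q v hv' e' ne') s hw := by
  obtain ⟨u, r⟩ := P
  obtain ⟨u', q⟩ := Q
  obtain rfl : u' = u := e'
  exact (R.repL_left hk _ s hu r v hv' hv hw).1 q (fun h => ne' (by rw [h])) _

theorem pL_cR_cR (Q : O.Pt n) (v : A.C n) (hu) (hu') (hv) (hv') (e) (e') (ne) (ne') (hw) :
    R.pL (O.cR hk s P hu) (O.cR hk s Q hu') v hv e ne =
      O.cR hk s (R.pL P Q v hv' e' ne') hw := by
  obtain ⟨u, r⟩ := P
  obtain ⟨u', q⟩ := Q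
  obtain rfl : u' = u := e'
  exact (R.repL_right hk s _ hu r v hv' hv hw).1 q (fun h => ne' (by rw [h])) _

theorem pL_cL_cR (Q : O.Pt n) (v : A.C n) (hu) (hu') (hv) (hv') (e) (ne) (hw) :
    R.pL (O.cL hk P Q.1 hu) (O.cR hk P.1 Q hu') v hv e ne =
      O.cR hk (R.rp le_rfl P v hv') Q hw :=
  (R.repL_left hk _ _ hu P.2 v hv' hv hw).2 Q.2 _

theorem pL_cR_cL (Q : O.Pt n) (v : A.C n) (hu) (hu') (hv) (hv') (e) (ne) (hw) :
    R.pL (O.cR hk Q.1 P hu) (O.cL hk Q P.1 hu') v hv e ne =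
      O.cL hk Q (R.rp le_rfl P v hv') hw :=
  (R.repL_right hk _ _ hu P.2 v hv' hv hw).2 Q.2 _

end

theorem lb_pR {n m : ℕ} (h : n ≤ m) (P : O.Pt n) (p : O.Pt m) (hv) : lb (R.pR h P p hv) = lb p := by
  induction P using pt_induction with
  | hx P hP => rw [pR_indet hP]
  | hL k hk P s hu ih =>
    exact (congrArg lb (pR_cL hk P s p hu hv (fits_cL hk hv) (rp_comp_L hk hu _))).trans
      ((lb_cL _ _ _ _).trans (ih _))
  | hR k hk s P hu ih =>
    exact (congrArg lb (pR_cR hk P s p hu hv (fits_cR hk hv) (rp_comp_R hk hu _))).trans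
      ((lb_cR _ _ _ _).trans (ih _))

theorem lb_pL {n : ℕ} (P Q : O.Pt n) (v : A.C n) (hv) (e) (ne) : lb (R.pL P Q v hv e ne) = lb Q := by
  revert hv
  refine pair_induction (fun P Q => ∀ (e) (ne) (hv), lb (R.pL P Q v hv e ne) = lb Q) ?_ ?_ ?_ ?_ P Q
    e ne e ne
  · intro k hk P Q s hu hu' e' ne' ih e ne hv
    have hw : A.d k hk.le (R.rp le_rfl P v (fits_cL hk hv)) = A.c k hk.le s := by
      rw [rp_comp_L hk hu, A.one_self]
    exact (congrArg lb (pL_cL_cL hk P s Q v hu hu' hv (fits_cL hk hv) e e' ne ne' hw)).trans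
      ((lb_cL _ _ _ _).trans ((ih _ _ _).trans (lb_cL _ _ _ _).symm))
  · intro k hk s P Q hu hu' e' ne' ih e ne hv
    have hw : A.d k hk.le s = A.c k hk.le (R.rp le_rfl P v (fits_cR hk hv)) := by
      rw [← rp_comp_R hk hu, A.one_self]
    exact (congrArg lb (pL_cR_cR hk P s Q v hu hu' hv (fits_cR hk hv) e e' ne ne' hw)).trans
      ((lb_cR _ _ _ _).trans ((ih _ _ _).trans (lb_cR _ _ _ _).symm))
  · intro k hk P Q hu e ne hv
    have hw : A.d k hk.le (R.rp le_rfl P v (fits_cL hk hv)) = A.c k hk.le Q.1 := by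
      rw [rp_comp_L hk hu, A.one_self]
    rw [pL_cL_cR hk P Q v hu hu hv (fits_cL hk hv) e ne hw, lb_cR, lb_cR]
  · intro k hk P Q hu e ne hv
    have hw : A.d k hk.le Q.1 = A.c k hk.le (R.rp le_rfl P v (fits_cR hk hv)) := by
      rw [← rp_comp_R hk hu, A.one_self]
    rw [pL_cR_cL hk P Q v hu hu hv (fits_cR hk hv) e ne hw, lb_cL, lb_cL]

end Replacement

end OccSystem

end Computad

namespace Computad

namespace OccSystem.Replacement

variable {A : Computad.{u}} {O : A.OccSystem} {R : O.Replacement}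

theorem rp_one {n m : ℕ} {h : n ≤ m} (P : O.Pt n) (v : A.C m) (e : v = A.one m h (lb P)) (hv) :
    R.rp h P v hv = A.one m h P.1 := by
  revert v
  induction P using pt_induction with
  | hx P hP => intro v e hv; rw [rp_indet hP, e, lb_of_indet hP]
  | hL k hk P s hu ih =>
    intro v e hv
    refine (rp_cL hk P s v hu hv (fits_cL hk hv) (rp_comp_L hk hu _)).trans ?_
    have e₁ := ih v (by rw [e, lb_cL]) (fits_cL hk hv)
    have hc : A.d k (hk.le.trans h) (A.one m h P.1) = A.c k (hk.le.trans h) (A.one m h s) :=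
      e₁ ▸ rp_comp_L hk hu _
    exact (A.comp_congr _ e₁ rfl _ hc).trans (A.one_comp_one hk h _ _ hu _)
  | hR k hk s P hu ih =>
    intro v e hv
    refine (rp_cR hk P s v hu hv (fits_cR hk hv) (rp_comp_R hk hu _)).trans ?_
    have e₁ := ih v (by rw [e, lb_cR]) (fits_cR hk hv)
    have hc : A.d k (hk.le.trans h) (A.one m h s) = A.c k (hk.le.trans h) (A.one m h P.1) :=
      e₁ ▸ rp_comp_R hk hu _
    exact (A.comp_congr _ rfl e₁ _ hc).trans (A.one_comp_one hk h _ _ hu _)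

theorem rp_lb {n : ℕ} (P : O.Pt n) (v : A.C n) (e : v = lb P) (hv) : R.rp le_rfl P v hv = P.1 :=
  R.rep_lab _ _ _ e hv

section self

variable {n k : ℕ} (hk : k < n) {P : O.Pt n} {s : A.C n}

theorem rp_comp_L' (hu : A.d k hk.le P.1 = A.c k hk.le s) {v : A.C n} (hv) :
    A.d k hk.le (R.rp le_rfl P v hv) = A.c k hk.le s := by
  rw [rp_comp_L hk hu, A.one_self]

theorem rp_comp_R' (hu : A.d k hk.le s = A.c k hk.le P.1) {v : A.C n} (hv) :
    A.d k hk.le s = A.c k hk.le (R.rp le_rfl P v hv) := by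
  rw [← rp_comp_R hk hu, A.one_self]

theorem rp_cL' (v : A.C n) (hu) (hv) (hv') (hw) :
    R.rp le_rfl (O.cL hk P s hu) v hv = A.comp k hk (R.rp le_rfl P v hv') s hw :=
  (rp_cL hk P s v hu hv hv' (rp_comp_L hk hu _)).trans (A.comp_congr hk rfl (A.one_self s) _ _)

theorem rp_cR' (v : A.C n) (hu) (hv) (hv') (hw) :
    R.rp le_rfl (O.cR hk s P hu) v hv = A.comp k hk s (R.rp le_rfl P v hv') hw :=
  (rp_cR hk P s v hu hv hv' (rp_comp_R hk hu _)).trans (A.comp_congr hk (A.one_self s) rfl _ _)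

theorem pR_cL' (p : O.Pt n) (hu) (hv) (hv') (hw) :
    R.pR le_rfl (O.cL hk P s hu) p hv = O.cL hk (R.pR le_rfl P p hv') s hw :=
  (pR_cL hk P s p hu hv hv' (rp_comp_L hk hu _)).trans (cL_congr hk rfl (A.one_self s) _ _)

theorem pR_cR' (p : O.Pt n) (hu) (hv) (hv') (hw) :
    R.pR le_rfl (O.cR hk s P hu) p hv = O.cR hk s (R.pR le_rfl P p hv') hw :=
  (pR_cR hk P s p hu hv hv' (rp_comp_R hk hu _)).trans (cR_congr hk rfl (A.one_self s) _ _)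

end self

theorem pR_lb {n : ℕ} (P p : O.Pt n) (e : p.1 = lb P) (hv) : R.pR le_rfl P p hv = P := by
  induction P using pt_induction with
  | hx P hP =>
    rw [pR_indet hP]
    obtain ⟨x, r⟩ := P
    obtain ⟨y, p⟩ := p
    obtain rfl : y = x := e.trans (lb_of_indet hP)
    exact congrArg (Sigma.mk y) (occ_indet_subsingleton hP _ _)
  | hL k hk P s hu ih =>
    exact (pR_cL' hk p hu hv (fits_cL hk hv) (rp_comp_L' hk hu _)).trans
      (cL_congr hk (ih (by rw [e, lb_cL]) _) rfl _ _)
  | hR k hk s P hu ih =>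
    exact (pR_cR' hk p hu hv (fits_cR hk hv) (rp_comp_R' hk hu _)).trans
      (cR_congr hk (ih (by rw [e, lb_cR]) _) rfl _ _)

theorem pL_lb {n : ℕ} (P Q : O.Pt n) (v : A.C n) (ev : v = lb P) (hv) (e) (ne) :
    R.pL P Q v hv e ne = Q := by
  revert hv ev v
  refine pair_induction (fun P Q => ∀ (e) (ne) (v), v = lb P → ∀ hv, R.pL P Q v hv e ne = Q)
    ?_ ?_ ?_ ?_ P Q e ne e ne
  · intro k hk P Q s hu hu' e' ne' ih e ne v ev hv
    exact (pL_cL_cL hk P s Q v hu hu' hv (fits_cL hk hv) e e' ne ne' (rp_comp_L' hk hu _)).trans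
      (cL_congr hk (ih _ _ _ (by rw [ev, lb_cL]) _) rfl _ _)
  · intro k hk s P Q hu hu' e' ne' ih e ne v ev hv
    exact (pL_cR_cR hk P s Q v hu hu' hv (fits_cR hk hv) e e' ne ne' (rp_comp_R' hk hu _)).trans
      (cR_congr hk (ih _ _ _ (by rw [ev, lb_cR]) _) rfl _ _)
  · intro k hk P Q hu e ne v ev hv
    exact (pL_cL_cR hk P Q v hu hu hv (fits_cL hk hv) e ne (rp_comp_L' hk hu _)).trans
      (cR_congr hk rfl (rp_lb P v (by rw [ev, lb_cL]) _) _ _)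
  · intro k hk P Q hu e ne v ev hv
    exact (pL_cR_cL hk P Q v hu hu hv (fits_cR hk hv) e ne (rp_comp_R' hk hu _)).trans
      (cL_congr hk rfl (rp_lb P v (by rw [ev, lb_cR]) _) _ _)

/-! Replacement in a cell that results from a replacement. -/

section nested

variable {n m l : ℕ} {h : n ≤ m} {h₂ : m ≤ l}

theorem fits_rp_of {P : O.Pt n} {p : O.Pt m} (hv : A.Fits h p.1 (lb P)) {w : A.C l} (hw) :
    A.Fits (h.trans h₂) (R.rp h₂ p w hw) (lb P) := fun k hk =>
  ⟨((fits_rp h₂ p w hw k (hk.trans_le h)).1).trans (hv k hk).1,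
    ((fits_rp h₂ p w hw k (hk.trans_le h)).2).trans (hv k hk).2⟩

theorem rp_pR (P : O.Pt n) (p : O.Pt m) (hv) (w : A.C l) (hw) (hw₀) (hw') :
    R.rp h₂ (R.pR h P p hv) w hw = R.rp (h.trans h₂) P (R.rp h₂ p w hw₀) hw' := by
  induction P using pt_induction with
  | hx P hP => rw [rp_indet hP]; exact rp_congr (pR_indet hP _ _) rfl _ _
  | hL k hk P s hu ih =>
    have e := pR_cL (R := R) hk P s p hu hv (fits_cL hk hv) (rp_comp_L hk hu _)
    refine (rp_congr e rfl hw (e ▸ hw)).trans ((rp_cL (hk.trans_le h) _ _ w _ _ (lb_cL _ _ _ _ ▸ e ▸ hw)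
      (rp_comp_L (hk.trans_le h) (rp_comp_L hk hu _) _)).trans ?_)
    refine Eq.trans ?_ (rp_cL hk P s _ hu hw' (fits_cL hk hw') (rp_comp_L hk hu _)).symm
    exact A.comp_congr _ (ih _ _ _) (A.one_one _ _ _) _ _
  | hR k hk s P hu ih =>
    have e := pR_cR (R := R) hk P s p hu hv (fits_cR hk hv) (rp_comp_R hk hu _)
    refine (rp_congr e rfl hw (e ▸ hw)).trans ((rp_cR (hk.trans_le h) _ _ w _ _ (lb_cR _ _ _ _ ▸ e ▸ hw)
      (rp_comp_R (hk.trans_le h) (rp_comp_R hk hu _) _)).trans ?_)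
    refine Eq.trans ?_ (rp_cR hk P s _ hu hw' (fits_cR hk hw') (rp_comp_R hk hu _)).symm
    exact A.comp_congr _ (A.one_one _ _ _) (ih _ _ _) _ _

theorem pR_pR (P : O.Pt n) (p : O.Pt m) (hv) (q : O.Pt l) (hw) (hw₀) (hw') :
    R.pR h₂ (R.pR h P p hv) q hw = R.pR (h.trans h₂) P (R.pR h₂ p q hw₀) hw' := by
  induction P using pt_induction with
  | hx P hP => rw [pR_indet hP (R.pR h₂ p q hw₀)]; exact pR_congr (pR_indet hP _ _) rfl _ _
  | hL k hk P s hu ih =>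
    have e := pR_cL (R := R) hk P s p hu hv (fits_cL hk hv) (rp_comp_L hk hu _)
    refine (pR_congr e rfl hw (e ▸ hw)).trans ((pR_cL (hk.trans_le h) _ _ q _ _ (lb_cL _ _ _ _ ▸ e ▸ hw)
      (rp_comp_L (hk.trans_le h) (rp_comp_L hk hu _) _)).trans ?_)
    refine Eq.trans ?_ (pR_cL hk P s _ hu hw' (fits_cL hk hw') (rp_comp_L hk hu _)).symm
    exact cL_congr _ (ih _ _ _) (A.one_one _ _ _) _ _
  | hR k hk s P hu ih =>
    have e := pR_cR (R := R) hk P s p hu hv (fits_cR hk hv) (rp_comp_R hk hu _)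
    refine (pR_congr e rfl hw (e ▸ hw)).trans ((pR_cR (hk.trans_le h) _ _ q _ _ (lb_cR _ _ _ _ ▸ e ▸ hw)
      (rp_comp_R (hk.trans_le h) (rp_comp_R hk hu _) _)).trans ?_)
    refine Eq.trans ?_ (pR_cR hk P s _ hu hw' (fits_cR hk hw') (rp_comp_R hk hu _)).symm
    exact cR_congr _ (ih _ _ _) (A.one_one _ _ _) _ _

theorem pL_pR_pR (P : O.Pt n) (p p' : O.Pt m) (hv) (hv') (w : A.C m) (hw) (hw₀) (e : p'.1 = p.1)
    (ne : p' ≠ p) (hw' : A.Fits h (R.pL p p' w hw₀ e ne).1 (lb P)) (e') (ne') :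
    R.pL (R.pR h P p hv) (R.pR h P p' hv') w hw e' ne' = R.pR h P (R.pL p p' w hw₀ e ne) hw' := by
  induction P using pt_induction with
  | hx P hP =>
    rw [pR_indet hP (R.pL p p' w hw₀ e ne)]
    exact pL_congr (pR_indet hP _ _) (pR_indet hP _ _) rfl _ _ _ _ _ _
  | hL k hk P s hu ih =>
    have e₁ := pR_cL (R := R) hk P s p hu hv (fits_cL hk hv) (rp_comp_L hk hu _)
    have e₂ := pR_cL (R := R) hk P s p' hu hv' (fits_cL hk hv') (rp_comp_L hk hu _)
    have e₀ : (R.pR h P p' (fits_cL hk hv')).1 = (R.pR h P p (fits_cL hk hv)).1 := rp_congr rfl e _ _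
    have ne₀ : R.pR h P p' (fits_cL hk hv') ≠ R.pR h P p (fits_cL hk hv) := fun h' =>
      ne' (e₂.trans ((cL_congr _ h' rfl _ _).trans e₁.symm))
    refine (pL_congr e₁ e₂ rfl hw (e₁ ▸ hw) e' (e₁ ▸ e₂ ▸ e') ne' (e₁ ▸ e₂ ▸ ne')).trans
      ((pL_cL_cL (hk.trans_le h) _ _ _ w _ _ _ (lb_cL _ _ _ _ ▸ e₁ ▸ hw) _ e₀ _ ne₀
        (rp_comp_L' (hk.trans_le h) (rp_comp_L hk hu _) _)).trans ?_)
    exact Eq.trans (cL_congr _ (ih _ _ _ _ _ _) rfl _ _)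
      (pR_cL hk P s _ hu hw' (fits_cL hk hw') (rp_comp_L hk hu _)).symm
  | hR k hk s P hu ih =>
    have e₁ := pR_cR (R := R) hk P s p hu hv (fits_cR hk hv) (rp_comp_R hk hu _)
    have e₂ := pR_cR (R := R) hk P s p' hu hv' (fits_cR hk hv') (rp_comp_R hk hu _)
    have e₀ : (R.pR h P p' (fits_cR hk hv')).1 = (R.pR h P p (fits_cR hk hv)).1 := rp_congr rfl e _ _
    have ne₀ : R.pR h P p' (fits_cR hk hv') ≠ R.pR h P p (fits_cR hk hv) := fun h' =>
      ne' (e₂.trans ((cR_congr _ h' rfl _ _).trans e₁.symm))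
    refine (pL_congr e₁ e₂ rfl hw (e₁ ▸ hw) e' (e₁ ▸ e₂ ▸ e') ne' (e₁ ▸ e₂ ▸ ne')).trans
      ((pL_cR_cR (hk.trans_le h) _ _ _ w _ _ _ (lb_cR _ _ _ _ ▸ e₁ ▸ hw) _ e₀ _ ne₀
        (rp_comp_R' (hk.trans_le h) (rp_comp_R hk hu _) _)).trans ?_)
    exact Eq.trans (cR_congr _ (ih _ _ _ _ _ _) rfl _ _)
      (pR_cR hk P s _ hu hw' (fits_cR hk hw') (rp_comp_R hk hu _)).symm

theorem pL_pR_pL (P Q p : O.Pt n) (hv) (w : A.C n) (hw) (hw₀) (hw') (e) (ne) (e') (ne') :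
    R.pL (R.pR le_rfl P p hv) (R.pL P Q p.1 hv e ne) w hw e' ne' =
      R.pL P Q (R.rp le_rfl p w hw₀) hw' e ne := by
  revert hv hw hw'
  refine pair_induction (fun P Q => ∀ (e) (ne) (hv) (hw) (hw') (e') (ne'),
    R.pL (R.pR le_rfl P p hv) (R.pL P Q p.1 hv e ne) w hw e' ne' =
      R.pL P Q (R.rp le_rfl p w hw₀) hw' e ne) ?_ ?_ ?_ ?_ P Q e ne e ne
  · intro k hk P Q s hu hu' e₀ ne₀ ih e ne hv hw hw' e' ne'
    have e₁ := pR_cL' (R := R) hk p hu hv (fits_cL hk hv) (rp_comp_L' hk hu _)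
    have e₂ := pL_cL_cL (R := R) hk P s Q p.1 hu hu' hv (fits_cL hk hv) e e₀ ne ne₀ (rp_comp_L' hk hu _)
    have ne₃ : R.pL P Q p.1 (fits_cL hk hv) e₀ ne₀ ≠ R.pR le_rfl P p (fits_cL hk hv) := fun h' =>
      ne' (e₂.trans ((cL_congr hk h' rfl _ _).trans e₁.symm))
    refine (pL_congr e₁ e₂ rfl hw (e₁ ▸ hw) e' (e₁ ▸ e₂ ▸ e') ne' (e₁ ▸ e₂ ▸ ne')).trans
      ((pL_cL_cL hk (R.pR le_rfl P p (fits_cL hk hv)) _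
        (R.pL P Q p.1 (fits_cL hk hv) e₀ ne₀) w _ _ _ (lb_cL _ _ _ _ ▸ e₁ ▸ hw) _ rfl _ ne₃
        (rp_comp_L' hk (rp_comp_L' hk hu _) _)).trans ?_)
    exact (cL_congr hk (ih _ _ _ _ (fits_cL hk hw') _ _) rfl _ _).trans
      (pL_cL_cL hk P s Q _ hu hu' hw' (fits_cL hk hw') e e₀ ne ne₀ (rp_comp_L' hk hu _)).symm
  · intro k hk s P Q hu hu' e₀ ne₀ ih e ne hv hw hw' e' ne'
    have e₁ := pR_cR' (R := R) hk p hu hv (fits_cR hk hv) (rp_comp_R' hk hu _)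
    have e₂ := pL_cR_cR (R := R) hk P s Q p.1 hu hu' hv (fits_cR hk hv) e e₀ ne ne₀ (rp_comp_R' hk hu _)
    have ne₃ : R.pL P Q p.1 (fits_cR hk hv) e₀ ne₀ ≠ R.pR le_rfl P p (fits_cR hk hv) := fun h' =>
      ne' (e₂.trans ((cR_congr hk h' rfl _ _).trans e₁.symm))
    refine (pL_congr e₁ e₂ rfl hw (e₁ ▸ hw) e' (e₁ ▸ e₂ ▸ e') ne' (e₁ ▸ e₂ ▸ ne')).trans
      ((pL_cR_cR hk (R.pR le_rfl P p (fits_cR hk hv)) _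
        (R.pL P Q p.1 (fits_cR hk hv) e₀ ne₀) w _ _ _ (lb_cR _ _ _ _ ▸ e₁ ▸ hw) _ rfl _ ne₃
        (rp_comp_R' hk (rp_comp_R' hk hu _) _)).trans ?_)
    exact (cR_congr hk (ih _ _ _ _ (fits_cR hk hw') _ _) rfl _ _).trans
      (pL_cR_cR hk P s Q _ hu hu' hw' (fits_cR hk hw') e e₀ ne ne₀ (rp_comp_R' hk hu _)).symm
  · intro k hk P Q hu e ne hv hw hw' e' ne'
    have e₁ := pR_cL' (R := R) hk p hu hv (fits_cL hk hv) (rp_comp_L' hk hu _)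
    have e₂ := pL_cL_cR (R := R) hk P Q p.1 hu hu hv (fits_cL hk hv) e ne (rp_comp_L' hk hu _)
    have ht : A.Fits le_rfl w (lb (R.pR le_rfl P p (fits_cL hk hv))) := lb_cL _ _ _ _ ▸ e₁ ▸ hw
    refine (pL_congr e₁ e₂ rfl hw (e₁ ▸ hw) e' (e₁ ▸ e₂ ▸ e') ne' (e₁ ▸ e₂ ▸ ne')).trans
      ((pL_cL_cR hk (R.pR le_rfl P p (fits_cL hk hv)) Q w _ _ _ ht _ _
        (rp_comp_L' hk (rp_comp_L' hk hu _) _)).trans ?_)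
    exact (cR_congr hk rfl (rp_pR P p _ w _ hw₀ (fits_cL hk hw')) _ _).trans
      (pL_cL_cR hk P Q _ hu hu hw' (fits_cL hk hw') e ne (rp_comp_L' hk hu _)).symm
  · intro k hk P Q hu e ne hv hw hw' e' ne'
    have e₁ := pR_cR' (R := R) hk p hu hv (fits_cR hk hv) (rp_comp_R' hk hu _)
    have e₂ := pL_cR_cL (R := R) hk P Q p.1 hu hu hv (fits_cR hk hv) e ne (rp_comp_R' hk hu _)
    have ht : A.Fits le_rfl w (lb (R.pR le_rfl P p (fits_cR hk hv))) := lb_cR _ _ _ _ ▸ e₁ ▸ hw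
    refine (pL_congr e₁ e₂ rfl hw (e₁ ▸ hw) e' (e₁ ▸ e₂ ▸ e') ne' (e₁ ▸ e₂ ▸ ne')).trans
      ((pL_cR_cL hk (R.pR le_rfl P p (fits_cR hk hv)) Q w _ _ _ ht _ _
        (rp_comp_R' hk (rp_comp_R' hk hu _) _)).trans ?_)
    exact (cL_congr hk rfl (rp_pR P p _ w _ hw₀ (fits_cR hk hw')) _ _).trans
      (pL_cR_cL hk P Q _ hu hu hw' (fits_cR hk hw') e ne (rp_comp_R' hk hu _)).symm

end nested

end OccSystem.Replacement

end Computad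

namespace OmegaCat

section Whiskering

variable (A : OmegaCat.{u}) {n k : ℕ} (hk : k < n) (hk' : k < n + 1)
include hk

theorem comp_whisker_right (a b : A.C (n + 1)) (s : A.C n) (h₁) (h₂) (h₃) (h₄) (h₅) :
    A.comp n n.lt_succ_self (A.comp k hk' a (A.one (n + 1) n.le_succ s) h₁)
        (A.comp k hk' b (A.one (n + 1) n.le_succ s) h₂) h₃ =
      A.comp k hk' (A.comp n n.lt_succ_self a b h₄) (A.one (n + 1) n.le_succ s) h₅ :=
  have e : A.d n n.le_succ (A.one (n + 1) n.le_succ s) = A.c n n.le_succ (A.one (n + 1) n.le_succ s) :=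
    by rw [A.d_one, A.c_one]
  have e' := A.one_comp n.lt_succ_self s _ e
  (A.exchange hk' n.lt_succ_self hk a b _ _ h₄ e (h₅.trans (congrArg _ e'.symm)) h₁ h₂ h₃).symm.trans
    (A.comp_congr hk' rfl e' _ _)

theorem comp_whisker_left (s : A.C n) (a b : A.C (n + 1)) (h₁) (h₂) (h₃) (h₄) (h₅) :
    A.comp n n.lt_succ_self (A.comp k hk' (A.one (n + 1) n.le_succ s) a h₁)
        (A.comp k hk' (A.one (n + 1) n.le_succ s) b h₂) h₃ =
      A.comp k hk' (A.one (n + 1) n.le_succ s) (A.comp n n.lt_succ_self a b h₄) h₅ :=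
  have e : A.d n n.le_succ (A.one (n + 1) n.le_succ s) = A.c n n.le_succ (A.one (n + 1) n.le_succ s) :=
    by rw [A.d_one, A.c_one]
  have e' := A.one_comp n.lt_succ_self s _ e
  (A.exchange hk' n.lt_succ_self hk _ _ a b e h₄ ((congrArg _ e').trans h₅) h₁ h₂ h₃).symm.trans
    (A.comp_congr hk' e' rfl _ _)

theorem whisker_comp_whisker (a b : A.C (n + 1)) {s t : A.C n} (hs : A.c n n.le_succ b = s)
    (ht : A.d n n.le_succ a = t) (h₁) (h₂) (h₃) (h₄) :
    A.comp n n.lt_succ_self (A.comp k hk' a (A.one (n + 1) n.le_succ s) h₁)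
        (A.comp k hk' (A.one (n + 1) n.le_succ t) b h₂) h₃ = A.comp k hk' a b h₄ := by
  have e₁ : A.d n n.le_succ a = A.c n n.le_succ (A.one (n + 1) n.le_succ t) := by rw [A.c_one, ht]
  have e₂ : A.d n n.le_succ (A.one (n + 1) n.le_succ s) = A.c n n.le_succ b := by rw [A.d_one, hs]
  have e₃ := A.comp_one n.lt_succ_self t a e₁
  have e₄ := A.one_comp n.lt_succ_self s b e₂
  exact (A.exchange hk' n.lt_succ_self hk a _ _ b e₁ e₂
    ((congrArg _ e₃).trans (h₄.trans (congrArg _ e₄.symm))) h₁ h₂ h₃).symm.trans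
      (A.comp_congr hk' e₃ e₄ _ _)

theorem whisker_comp_whisker' (a b : A.C (n + 1)) {s t : A.C n} (hs : A.d n n.le_succ b = s)
    (ht : A.c n n.le_succ a = t) (h₁) (h₂) (h₃) (h₄) :
    A.comp n n.lt_succ_self (A.comp k hk' (A.one (n + 1) n.le_succ t) b h₁)
        (A.comp k hk' a (A.one (n + 1) n.le_succ s) h₂) h₃ = A.comp k hk' a b h₄ := by
  have e₁ : A.d n n.le_succ (A.one (n + 1) n.le_succ t) = A.c n n.le_succ a := by rw [A.d_one, ht]
  have e₂ : A.d n n.le_succ b = A.c n n.le_succ (A.one (n + 1) n.le_succ s) := by rw [A.c_one, hs]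
  have e₃ := A.one_comp n.lt_succ_self t a e₁
  have e₄ := A.comp_one n.lt_succ_self s b e₂
  exact (A.exchange hk' n.lt_succ_self hk _ a b _ e₁ e₂
    ((congrArg _ e₃).trans (h₄.trans (congrArg _ e₄.symm))) h₁ h₂ h₃).symm.trans
      (A.comp_congr hk' e₃ e₄ _ _)

end Whiskering

end OmegaCat

namespace Computad

namespace OccSystem

variable {A : Computad.{u}} {O : A.OccSystem}

section Whiskering

variable {n k : ℕ} (hk : k < n) (hk' : k < n + 1)
include hk

theorem cL_whisker_right (p : O.Pt (n + 1)) (b : A.C (n + 1)) (s : A.C n) (h₁) (h₂) (h₃) (h₄) (h₅) :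
    O.cL n.lt_succ_self (O.cL hk' p (A.one (n + 1) n.le_succ s) h₁)
        (A.comp k hk' b (A.one (n + 1) n.le_succ s) h₂) h₃ =
      O.cL hk' (O.cL n.lt_succ_self p b h₄) (A.one (n + 1) n.le_succ s) h₅ :=
  have e : A.d n n.le_succ (A.one (n + 1) n.le_succ s) = A.c n n.le_succ (A.one (n + 1) n.le_succ s) :=
    by rw [A.d_one, A.c_one]
  have e' := A.one_comp n.lt_succ_self s _ e
  (exch_LL n.lt_succ_self hk' hk p b _ _ h₄ e (h₅.trans (congrArg _ e'.symm)) h₁ h₂ h₃).symm.trans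
    (cL_congr hk' rfl e' _ _)

theorem cR_whisker_right (a : A.C (n + 1)) (p : O.Pt (n + 1)) (s : A.C n) (h₁) (h₂) (h₃) (h₄) (h₅) :
    O.cR n.lt_succ_self (A.comp k hk' a (A.one (n + 1) n.le_succ s) h₁)
        (O.cL hk' p (A.one (n + 1) n.le_succ s) h₂) h₃ =
      O.cL hk' (O.cR n.lt_succ_self a p h₄) (A.one (n + 1) n.le_succ s) h₅ :=
  have e : A.d n n.le_succ (A.one (n + 1) n.le_succ s) = A.c n n.le_succ (A.one (n + 1) n.le_succ s) :=
    by rw [A.d_one, A.c_one]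
  have e' := A.one_comp n.lt_succ_self s _ e
  (exch_LR n.lt_succ_self hk' hk a p _ _ h₄ e (h₅.trans (congrArg _ e'.symm)) h₁ h₂ h₃).symm.trans
    (cL_congr hk' rfl e' _ _)

theorem cL_whisker_left (s : A.C n) (p : O.Pt (n + 1)) (b : A.C (n + 1)) (h₁) (h₂) (h₃) (h₄) (h₅) :
    O.cL n.lt_succ_self (O.cR hk' (A.one (n + 1) n.le_succ s) p h₁)
        (A.comp k hk' (A.one (n + 1) n.le_succ s) b h₂) h₃ =
      O.cR hk' (A.one (n + 1) n.le_succ s) (O.cL n.lt_succ_self p b h₄) h₅ :=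
  have e : A.d n n.le_succ (A.one (n + 1) n.le_succ s) = A.c n n.le_succ (A.one (n + 1) n.le_succ s) :=
    by rw [A.d_one, A.c_one]
  have e' := A.one_comp n.lt_succ_self s _ e
  (exch_RL n.lt_succ_self hk' hk _ _ p b e h₄ ((congrArg _ e').trans h₅) h₁ h₂ h₃).symm.trans
    (cR_congr hk' rfl e' _ _)

theorem cR_whisker_left (s : A.C n) (a : A.C (n + 1)) (p : O.Pt (n + 1)) (h₁) (h₂) (h₃) (h₄) (h₅) :
    O.cR n.lt_succ_self (A.comp k hk' (A.one (n + 1) n.le_succ s) a h₁)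
        (O.cR hk' (A.one (n + 1) n.le_succ s) p h₂) h₃ =
      O.cR hk' (A.one (n + 1) n.le_succ s) (O.cR n.lt_succ_self a p h₄) h₅ :=
  have e : A.d n n.le_succ (A.one (n + 1) n.le_succ s) = A.c n n.le_succ (A.one (n + 1) n.le_succ s) :=
    by rw [A.d_one, A.c_one]
  have e' := A.one_comp n.lt_succ_self s _ e
  (exch_RR n.lt_succ_self hk' hk _ _ a p e h₄ ((congrArg _ e').trans h₅) h₁ h₂ h₃).symm.trans
    (cR_congr hk' rfl e' _ _)

theorem cL_whisker_whisker (p : O.Pt (n + 1)) (b : A.C (n + 1)) {s t : A.C n}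
    (hs : A.c n n.le_succ b = s) (ht : A.d n n.le_succ p.1 = t) (h₁) (h₂) (h₃) (h₄) :
    O.cL n.lt_succ_self (O.cL hk' p (A.one (n + 1) n.le_succ s) h₁)
        (A.comp k hk' (A.one (n + 1) n.le_succ t) b h₂) h₃ = O.cL hk' p b h₄ := by
  have e₁ : A.d n n.le_succ p.1 = A.c n n.le_succ (A.one (n + 1) n.le_succ t) := by rw [A.c_one, ht]
  have e₂ : A.d n n.le_succ (A.one (n + 1) n.le_succ s) = A.c n n.le_succ b := by rw [A.d_one, hs]
  have e₃ : O.cL n.lt_succ_self p _ e₁ = p := cL_one n.lt_succ_self rfl p e₁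
  have e₄ := A.one_comp n.lt_succ_self s b e₂
  exact (exch_LL n.lt_succ_self hk' hk p _ _ b e₁ e₂
    ((congrArg (fun q : O.Pt (n + 1) => A.d k hk'.le q.1) e₃).trans (h₄.trans (congrArg _ e₄.symm)))
      h₁ h₂ h₃).symm.trans (cL_congr hk' e₃ e₄ _ _)

theorem cL_whisker_whisker' (p : O.Pt (n + 1)) (a : A.C (n + 1)) {s t : A.C n}
    (hs : A.d n n.le_succ p.1 = s) (ht : A.c n n.le_succ a = t) (h₁) (h₂) (h₃) (h₄) :
    O.cL n.lt_succ_self (O.cR hk' (A.one (n + 1) n.le_succ t) p h₁)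
        (A.comp k hk' a (A.one (n + 1) n.le_succ s) h₂) h₃ = O.cR hk' a p h₄ := by
  have e₁ : A.d n n.le_succ (A.one (n + 1) n.le_succ t) = A.c n n.le_succ a := by rw [A.d_one, ht]
  have e₂ : A.d n n.le_succ p.1 = A.c n n.le_succ (A.one (n + 1) n.le_succ s) := by rw [A.c_one, hs]
  have e₃ := A.one_comp n.lt_succ_self t a e₁
  have e₄ : O.cL n.lt_succ_self p _ e₂ = p := cL_one n.lt_succ_self rfl p e₂
  exact (exch_RL n.lt_succ_self hk' hk _ a p _ e₁ e₂
    ((congrArg _ e₃).trans (h₄.trans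
      (congrArg (fun q : O.Pt (n + 1) => A.c k hk'.le q.1) e₄.symm))) h₁ h₂ h₃).symm.trans
      (cR_congr hk' e₄ e₃ _ _)

theorem cR_whisker_whisker (a : A.C (n + 1)) (p : O.Pt (n + 1)) {s t : A.C n}
    (hs : A.c n n.le_succ p.1 = s) (ht : A.d n n.le_succ a = t) (h₁) (h₂) (h₃) (h₄) :
    O.cR n.lt_succ_self (A.comp k hk' a (A.one (n + 1) n.le_succ s) h₁)
        (O.cR hk' (A.one (n + 1) n.le_succ t) p h₂) h₃ = O.cR hk' a p h₄ := by
  have e₁ : A.d n n.le_succ a = A.c n n.le_succ (A.one (n + 1) n.le_succ t) := by rw [A.c_one, ht]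
  have e₂ : A.d n n.le_succ (A.one (n + 1) n.le_succ s) = A.c n n.le_succ p.1 := by rw [A.d_one, hs]
  have e₃ := A.comp_one n.lt_succ_self t a e₁
  have e₄ : O.cR n.lt_succ_self _ p e₂ = p := cR_one n.lt_succ_self rfl p e₂
  exact (exch_RR n.lt_succ_self hk' hk a _ _ p e₁ e₂
    ((congrArg _ e₃).trans (h₄.trans
      (congrArg (fun q : O.Pt (n + 1) => A.c k hk'.le q.1) e₄.symm))) h₁ h₂ h₃).symm.trans
      (cR_congr hk' e₄ e₃ _ _)

theorem cR_whisker_whisker' (p : O.Pt (n + 1)) (b : A.C (n + 1)) {s t : A.C n}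
    (hs : A.d n n.le_succ b = s) (ht : A.c n n.le_succ p.1 = t) (h₁) (h₂) (h₃) (h₄) :
    O.cR n.lt_succ_self (A.comp k hk' (A.one (n + 1) n.le_succ t) b h₁)
        (O.cL hk' p (A.one (n + 1) n.le_succ s) h₂) h₃ = O.cL hk' p b h₄ := by
  have e₁ : A.d n n.le_succ (A.one (n + 1) n.le_succ t) = A.c n n.le_succ p.1 := by rw [A.d_one, ht]
  have e₂ : A.d n n.le_succ b = A.c n n.le_succ (A.one (n + 1) n.le_succ s) := by rw [A.c_one, hs]
  have e₃ : O.cR n.lt_succ_self _ p e₁ = p := cR_one n.lt_succ_self rfl p e₁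
  have e₄ := A.comp_one n.lt_succ_self s b e₂
  exact (exch_LR n.lt_succ_self hk' hk _ p b _ e₁ e₂
    ((congrArg (fun q : O.Pt (n + 1) => A.d k hk'.le q.1) e₃).trans (h₄.trans (congrArg _ e₄.symm)))
      h₁ h₂ h₃).symm.trans (cL_congr hk' e₃ e₄ _ _)

end Whiskering

namespace Replacement

variable {R : O.Replacement}

theorem fits_to_pL {n m : ℕ} {h : n ≤ m} {P Q : O.Pt n} {v : A.C n} {hv e ne} {w : A.C m}
    (hw : A.Fits h w (lb Q)) : A.Fits h w (lb (R.pL P Q v hv e ne)) := (lb_pL P Q v hv e ne).symm ▸ hw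

theorem fits_to_cL {n m k : ℕ} {hk : k < n} {h : n ≤ m} {P : O.Pt n} {s : A.C n} {hu} {v : A.C m}
    (hv : A.Fits h v (lb P)) : A.Fits h v (lb (O.cL hk P s hu)) :=
  (lb_cL hk P s hu).symm ▸ hv

theorem fits_to_cR {n m k : ℕ} {hk : k < n} {h : n ≤ m} {P : O.Pt n} {s : A.C n} {hu} {v : A.C m}
    (hv : A.Fits h v (lb P)) : A.Fits h v (lb (O.cR hk s P hu)) :=
  (lb_cR hk s P hu).symm ▸ hv

theorem rp_composable {n : ℕ} {P : O.Pt n} {v v' : A.C (n + 1)} {hv hv'}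
    (h : A.d n n.le_succ v = A.c n n.le_succ v') :
    A.d n n.le_succ (R.rp n.le_succ P v hv) = A.c n n.le_succ (R.rp n.le_succ P v' hv') :=
  (R.d_rep_succ _ _ _ hv).trans ((rp_congr rfl h _ _).trans (R.c_rep_succ _ _ _ hv').symm)

theorem rp_comp_top {n : ℕ} (P : O.Pt n) (v v' : A.C (n + 1)) (h) (hv) (hv') (hvv) (hc) :
    R.rp n.le_succ P (A.comp n n.lt_succ_self v v' h) hvv =
      A.comp n n.lt_succ_self (R.rp n.le_succ P v hv) (R.rp n.le_succ P v' hv') hc := by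
  induction P using pt_induction with
  | hx P hP =>
    exact (rp_indet hP _ _).trans (A.comp_congr _ (rp_indet hP _ _).symm (rp_indet hP _ _).symm _ _)
  | hL k hk P s hu ih =>
    refine (rp_cL hk P s _ hu hvv (fits_cL hk hvv) (rp_comp_L hk hu _)).trans ?_
    refine (A.comp_congr _ (ih (fits_cL hk hv) (fits_cL hk hv') _ (rp_composable h)) rfl _ ?_).trans
      ((A.comp_whisker_right hk _ _ _ s (rp_comp_L hk hu _) (rp_comp_L hk hu _) ?_ _ _).symm.trans
      (A.comp_congr _ (rp_cL hk P s _ hu hv (fits_cL hk hv) (rp_comp_L hk hu _)).symm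
        (rp_cL hk P s _ hu hv' (fits_cL hk hv') (rp_comp_L hk hu _)).symm _ _))
    · rw [← ih (fits_cL hk hv) (fits_cL hk hv') (fits_cL hk hvv) (rp_composable h)]
      exact rp_comp_L hk hu _
    · rw [← rp_cL hk P s _ hu hv (fits_cL hk hv) (rp_comp_L hk hu _),
        ← rp_cL hk P s _ hu hv' (fits_cL hk hv') (rp_comp_L hk hu _)]
      exact hc
  | hR k hk s P hu ih =>
    refine (rp_cR hk P s _ hu hvv (fits_cR hk hvv) (rp_comp_R hk hu _)).trans ?_
    refine (A.comp_congr _ rfl (ih (fits_cR hk hv) (fits_cR hk hv') _ (rp_composable h)) _ ?_).trans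
      ((A.comp_whisker_left hk _ s _ _ (rp_comp_R hk hu _) (rp_comp_R hk hu _) ?_ _ _).symm.trans
      (A.comp_congr _ (rp_cR hk P s _ hu hv (fits_cR hk hv) (rp_comp_R hk hu _)).symm
        (rp_cR hk P s _ hu hv' (fits_cR hk hv') (rp_comp_R hk hu _)).symm _ _))
    · rw [← ih (fits_cR hk hv) (fits_cR hk hv') (fits_cR hk hvv) (rp_composable h)]
      exact rp_comp_R hk hu _
    · rw [← rp_cR hk P s _ hu hv (fits_cR hk hv) (rp_comp_R hk hu _),
        ← rp_cR hk P s _ hu hv' (fits_cR hk hv') (rp_comp_R hk hu _)]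
      exact hc

theorem pR_cL_top {n : ℕ} (P : O.Pt n) (p : O.Pt (n + 1)) (v' : A.C (n + 1)) (h) (hv) (hv') (hvv) (hc) :
    R.pR n.le_succ P (O.cL n.lt_succ_self p v' h) hvv =
      O.cL n.lt_succ_self (R.pR n.le_succ P p hv) (R.rp n.le_succ P v' hv') hc := by
  induction P using pt_induction with
  | hx P hP =>
    exact (pR_indet hP _ _).trans (cL_congr _ (pR_indet hP _ _).symm (rp_indet hP _ _).symm _ _)
  | hL k hk P s hu ih =>
    have hc' : A.d n n.le_succ (R.rp n.le_succ P p.1 (fits_cL hk hv)) = _ :=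
      rp_composable (hv' := fits_cL hk hv') h
    have e₁ := rp_cL (R := R) hk P s p.1 hu hv (fits_cL hk hv) (rp_comp_L hk hu _)
    have e₂ := rp_cL (R := R) hk P s _ hu hv' (fits_cL hk hv') (rp_comp_L hk hu _)
    refine (pR_cL hk P s _ hu hvv (fits_cL hk hvv) (rp_comp_L hk hu _)).trans ?_
    refine (cL_congr _ (ih (fits_cL hk hv) (fits_cL hk hv') _ hc') rfl _ ?_).trans
      ((cL_whisker_right hk _ _ _ s (rp_comp_L hk hu _) (rp_comp_L hk hu _)
        ?_ _ _).symm.trans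
      (cL_congr _ (pR_cL hk P s _ hu hv (fits_cL hk hv) (rp_comp_L hk hu _)).symm e₂.symm _ _))
    have e₃ := rp_comp_top (R := R) P p.1 v' h (fits_cL hk hv) (fits_cL hk hv') (fits_cL hk hvv) hc'
    · exact (congrArg _ e₃.symm).trans (rp_comp_L hk hu _)
    · exact (congrArg _ e₁.symm).trans (hc.trans (congrArg _ e₂))
  | hR k hk s P hu ih =>
    have hc' : A.d n n.le_succ (R.rp n.le_succ P p.1 (fits_cR hk hv)) = _ :=
      rp_composable (hv' := fits_cR hk hv') h
    have e₁ := rp_cR (R := R) hk P s p.1 hu hv (fits_cR hk hv) (rp_comp_R hk hu _)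
    have e₂ := rp_cR (R := R) hk P s _ hu hv' (fits_cR hk hv') (rp_comp_R hk hu _)
    refine (pR_cR hk P s _ hu hvv (fits_cR hk hvv) (rp_comp_R hk hu _)).trans ?_
    refine (cR_congr _ (ih (fits_cR hk hv) (fits_cR hk hv') _ hc') rfl _ ?_).trans
      ((cL_whisker_left hk _ s _ _ (rp_comp_R hk hu _) (rp_comp_R hk hu _)
        ?_ _ _).symm.trans
      (cL_congr _ (pR_cR hk P s _ hu hv (fits_cR hk hv) (rp_comp_R hk hu _)).symm e₂.symm _ _))
    have e₃ := rp_comp_top (R := R) P p.1 v' h (fits_cR hk hv) (fits_cR hk hv') (fits_cR hk hvv) hc'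
    · exact (rp_comp_R hk hu _).trans (congrArg _ e₃)
    · exact (congrArg _ e₁.symm).trans (hc.trans (congrArg _ e₂))

theorem pR_cR_top {n : ℕ} (P : O.Pt n) (v : A.C (n + 1)) (p : O.Pt (n + 1)) (h) (hv) (hv') (hvv) (hc) :
    R.pR n.le_succ P (O.cR n.lt_succ_self v p h) hvv =
      O.cR n.lt_succ_self (R.rp n.le_succ P v hv) (R.pR n.le_succ P p hv') hc := by
  induction P using pt_induction with
  | hx P hP =>
    exact (pR_indet hP _ _).trans (cR_congr _ (pR_indet hP _ _).symm (rp_indet hP _ _).symm _ _)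
  | hL k hk P s hu ih =>
    have hc' : A.d n n.le_succ (R.rp n.le_succ P v (fits_cL hk hv)) = _ :=
      rp_composable (hv' := fits_cL hk hv') h
    have e₁ := rp_cL (R := R) hk P s v hu hv (fits_cL hk hv) (rp_comp_L hk hu _)
    have e₂ := rp_cL (R := R) hk P s _ hu hv' (fits_cL hk hv') (rp_comp_L hk hu _)
    refine (pR_cL hk P s _ hu hvv (fits_cL hk hvv) (rp_comp_L hk hu _)).trans ?_
    refine (cL_congr _ (ih (fits_cL hk hv) (fits_cL hk hv') _ hc') rfl _ ?_).trans
      ((cR_whisker_right hk _ _ _ s (rp_comp_L hk hu _) (rp_comp_L hk hu _)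
        ?_ _ _).symm.trans
      (cR_congr _ (pR_cL hk P s _ hu hv' (fits_cL hk hv') (rp_comp_L hk hu _)).symm e₁.symm _ _))
    have e₃ := rp_comp_top (R := R) P v p.1 h (fits_cL hk hv) (fits_cL hk hv') (fits_cL hk hvv) hc'
    · exact (congrArg _ e₃.symm).trans (rp_comp_L hk hu _)
    · exact (congrArg _ e₁.symm).trans (hc.trans (congrArg _ e₂))
  | hR k hk s P hu ih =>
    have hc' : A.d n n.le_succ (R.rp n.le_succ P v (fits_cR hk hv)) = _ :=
      rp_composable (hv' := fits_cR hk hv') h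
    have e₁ := rp_cR (R := R) hk P s v hu hv (fits_cR hk hv) (rp_comp_R hk hu _)
    have e₂ := rp_cR (R := R) hk P s _ hu hv' (fits_cR hk hv') (rp_comp_R hk hu _)
    refine (pR_cR hk P s _ hu hvv (fits_cR hk hvv) (rp_comp_R hk hu _)).trans ?_
    refine (cR_congr _ (ih (fits_cR hk hv) (fits_cR hk hv') _ hc') rfl _ ?_).trans
      ((cR_whisker_left hk _ s _ _ (rp_comp_R hk hu _) (rp_comp_R hk hu _)
        ?_ _ _).symm.trans
      (cR_congr _ (pR_cR hk P s _ hu hv' (fits_cR hk hv') (rp_comp_R hk hu _)).symm e₁.symm _ _))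
    have e₃ := rp_comp_top (R := R) P v p.1 h (fits_cR hk hv) (fits_cR hk hv') (fits_cR hk hvv) hc'
    · exact (rp_comp_R hk hu _).trans (congrArg _ e₃)
    · exact (congrArg _ e₁.symm).trans (hc.trans (congrArg _ e₂))

end Replacement

end OccSystem

end Computad

namespace Computad

namespace OccSystem

namespace Replacement

variable {A : Computad.{u}} {O : A.OccSystem} {R : O.Replacement} {n : ℕ}

theorem d_rp_eq_c_rp {P X : O.Pt n} {v w : A.C (n + 1)} {hv hv' hw}
    (hX : X.1 = R.rp le_rfl P (A.d n n.le_succ v) hv') (hw' : A.c n n.le_succ w = lb X) :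
    A.d n n.le_succ (R.rp n.le_succ P v hv) = A.c n n.le_succ (R.rp n.le_succ X w hw) :=
  (R.d_rep_succ _ _ _ hv).trans (hX.symm.trans
    ((rp_lb (R := R) X _ hw' (hw' ▸ fits_self _)).symm.trans (R.c_rep_succ _ _ _ hw).symm))

theorem c_eq_lb_pL {P Q : O.Pt n} {v : A.C n} {hv e ne} {w : A.C (n + 1)}
    (hw : A.c n n.le_succ w = lb Q) : A.c n n.le_succ w = lb (R.pL P Q v hv e ne) :=
  hw.trans (lb_pL P Q v hv e ne).symm

variable (R) in
/-- The simultaneous replacement of two points by cells of the next dimension. -/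
def rpTwo (P Q : O.Pt n) (e : Q.1 = P.1) (ne : Q ≠ P) (v w : A.C (n + 1))
    (hv : A.c n n.le_succ v = lb P) (hw : A.c n n.le_succ w = lb Q) : A.C (n + 1) :=
  A.comp n n.lt_succ_self (R.rp n.le_succ P v (fits_of_c_eq hv))
    (R.rp n.le_succ (R.pL P Q (A.d n n.le_succ v) (fits_of_c_eq hv).d e ne) w
      (fits_of_c_eq (c_eq_lb_pL hw))) (d_rp_eq_c_rp rfl (c_eq_lb_pL hw))

variable (R) in
/-- The image of a point of the first cell. -/
def pTwoL (P Q : O.Pt n) (e : Q.1 = P.1) (ne : Q ≠ P) (p : O.Pt (n + 1)) (w : A.C (n + 1))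
    (hv : A.c n n.le_succ p.1 = lb P) (hw : A.c n n.le_succ w = lb Q) : O.Pt (n + 1) :=
  O.cL n.lt_succ_self (R.pR n.le_succ P p (fits_of_c_eq hv))
    (R.rp n.le_succ (R.pL P Q (A.d n n.le_succ p.1) (fits_of_c_eq hv).d e ne) w
      (fits_of_c_eq (c_eq_lb_pL hw))) (d_rp_eq_c_rp rfl (c_eq_lb_pL hw))

variable (R) in
/-- The image of a point of the second cell. -/
def pTwoR (P Q : O.Pt n) (e : Q.1 = P.1) (ne : Q ≠ P) (v : A.C (n + 1)) (p : O.Pt (n + 1))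
    (hv : A.c n n.le_succ v = lb P) (hw : A.c n n.le_succ p.1 = lb Q) : O.Pt (n + 1) :=
  O.cR n.lt_succ_self (R.rp n.le_succ P v (fits_of_c_eq hv))
    (R.pR n.le_succ (R.pL P Q (A.d n n.le_succ v) (fits_of_c_eq hv).d e ne) p
      (fits_of_c_eq (c_eq_lb_pL hw))) (d_rp_eq_c_rp rfl (c_eq_lb_pL hw))

theorem fits_rpTwo (P Q : O.Pt n) (e) (ne) (v w : A.C (n + 1)) (hv) (hw) :
    A.Fits n.le_succ (R.rpTwo P Q e ne v w hv hw) P.1 := fun k hk => by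
  constructor
  · refine (A.d_d hk.le n.le_succ _).symm.trans ((congrArg _ (A.d_comp n.lt_succ_self _ _ _)).trans ?_)
    refine (A.d_d hk.le n.le_succ _).trans ((fits_rp _ _ _ _ k hk).1.trans ?_)
    exact (fits_rp (R := R) le_rfl P _ _ k hk).1
  · refine (A.c_c hk.le n.le_succ _).symm.trans ((congrArg _ (A.c_comp n.lt_succ_self _ _ _)).trans ?_)
    exact (A.c_c hk.le n.le_succ _).trans (fits_rp _ _ _ _ k hk).2

section

variable {k : ℕ} (hk : k < n)

theorem rpTwo_cL (P Q : O.Pt n) (s : A.C n) (hu hu') (e₀ : Q.1 = P.1) (ne₀ : Q ≠ P) (e) (ne)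
    (v w : A.C (n + 1)) (hv₀ hw₀) (hv) (hw) (h) :
    R.rpTwo (O.cL hk P s hu) (O.cL hk Q s hu') e ne v w hv hw =
      A.comp k (hk.trans n.lt_succ_self) (R.rpTwo P Q e₀ ne₀ v w hv₀ hw₀) (A.one (n + 1) n.le_succ s) h := by
  have hd := fits_of_c_eq hv
  have e₁ := pL_cL_cL (R := R) hk P s Q (A.d n n.le_succ v) hu hu' hd.d (fits_of_c_eq hv₀).d e e₀ ne ne₀
    (rp_comp_L' hk hu _)
  have e₂ := rp_cL (R := R) hk P s v hu hd (fits_of_c_eq hv₀) (rp_comp_L hk hu _)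
  have f : A.Fits n.le_succ w (lb (R.pL P Q (A.d n n.le_succ v) (fits_of_c_eq hv₀).d e₀ ne₀)) :=
    fits_of_c_eq (c_eq_lb_pL hw₀)
  have hc := rp_comp_L' (R := R) hk hu (fits_of_c_eq hv₀).d
  have e₃ := (rp_congr e₁ rfl (fits_of_c_eq (c_eq_lb_pL hw)) (fits_to_cL f)).trans
    (rp_cL (R := R) hk _ s w hc (fits_to_cL f) f (rp_comp_L hk hc _))
  refine (A.comp_congr _ e₂ e₃ _ ?_).trans (A.comp_whisker_right hk _ _ _ s _ _ _ _ _)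
  exact (congrArg _ e₂.symm).trans ((d_rp_eq_c_rp (hv' := hd.d) rfl (c_eq_lb_pL hw)).trans (congrArg _ e₃))

theorem rpTwo_cR (s : A.C n) (P Q : O.Pt n) (hu hu') (e₀ : Q.1 = P.1) (ne₀ : Q ≠ P) (e) (ne)
    (v w : A.C (n + 1)) (hv₀ hw₀) (hv) (hw) (h) :
    R.rpTwo (O.cR hk s P hu) (O.cR hk s Q hu') e ne v w hv hw =
      A.comp k (hk.trans n.lt_succ_self) (A.one (n + 1) n.le_succ s) (R.rpTwo P Q e₀ ne₀ v w hv₀ hw₀) h := by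
  have hd := fits_of_c_eq hv
  have e₁ := pL_cR_cR (R := R) hk P s Q (A.d n n.le_succ v) hu hu' hd.d (fits_of_c_eq hv₀).d e e₀ ne ne₀
    (rp_comp_R' hk hu _)
  have e₂ := rp_cR (R := R) hk P s v hu hd (fits_of_c_eq hv₀) (rp_comp_R hk hu _)
  have f : A.Fits n.le_succ w (lb (R.pL P Q (A.d n n.le_succ v) (fits_of_c_eq hv₀).d e₀ ne₀)) :=
    fits_of_c_eq (c_eq_lb_pL hw₀)
  have hc := rp_comp_R' (R := R) hk hu (fits_of_c_eq hv₀).d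
  have e₃ := (rp_congr e₁ rfl (fits_of_c_eq (c_eq_lb_pL hw)) (fits_to_cR f)).trans
    (rp_cR (R := R) hk _ s w hc (fits_to_cR f) f (rp_comp_R hk hc _))
  refine (A.comp_congr _ e₂ e₃ _ ?_).trans (A.comp_whisker_left hk _ s _ _ _ _ _ _ _)
  exact (congrArg _ e₂.symm).trans ((d_rp_eq_c_rp (hv' := hd.d) rfl (c_eq_lb_pL hw)).trans (congrArg _ e₃))

theorem rpTwo_cL_cR (P Q : O.Pt n) (hu hu') (e) (ne) (v w : A.C (n + 1)) (hv₀) (hw₀) (hv) (hw) (h) :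
    R.rpTwo (O.cL hk P Q.1 hu) (O.cR hk P.1 Q hu') e ne v w hv hw =
      A.comp k (hk.trans n.lt_succ_self) (R.rp n.le_succ P v (fits_of_c_eq hv₀))
        (R.rp n.le_succ Q w (fits_of_c_eq hw₀)) h := by
  have hd := fits_of_c_eq hv
  have e₁ := pL_cL_cR (R := R) hk P Q (A.d n n.le_succ v) hu hu' hd.d (fits_of_c_eq hv₀).d e ne
    (rp_comp_L' hk hu _)
  have e₂ := rp_cL (R := R) hk P Q.1 v hu hd (fits_of_c_eq hv₀) (rp_comp_L hk hu _)
  have hc := rp_comp_L' (R := R) hk hu (fits_of_c_eq hv₀).d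
  have e₃ := (rp_congr e₁ rfl (fits_of_c_eq (c_eq_lb_pL hw)) (fits_to_cR (fits_of_c_eq hw₀))).trans
    (rp_cR (R := R) hk Q _ w hc (fits_to_cR (fits_of_c_eq hw₀)) (fits_of_c_eq hw₀) (rp_comp_R hk hc _))
  refine (A.comp_congr _ e₂ e₃ _ ?_).trans (A.whisker_comp_whisker hk _ _ _
    ((R.c_rep_succ _ _ _ _).trans (rp_lb (R := R) Q _ hw₀ (fits_of_c_eq hw₀).c)) (R.d_rep_succ _ _ _ _)
    _ _ _ _)
  exact (congrArg _ e₂.symm).trans ((d_rp_eq_c_rp (hv' := hd.d) rfl (c_eq_lb_pL hw)).trans (congrArg _ e₃))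

theorem rpTwo_cR_cL (P Q : O.Pt n) (hu hu') (e) (ne) (v w : A.C (n + 1)) (hv₀) (hw₀) (hv) (hw) (h) :
    R.rpTwo (O.cR hk Q.1 P hu) (O.cL hk Q P.1 hu') e ne v w hv hw =
      A.comp k (hk.trans n.lt_succ_self) (R.rp n.le_succ Q w (fits_of_c_eq hw₀))
        (R.rp n.le_succ P v (fits_of_c_eq hv₀)) h := by
  have hd := fits_of_c_eq hv
  have e₁ := pL_cR_cL (R := R) hk P Q (A.d n n.le_succ v) hu hu' hd.d (fits_of_c_eq hv₀).d e ne
    (rp_comp_R' hk hu _)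
  have e₂ := rp_cR (R := R) hk P Q.1 v hu hd (fits_of_c_eq hv₀) (rp_comp_R hk hu _)
  have hc := rp_comp_R' (R := R) hk hu (fits_of_c_eq hv₀).d
  have e₃ := (rp_congr e₁ rfl (fits_of_c_eq (c_eq_lb_pL hw)) (fits_to_cL (fits_of_c_eq hw₀))).trans
    (rp_cL (R := R) hk Q _ w hc (fits_to_cL (fits_of_c_eq hw₀)) (fits_of_c_eq hw₀) (rp_comp_L hk hc _))
  refine (A.comp_congr _ e₂ e₃ _ ?_).trans (A.whisker_comp_whisker' hk _ _ _ (R.d_rep_succ _ _ _ _)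
    ((R.c_rep_succ _ _ _ _).trans (rp_lb (R := R) Q _ hw₀ (fits_of_c_eq hw₀).c)) _ _ _ _)
  exact (congrArg _ e₂.symm).trans ((d_rp_eq_c_rp (hv' := hd.d) rfl (c_eq_lb_pL hw)).trans (congrArg _ e₃))

theorem pTwoL_cL (P Q : O.Pt n) (s : A.C n) (hu hu') (e₀ : Q.1 = P.1) (ne₀ : Q ≠ P) (e) (ne)
    (p : O.Pt (n + 1)) (w : A.C (n + 1)) (hv₀ hw₀) (hv) (hw) (h) :
    R.pTwoL (O.cL hk P s hu) (O.cL hk Q s hu') e ne p w hv hw =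
      O.cL (hk.trans n.lt_succ_self) (R.pTwoL P Q e₀ ne₀ p w hv₀ hw₀) (A.one (n + 1) n.le_succ s) h := by
  have hd := fits_of_c_eq hv
  have e₁ := pL_cL_cL (R := R) hk P s Q (A.d n n.le_succ p.1) hu hu' hd.d (fits_of_c_eq hv₀).d e e₀ ne ne₀
    (rp_comp_L' hk hu _)
  have e₂ := pR_cL (R := R) hk P s p hu hd (fits_of_c_eq hv₀) (rp_comp_L hk hu _)
  have f : A.Fits n.le_succ w (lb (R.pL P Q (A.d n n.le_succ p.1) (fits_of_c_eq hv₀).d e₀ ne₀)) :=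
    fits_of_c_eq (c_eq_lb_pL hw₀)
  have hc := rp_comp_L' (R := R) hk hu (fits_of_c_eq hv₀).d
  have e₃ := (rp_congr e₁ rfl (fits_of_c_eq (c_eq_lb_pL hw)) (fits_to_cL f)).trans
    (rp_cL (R := R) hk _ s w hc (fits_to_cL f) f (rp_comp_L hk hc _))
  refine (cL_congr _ e₂ e₃ _ ?_).trans (cL_whisker_right hk _ _ _ s _ _ _ _ _)
  exact (congrArg (fun q : O.Pt (n + 1) => A.d n n.le_succ q.1) e₂.symm).trans
    ((d_rp_eq_c_rp (hv' := hd.d) rfl (c_eq_lb_pL hw)).trans (congrArg _ e₃))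

theorem pTwoL_cR (s : A.C n) (P Q : O.Pt n) (hu hu') (e₀ : Q.1 = P.1) (ne₀ : Q ≠ P) (e) (ne)
    (p : O.Pt (n + 1)) (w : A.C (n + 1)) (hv₀ hw₀) (hv) (hw) (h) :
    R.pTwoL (O.cR hk s P hu) (O.cR hk s Q hu') e ne p w hv hw =
      O.cR (hk.trans n.lt_succ_self) (A.one (n + 1) n.le_succ s) (R.pTwoL P Q e₀ ne₀ p w hv₀ hw₀) h := by
  have hd := fits_of_c_eq hv
  have e₁ := pL_cR_cR (R := R) hk P s Q (A.d n n.le_succ p.1) hu hu' hd.d (fits_of_c_eq hv₀).d e e₀ ne ne₀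
    (rp_comp_R' hk hu _)
  have e₂ := pR_cR (R := R) hk P s p hu hd (fits_of_c_eq hv₀) (rp_comp_R hk hu _)
  have f : A.Fits n.le_succ w (lb (R.pL P Q (A.d n n.le_succ p.1) (fits_of_c_eq hv₀).d e₀ ne₀)) :=
    fits_of_c_eq (c_eq_lb_pL hw₀)
  have hc := rp_comp_R' (R := R) hk hu (fits_of_c_eq hv₀).d
  have e₃ := (rp_congr e₁ rfl (fits_of_c_eq (c_eq_lb_pL hw)) (fits_to_cR f)).trans
    (rp_cR (R := R) hk _ s w hc (fits_to_cR f) f (rp_comp_R hk hc _))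
  refine (cL_congr _ e₂ e₃ _ ?_).trans (cL_whisker_left hk _ s _ _ _ _ _ _ _)
  exact (congrArg (fun q : O.Pt (n + 1) => A.d n n.le_succ q.1) e₂.symm).trans
    ((d_rp_eq_c_rp (hv' := hd.d) rfl (c_eq_lb_pL hw)).trans (congrArg _ e₃))

theorem pTwoL_cL_cR (P Q : O.Pt n) (hu hu') (e) (ne) (p : O.Pt (n + 1)) (w : A.C (n + 1)) (hv₀) (hw₀)
    (hv) (hw) (h) : R.pTwoL (O.cL hk P Q.1 hu) (O.cR hk P.1 Q hu') e ne p w hv hw =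
      O.cL (hk.trans n.lt_succ_self) (R.pR n.le_succ P p (fits_of_c_eq hv₀))
        (R.rp n.le_succ Q w (fits_of_c_eq hw₀)) h := by
  have hd := fits_of_c_eq hv
  have e₁ := pL_cL_cR (R := R) hk P Q (A.d n n.le_succ p.1) hu hu' hd.d (fits_of_c_eq hv₀).d e ne
    (rp_comp_L' hk hu _)
  have e₂ := pR_cL (R := R) hk P Q.1 p hu hd (fits_of_c_eq hv₀) (rp_comp_L hk hu _)
  have hc := rp_comp_L' (R := R) hk hu (fits_of_c_eq hv₀).d
  have e₃ := (rp_congr e₁ rfl (fits_of_c_eq (c_eq_lb_pL hw)) (fits_to_cR (fits_of_c_eq hw₀))).trans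
    (rp_cR (R := R) hk Q _ w hc (fits_to_cR (fits_of_c_eq hw₀)) (fits_of_c_eq hw₀) (rp_comp_R hk hc _))
  refine (cL_congr _ e₂ e₃ _ ?_).trans (cL_whisker_whisker hk _ _ _
    ((R.c_rep_succ _ _ _ _).trans (rp_lb (R := R) Q _ hw₀ (fits_of_c_eq hw₀).c)) (R.d_rep_succ _ _ _ _)
    _ _ _ _)
  exact (congrArg (fun q : O.Pt (n + 1) => A.d n n.le_succ q.1) e₂.symm).trans
    ((d_rp_eq_c_rp (hv' := hd.d) rfl (c_eq_lb_pL hw)).trans (congrArg _ e₃))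

theorem pTwoL_cR_cL (P Q : O.Pt n) (hu hu') (e) (ne) (p : O.Pt (n + 1)) (w : A.C (n + 1)) (hv₀) (hw₀)
    (hv) (hw) (h) : R.pTwoL (O.cR hk Q.1 P hu) (O.cL hk Q P.1 hu') e ne p w hv hw =
      O.cR (hk.trans n.lt_succ_self) (R.rp n.le_succ Q w (fits_of_c_eq hw₀))
        (R.pR n.le_succ P p (fits_of_c_eq hv₀)) h := by
  have hd := fits_of_c_eq hv
  have e₁ := pL_cR_cL (R := R) hk P Q (A.d n n.le_succ p.1) hu hu' hd.d (fits_of_c_eq hv₀).d e ne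
    (rp_comp_R' hk hu _)
  have e₂ := pR_cR (R := R) hk P Q.1 p hu hd (fits_of_c_eq hv₀) (rp_comp_R hk hu _)
  have hc := rp_comp_R' (R := R) hk hu (fits_of_c_eq hv₀).d
  have e₃ := (rp_congr e₁ rfl (fits_of_c_eq (c_eq_lb_pL hw)) (fits_to_cL (fits_of_c_eq hw₀))).trans
    (rp_cL (R := R) hk Q _ w hc (fits_to_cL (fits_of_c_eq hw₀)) (fits_of_c_eq hw₀) (rp_comp_L hk hc _))
  refine (cL_congr _ e₂ e₃ _ ?_).trans (cL_whisker_whisker' hk _ _ _ (R.d_rep_succ _ _ _ _)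
    ((R.c_rep_succ _ _ _ _).trans (rp_lb (R := R) Q _ hw₀ (fits_of_c_eq hw₀).c)) _ _ _ _)
  exact (congrArg (fun q : O.Pt (n + 1) => A.d n n.le_succ q.1) e₂.symm).trans
    ((d_rp_eq_c_rp (hv' := hd.d) rfl (c_eq_lb_pL hw)).trans (congrArg _ e₃))

theorem pTwoR_cL (P Q : O.Pt n) (s : A.C n) (hu hu') (e₀ : Q.1 = P.1) (ne₀ : Q ≠ P) (e) (ne)
    (v : A.C (n + 1)) (p : O.Pt (n + 1)) (hv₀ hw₀) (hv) (hw) (h) :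
    R.pTwoR (O.cL hk P s hu) (O.cL hk Q s hu') e ne v p hv hw =
      O.cL (hk.trans n.lt_succ_self) (R.pTwoR P Q e₀ ne₀ v p hv₀ hw₀) (A.one (n + 1) n.le_succ s) h := by
  have hd := fits_of_c_eq hv
  have e₁ := pL_cL_cL (R := R) hk P s Q (A.d n n.le_succ v) hu hu' hd.d (fits_of_c_eq hv₀).d e e₀ ne ne₀
    (rp_comp_L' hk hu _)
  have e₂ := rp_cL (R := R) hk P s v hu hd (fits_of_c_eq hv₀) (rp_comp_L hk hu _)
  have f : A.Fits n.le_succ p.1 (lb (R.pL P Q (A.d n n.le_succ v) (fits_of_c_eq hv₀).d e₀ ne₀)) :=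
    fits_of_c_eq (c_eq_lb_pL hw₀)
  have hc := rp_comp_L' (R := R) hk hu (fits_of_c_eq hv₀).d
  have e₃ := (pR_congr e₁ rfl (fits_of_c_eq (c_eq_lb_pL hw)) (fits_to_cL f)).trans
    (pR_cL (R := R) hk _ s p hc (fits_to_cL f) f (rp_comp_L hk hc _))
  refine (cR_congr _ e₃ e₂ _ ?_).trans (cR_whisker_right hk _ _ _ s _ _ _ _ _)
  exact (congrArg _ e₂.symm).trans ((d_rp_eq_c_rp (hv' := hd.d) rfl (c_eq_lb_pL hw)).trans
    (congrArg (fun q : O.Pt (n + 1) => A.c n n.le_succ q.1) e₃))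

theorem pTwoR_cR (s : A.C n) (P Q : O.Pt n) (hu hu') (e₀ : Q.1 = P.1) (ne₀ : Q ≠ P) (e) (ne)
    (v : A.C (n + 1)) (p : O.Pt (n + 1)) (hv₀ hw₀) (hv) (hw) (h) :
    R.pTwoR (O.cR hk s P hu) (O.cR hk s Q hu') e ne v p hv hw =
      O.cR (hk.trans n.lt_succ_self) (A.one (n + 1) n.le_succ s) (R.pTwoR P Q e₀ ne₀ v p hv₀ hw₀) h := by
  have hd := fits_of_c_eq hv
  have e₁ := pL_cR_cR (R := R) hk P s Q (A.d n n.le_succ v) hu hu' hd.d (fits_of_c_eq hv₀).d e e₀ ne ne₀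
    (rp_comp_R' hk hu _)
  have e₂ := rp_cR (R := R) hk P s v hu hd (fits_of_c_eq hv₀) (rp_comp_R hk hu _)
  have f : A.Fits n.le_succ p.1 (lb (R.pL P Q (A.d n n.le_succ v) (fits_of_c_eq hv₀).d e₀ ne₀)) :=
    fits_of_c_eq (c_eq_lb_pL hw₀)
  have hc := rp_comp_R' (R := R) hk hu (fits_of_c_eq hv₀).d
  have e₃ := (pR_congr e₁ rfl (fits_of_c_eq (c_eq_lb_pL hw)) (fits_to_cR f)).trans
    (pR_cR (R := R) hk _ s p hc (fits_to_cR f) f (rp_comp_R hk hc _))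
  refine (cR_congr _ e₃ e₂ _ ?_).trans (cR_whisker_left hk _ s _ _ _ _ _ _ _)
  exact (congrArg _ e₂.symm).trans ((d_rp_eq_c_rp (hv' := hd.d) rfl (c_eq_lb_pL hw)).trans
    (congrArg (fun q : O.Pt (n + 1) => A.c n n.le_succ q.1) e₃))

theorem pTwoR_cL_cR (P Q : O.Pt n) (hu hu') (e) (ne) (v : A.C (n + 1)) (p : O.Pt (n + 1)) (hv₀) (hw₀)
    (hv) (hw) (h) : R.pTwoR (O.cL hk P Q.1 hu) (O.cR hk P.1 Q hu') e ne v p hv hw =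
      O.cR (hk.trans n.lt_succ_self) (R.rp n.le_succ P v (fits_of_c_eq hv₀))
        (R.pR n.le_succ Q p (fits_of_c_eq hw₀)) h := by
  have hd := fits_of_c_eq hv
  have e₁ := pL_cL_cR (R := R) hk P Q (A.d n n.le_succ v) hu hu' hd.d (fits_of_c_eq hv₀).d e ne
    (rp_comp_L' hk hu _)
  have e₂ := rp_cL (R := R) hk P Q.1 v hu hd (fits_of_c_eq hv₀) (rp_comp_L hk hu _)
  have hc := rp_comp_L' (R := R) hk hu (fits_of_c_eq hv₀).d
  have e₃ := (pR_congr e₁ rfl (fits_of_c_eq (c_eq_lb_pL hw)) (fits_to_cR (fits_of_c_eq hw₀))).trans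
    (pR_cR (R := R) hk Q _ p hc (fits_to_cR (fits_of_c_eq hw₀)) (fits_of_c_eq hw₀) (rp_comp_R hk hc _))
  refine (cR_congr _ e₃ e₂ _ ?_).trans (cR_whisker_whisker hk _ _ _
    ((R.c_rep_succ _ _ _ _).trans (rp_lb (R := R) Q _ hw₀ (fits_of_c_eq hw₀).c)) (R.d_rep_succ _ _ _ _)
    _ _ _ _)
  exact (congrArg _ e₂.symm).trans ((d_rp_eq_c_rp (hv' := hd.d) rfl (c_eq_lb_pL hw)).trans
    (congrArg (fun q : O.Pt (n + 1) => A.c n n.le_succ q.1) e₃))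

theorem pTwoR_cR_cL (P Q : O.Pt n) (hu hu') (e) (ne) (v : A.C (n + 1)) (p : O.Pt (n + 1)) (hv₀) (hw₀)
    (hv) (hw) (h) : R.pTwoR (O.cR hk Q.1 P hu) (O.cL hk Q P.1 hu') e ne v p hv hw =
      O.cL (hk.trans n.lt_succ_self) (R.pR n.le_succ Q p (fits_of_c_eq hw₀))
        (R.rp n.le_succ P v (fits_of_c_eq hv₀)) h := by
  have hd := fits_of_c_eq hv
  have e₁ := pL_cR_cL (R := R) hk P Q (A.d n n.le_succ v) hu hu' hd.d (fits_of_c_eq hv₀).d e ne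
    (rp_comp_R' hk hu _)
  have e₂ := rp_cR (R := R) hk P Q.1 v hu hd (fits_of_c_eq hv₀) (rp_comp_R hk hu _)
  have hc := rp_comp_R' (R := R) hk hu (fits_of_c_eq hv₀).d
  have e₃ := (pR_congr e₁ rfl (fits_of_c_eq (c_eq_lb_pL hw)) (fits_to_cL (fits_of_c_eq hw₀))).trans
    (pR_cL (R := R) hk Q _ p hc (fits_to_cL (fits_of_c_eq hw₀)) (fits_of_c_eq hw₀) (rp_comp_L hk hc _))
  refine (cR_congr _ e₃ e₂ _ ?_).trans (cR_whisker_whisker' hk _ _ _ (R.d_rep_succ _ _ _ _)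
    ((R.c_rep_succ _ _ _ _).trans (rp_lb (R := R) Q _ hw₀ (fits_of_c_eq hw₀).c)) _ _ _ _)
  exact (congrArg _ e₂.symm).trans ((d_rp_eq_c_rp (hv' := hd.d) rfl (c_eq_lb_pL hw)).trans
    (congrArg (fun q : O.Pt (n + 1) => A.c n n.le_succ q.1) e₃))

end

theorem rpTwo_comm (P Q : O.Pt n) (e) (ne) (e') (ne') (v w : A.C (n + 1)) (hv) (hw) :
    R.rpTwo P Q e ne v w hv hw = R.rpTwo Q P e' ne' w v hw hv := by
  revert hv hw
  refine pair_induction (fun P Q => ∀ (e) (ne) (e') (ne') (hv) (hw),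
    R.rpTwo P Q e ne v w hv hw = R.rpTwo Q P e' ne' w v hw hv) ?_ ?_ ?_ ?_ P Q e ne e ne e' ne'
  · intro k hk P Q s hu hu' e₀ ne₀ ih e ne e' ne' hv hw
    have hv₀ := hv.trans (lb_cL _ _ _ _)
    have hw₀ := hw.trans (lb_cL _ _ _ _)
    have f := fits_one n.le_succ s
    exact (rpTwo_cL hk P Q s hu hu' e₀ ne₀ e ne v w hv₀ hw₀ hv hw
      ((fits_rpTwo _ _ _ _ _ _ _ _).composable hk f hu)).trans
      ((A.comp_congr _ (ih e₀ ne₀ e₀.symm ne₀.symm hv₀ hw₀) rfl _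
        ((fits_rpTwo _ _ _ _ _ _ _ _).composable hk f hu')).trans
        (rpTwo_cL hk Q P s hu' hu e₀.symm ne₀.symm e' ne' w v hw₀ hv₀ hw hv _).symm)
  · intro k hk s P Q hu hu' e₀ ne₀ ih e ne e' ne' hv hw
    have hv₀ := hv.trans (lb_cR _ _ _ _)
    have hw₀ := hw.trans (lb_cR _ _ _ _)
    have f := fits_one n.le_succ s
    exact (rpTwo_cR hk s P Q hu hu' e₀ ne₀ e ne v w hv₀ hw₀ hv hw
      (f.composable hk (fits_rpTwo _ _ _ _ _ _ _ _) hu)).trans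
      ((A.comp_congr _ rfl (ih e₀ ne₀ e₀.symm ne₀.symm hv₀ hw₀) _
        (f.composable hk (fits_rpTwo _ _ _ _ _ _ _ _) hu')).trans
        (rpTwo_cR hk s Q P hu' hu e₀.symm ne₀.symm e' ne' w v hw₀ hv₀ hw hv _).symm)
  · intro k hk P Q hu e ne e' ne' hv hw
    have hv₀ := hv.trans (lb_cL _ _ _ _)
    have hw₀ := hw.trans (lb_cR _ _ _ _)
    have hc := (fits_rp (R := R) n.le_succ P v (fits_of_c_eq hv₀)).composable hk
      (fits_rp (R := R) n.le_succ Q w (fits_of_c_eq hw₀)) hu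
    exact (rpTwo_cL_cR hk P Q hu hu e ne v w hv₀ hw₀ hv hw hc).trans
      (rpTwo_cR_cL hk Q P hu hu e' ne' w v hw₀ hv₀ hw hv hc).symm
  · intro k hk P Q hu e ne e' ne' hv hw
    have hv₀ := hv.trans (lb_cR _ _ _ _)
    have hw₀ := hw.trans (lb_cL _ _ _ _)
    have hc := (fits_rp (R := R) n.le_succ Q w (fits_of_c_eq hw₀)).composable hk
      (fits_rp (R := R) n.le_succ P v (fits_of_c_eq hv₀)) hu
    exact (rpTwo_cR_cL hk P Q hu hu e ne v w hv₀ hw₀ hv hw hc).trans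
      (rpTwo_cL_cR hk Q P hu hu e' ne' w v hw₀ hv₀ hw hv hc).symm

theorem pTwo_comm (P Q : O.Pt n) (e) (ne) (e') (ne') (p : O.Pt (n + 1)) (w : A.C (n + 1)) (hv) (hw) :
    R.pTwoL P Q e ne p w hv hw = R.pTwoR Q P e' ne' w p hw hv := by
  revert hv hw
  refine pair_induction (fun P Q => ∀ (e) (ne) (e') (ne') (hv) (hw),
    R.pTwoL P Q e ne p w hv hw = R.pTwoR Q P e' ne' w p hw hv) ?_ ?_ ?_ ?_ P Q e ne e ne e' ne'
  · intro k hk P Q s hu hu' e₀ ne₀ ih e ne e' ne' hv hw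
    have hv₀ := hv.trans (lb_cL _ _ _ _)
    have hw₀ := hw.trans (lb_cL _ _ _ _)
    have f := fits_one n.le_succ s
    exact (pTwoL_cL hk P Q s hu hu' e₀ ne₀ e ne p w hv₀ hw₀ hv hw
      ((fits_rpTwo (R := R) P Q e₀ ne₀ p.1 w hv₀ hw₀).composable hk f hu)).trans
      ((cL_congr _ (ih e₀ ne₀ e₀.symm ne₀.symm hv₀ hw₀) rfl _
        ((fits_rpTwo (R := R) Q P e₀.symm ne₀.symm w p.1 hw₀ hv₀).composable hk f hu')).trans
        (pTwoR_cL hk Q P s hu' hu e₀.symm ne₀.symm e' ne' w p hw₀ hv₀ hw hv _).symm)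
  · intro k hk s P Q hu hu' e₀ ne₀ ih e ne e' ne' hv hw
    have hv₀ := hv.trans (lb_cR _ _ _ _)
    have hw₀ := hw.trans (lb_cR _ _ _ _)
    have f := fits_one n.le_succ s
    exact (pTwoL_cR hk s P Q hu hu' e₀ ne₀ e ne p w hv₀ hw₀ hv hw
      (f.composable hk (fits_rpTwo (R := R) P Q e₀ ne₀ p.1 w hv₀ hw₀) hu)).trans
      ((cR_congr _ (ih e₀ ne₀ e₀.symm ne₀.symm hv₀ hw₀) rfl _
        (f.composable hk (fits_rpTwo (R := R) Q P e₀.symm ne₀.symm w p.1 hw₀ hv₀) hu')).trans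
        (pTwoR_cR hk s Q P hu' hu e₀.symm ne₀.symm e' ne' w p hw₀ hv₀ hw hv _).symm)
  · intro k hk P Q hu e ne e' ne' hv hw
    have hv₀ := hv.trans (lb_cL _ _ _ _)
    have hw₀ := hw.trans (lb_cR _ _ _ _)
    have hc := (fits_rp (R := R) n.le_succ P p.1 (fits_of_c_eq hv₀)).composable hk
      (fits_rp (R := R) n.le_succ Q w (fits_of_c_eq hw₀)) hu
    exact (pTwoL_cL_cR hk P Q hu hu e ne p w hv₀ hw₀ hv hw hc).trans
      (pTwoR_cR_cL hk Q P hu hu e' ne' w p hw₀ hv₀ hw hv hc).symm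
  · intro k hk P Q hu e ne e' ne' hv hw
    have hv₀ := hv.trans (lb_cR _ _ _ _)
    have hw₀ := hw.trans (lb_cL _ _ _ _)
    have hc := (fits_rp (R := R) n.le_succ Q w (fits_of_c_eq hw₀)).composable hk
      (fits_rp (R := R) n.le_succ P p.1 (fits_of_c_eq hv₀)) hu
    exact (pTwoL_cR_cL hk P Q hu hu e ne p w hv₀ hw₀ hv hw hc).trans
      (pTwoR_cL_cR hk Q P hu hu e' ne' w p hw₀ hv₀ hw hv hc).symm

end Replacement

end OccSystem

end Computad

namespace Computad

namespace OccSystem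

namespace Replacement

variable {A : Computad.{u}} {O : A.OccSystem} {R : O.Replacement} {n : ℕ}

section

variable {k : ℕ} (hk : k < n)

theorem cL_ne_cR_of_eq (P Q : O.Pt n) {t s : A.C n} (hP : P.1 = t) (hQ : Q.1 = s) (h) (h') :
    O.cL hk P s h ≠ O.cR hk t Q h' := by
  subst hP hQ
  exact cL_ne_cR hk P Q h

theorem pL_cL_cR_of_eq (P Q : O.Pt n) {t s : A.C n} (hP : P.1 = t) (hQ : Q.1 = s) (v : A.C n) (hu) (hu')
    (hv) (hv') (e) (ne) (hw) :
    R.pL (O.cL hk P s hu) (O.cR hk t Q hu') v hv e ne = O.cR hk (R.rp le_rfl P v hv') Q hw := by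
  subst hP hQ
  exact pL_cL_cR hk P Q v hu hu' hv hv' e ne hw

theorem pL_cR_cL_of_eq (P Q : O.Pt n) {t s : A.C n} (hP : P.1 = t) (hQ : Q.1 = s) (v : A.C n) (hu) (hu')
    (hv) (hv') (e) (ne) (hw) :
    R.pL (O.cR hk s P hu) (O.cL hk Q t hu') v hv e ne = O.cL hk Q (R.rp le_rfl P v hv') hw := by
  subst hP hQ
  exact pL_cR_cL hk P Q v hu hu' hv hv' e ne hw

end

theorem rp_pL_comm (P Q : O.Pt n) (v w : A.C n) (e) (ne) (e') (ne') (hv) (hw) (hv') (hw') :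
    R.rp le_rfl (R.pL P Q v hv e ne) w hw' = R.rp le_rfl (R.pL Q P w hw e' ne') v hv' := by
  revert hv hw hv' hw'
  have hLR : ∀ (v w : A.C n) (k : ℕ) (hk : k < n) (P Q : O.Pt n) (h) (e) (ne) (e') (ne') (hv) (hw) (hv')
      (hw'), R.rp le_rfl (R.pL (O.cL hk P Q.1 h) (O.cR hk P.1 Q h) v hv e ne) w hw' =
        R.rp le_rfl (R.pL (O.cR hk P.1 Q h) (O.cL hk P Q.1 h) w hw e' ne') v hv' := by
    intro v w k hk P Q hu e ne e' ne' hv hw hv' hw'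
    have e₁ := pL_cL_cR (R := R) hk P Q v hu hu hv (fits_cL hk hv) e ne (rp_comp_L' hk hu _)
    have e₂ := pL_cR_cL (R := R) hk Q P w hu hu hw (fits_cR hk hw) e' ne' (rp_comp_R' hk hu _)
    exact ((rp_congr e₁ rfl hw' (fits_to_cR (fits_cR hk hw))).trans
      (rp_cR' hk w _ _ (fits_cR hk hw) (rp_comp_R' hk (rp_comp_L' hk hu (fits_cL hk hv)) _))).trans
      ((rp_congr e₂ rfl hv' (fits_to_cL (fits_cL hk hv))).trans
      (rp_cL' hk v _ _ (fits_cL hk hv) (rp_comp_L' hk (rp_comp_R' hk hu (fits_cR hk hw)) _))).symm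
  refine pair_induction (fun P Q => ∀ (e) (ne) (e') (ne') (hv) (hw) (hv') (hw'),
    R.rp le_rfl (R.pL P Q v hv e ne) w hw' = R.rp le_rfl (R.pL Q P w hw e' ne') v hv') ?_ ?_ ?_ ?_
    P Q e ne e ne e' ne'
  · intro k hk P Q s hu hu' e₀ ne₀ ih e ne e' ne' hv hw hv' hw'
    have e₁ := pL_cL_cL (R := R) hk P s Q v hu hu' hv (fits_cL hk hv) e e₀ ne ne₀ (rp_comp_L' hk hu _)
    have e₂ := pL_cL_cL (R := R) hk Q s P w hu' hu hw (fits_cL hk hw) e' e₀.symm ne' ne₀.symm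
      (rp_comp_L' hk hu' _)
    have f₁ : A.Fits le_rfl w (lb (R.pL P Q v (fits_cL hk hv) e₀ ne₀)) := fits_to_pL (fits_cL hk hw)
    have f₂ : A.Fits le_rfl v (lb (R.pL Q P w (fits_cL hk hw) e₀.symm ne₀.symm)) :=
      fits_to_pL (fits_cL hk hv)
    exact ((rp_congr e₁ rfl hw' (fits_to_cL f₁)).trans
      (rp_cL' hk w _ _ f₁ (rp_comp_L' hk (rp_comp_L' hk hu (fits_cL hk hv)) _))).trans
      ((A.comp_congr hk (ih _ _ _ _ _ _ f₂ _) rfl _ _).trans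
      ((rp_congr e₂ rfl hv' (fits_to_cL f₂)).trans
      (rp_cL' hk v _ _ f₂ (rp_comp_L' hk (rp_comp_L' hk hu' (fits_cL hk hw)) _))).symm)
  · intro k hk s P Q hu hu' e₀ ne₀ ih e ne e' ne' hv hw hv' hw'
    have e₁ := pL_cR_cR (R := R) hk P s Q v hu hu' hv (fits_cR hk hv) e e₀ ne ne₀ (rp_comp_R' hk hu _)
    have e₂ := pL_cR_cR (R := R) hk Q s P w hu' hu hw (fits_cR hk hw) e' e₀.symm ne' ne₀.symm
      (rp_comp_R' hk hu' _)
    have f₁ : A.Fits le_rfl w (lb (R.pL P Q v (fits_cR hk hv) e₀ ne₀)) := fits_to_pL (fits_cR hk hw)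
    have f₂ : A.Fits le_rfl v (lb (R.pL Q P w (fits_cR hk hw) e₀.symm ne₀.symm)) :=
      fits_to_pL (fits_cR hk hv)
    exact ((rp_congr e₁ rfl hw' (fits_to_cR f₁)).trans
      (rp_cR' hk w _ _ f₁ (rp_comp_R' hk (rp_comp_R' hk hu (fits_cR hk hv)) _))).trans
      ((A.comp_congr hk rfl (ih _ _ _ _ _ _ f₂ _) _ _).trans
      ((rp_congr e₂ rfl hv' (fits_to_cR f₂)).trans
      (rp_cR' hk v _ _ f₂ (rp_comp_R' hk (rp_comp_R' hk hu' (fits_cR hk hw)) _))).symm)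
  · intro k hk P Q hu e ne e' ne' hv hw hv' hw'
    exact hLR v w k hk P Q hu e ne e' ne' hv hw hv' hw'
  · intro k hk P Q hu e ne e' ne' hv hw hv' hw'
    exact (hLR w v k hk Q P hu e' ne' e ne hw hv hw' hv').symm

theorem pL_pR_comm (P Q p : O.Pt n) (w : A.C n) (e) (ne) (e') (ne') (hv) (hw) (hv') (hw') (e₃) (ne₃) :
    R.pL (R.pL P Q p.1 hv e ne) (R.pR le_rfl P p hv) w hw' e₃ ne₃ =
      R.pR le_rfl (R.pL Q P w hw e' ne') p hv' := by
  revert hv hw hv' hw' e₃ ne₃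
  refine pair_induction (fun P Q => ∀ (e) (ne) (e') (ne') (hv) (hw) (hv') (hw') (e₃) (ne₃),
    R.pL (R.pL P Q p.1 hv e ne) (R.pR le_rfl P p hv) w hw' e₃ ne₃ =
      R.pR le_rfl (R.pL Q P w hw e' ne') p hv') ?_ ?_ ?_ ?_ P Q e ne e ne e' ne'
  · intro k hk P Q s hu hu' e₀ ne₀ ih e ne e' ne' hv hw hv' hw' e₃ ne₃
    have e₁ := pL_cL_cL (R := R) hk P s Q p.1 hu hu' hv (fits_cL hk hv) e e₀ ne ne₀ (rp_comp_L' hk hu _)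
    have e₂ := pL_cL_cL (R := R) hk Q s P w hu' hu hw (fits_cL hk hw) e' e₀.symm ne' ne₀.symm
      (rp_comp_L' hk hu' _)
    have e₄ := pR_cL' (R := R) hk p hu hv (fits_cL hk hv) (rp_comp_L' hk hu _)
    have f₁ : A.Fits le_rfl w (lb (R.pL P Q p.1 (fits_cL hk hv) e₀ ne₀)) := fits_to_pL (fits_cL hk hw)
    have f₂ : A.Fits le_rfl p.1 (lb (R.pL Q P w (fits_cL hk hw) e₀.symm ne₀.symm)) :=
      fits_to_pL (fits_cL hk hv)
    have ne₄ : R.pR le_rfl P p (fits_cL hk hv) ≠ R.pL P Q p.1 (fits_cL hk hv) e₀ ne₀ := fun h =>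
      ne₃ (e₄.trans ((cL_congr hk h rfl _ _).trans e₁.symm))
    have h₀ := rp_comp_L' (R := R) hk hu (fits_cL hk hv)
    exact ((pL_congr e₁ e₄ rfl hw' (fits_to_cL f₁) e₃ rfl ne₃ (fun h => ne₄ (cL_injective hk rfl h))).trans
      (pL_cL_cL hk (R.pL P Q p.1 (fits_cL hk hv) e₀ ne₀) s (R.pR le_rfl P p (fits_cL hk hv)) w _ _ _ f₁ _
        rfl _ ne₄ (rp_comp_L' hk h₀ _))).trans
      ((cL_congr hk (ih _ _ _ _ _ _ f₂ _ _ _) rfl _ _).trans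
      ((pR_congr e₂ rfl hv' (fits_to_cL f₂)).trans
      (pR_cL' hk p _ _ f₂ (rp_comp_L' hk (rp_comp_L' hk hu' (fits_cL hk hw)) _))).symm)
  · intro k hk s P Q hu hu' e₀ ne₀ ih e ne e' ne' hv hw hv' hw' e₃ ne₃
    have e₁ := pL_cR_cR (R := R) hk P s Q p.1 hu hu' hv (fits_cR hk hv) e e₀ ne ne₀ (rp_comp_R' hk hu _)
    have e₂ := pL_cR_cR (R := R) hk Q s P w hu' hu hw (fits_cR hk hw) e' e₀.symm ne' ne₀.symm
      (rp_comp_R' hk hu' _)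
    have e₄ := pR_cR' (R := R) hk p hu hv (fits_cR hk hv) (rp_comp_R' hk hu _)
    have f₁ : A.Fits le_rfl w (lb (R.pL P Q p.1 (fits_cR hk hv) e₀ ne₀)) := fits_to_pL (fits_cR hk hw)
    have f₂ : A.Fits le_rfl p.1 (lb (R.pL Q P w (fits_cR hk hw) e₀.symm ne₀.symm)) :=
      fits_to_pL (fits_cR hk hv)
    have ne₄ : R.pR le_rfl P p (fits_cR hk hv) ≠ R.pL P Q p.1 (fits_cR hk hv) e₀ ne₀ := fun h =>
      ne₃ (e₄.trans ((cR_congr hk h rfl _ _).trans e₁.symm))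
    have h₀ := rp_comp_R' (R := R) hk hu (fits_cR hk hv)
    exact ((pL_congr e₁ e₄ rfl hw' (fits_to_cR f₁) e₃ rfl ne₃ (fun h => ne₄ (cR_injective hk rfl h))).trans
      (pL_cR_cR hk (R.pL P Q p.1 (fits_cR hk hv) e₀ ne₀) s (R.pR le_rfl P p (fits_cR hk hv)) w _ _ _ f₁ _
        rfl _ ne₄ (rp_comp_R' hk h₀ _))).trans
      ((cR_congr hk (ih _ _ _ _ _ _ f₂ _ _ _) rfl _ _).trans
      ((pR_congr e₂ rfl hv' (fits_to_cR f₂)).trans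
      (pR_cR' hk p _ _ f₂ (rp_comp_R' hk (rp_comp_R' hk hu' (fits_cR hk hw)) _))).symm)
  · intro k hk P Q hu e ne e' ne' hv hw hv' hw' e₃ ne₃
    have e₁ := pL_cL_cR (R := R) hk P Q p.1 hu hu hv (fits_cL hk hv) e ne (rp_comp_L' hk hu _)
    have e₂ := pL_cR_cL (R := R) hk Q P w hu hu hw (fits_cR hk hw) e' ne' (rp_comp_R' hk hu _)
    have e₄ := pR_cL' (R := R) hk p hu hv (fits_cL hk hv) (rp_comp_L' hk hu _)
    have h₀ := rp_comp_L' (R := R) hk hu (fits_cL hk hv)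
    exact ((pL_congr e₁ e₄ rfl hw' (fits_to_cR (fits_cR hk hw)) e₃ rfl ne₃ (cL_ne_cR hk _ _ h₀)).trans
      (pL_cR_cL_of_eq hk Q (R.pR le_rfl P p (fits_cL hk hv)) rfl rfl w _ _ _ (fits_cR hk hw) _ _ (rp_comp_R' hk h₀ _))).trans
      ((pR_congr e₂ rfl hv' (fits_to_cL (fits_cL hk hv))).trans
      (pR_cL' hk p _ _ (fits_cL hk hv) (rp_comp_L' hk (rp_comp_R' hk hu (fits_cR hk hw)) _))).symm
  · intro k hk P Q hu e ne e' ne' hv hw hv' hw' e₃ ne₃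
    have e₁ := pL_cR_cL (R := R) hk P Q p.1 hu hu hv (fits_cR hk hv) e ne (rp_comp_R' hk hu _)
    have e₂ := pL_cL_cR (R := R) hk Q P w hu hu hw (fits_cL hk hw) e' ne' (rp_comp_L' hk hu _)
    have e₄ := pR_cR' (R := R) hk p hu hv (fits_cR hk hv) (rp_comp_R' hk hu _)
    have h₀ := rp_comp_R' (R := R) hk hu (fits_cR hk hv)
    exact ((pL_congr e₁ e₄ rfl hw' (fits_to_cL (fits_cL hk hw)) e₃ rfl ne₃ (cL_ne_cR hk _ _ h₀).symm).trans
      (pL_cL_cR_of_eq hk Q (R.pR le_rfl P p (fits_cR hk hv)) rfl rfl w _ _ _ (fits_cL hk hw) _ _ (rp_comp_L' hk h₀ _))).trans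
      ((pR_congr e₂ rfl hv' (fits_to_cR (fits_cR hk hv))).trans
      (pR_cR' hk p _ _ (fits_cR hk hv) (rp_comp_R' hk (rp_comp_L' hk hu (fits_cL hk hw)) _))).symm

theorem pL_injective {P Q Q' : O.Pt n} {v : A.C n} {hv e ne e' ne'}
    (h : R.pL P Q v hv e ne = R.pL P Q' v hv e' ne') : Q = Q' := by
  induction P using pt_induction generalizing Q Q' with
  | hx P hP =>
    obtain ⟨u, r⟩ := P
    obtain ⟨u', q⟩ := Q
    obtain rfl : u' = u := e
    exact (ne (congrArg (Sigma.mk u') (occ_indet_subsingleton hP _ _))).elim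
  | hL k hk P s hu ih =>
    rcases pt_cases hk hu Q e with ⟨S, hS, rfl⟩ | ⟨S, hS, rfl⟩ <;>
      rcases pt_cases hk hu Q' e' with ⟨S', hS', rfl⟩ | ⟨S', hS', rfl⟩
    · have ne₁ : S ≠ P := fun h => ne (cL_congr hk h rfl _ _)
      have ne₂ : S' ≠ P := fun h => ne' (cL_congr hk h rfl _ _)
      have e₁ := pL_cL_cL (R := R) hk P s S v hu (hS ▸ hu) hv (fits_cL hk hv) e hS ne ne₁ (rp_comp_L' hk hu _)
      have e₂ := pL_cL_cL (R := R) hk P s S' v hu (hS' ▸ hu) hv (fits_cL hk hv) e' hS' ne' ne₂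
        (rp_comp_L' hk hu _)
      exact cL_congr hk (ih (cL_injective hk (Q := R.pL P S v (fits_cL hk hv) hS ne₁)
        (P := R.pL P S' v (fits_cL hk hv) hS' ne₂) rfl (e₁.symm.trans (h.trans e₂)))) rfl _ _
    · have ne₁ : S ≠ P := fun h => ne (cL_congr hk h rfl _ _)
      have e₁ := pL_cL_cL (R := R) hk P s S v hu (hS ▸ hu) hv (fits_cL hk hv) e hS ne ne₁ (rp_comp_L' hk hu _)
      have e₂ := pL_cL_cR_of_eq (R := R) hk P S' rfl hS' v hu _ hv (fits_cL hk hv) e' ne'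
        ((rp_comp_L' hk hu _).trans (congrArg (A.c k hk.le) hS'.symm))
      exact (cL_ne_cR_of_eq hk _ _ rfl hS' _ _ (e₁.symm.trans (h.trans e₂))).elim
    · have ne₂ : S' ≠ P := fun h => ne' (cL_congr hk h rfl _ _)
      have e₂ := pL_cL_cL (R := R) hk P s S' v hu (hS' ▸ hu) hv (fits_cL hk hv) e' hS' ne' ne₂
        (rp_comp_L' hk hu _)
      have e₁ := pL_cL_cR_of_eq (R := R) hk P S rfl hS v hu _ hv (fits_cL hk hv) e ne
        ((rp_comp_L' hk hu _).trans (congrArg (A.c k hk.le) hS.symm))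
      exact (cL_ne_cR_of_eq hk _ _ rfl hS _ _ (e₂.symm.trans (h.symm.trans e₁))).elim
    · have e₁ := pL_cL_cR_of_eq (R := R) hk P S rfl hS v hu _ hv (fits_cL hk hv) e ne
        ((rp_comp_L' hk hu _).trans (congrArg (A.c k hk.le) hS.symm))
      have e₂ := pL_cL_cR_of_eq (R := R) hk P S' rfl hS' v hu _ hv (fits_cL hk hv) e' ne'
        ((rp_comp_L' hk hu _).trans (congrArg (A.c k hk.le) hS'.symm))
      exact cR_congr hk (cR_injective hk (hS.trans hS'.symm) (e₁.symm.trans (h.trans e₂))) rfl _ _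
  | hR k hk s P hu ih =>
    rcases pt_cases hk hu Q e with ⟨S, hS, rfl⟩ | ⟨S, hS, rfl⟩ <;>
      rcases pt_cases hk hu Q' e' with ⟨S', hS', rfl⟩ | ⟨S', hS', rfl⟩
    · have e₁ := pL_cR_cL_of_eq (R := R) hk P S rfl hS v hu _ hv (fits_cR hk hv) e ne
        ((congrArg (A.d k hk.le) hS).trans (rp_comp_R' hk hu _))
      have e₂ := pL_cR_cL_of_eq (R := R) hk P S' rfl hS' v hu _ hv (fits_cR hk hv) e' ne'
        ((congrArg (A.d k hk.le) hS').trans (rp_comp_R' hk hu _))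
      exact cL_congr hk (cL_injective hk (hS.trans hS'.symm) (e₁.symm.trans (h.trans e₂))) rfl _ _
    · have ne₂ : S' ≠ P := fun h => ne' (cR_congr hk h rfl _ _)
      have e₂ := pL_cR_cR (R := R) hk P s S' v hu (hS' ▸ hu) hv (fits_cR hk hv) e' hS' ne' ne₂
        (rp_comp_R' hk hu _)
      have e₁ := pL_cR_cL_of_eq (R := R) hk P S rfl hS v hu _ hv (fits_cR hk hv) e ne
        ((congrArg (A.d k hk.le) hS).trans (rp_comp_R' hk hu _))
      exact (cL_ne_cR_of_eq hk _ (R.pL P S' v (fits_cR hk hv) hS' ne₂) hS rfl _ _ (e₁.symm.trans (h.trans e₂))).elim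
    · have ne₁ : S ≠ P := fun h => ne (cR_congr hk h rfl _ _)
      have e₁ := pL_cR_cR (R := R) hk P s S v hu (hS ▸ hu) hv (fits_cR hk hv) e hS ne ne₁ (rp_comp_R' hk hu _)
      have e₂ := pL_cR_cL_of_eq (R := R) hk P S' rfl hS' v hu _ hv (fits_cR hk hv) e' ne'
        ((congrArg (A.d k hk.le) hS').trans (rp_comp_R' hk hu _))
      exact (cL_ne_cR_of_eq hk _ (R.pL P S v (fits_cR hk hv) hS ne₁) hS' rfl _ _ (e₂.symm.trans (h.symm.trans e₁))).elim
    · have ne₁ : S ≠ P := fun h => ne (cR_congr hk h rfl _ _)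
      have ne₂ : S' ≠ P := fun h => ne' (cR_congr hk h rfl _ _)
      have e₁ := pL_cR_cR (R := R) hk P s S v hu (hS ▸ hu) hv (fits_cR hk hv) e hS ne ne₁ (rp_comp_R' hk hu _)
      have e₂ := pL_cR_cR (R := R) hk P s S' v hu (hS' ▸ hu) hv (fits_cR hk hv) e' hS' ne' ne₂
        (rp_comp_R' hk hu _)
      exact cR_congr hk (ih (cR_injective hk (Q := R.pL P S v (fits_cR hk hv) hS ne₁)
        (P := R.pL P S' v (fits_cR hk hv) hS' ne₂) rfl (e₁.symm.trans (h.trans e₂)))) rfl _ _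

theorem pR_injective {m : ℕ} {h : n ≤ m} {P : O.Pt n} {p p' : O.Pt m} {hv hv'} (e : p.1 = p'.1)
    (he : R.pR h P p hv = R.pR h P p' hv') : p = p' := by
  induction P using pt_induction with
  | hx P hP => exact (pR_indet hP p hv).symm.trans (he.trans (pR_indet hP p' hv'))
  | hL k hk P s hu ih =>
    have e₁ := pR_cL (R := R) hk P s p hu hv (fits_cL hk hv) (rp_comp_L hk hu _)
    have e₂ := pR_cL (R := R) hk P s p' hu hv' (fits_cL hk hv') (rp_comp_L hk hu _)
    exact ih (cL_injective _ (rp_congr rfl e _ _) (e₁.symm.trans (he.trans e₂)))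
  | hR k hk s P hu ih =>
    have e₁ := pR_cR (R := R) hk P s p hu hv (fits_cR hk hv) (rp_comp_R hk hu _)
    have e₂ := pR_cR (R := R) hk P s p' hu hv' (fits_cR hk hv') (rp_comp_R hk hu _)
    exact ih (cR_injective _ (rp_congr rfl e _ _) (e₁.symm.trans (he.trans e₂)))

theorem pL_ne_pR {P Q p : O.Pt n} {hv e ne} : R.pL P Q p.1 hv e ne ≠ R.pR le_rfl P p hv := by
  intro h
  induction P using pt_induction generalizing Q with
  | hx P hP =>
    obtain ⟨u, r⟩ := P
    obtain ⟨u', q⟩ := Q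
    obtain rfl : u' = u := e
    exact (ne (congrArg (Sigma.mk u') (occ_indet_subsingleton hP _ _))).elim
  | hL k hk P s hu ih =>
    have e₄ := pR_cL' (R := R) hk p hu hv (fits_cL hk hv) (rp_comp_L' hk hu _)
    rcases pt_cases hk hu Q e with ⟨S, hS, rfl⟩ | ⟨S, hS, rfl⟩
    · have ne₁ : S ≠ P := fun h => ne (cL_congr hk h rfl _ _)
      have e₁ := pL_cL_cL (R := R) hk P s S p.1 hu (hS ▸ hu) hv (fits_cL hk hv) e hS ne ne₁
        (rp_comp_L' hk hu _)
      exact ih (cL_injective hk (Q := R.pL P S p.1 (fits_cL hk hv) hS ne₁)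
        (P := R.pR le_rfl P p (fits_cL hk hv)) rfl (e₁.symm.trans (h.trans e₄)))
    · have e₁ := pL_cL_cR_of_eq (R := R) hk P S rfl hS p.1 hu _ hv (fits_cL hk hv) e ne
        ((rp_comp_L' hk hu _).trans (congrArg (A.c k hk.le) hS.symm))
      exact cL_ne_cR_of_eq hk _ _ rfl hS _ _ (e₄.symm.trans (h.symm.trans e₁))
  | hR k hk s P hu ih =>
    have e₄ := pR_cR' (R := R) hk p hu hv (fits_cR hk hv) (rp_comp_R' hk hu _)
    rcases pt_cases hk hu Q e with ⟨S, hS, rfl⟩ | ⟨S, hS, rfl⟩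
    · have e₁ := pL_cR_cL_of_eq (R := R) hk P S rfl hS p.1 hu _ hv (fits_cR hk hv) e ne
        ((congrArg (A.d k hk.le) hS).trans (rp_comp_R' hk hu _))
      exact cL_ne_cR_of_eq hk _ (R.pR le_rfl P p (fits_cR hk hv)) hS rfl _ _ (e₁.symm.trans (h.trans e₄))
    · have ne₁ : S ≠ P := fun h => ne (cR_congr hk h rfl _ _)
      have e₁ := pL_cR_cR (R := R) hk P s S p.1 hu (hS ▸ hu) hv (fits_cR hk hv) e hS ne ne₁
        (rp_comp_R' hk hu _)
      exact ih (cR_injective hk (Q := R.pL P S p.1 (fits_cR hk hv) hS ne₁)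
        (P := R.pR le_rfl P p (fits_cR hk hv)) rfl (e₁.symm.trans (h.trans e₄)))

theorem exists_eq_pL_or_pR {P : O.Pt n} {v : A.C n} (hv) (T : O.Pt n) (hT : T.1 = R.rp le_rfl P v hv) :
    (∃ Q e ne, T = R.pL P Q v hv e ne) ∨ ∃ (p : O.Pt n) (e : p.1 = v), T = R.pR le_rfl P p (e ▸ hv) := by
  induction P using pt_induction generalizing T with
  | hx P hP =>
    have e := hT.trans (rp_indet hP v hv)
    exact Or.inr ⟨T, e, (pR_indet hP _ _).symm⟩
  | hL k hk P s hu ih =>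
    have h₀ := rp_comp_L' (R := R) hk hu (fits_cL hk hv)
    have e := hT.trans (rp_cL' hk v _ _ (fits_cL hk hv) h₀)
    rcases pt_cases hk h₀ T e with ⟨S, hS, rfl⟩ | ⟨S, hS, rfl⟩
    · rcases ih (fits_cL hk hv) S hS with ⟨Q, eQ, ne, rfl⟩ | ⟨p, rfl, rfl⟩
      · exact Or.inl ⟨O.cL hk Q s (eQ ▸ hu), A.comp_congr hk eQ rfl _ _, fun h => ne (cL_injective hk eQ h),
          (pL_cL_cL hk P s Q v hu _ hv (fits_cL hk hv) _ eQ _ ne h₀).symm⟩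
      · exact Or.inr ⟨p, rfl, (pR_cL' hk p _ hv _ h₀).symm⟩
    · subst hS
      exact Or.inl ⟨O.cR hk P.1 S hu, rfl, (cL_ne_cR hk P S hu).symm,
        (pL_cL_cR hk P S v hu hu hv (fits_cL hk hv) _ _ h₀).symm⟩
  | hR k hk s P hu ih =>
    have h₀ := rp_comp_R' (R := R) hk hu (fits_cR hk hv)
    have e := hT.trans (rp_cR' hk v _ _ (fits_cR hk hv) h₀)
    rcases pt_cases hk h₀ T e with ⟨S, hS, rfl⟩ | ⟨S, hS, rfl⟩
    · subst hS
      exact Or.inl ⟨O.cL hk S P.1 hu, rfl, (cL_ne_cR hk S P hu),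
        (pL_cR_cL hk P S v hu hu hv (fits_cR hk hv) _ _ h₀).symm⟩
    · rcases ih (fits_cR hk hv) S hS with ⟨Q, eQ, ne, rfl⟩ | ⟨p, rfl, rfl⟩
      · exact Or.inl ⟨O.cR hk s Q (eQ ▸ hu), A.comp_congr hk rfl eQ _ _, fun h => ne (cR_injective hk eQ h),
          (pL_cR_cR hk P s Q v hu _ hv (fits_cR hk hv) _ eQ _ ne h₀).symm⟩
      · exact Or.inr ⟨p, rfl, (pR_cR' hk p _ hv _ h₀).symm⟩

theorem exists_eq_pR {m : ℕ} (hnm : n < m) {P : O.Pt n} {v : A.C m} (hv) (T : O.Pt m)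
    (hT : T.1 = R.rp hnm.le P v hv) : ∃ (p : O.Pt m) (e : p.1 = v), T = R.pR hnm.le P p (e ▸ hv) := by
  induction P using pt_induction generalizing T with
  | hx P hP =>
    have e := hT.trans (rp_indet hP v hv)
    exact ⟨T, e, (pR_indet hP _ _).symm⟩
  | hL k hk P s hu ih =>
    have h₀ := rp_comp_L (R := R) hk hu (fits_cL hk hv)
    have e := hT.trans (rp_cL hk P s v _ _ (fits_cL hk hv) h₀)
    rcases pt_cases (hk.trans hnm) h₀ T e with ⟨S, hS, rfl⟩ | ⟨S, hS, rfl⟩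
    · obtain ⟨p, rfl, rfl⟩ := ih (fits_cL hk hv) S hS
      exact ⟨p, rfl, (pR_cL hk P s p _ hv _ h₀).symm⟩
    · exact ((occ_one_isEmpty hnm s).false (hS ▸ S.2)).elim
  | hR k hk s P hu ih =>
    have h₀ := rp_comp_R (R := R) hk hu (fits_cR hk hv)
    have e := hT.trans (rp_cR hk P s v _ _ (fits_cR hk hv) h₀)
    rcases pt_cases (hk.trans hnm) h₀ T e with ⟨S, hS, rfl⟩ | ⟨S, hS, rfl⟩
    · exact ((occ_one_isEmpty hnm s).false (hS ▸ S.2)).elim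
    · obtain ⟨p, rfl, rfl⟩ := ih (fits_cR hk hv) S hS
      exact ⟨p, rfl, (pR_cR hk P s p _ hv _ h₀).symm⟩

theorem pL_pL_comm (P Q T : O.Pt n) (v w : A.C n) (e) (ne) (e') (ne') (eP) (neP) (eQ) (neQ)
    (hv) (hw) (hv') (hw') (e₁) (ne₁) (e₂) (ne₂) :
    R.pL (R.pL P Q v hv e ne) (R.pL P T v hv eP neP) w hw' e₁ ne₁ =
      R.pL (R.pL Q P w hw e' ne') (R.pL Q T w hw eQ neQ) v hv' e₂ ne₂ := by
  revert T hv hw hv' hw'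
  have hLR : ∀ (v w : A.C n) (k : ℕ) (hk : k < n) (P Q : O.Pt n) (h) (e) (ne) (e') (ne') (T : O.Pt n) (eP)
      (neP) (eQ) (neQ) (hv) (hw) (hv') (hw') (e₁) (ne₁) (e₂) (ne₂),
      R.pL (R.pL (O.cL hk P Q.1 h) (O.cR hk P.1 Q h) v hv e ne)
        (R.pL (O.cL hk P Q.1 h) T v hv eP neP) w hw' e₁ ne₁ =
      R.pL (R.pL (O.cR hk P.1 Q h) (O.cL hk P Q.1 h) w hw e' ne')
        (R.pL (O.cR hk P.1 Q h) T w hw eQ neQ) v hv' e₂ ne₂ := by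
    intro v w k hk P Q hu e ne e' ne' T eP neP eQ neQ hv hw hv' hw' e₁ ne₁ e₂ ne₂
    have a₁ := pL_cL_cR (R := R) hk P Q v hu hu hv (fits_cL hk hv) e ne (rp_comp_L' hk hu _)
    have a₂ := pL_cR_cL (R := R) hk Q P w hu hu hw (fits_cR hk hw) e' ne' (rp_comp_R' hk hu _)
    have h₁ := rp_comp_L' (R := R) hk hu (fits_cL hk hv)
    have h₂ := rp_comp_R' (R := R) hk hu (fits_cR hk hw)
    rcases pt_cases hk hu T eP with ⟨S, hS, rfl⟩ | ⟨S, hS, rfl⟩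
    · have ne₃ : S ≠ P := fun h => neP (cL_congr hk h rfl _ _)
      have a₃ := pL_cL_cL (R := R) hk P Q.1 S v hu (hS ▸ hu) hv (fits_cL hk hv) eP hS neP ne₃ h₁
      have a₄ := pL_cR_cL_of_eq (R := R) hk Q S rfl hS w hu (hS ▸ hu) hw (fits_cR hk hw) eQ neQ ((congrArg (A.d k hk.le) hS).trans h₂)
      have n₁ := cL_ne_cR hk (R.pL P S v (fits_cL hk hv) hS ne₃) Q h₁
      have b₁ := (pL_congr (R := R) a₁ a₃ rfl hw' (fits_to_cR (fits_cR hk hw)) e₁ rfl ne₁ n₁).trans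
        (pL_cR_cL_of_eq hk Q (R.pL P S v (fits_cL hk hv) hS ne₃) rfl rfl w _ _ _ (fits_cR hk hw) _ _ (rp_comp_R' hk h₁ _))
      have n₂ : O.cL hk S _ ((congrArg (A.d k hk.le) hS).trans h₂) ≠ O.cL hk P _ h₂ := fun h => ne₃ (cL_injective hk hS h)
      have b₂ := (pL_congr (R := R) a₂ a₄ rfl hv' (fits_to_cL (fits_cL hk hv)) e₂ (A.comp_congr hk hS rfl _ _) ne₂
        n₂).trans (pL_cL_cL hk P _ S v _ _ _ (fits_cL hk hv) _ hS _ ne₃ (rp_comp_L' hk h₂ _))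
      exact b₁.trans b₂.symm
    · have ne₃ : S ≠ Q := fun h => neQ (cR_congr hk h rfl _ _)
      have a₃ := pL_cL_cR_of_eq (R := R) hk P S rfl hS v hu (hS ▸ hu) hv (fits_cL hk hv) eP neP (h₁.trans (congrArg (A.c k hk.le) hS.symm))
      have a₄ := pL_cR_cR (R := R) hk Q P.1 S w hu (hS ▸ hu) hw (fits_cR hk hw) eQ hS neQ ne₃ h₂
      have n₁ : O.cR hk _ S (h₁.trans (congrArg (A.c k hk.le) hS.symm)) ≠ O.cR hk _ Q h₁ := fun h => ne₃ (cR_injective hk hS h)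
      have b₁ := (pL_congr (R := R) a₁ a₃ rfl hw' (fits_to_cR (fits_cR hk hw)) e₁ (A.comp_congr hk rfl hS _ _) ne₁
        n₁).trans (pL_cR_cR hk Q _ S w _ _ _ (fits_cR hk hw) _ hS _ ne₃ (rp_comp_R' hk h₁ _))
      have n₂ := (cL_ne_cR hk P (R.pL Q S w (fits_cR hk hw) hS ne₃) h₂).symm
      have b₂ := (pL_congr (R := R) a₂ a₄ rfl hv' (fits_to_cL (fits_cL hk hv)) e₂ rfl ne₂ n₂).trans
        (pL_cL_cR_of_eq hk P (R.pL Q S w (fits_cR hk hw) hS ne₃) rfl rfl v _ _ _ (fits_cL hk hv) _ _ (rp_comp_L' hk h₂ _))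
      exact b₁.trans b₂.symm
  refine pair_induction (fun P Q => ∀ (e) (ne) (e') (ne') (T : O.Pt n) (eP) (neP) (eQ) (neQ)
      (hv) (hw) (hv') (hw') (e₁) (ne₁) (e₂) (ne₂),
    R.pL (R.pL P Q v hv e ne) (R.pL P T v hv eP neP) w hw' e₁ ne₁ =
      R.pL (R.pL Q P w hw e' ne') (R.pL Q T w hw eQ neQ) v hv' e₂ ne₂) ?_ ?_ ?_ ?_ P Q e ne e ne e' ne'
  · intro k hk P Q s hu hu' e₀ ne₀ ih e ne e' ne' T eP neP eQ neQ hv hw hv' hw' e₁ ne₁ e₂ ne₂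
    have h₁ := rp_comp_L' (R := R) hk hu (fits_cL hk hv)
    have h₂ := rp_comp_L' (R := R) hk hu' (fits_cL hk hw)
    have a₁ := pL_cL_cL (R := R) hk P s Q v hu hu' hv (fits_cL hk hv) e e₀ ne ne₀ h₁
    have a₂ := pL_cL_cL (R := R) hk Q s P w hu' hu hw (fits_cL hk hw) e' e₀.symm ne' ne₀.symm h₂
    have f₁ : A.Fits le_rfl w (lb (R.pL P Q v (fits_cL hk hv) e₀ ne₀)) := fits_to_pL (fits_cL hk hw)
    have f₂ : A.Fits le_rfl v (lb (R.pL Q P w (fits_cL hk hw) e₀.symm ne₀.symm)) :=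
      fits_to_pL (fits_cL hk hv)
    rcases pt_cases hk hu T eP with ⟨S, hS, rfl⟩ | ⟨S, hS, rfl⟩
    · have ne₃ : S ≠ P := fun h => neP (cL_congr hk h rfl _ _)
      have ne₄ : S ≠ Q := fun h => neQ (cL_congr hk h rfl _ _)
      have a₃ := pL_cL_cL (R := R) hk P s S v hu (hS ▸ hu) hv (fits_cL hk hv) eP hS neP ne₃ h₁
      have a₄ := pL_cL_cL (R := R) hk Q s S w hu' (hS ▸ hu) hw (fits_cL hk hw) eQ (hS.trans e₀.symm) neQ
        ne₄ h₂
      have n₁ := fun h => ne₄ (pL_injective (R := R) (P := P) (v := v) (hv := fits_cL hk hv) (e := hS)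
        (ne := ne₃) (e' := e₀) (ne' := ne₀) h)
      have n₂ := fun h => ne₃ (pL_injective (R := R) (P := Q) (v := w) (hv := fits_cL hk hw)
        (e := hS.trans e₀.symm) (ne := ne₄) (e' := e₀.symm) (ne' := ne₀.symm) h)
      have b₁ := (pL_congr (R := R) a₁ a₃ rfl hw' (fits_to_cL f₁) e₁ rfl ne₁
        (fun h => n₁ (cL_injective hk rfl h))).trans
        (pL_cL_cL hk (R.pL P Q v (fits_cL hk hv) e₀ ne₀) s (R.pL P S v (fits_cL hk hv) hS ne₃) w _ _ _ f₁ _ rfl _ n₁ (rp_comp_L' hk h₁ _))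
      have b₂ := (pL_congr (R := R) a₂ a₄ rfl hv' (fits_to_cL f₂) e₂ rfl ne₂
        (fun h => n₂ (cL_injective hk rfl h))).trans
        (pL_cL_cL hk (R.pL Q P w (fits_cL hk hw) e₀.symm ne₀.symm) s (R.pL Q S w (fits_cL hk hw) (hS.trans e₀.symm) ne₄) v _ _ _ f₂ _ rfl _ n₂ (rp_comp_L' hk h₂ _))
      exact b₁.trans ((cL_congr hk (ih e₀ ne₀ e₀.symm ne₀.symm S hS ne₃ (hS.trans e₀.symm) ne₄ _ _ f₂ f₁
        rfl n₁ rfl n₂) rfl _ _).trans b₂.symm)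
    · have a₃ := pL_cL_cR_of_eq (R := R) hk P S rfl hS v hu (hS ▸ hu) hv (fits_cL hk hv) eP neP
        (h₁.trans (congrArg (A.c k hk.le) hS.symm))
      have a₄ := pL_cL_cR_of_eq (R := R) hk Q S e₀ hS w hu' (hS ▸ hu) hw (fits_cL hk hw) eQ neQ
        (h₂.trans (congrArg (A.c k hk.le) hS.symm))
      subst hS
      have n₁ := (cL_ne_cR hk (R.pL P Q v (fits_cL hk hv) e₀ ne₀) S h₁).symm
      have n₂ := (cL_ne_cR hk (R.pL Q P w (fits_cL hk hw) e₀.symm ne₀.symm) S h₂).symm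
      have b₁ := (pL_congr (R := R) a₁ a₃ rfl hw' (fits_to_cL f₁) e₁ rfl ne₁ n₁).trans
        (pL_cL_cR_of_eq hk _ S rfl rfl w _ _ _ f₁ _ _ (rp_comp_L' hk h₁ _))
      have b₂ := (pL_congr (R := R) a₂ a₄ rfl hv' (fits_to_cL f₂) e₂ rfl ne₂ n₂).trans
        (pL_cL_cR_of_eq hk _ S rfl rfl v _ _ _ f₂ _ _ (rp_comp_L' hk h₂ _))
      exact b₁.trans ((cR_congr hk rfl (rp_pL_comm P Q v w e₀ ne₀ e₀.symm ne₀.symm _ _ f₂ f₁) _ _).trans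
        b₂.symm)
  · intro k hk s P Q hu hu' e₀ ne₀ ih e ne e' ne' T eP neP eQ neQ hv hw hv' hw' e₁ ne₁ e₂ ne₂
    have h₁ := rp_comp_R' (R := R) hk hu (fits_cR hk hv)
    have h₂ := rp_comp_R' (R := R) hk hu' (fits_cR hk hw)
    have a₁ := pL_cR_cR (R := R) hk P s Q v hu hu' hv (fits_cR hk hv) e e₀ ne ne₀ h₁
    have a₂ := pL_cR_cR (R := R) hk Q s P w hu' hu hw (fits_cR hk hw) e' e₀.symm ne' ne₀.symm h₂
    have f₁ : A.Fits le_rfl w (lb (R.pL P Q v (fits_cR hk hv) e₀ ne₀)) := fits_to_pL (fits_cR hk hw)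
    have f₂ : A.Fits le_rfl v (lb (R.pL Q P w (fits_cR hk hw) e₀.symm ne₀.symm)) :=
      fits_to_pL (fits_cR hk hv)
    rcases pt_cases hk hu T eP with ⟨S, hS, rfl⟩ | ⟨S, hS, rfl⟩
    · have a₃ := pL_cR_cL_of_eq (R := R) hk P S rfl hS v hu (hS ▸ hu) hv (fits_cR hk hv) eP neP
        ((congrArg (A.d k hk.le) hS).trans h₁)
      have a₄ := pL_cR_cL_of_eq (R := R) hk Q S e₀ hS w hu' (hS ▸ hu) hw (fits_cR hk hw) eQ neQ
        ((congrArg (A.d k hk.le) hS).trans h₂)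
      subst hS
      have n₁ := cL_ne_cR hk S (R.pL P Q v (fits_cR hk hv) e₀ ne₀) h₁
      have n₂ := cL_ne_cR hk S (R.pL Q P w (fits_cR hk hw) e₀.symm ne₀.symm) h₂
      have b₁ := (pL_congr (R := R) a₁ a₃ rfl hw' (fits_to_cR f₁) e₁ rfl ne₁ n₁).trans
        (pL_cR_cL_of_eq hk _ S rfl rfl w _ _ _ f₁ _ _ (rp_comp_R' hk h₁ _))
      have b₂ := (pL_congr (R := R) a₂ a₄ rfl hv' (fits_to_cR f₂) e₂ rfl ne₂ n₂).trans
        (pL_cR_cL_of_eq hk _ S rfl rfl v _ _ _ f₂ _ _ (rp_comp_R' hk h₂ _))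
      exact b₁.trans ((cL_congr hk rfl (rp_pL_comm P Q v w e₀ ne₀ e₀.symm ne₀.symm _ _ f₂ f₁) _ _).trans
        b₂.symm)
    · have ne₃ : S ≠ P := fun h => neP (cR_congr hk h rfl _ _)
      have ne₄ : S ≠ Q := fun h => neQ (cR_congr hk h rfl _ _)
      have a₃ := pL_cR_cR (R := R) hk P s S v hu (hS ▸ hu) hv (fits_cR hk hv) eP hS neP ne₃ h₁
      have a₄ := pL_cR_cR (R := R) hk Q s S w hu' (hS ▸ hu) hw (fits_cR hk hw) eQ (hS.trans e₀.symm) neQ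
        ne₄ h₂
      have n₁ := fun h => ne₄ (pL_injective (R := R) (P := P) (v := v) (hv := fits_cR hk hv) (e := hS)
        (ne := ne₃) (e' := e₀) (ne' := ne₀) h)
      have n₂ := fun h => ne₃ (pL_injective (R := R) (P := Q) (v := w) (hv := fits_cR hk hw)
        (e := hS.trans e₀.symm) (ne := ne₄) (e' := e₀.symm) (ne' := ne₀.symm) h)
      have b₁ := (pL_congr (R := R) a₁ a₃ rfl hw' (fits_to_cR f₁) e₁ rfl ne₁
        (fun h => n₁ (cR_injective hk rfl h))).trans
        (pL_cR_cR hk (R.pL P Q v (fits_cR hk hv) e₀ ne₀) s (R.pL P S v (fits_cR hk hv) hS ne₃) w _ _ _ f₁ _ rfl _ n₁ (rp_comp_R' hk h₁ _))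
      have b₂ := (pL_congr (R := R) a₂ a₄ rfl hv' (fits_to_cR f₂) e₂ rfl ne₂
        (fun h => n₂ (cR_injective hk rfl h))).trans
        (pL_cR_cR hk (R.pL Q P w (fits_cR hk hw) e₀.symm ne₀.symm) s (R.pL Q S w (fits_cR hk hw) (hS.trans e₀.symm) ne₄) v _ _ _ f₂ _ rfl _ n₂ (rp_comp_R' hk h₂ _))
      exact b₁.trans ((cR_congr hk (ih e₀ ne₀ e₀.symm ne₀.symm S hS ne₃ (hS.trans e₀.symm) ne₄ _ _ f₂ f₁
        rfl n₁ rfl n₂) rfl _ _).trans b₂.symm)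
  · intro k hk P Q hu e ne e' ne' T eP neP eQ neQ hv hw hv' hw' e₁ ne₁ e₂ ne₂
    exact hLR v w k hk P Q hu e ne e' ne' T eP neP eQ neQ hv hw hv' hw' e₁ ne₁ e₂ ne₂
  · intro k hk P Q hu e ne e' ne' T eP neP eQ neQ hv hw hv' hw' e₁ ne₁ e₂ ne₂
    exact (hLR w v k hk Q P hu e' ne' e ne T eQ neQ eP neP hw hv hw' hv' e₂ ne₂ e₁ ne₁).symm

end Replacement

end OccSystem

end Computad

namespace ManyToOneComputad

open Computad Computad.OccSystem Computad.OccSystem.Replacement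

variable {A : ManyToOneComputad.{u}} {Q : A.Parametrization}

section

variable {n : ℕ}

/-- A position of the source of an arrow. -/
def srcPt (u : (A.multitopicData Q).P (n + 1)) (q : (A.multitopicData Q).Occ ((A.multitopicData Q).d u)) :
    Q.occ.Pt n := ⟨A.d n n.le_succ u.1, q⟩

theorem same_occ {a b : (A.multitopicData Q).P n} {p : (A.multitopicData Q).Occ a}
    {q : (A.multitopicData Q).Occ b} (h : (⟨a.1, p⟩ : Q.occ.Pt n) = ⟨b.1, q⟩) :
    Same (A.multitopicData Q).Occ p q := by
  obtain rfl : a = b := Subtype.ext (congrArg Sigma.fst h)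
  obtain rfl := eq_of_heq (Sigma.mk.inj h).2
  rfl

theorem same_pos {a b : (A.multitopicData Q).P (n + 1)} {p : ((A.multitopicData Q).mc n).Pos a}
    {q : ((A.multitopicData Q).mc n).Pos b} (hab : a.1 = b.1) (h : srcPt a p = srcPt b q) :
    Same ((A.multitopicData Q).mc n).Pos p q := by
  obtain rfl : a = b := Subtype.ext hab
  obtain rfl := eq_of_heq (Sigma.mk.inj h).2
  rfl

theorem srcPt_ne {u : (A.multitopicData Q).P (n + 1)} {q r} (h : q ≠ r) : srcPt u q ≠ srcPt u r :=
  fun e => h (eq_of_heq (Sigma.mk.inj e).2)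

theorem cod_eq_lb {u v : (A.multitopicData Q).P (n + 1)} {r}
    (h : (A.multitopicData Q).c v = (A.multitopicData Q).lab ((A.multitopicData Q).d u) r) :
    A.c n n.le_succ v.1 = lb (srcPt u r) :=
  congrArg (fun x => x.1.1) h

theorem srcPt_inl (u v : (A.multitopicData Q).P (n + 1)) (r) (h) (q) (hq) (hv) (e) :
    srcPt _ ((A.multitopicData Q).inl u r v h q hq) =
      Q.repl.pL (srcPt u r) (srcPt u q) (A.d n n.le_succ v.1) hv e (srcPt_ne hq) :=
  same_cast_pt (Q.repl.pL (srcPt u r) (srcPt u q) (A.d n n.le_succ v.1) hv e (srcPt_ne hq))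
    (Q.repl.d_placed u.1 r v.1 (congrArg (fun x => x.1.1) h))

theorem srcPt_inr (u v : (A.multitopicData Q).P (n + 1)) (r) (h) (p) (hv) :
    srcPt _ ((A.multitopicData Q).inr u r v h p) = Q.repl.pR le_rfl (srcPt u r) (srcPt v p) hv :=
  same_cast_pt (Q.repl.pR le_rfl (srcPt u r) (srcPt v p) hv)
    (Q.repl.d_placed u.1 r v.1 (congrArg (fun x => x.1.1) h))

theorem rp_composable' (u v : (A.multitopicData Q).P (n + 1)) (r) (hv : A.c n n.le_succ v.1 = lb (srcPt u r)) :
    A.d n n.le_succ u.1 =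
      A.c n n.le_succ (Q.repl.rp n.le_succ (srcPt u r) v.1 (fits_of_c_eq hv)) :=
  Q.repl.placed_aux u.1 r v.1 hv

theorem c_rpTwo {R : Q.occ.Replacement} {P P' : Q.occ.Pt n} {e ne} {v w : A.C (n + 1)} {hv hw} :
    A.c n n.le_succ (R.rpTwo P P' e ne v w hv hw) = P.1 :=
  (A.c_comp n.lt_succ_self _ _ _).trans ((R.c_rep_succ _ _ _ _).trans
    (rp_lb (R := R) P _ hv (hv ▸ fits_self _)))

section comm

variable (u v w : (A.multitopicData Q).P (n + 1)) (r q) (hqr : q ≠ r)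
  (hv : (A.multitopicData Q).c v = (A.multitopicData Q).lab ((A.multitopicData Q).d u) r)
  (hw : (A.multitopicData Q).c w = (A.multitopicData Q).lab ((A.multitopicData Q).d u) q)
  (hw' : (A.multitopicData Q).c w =
    (A.multitopicData Q).lab _ ((A.multitopicData Q).inl u r v hv q hqr))

theorem comp_comp_inl (h) : ((A.multitopicData Q).comp ((A.multitopicData Q).comp u r v hv)
      ((A.multitopicData Q).inl u r v hv q hqr) w hw').1 =
    A.comp n n.lt_succ_self u.1 (Q.repl.rpTwo (srcPt u r) (srcPt u q) rfl (srcPt_ne hqr) v.1 w.1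
      (cod_eq_lb hv) (cod_eq_lb hw)) h := by
  have e := srcPt_inl u v r hv q hqr (fits_of_c_eq (cod_eq_lb hv)).d rfl
  have f := fits_of_c_eq (c_eq_lb_pL (cod_eq_lb hw) (R := Q.repl) (P := srcPt u r)
    (Q := srcPt u q) (e := rfl) (ne := srcPt_ne hqr) (hv := (fits_of_c_eq (cod_eq_lb hv)).d))
  have hc := d_rp_eq_c_rp (hv' := (fits_of_c_eq (cod_eq_lb hv)).d) (hv := fits_of_c_eq (cod_eq_lb hv))
    (hw := f) rfl (c_eq_lb_pL (cod_eq_lb hw))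
  exact (A.comp_congr _ rfl (rp_congr e rfl _ f) _ ((A.d_comp n.lt_succ_self _ _ _).trans hc)).trans
    (A.assoc _ _ _ _ (rp_composable' u v r (cod_eq_lb hv)) _ hc h)

theorem occL_occL_inl (p : (A.multitopicData Q).Occ u) (h) :
    (⟨_, (A.multitopicData Q).occL ((A.multitopicData Q).comp u r v hv)
      ((A.multitopicData Q).inl u r v hv q hqr) w hw' ((A.multitopicData Q).occL u r v hv p)⟩ :
        Q.occ.Pt (n + 1)) =
    Q.occ.cL n.lt_succ_self ⟨u.1, p⟩ (Q.repl.rpTwo (srcPt u r) (srcPt u q) rfl (srcPt_ne hqr) v.1 w.1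
      (cod_eq_lb hv) (cod_eq_lb hw)) h := by
  have e := srcPt_inl u v r hv q hqr (fits_of_c_eq (cod_eq_lb hv)).d rfl
  have f := fits_of_c_eq (c_eq_lb_pL (cod_eq_lb hw) (R := Q.repl) (P := srcPt u r)
    (Q := srcPt u q) (e := rfl) (ne := srcPt_ne hqr) (hv := (fits_of_c_eq (cod_eq_lb hv)).d))
  have hc := d_rp_eq_c_rp (hv' := (fits_of_c_eq (cod_eq_lb hv)).d) (hv := fits_of_c_eq (cod_eq_lb hv))
    (hw := f) rfl (c_eq_lb_pL (cod_eq_lb hw))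
  exact (cL_congr _ rfl (rp_congr e rfl _ f) _ ((A.d_comp n.lt_succ_self _ _ _).trans hc)).trans
    (cL_cL _ ⟨u.1, p⟩ _ _ (rp_composable' u v r (cod_eq_lb hv)) _ hc h)

theorem occL_occR_inl (p : (A.multitopicData Q).Occ v) (h) :
    (⟨_, (A.multitopicData Q).occL ((A.multitopicData Q).comp u r v hv)
      ((A.multitopicData Q).inl u r v hv q hqr) w hw' ((A.multitopicData Q).occR u r v hv p)⟩ :
        Q.occ.Pt (n + 1)) =
    Q.occ.cR n.lt_succ_self u.1 (Q.repl.pTwoL (srcPt u r) (srcPt u q) rfl (srcPt_ne hqr) ⟨v.1, p⟩ w.1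
      (cod_eq_lb hv) (cod_eq_lb hw)) h := by
  have e := srcPt_inl u v r hv q hqr (fits_of_c_eq (cod_eq_lb hv)).d rfl
  have f := fits_of_c_eq (c_eq_lb_pL (cod_eq_lb hw) (R := Q.repl) (P := srcPt u r)
    (Q := srcPt u q) (e := rfl) (ne := srcPt_ne hqr) (hv := (fits_of_c_eq (cod_eq_lb hv)).d))
  have hc := d_rp_eq_c_rp (hv' := (fits_of_c_eq (cod_eq_lb hv)).d) (hv := fits_of_c_eq (cod_eq_lb hv))
    (hw := f) rfl (c_eq_lb_pL (cod_eq_lb hw))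
  exact (cL_congr _ rfl (rp_congr e rfl _ f) _ ((A.d_comp n.lt_succ_self _ _ _).trans hc)).trans
    (cL_cR _ u.1 (Q.repl.pR n.le_succ (srcPt u r) ⟨v.1, p⟩ (fits_of_c_eq (cod_eq_lb hv))) _
      (rp_composable' u v r (cod_eq_lb hv)) _ hc h)

theorem occR_inl (p : (A.multitopicData Q).Occ w) (h) :
    (⟨_, (A.multitopicData Q).occR ((A.multitopicData Q).comp u r v hv)
      ((A.multitopicData Q).inl u r v hv q hqr) w hw' p⟩ : Q.occ.Pt (n + 1)) =
    Q.occ.cR n.lt_succ_self u.1 (Q.repl.pTwoR (srcPt u r) (srcPt u q) rfl (srcPt_ne hqr) v.1 ⟨w.1, p⟩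
      (cod_eq_lb hv) (cod_eq_lb hw)) h := by
  have e := srcPt_inl u v r hv q hqr (fits_of_c_eq (cod_eq_lb hv)).d rfl
  have f := fits_of_c_eq (c_eq_lb_pL (cod_eq_lb hw) (R := Q.repl) (P := srcPt u r)
    (Q := srcPt u q) (e := rfl) (ne := srcPt_ne hqr) (hv := (fits_of_c_eq (cod_eq_lb hv)).d))
  have hc := d_rp_eq_c_rp (hv' := (fits_of_c_eq (cod_eq_lb hv)).d) (hv := fits_of_c_eq (cod_eq_lb hv))
    (hw := f) rfl (c_eq_lb_pL (cod_eq_lb hw))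
  exact (cR_congr _ (pR_congr (v' := ⟨w.1, p⟩) e rfl _ f) rfl _
    ((A.d_comp n.lt_succ_self _ _ _).trans hc)).trans
    (cR_comp _ u.1 _ (Q.repl.pR n.le_succ _ ⟨w.1, p⟩ f) (rp_composable' u v r (cod_eq_lb hv)) _ hc h)

end comm

section assoc

variable (u v w : (A.multitopicData Q).P (n + 1)) (r q)
  (hv : (A.multitopicData Q).c v = (A.multitopicData Q).lab ((A.multitopicData Q).d u) r)
  (hw : (A.multitopicData Q).c w = (A.multitopicData Q).lab ((A.multitopicData Q).d v) q)
  (hw' : (A.multitopicData Q).c w = (A.multitopicData Q).lab _ ((A.multitopicData Q).inr u r v hv q))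
  (hv' : (A.multitopicData Q).c ((A.multitopicData Q).comp v q w hw) =
    (A.multitopicData Q).lab ((A.multitopicData Q).d u) r)

include hw in
theorem rp_inr (f) (f') : Q.repl.rp n.le_succ
      (srcPt ((A.multitopicData Q).comp u r v hv) ((A.multitopicData Q).inr u r v hv q)) w.1 f =
    Q.repl.rp n.le_succ (srcPt u r)
      (Q.repl.rp n.le_succ (srcPt v q) w.1 (fits_of_c_eq (cod_eq_lb hw))) f' := by
  have e := srcPt_inr u v r hv q (fits_of_c_eq (cod_eq_lb hv)).d
  exact (rp_congr e rfl _ (e ▸ f)).trans (rp_pR (srcPt u r) (srcPt v q) _ w.1 _ _ f')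

include hw in
theorem pR_inr (p : (A.multitopicData Q).Occ w) (f) (f') : Q.repl.pR n.le_succ
      (srcPt ((A.multitopicData Q).comp u r v hv) ((A.multitopicData Q).inr u r v hv q)) ⟨w.1, p⟩ f =
    Q.repl.pR n.le_succ (srcPt u r)
      (Q.repl.pR n.le_succ (srcPt v q) ⟨w.1, p⟩ (fits_of_c_eq (cod_eq_lb hw))) f' := by
  have e := srcPt_inr u v r hv q (fits_of_c_eq (cod_eq_lb hv)).d
  exact (pR_congr (v' := ⟨w.1, p⟩) e rfl _ (e ▸ f)).trans
    (pR_pR (srcPt u r) (srcPt v q) _ ⟨w.1, p⟩ _ _ f')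

include hv in
theorem fits_rp_rp : A.Fits n.le_succ
    (Q.repl.rp n.le_succ (srcPt v q) w.1 (fits_of_c_eq (cod_eq_lb hw))) (lb (srcPt u r)) :=
  fits_rp_of (h := le_rfl) (fits_of_c_eq (cod_eq_lb hv)).d _

include hv hv' hw' in
theorem rp_comp_rp_inr (h) :
    A.comp n n.lt_succ_self (Q.repl.rp n.le_succ (srcPt u r) v.1 (fits_of_c_eq (cod_eq_lb hv)))
      (Q.repl.rp n.le_succ (srcPt ((A.multitopicData Q).comp u r v hv)
        ((A.multitopicData Q).inr u r v hv q)) w.1 (fits_of_c_eq (cod_eq_lb hw'))) h =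
    Q.repl.rp n.le_succ (srcPt u r) ((A.multitopicData Q).comp v q w hw).1
      (fits_of_c_eq (cod_eq_lb hv')) := by
  have hc := rp_composable' v w q (cod_eq_lb hw)
  have f := fits_rp_rp u v w r q hv hw
  exact (A.comp_congr _ rfl (rp_inr u v w r q hv hw _ f) _ (rp_composable hc)).trans
    (rp_comp_top (srcPt u r) v.1 _ hc _ f _ _).symm

theorem inr_composable : A.d n n.le_succ
      (Q.repl.rp n.le_succ (srcPt u r) v.1 (fits_of_c_eq (cod_eq_lb hv))) = A.c n n.le_succ
      (Q.repl.rp n.le_succ (srcPt ((A.multitopicData Q).comp u r v hv)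
        ((A.multitopicData Q).inr u r v hv q)) w.1 (fits_of_c_eq (cod_eq_lb hw'))) :=
  (A.d_comp n.lt_succ_self _ _ _).symm.trans (rp_composable' _ w _ (cod_eq_lb hw'))

theorem comp_comp_inr : ((A.multitopicData Q).comp ((A.multitopicData Q).comp u r v hv)
      ((A.multitopicData Q).inr u r v hv q) w hw').1 =
    ((A.multitopicData Q).comp u r ((A.multitopicData Q).comp v q w hw) hv').1 := by
  have hc := inr_composable u v w r q hv hw'
  have hr := rp_comp_rp_inr u v w r q hv hw hw' hv' hc
  exact (A.assoc _ _ _ _ (rp_composable' u v r (cod_eq_lb hv)) _ hc ((rp_composable' u _ r (cod_eq_lb hv')).trans (congrArg (A.c n n.le_succ) hr.symm))).trans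
    (A.comp_congr _ rfl hr _ _)

theorem occL_occL_inr (p : (A.multitopicData Q).Occ u) :
    (⟨_, (A.multitopicData Q).occL ((A.multitopicData Q).comp u r v hv)
      ((A.multitopicData Q).inr u r v hv q) w hw' ((A.multitopicData Q).occL u r v hv p)⟩ :
        Q.occ.Pt (n + 1)) =
    ⟨_, (A.multitopicData Q).occL u r ((A.multitopicData Q).comp v q w hw) hv' p⟩ := by
  have hc := inr_composable u v w r q hv hw'
  have hr := rp_comp_rp_inr u v w r q hv hw hw' hv' hc
  exact (cL_cL _ ⟨u.1, p⟩ _ _ (rp_composable' u v r (cod_eq_lb hv)) _ hc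
    ((rp_composable' u _ r (cod_eq_lb hv')).trans (congrArg (A.c n n.le_succ) hr.symm))).trans (cL_congr _ rfl hr _ _)

theorem occL_occR_inr (p : (A.multitopicData Q).Occ v) :
    (⟨_, (A.multitopicData Q).occL ((A.multitopicData Q).comp u r v hv)
      ((A.multitopicData Q).inr u r v hv q) w hw' ((A.multitopicData Q).occR u r v hv p)⟩ :
        Q.occ.Pt (n + 1)) =
    ⟨_, (A.multitopicData Q).occR u r ((A.multitopicData Q).comp v q w hw) hv'
      ((A.multitopicData Q).occL v q w hw p)⟩ := by
  have hc := inr_composable u v w r q hv hw'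
  have hr := rp_comp_rp_inr u v w r q hv hw hw' hv' hc
  have hc' := rp_composable' v w q (cod_eq_lb hw)
  have f := fits_rp_rp u v w r q hv hw
  refine (cL_cR _ u.1 (Q.repl.pR n.le_succ (srcPt u r) ⟨v.1, p⟩ (fits_of_c_eq (cod_eq_lb hv))) _
    (rp_composable' u v r (cod_eq_lb hv)) _ hc ((rp_composable' u _ r (cod_eq_lb hv')).trans
      (congrArg (A.c n n.le_succ) hr.symm))).trans
    (cR_congr _ (p' := Q.repl.pR n.le_succ (srcPt u r)
      ⟨_, (A.multitopicData Q).occL v q w hw p⟩ (fits_of_c_eq (cod_eq_lb hv'))) ?_ rfl _ (rp_composable' u _ r (cod_eq_lb hv')))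
  exact (cL_congr _ rfl (rp_inr u v w r q hv hw _ f) _ (rp_composable hc')).trans
    (pR_cL_top (srcPt u r) ⟨v.1, p⟩ _ hc' _ f _ _).symm

theorem occR_inr (p : (A.multitopicData Q).Occ w) :
    (⟨_, (A.multitopicData Q).occR ((A.multitopicData Q).comp u r v hv)
      ((A.multitopicData Q).inr u r v hv q) w hw' p⟩ : Q.occ.Pt (n + 1)) =
    ⟨_, (A.multitopicData Q).occR u r ((A.multitopicData Q).comp v q w hw) hv'
      ((A.multitopicData Q).occR v q w hw p)⟩ := by
  have hc := inr_composable u v w r q hv hw'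
  have hr := rp_comp_rp_inr u v w r q hv hw hw' hv' hc
  have hc' := rp_composable' v w q (cod_eq_lb hw)
  have f := fits_rp_rp u v w r q hv hw
  refine (cR_comp _ u.1 _ (Q.repl.pR n.le_succ _ ⟨w.1, p⟩ (fits_of_c_eq (cod_eq_lb hw')))
    (rp_composable' u v r (cod_eq_lb hv)) _ hc ((rp_composable' u _ r (cod_eq_lb hv')).trans
      (congrArg (A.c n n.le_succ) hr.symm))).trans
    (cR_congr _ (p' := Q.repl.pR n.le_succ (srcPt u r)
      ⟨_, (A.multitopicData Q).occR v q w hw p⟩ (fits_of_c_eq (cod_eq_lb hv'))) ?_ rfl _ (rp_composable' u _ r (cod_eq_lb hv')))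
  exact (cR_congr _ (pR_inr u v w r q hv hw p _ f) rfl _ (rp_composable hc')).trans
    (pR_cR_top (srcPt u r) v.1 (Q.repl.pR n.le_succ (srcPt v q) ⟨w.1, p⟩ (fits_of_c_eq (cod_eq_lb hw)))
      hc' _ f _ _).symm

end assoc

theorem isMulticategory_mc (A : ManyToOneComputad.{u}) (Q : A.Parametrization) (n : ℕ) :
    ((A.multitopicData Q).mc n).IsMulticategory where
  finite_pos u := Q.occ.finite_occ _
  bijective := by
    intro u r v h
    have hv := (fits_of_c_eq (cod_eq_lb h)).d
    have he : ∀ q hq, srcPt _ ((A.multitopicData Q).inl u r v h q hq) = _ := fun q hq =>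
      srcPt_inl u v r h q hq hv rfl
    have he' : ∀ p, srcPt _ ((A.multitopicData Q).inr u r v h p) = _ := fun p => srcPt_inr u v r h p hv
    constructor
    · rintro (⟨q, hq⟩ | p) (⟨q', hq'⟩ | p') e
      · have := (he q hq).symm.trans ((congrArg (srcPt _) e).trans (he q' hq'))
        obtain rfl := eq_of_heq (Sigma.mk.inj (pL_injective this)).2
        rfl
      · exact (pL_ne_pR (p := srcPt v p') ((he q hq).symm.trans ((congrArg (srcPt _) e).trans (he' p')))).elim
      · exact (pL_ne_pR (p := srcPt v p) ((he q' hq').symm.trans ((congrArg (srcPt _) e.symm).trans (he' p)))).elim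
      · have := (he' p).symm.trans ((congrArg (srcPt _) e).trans (he' p'))
        obtain rfl := eq_of_heq (Sigma.mk.inj (pR_injective (p := srcPt v p) (p' := srcPt v p') rfl this)).2
        rfl
    · intro t
      rcases exists_eq_pL_or_pR (R := Q.repl) (P := srcPt u r) hv (srcPt _ t)
          (Q.repl.d_placed u.1 r v.1 (congrArg (fun x => x.1.1) h)).symm with
        ⟨⟨_, q⟩, e, ne, h'⟩ | ⟨⟨_, p⟩, e, h'⟩
      · cases e
        have hq : q ≠ r := fun e => ne (congrArg (Sigma.mk _) e)
        exact ⟨Sum.inl ⟨q, hq⟩, eq_of_heq (Sigma.mk.inj ((he q hq).trans h'.symm)).2⟩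
      · cases e
        exact ⟨Sum.inr p, eq_of_heq (Sigma.mk.inj ((he' p).trans h'.symm)).2⟩
  src_inl u r v h q hq := Subtype.ext (Subtype.ext
    ((congrArg lb (srcPt_inl u v r h q hq (fits_of_c_eq (cod_eq_lb h)).d rfl)).trans (lb_pL _ _ _ _ _ _)))
  src_inr u r v h p := Subtype.ext (Subtype.ext
    ((congrArg lb (srcPt_inr u v r h p (fits_of_c_eq (cod_eq_lb h)).d)).trans (lb_pR _ _ _ _)))
  tgt_comp u r v h := Subtype.ext (Subtype.ext (Q.repl.c_placed u.1 r v.1 (cod_eq_lb h)))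
  pos_one x := by
    have hx : A.d n n.le_succ (A.one (n + 1) n.le_succ x.1.1) ∈ A.indet n := by
      rw [A.d_one]; exact x.2
    exact (Q.occ.occ_indet _ hx).1
  src_one x p := by
    have hx : A.d n n.le_succ (A.one (n + 1) n.le_succ x.1.1) ∈ A.indet n := by
      rw [A.d_one]; exact x.2
    exact Subtype.ext (Subtype.ext (((Q.occ.occ_indet _ hx).2 p).trans (A.d_one _ _)))
  tgt_one x := Subtype.ext (Subtype.ext (A.c_one _ _))
  one_comp x r u h := by
    have hx : A.d n n.le_succ (A.one (n + 1) n.le_succ x.1.1) ∈ A.indet n := by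
      rw [A.d_one]; exact x.2
    change (srcPt ((A.multitopicData Q).one x) r).1 ∈ A.indet n at hx
    have e₁ := rp_indet (R := Q.repl) hx u.1 (fits_of_c_eq (cod_eq_lb h))
    have e₂ : ((A.multitopicData Q).comp ((A.multitopicData Q).one x) r u h).1 = u.1 :=
      (A.one_comp n.lt_succ_self _ _ _).trans e₁
    exact ⟨Subtype.ext e₂, fun p => same_pos e₂
      ((srcPt_inr _ u r h p (fits_of_c_eq (cod_eq_lb h)).d).trans (pR_indet hx _ _))⟩
  comp_one u r h := by
    have hv := cod_eq_lb (u := u) (r := r) h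
    have e₁ := rp_one (R := Q.repl) (srcPt u r) _ rfl (fits_of_c_eq hv)
    have e₂ : ((A.multitopicData Q).comp u r _ h).1 = u.1 :=
      (A.comp_congr n.lt_succ_self rfl e₁ _ (e₁ ▸ rp_composable' u _ r hv)).trans
        (A.comp_one n.lt_succ_self _ _ _)
    have e₃ : A.d n n.le_succ (A.one (n + 1) n.le_succ (lb (srcPt u r))) = lb (srcPt u r) := A.d_one _ _
    exact ⟨Subtype.ext e₂, fun p hp => same_pos e₂ ((srcPt_inl u _ r h p hp (fits_of_c_eq hv).d rfl).trans
      (pL_lb _ _ _ e₃ _ _ _)), fun p => same_pos e₂ ((srcPt_inr u _ r h p (fits_of_c_eq hv).d).trans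
      (pR_lb _ _ e₃ _))⟩
  comm u r q hqr hrq v w hv hw hw' hv' := by
    have hP := cod_eq_lb (u := u) hv
    have hQ := cod_eq_lb (u := u) hw
    have e₀ : (_ : A.C (n + 1)) = _ := (comp_comp_inl u v w r q hqr hv hw hw' (c_rpTwo (P := srcPt u r)).symm).trans
      ((A.comp_congr _ rfl (rpTwo_comm (srcPt u r) (srcPt u q) rfl _ rfl (srcPt_ne hrq) _ _ _ _) _
        (c_rpTwo (P := srcPt u q)).symm).trans
        (comp_comp_inl u w v q r hrq hw hv hv' (c_rpTwo (P := srcPt u q)).symm).symm)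
    have i₁ := fun p (hp : p ≠ r) => srcPt_inl u v r hv p hp (fits_of_c_eq hP).d rfl
    have i₂ := fun p (hp : p ≠ q) => srcPt_inl u w q hw p hp (fits_of_c_eq hQ).d rfl
    have i₃ := fun p => srcPt_inr u v r hv p (fits_of_c_eq hP).d
    have i₄ := fun p => srcPt_inr u w q hw p (fits_of_c_eq hQ).d
    have f₁ := fits_to_pL (R := Q.repl) (P := srcPt u r) (Q := srcPt u q) (hv := (fits_of_c_eq hP).d) (e := rfl)
      (ne := srcPt_ne hqr) (fits_of_c_eq hQ).d
    have f₂ := fits_to_pL (R := Q.repl) (P := srcPt u q) (Q := srcPt u r) (hv := (fits_of_c_eq hQ).d) (e := rfl)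
      (ne := srcPt_ne hrq) (fits_of_c_eq hP).d
    refine ⟨Subtype.ext e₀, fun p hp hp' hp₁ hp₂ => same_pos e₀ ?_, fun p hp₁ => same_pos e₀ ?_,
      fun p hp₂ => same_pos e₀ ?_⟩
    · refine (srcPt_inl _ w _ hw' _ hp₁ (fits_of_c_eq (cod_eq_lb hw')).d rfl).trans
        (Eq.trans ?_ (srcPt_inl _ v _ hv' _ hp₂ (fits_of_c_eq (cod_eq_lb hv')).d rfl).symm)
      have n₁ : Q.repl.pL (srcPt u r) (srcPt u p) _ (fits_of_c_eq hP).d rfl (srcPt_ne hp) ≠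
          Q.repl.pL (srcPt u r) (srcPt u q) _ (fits_of_c_eq hP).d rfl (srcPt_ne hqr) := fun h =>
        srcPt_ne hp' (pL_injective h)
      have n₂ : Q.repl.pL (srcPt u q) (srcPt u p) _ (fits_of_c_eq hQ).d rfl (srcPt_ne hp') ≠
          Q.repl.pL (srcPt u q) (srcPt u r) _ (fits_of_c_eq hQ).d rfl (srcPt_ne hrq) := fun h =>
        srcPt_ne hp (pL_injective h)
      exact (pL_congr (i₁ q hqr) (i₁ p hp) rfl _ f₁ _ rfl _ n₁).trans
        ((pL_pL_comm (srcPt u r) (srcPt u q) (srcPt u p) _ _ rfl _ rfl (srcPt_ne hrq) rfl _ rfl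
          (srcPt_ne hp') _ _ f₂ f₁ rfl n₁ rfl n₂).trans
          (pL_congr (i₂ r hrq) (i₂ p hp') rfl _ f₂ _ rfl _ n₂).symm)
    · refine (srcPt_inl _ w _ hw' _ hp₁ (fits_of_c_eq (cod_eq_lb hw')).d rfl).trans
        (Eq.trans ?_ (srcPt_inr _ v _ hv' _ (fits_of_c_eq (cod_eq_lb hv')).d).symm)
      have n₁ : Q.repl.pR le_rfl (srcPt u r) (srcPt v p) (fits_of_c_eq hP).d ≠
          Q.repl.pL (srcPt u r) (srcPt u q) _ (fits_of_c_eq hP).d rfl (srcPt_ne hqr) := fun h =>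
        pL_ne_pR (p := srcPt v p) h.symm
      exact (pL_congr (i₁ q hqr) (i₃ p) rfl _ f₁ _ rfl _ n₁).trans
        ((pL_pR_comm (srcPt u r) (srcPt u q) (srcPt v p) _ rfl _ rfl (srcPt_ne hrq) _ _ f₂ f₁ _ _).trans
          (pR_congr (i₂ r hrq) rfl _ f₂).symm)
    · refine (srcPt_inr _ w _ hw' _ (fits_of_c_eq (cod_eq_lb hw')).d).trans
        (Eq.trans ?_ (srcPt_inl _ v _ hv' _ hp₂ (fits_of_c_eq (cod_eq_lb hv')).d rfl).symm)
      have n₁ : Q.repl.pR le_rfl (srcPt u q) (srcPt w p) (fits_of_c_eq hQ).d ≠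
          Q.repl.pL (srcPt u q) (srcPt u r) _ (fits_of_c_eq hQ).d rfl (srcPt_ne hrq) := fun h =>
        pL_ne_pR (p := srcPt w p) h.symm
      exact ((pL_congr (i₂ r hrq) (i₄ p) rfl _ f₂ _ rfl _ n₁).trans
        ((pL_pR_comm (srcPt u q) (srcPt u r) (srcPt w p) _ rfl _ rfl (srcPt_ne hqr) _ _ f₁ f₂ _ _).trans
          (pR_congr (i₁ q hqr) rfl _ f₁).symm)).symm
  assoc u r v q w hv hw hw' hv' := by
    have e₀ := comp_comp_inr u v w r q hv hw hw' hv'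
    have hP := cod_eq_lb (u := u) hv
    have hQ := cod_eq_lb (u := v) hw
    have hP' := cod_eq_lb (u := u) hv'
    have i₁ := fun p (hp : p ≠ r) => srcPt_inl u v r hv p hp (fits_of_c_eq hP).d rfl
    have i₂ := fun p (hp : p ≠ q) => srcPt_inl v w q hw p hp (fits_of_c_eq hQ).d rfl
    have i₃ := fun p => srcPt_inr u v r hv p (fits_of_c_eq hP).d
    have i₄ := fun p => srcPt_inr v w q hw p (fits_of_c_eq hQ).d
    have f₁ := (i₃ q) ▸ (fits_of_c_eq (cod_eq_lb hw')).d
    have ed : A.d n n.le_succ ((A.multitopicData Q).comp v q w hw).1 =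
        Q.repl.rp le_rfl (srcPt v q) _ (fits_of_c_eq hQ).d := (Q.repl.d_placed v.1 q w.1 hQ).symm
    have f₂ := ed ▸ (fits_of_c_eq hP').d
    refine ⟨Subtype.ext e₀, fun p hp hp₁ => same_pos e₀ ?_, fun p hp hp₁ => same_pos e₀ ?_,
      fun p => same_pos e₀ ?_⟩
    · refine (srcPt_inl _ w _ hw' _ hp₁ (fits_of_c_eq (cod_eq_lb hw')).d rfl).trans
        (Eq.trans ?_ (srcPt_inl _ _ _ hv' _ hp (fits_of_c_eq hP').d rfl).symm)
      have n₁ : Q.repl.pL (srcPt u r) (srcPt u p) _ (fits_of_c_eq hP).d rfl (srcPt_ne hp) ≠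
          Q.repl.pR le_rfl (srcPt u r) (srcPt v q) (fits_of_c_eq hP).d := fun h =>
        pL_ne_pR (p := srcPt v q) h
      exact (pL_congr (i₃ q) (i₁ p hp) rfl _ f₁ _ rfl _ n₁).trans
        ((pL_pR_pL (srcPt u r) (srcPt u p) (srcPt v q) _ _ _ (fits_of_c_eq hQ).d f₂ rfl (srcPt_ne hp) _
          _).trans (pL_congr rfl rfl ed.symm _ _ _ _ _ _))
    · refine (srcPt_inl _ w _ hw' _ hp₁ (fits_of_c_eq (cod_eq_lb hw')).d rfl).trans
        (Eq.trans ?_ (srcPt_inr _ _ _ hv' _ (fits_of_c_eq hP').d).symm)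
      have n₁ : Q.repl.pR le_rfl (srcPt u r) (srcPt v p) (fits_of_c_eq hP).d ≠
          Q.repl.pR le_rfl (srcPt u r) (srcPt v q) (fits_of_c_eq hP).d := fun h =>
        srcPt_ne hp (pR_injective rfl h)
      exact (pL_congr (i₃ q) (i₃ p) rfl _ f₁ _ rfl _ n₁).trans
        ((pL_pR_pR (srcPt u r) (srcPt v q) (srcPt v p) _ _ _ _ (fits_of_c_eq hQ).d rfl (srcPt_ne hp) f₂ _
          _).trans (pR_congr rfl (i₂ p hp).symm _ _))
    · refine (srcPt_inr _ w _ hw' _ (fits_of_c_eq (cod_eq_lb hw')).d).trans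
        (Eq.trans ?_ (srcPt_inr _ _ _ hv' _ (fits_of_c_eq hP').d).symm)
      exact (pR_congr (i₃ q) rfl _ f₁).trans
        ((pR_pR (srcPt u r) (srcPt v q) _ (srcPt w p) _ (fits_of_c_eq hQ).d f₂).trans
          (pR_congr rfl (i₄ p).symm _ _))

end

end ManyToOneComputad

namespace ManyToOneComputad

open Computad Computad.OccSystem Computad.OccSystem.Replacement

variable {A : ManyToOneComputad.{u}} {Q : A.Parametrization}

theorem isOccSystem (A : ManyToOneComputad.{u}) (Q : A.Parametrization) :
    (A.multitopicData Q).IsOccSystem where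
  finite_occ u := Q.occ.finite_occ _
  occ_indet x hx := ⟨(Q.occ.occ_indet _ hx).1, fun r => Subtype.ext ((Q.occ.occ_indet _ hx).2 r)⟩
  occ_one x := Q.occ.occ_one _
  bijective {n} u r v h := by
    have hv := fits_of_c_eq (cod_eq_lb h)
    have hc := rp_composable' u v r (cod_eq_lb h)
    have hb := Q.occ.bijective n.lt_succ_self u.1 _ hc
    have he : ∀ p, (⟨_, Q.repl.repR n.le_succ _ r v.1 hv p⟩ : Q.occ.Pt (n + 1)) =
      Q.repl.pR n.le_succ (srcPt u r) ⟨v.1, p⟩ hv := fun p => rfl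
    have hR : Function.Bijective (Q.repl.repR n.le_succ _ r v.1 hv) := by
      constructor
      · intro p p' e
        have := pR_injective (R := Q.repl) (P := srcPt u r) (p := ⟨v.1, p⟩) (p' := ⟨v.1, p'⟩) (hv := hv)
          (hv' := hv) rfl (congrArg (Sigma.mk _) e)
        exact eq_of_heq (Sigma.mk.inj this).2
      · intro t
        obtain ⟨⟨w, p⟩, e, h'⟩ := exists_eq_pR (R := Q.repl) n.lt_succ_self (P := srcPt u r) hv ⟨_, t⟩ rfl
        cases e
        exact ⟨p, (eq_of_heq (Sigma.mk.inj h').2).symm⟩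
    have hs : Sum.elim ((A.multitopicData Q).occL u r v h) ((A.multitopicData Q).occR u r v h) =
        Sum.elim (Q.occ.occL n.lt_succ_self u.1 _ hc) (Q.occ.occR n.lt_succ_self u.1 _ hc) ∘
          Sum.map id (Q.repl.repR n.le_succ _ r v.1 hv) := by
      funext x; cases x <;> rfl
    rw [hs]
    exact hb.comp (Function.bijective_id.sumMap hR)
  lab_occL u r v h p := Subtype.ext (Subtype.ext (Q.occ.lab_occL _ _ _ _ _))
  lab_occR {n} u r v h p := Subtype.ext (Subtype.ext ((Q.occ.lab_occR n.lt_succ_self _ _ _ _).trans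
    (lb_pR (R := Q.repl) n.le_succ (srcPt u r) ⟨v.1, p⟩ (fits_of_c_eq (cod_eq_lb h)))))
  one_comp {n} x r u h p := by
    have hx : A.d n n.le_succ (A.one (n + 1) n.le_succ x.1.1) ∈ A.indet n := by
      rw [A.d_one]; exact x.2
    exact same_occ ((cR_one n.lt_succ_self rfl (Q.repl.pR n.le_succ (srcPt ((A.multitopicData Q).one x) r)
      ⟨u.1, p⟩ (fits_of_c_eq (cod_eq_lb h))) _).trans
      (pR_indet (P := srcPt ((A.multitopicData Q).one x) r) hx _ _))
  comp_one {n} u r h p := same_occ (cL_one n.lt_succ_self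
    (rp_one (R := Q.repl) (srcPt u r) _ rfl (fits_of_c_eq (cod_eq_lb h))) ⟨u.1, p⟩ _)
  comm {n} u r q hqr hrq v w hv hw hw' hv' := by
    have hP := cod_eq_lb (u := u) hv
    have hQ := cod_eq_lb (u := u) hw
    have h₁ := rpTwo_comm (R := Q.repl) (srcPt u r) (srcPt u q) rfl (srcPt_ne hqr) rfl (srcPt_ne hrq)
      v.1 w.1 hP hQ
    have c₁ : A.d n n.le_succ u.1 = _ := (c_rpTwo (R := Q.repl) (P := srcPt u r) (P' := srcPt u q) (e := rfl) (ne := srcPt_ne hqr)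
      (hv := hP) (hw := hQ)).symm
    have c₂ : A.d n n.le_succ u.1 = _ := (c_rpTwo (R := Q.repl) (P := srcPt u q) (P' := srcPt u r) (e := rfl) (ne := srcPt_ne hrq)
      (hv := hQ) (hw := hP)).symm
    refine ⟨fun p => same_occ ?_, fun p => same_occ ?_, fun p => same_occ ?_⟩
    · exact (occL_occL_inl u v w r q hqr hv hw hw' p c₁).trans ((cL_congr _ rfl h₁ c₁ c₂).trans
        (occL_occL_inl u w v q r hrq hw hv hv' p c₂).symm)
    · exact (occL_occR_inl u v w r q hqr hv hw hw' p c₁).trans ((cR_congr _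
        (pTwo_comm (srcPt u r) (srcPt u q) rfl (srcPt_ne hqr) rfl (srcPt_ne hrq) ⟨v.1, p⟩ w.1 hP hQ)
          rfl c₁ c₂).trans (occR_inl u w v q r hrq hw hv hv' p c₂).symm)
    · exact (occR_inl u v w r q hqr hv hw hw' p c₁).trans ((cR_congr _
        (pTwo_comm (srcPt u q) (srcPt u r) rfl (srcPt_ne hrq) rfl (srcPt_ne hqr) ⟨w.1, p⟩ v.1 hQ hP).symm
          rfl c₁ c₂).trans (occL_occR_inl u w v q r hrq hw hv hv' p c₂).symm)
  assoc u r v q w hv hw hw' hv' :=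
    ⟨fun p => same_occ (occL_occL_inr u v w r q hv hw hw' hv' p),
      fun p => same_occ (occL_occR_inr u v w r q hv hw hw' hv' p),
      fun p => same_occ (occR_inr u v w r q hv hw hw' hv' p)⟩

theorem fits_of_par {n : ℕ} {u v : (A.multitopicData Q).P n} (h : (A.multitopicData Q).Par u v) :
    A.Fits le_rfl u.1 v.1 := by
  cases n with
  | zero => exact fun k hk => (Nat.not_lt_zero k hk).elim
  | succ n =>
    intro k hk
    have h₁ : A.d n n.le_succ u.1 = A.d n n.le_succ v.1 := congrArg Subtype.val h.1
    have h₂ : A.c n n.le_succ u.1 = A.c n n.le_succ v.1 := congrArg (fun x => x.1.1) h.2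
    rcases Nat.lt_succ_iff_lt_or_eq.1 hk with hk' | rfl
    · have a := A.d_d hk'.le n.le_succ
      have b := A.c_c hk'.le n.le_succ
      exact ⟨(a _).symm.trans ((congrArg _ h₁).trans (a _)), (b _).symm.trans ((congrArg _ h₂).trans (b _))⟩
    · exact ⟨h₁, h₂⟩

theorem isManyToOne_rep {n : ℕ} (u : (A.multitopicData Q).P n) (r : Q.occ.Occ u.1) (v : A.C n)
    (hv : A.Fits le_rfl v (Q.occ.lab u.1 r)) : A.IsManyToOne (Q.repl.rep le_rfl u.1 r v hv) := by
  cases n with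
  | zero => trivial
  | succ n =>
    change A.c n _ _ ∈ A.indet n
    rw [Q.repl.c_rep le_rfl u.1 r v hv n n.lt_succ_self]
    exact u.2

theorem par_rep {n : ℕ} (u : (A.multitopicData Q).P n) (r : Q.occ.Occ u.1) (v : A.C n)
    (hv : A.Fits le_rfl v (Q.occ.lab u.1 r)) :
    (A.multitopicData Q).Par ⟨Q.repl.rep le_rfl u.1 r v hv, isManyToOne_rep u r v hv⟩ u := by
  cases n with
  | zero => trivial
  | succ n =>
    exact ⟨Subtype.ext (Q.repl.d_rep le_rfl u.1 r v hv n n.lt_succ_self),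
      Subtype.ext (Subtype.ext (Q.repl.c_rep le_rfl u.1 r v hv n n.lt_succ_self))⟩

/-- Replacement of occurrences in the many-to-one cells. -/
def replacement (A : ManyToOneComputad.{u}) (Q : A.Parametrization) :
    (A.multitopicData Q).Replacement where
  rep u r v h := ⟨Q.repl.rep le_rfl u.1 r v.1 (fits_of_par h), isManyToOne_rep u r v.1 _⟩
  repL u r v h q hq := Q.repl.repL u.1 r v.1 (fits_of_par h) q hq
  repR u r v h p := Q.repl.repR le_rfl u.1 r v.1 (fits_of_par h) p
  par_rep u r v h := par_rep u r v.1 _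
  rep_indet x r v h hx := by
    have := Q.repl.rep_indet le_rfl x.1 r v.1 (fits_of_par h) hx
    exact ⟨Subtype.ext this.1, fun p => same_occ (this.2 p)⟩
  rep_left {n} u j w hj r v hv hv' j' hjj hj' := by
    have e : A.d n n.le_succ (Q.repl.rep le_rfl u.1 r v.1 (fits_of_par hv)) = A.d n n.le_succ u.1 :=
      Q.repl.d_rep le_rfl u.1 r v.1 (fits_of_par hv) n n.lt_succ_self
    have ej : (⟨_, j'⟩ : Q.occ.Pt n) = srcPt u j := hjj.map Subtype.val (fun _ p => p)
    have hu := rp_composable' u w j (cod_eq_lb hj)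
    have hw := e.trans hu
    have hr : Q.repl.rp n.le_succ (srcPt u j) w.1 (fits_of_c_eq (cod_eq_lb hj)) =
      Q.repl.rep n.le_succ _ j' w.1 (fits_of_c_eq (congrArg (fun x => x.1.1) hj')) :=
      rp_congr (P' := ⟨_, j'⟩) ej.symm rfl _ _
    have hw' := hw.trans (congrArg _ hr)
    refine ⟨Subtype.ext ?_, fun q hq hq' => same_occ ?_, fun q hq' => same_occ ?_, fun p => same_occ ?_⟩
    · exact (rp_cL' (R := Q.repl) n.lt_succ_self (P := ⟨u.1, r⟩) v.1 hu (fits_of_par hv') (fits_of_par hv) hw).trans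
        (A.comp_congr _ rfl hr _ hw')
    · exact (pL_cL_cL (R := Q.repl) n.lt_succ_self ⟨u.1, r⟩ _ ⟨u.1, q⟩ v.1 hu hu (fits_of_par hv') (fits_of_par hv) rfl rfl
        (fun e => hq' (eq_of_heq (Sigma.mk.inj e).2)) (fun e => hq (eq_of_heq (Sigma.mk.inj e).2)) hw).trans
        (cL_congr _ rfl hr _ hw')
    · exact (pL_cL_cR_of_eq (R := Q.repl) n.lt_succ_self ⟨u.1, r⟩
        (Q.repl.pR n.le_succ (srcPt u j) ⟨w.1, q⟩ (fits_of_c_eq (cod_eq_lb hj))) rfl rfl v.1 hu hu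
        (fits_of_par hv') (fits_of_par hv) rfl (fun e => hq' (eq_of_heq (Sigma.mk.inj e).2)) hw).trans
        (cR_congr _ (pR_congr (P' := ⟨_, j'⟩) ej.symm rfl _ _) rfl _ hw')
    · exact (pR_cL' (R := Q.repl) n.lt_succ_self (P := ⟨u.1, r⟩) ⟨v.1, p⟩ hu (fits_of_par hv') (fits_of_par hv) hw).trans
        (cL_congr _ rfl hr _ hw')
  rep_right {n} u j w hj r v hv hv' hj' := by
    have hu := rp_composable' u w j (cod_eq_lb hj)
    have f := fits_of_c_eq (cod_eq_lb hj)
    have f' := fits_of_c_eq (congrArg (fun x => x.1.1) hj')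
    have hl := lb_pR (R := Q.repl) n.le_succ (srcPt u j) ⟨w.1, r⟩ f
    have g : A.Fits le_rfl v.1 (lb (Q.repl.pR n.le_succ (srcPt u j) ⟨w.1, r⟩ f)) := hl ▸ (fits_of_par hv)
    have hr : Q.repl.rp le_rfl (Q.repl.pR n.le_succ (srcPt u j) ⟨w.1, r⟩ f) v.1 g =
        Q.repl.rp n.le_succ (srcPt u j) (Q.repl.rep le_rfl w.1 r v.1 (fits_of_par hv)) f' :=
      rp_pR (srcPt u j) ⟨w.1, r⟩ f v.1 g (fits_of_par hv) f'
    have hw := rp_comp_R' (R := Q.repl) n.lt_succ_self hu g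
    have hw' := hw.trans (congrArg _ hr)
    refine ⟨Subtype.ext ?_, fun q hq hq' => same_occ ?_, fun q hq' => same_occ ?_, fun p => same_occ ?_⟩
    · exact (rp_cR' (R := Q.repl) n.lt_succ_self (P := Q.repl.pR n.le_succ (srcPt u j) ⟨w.1, r⟩ f) v.1 hu
        (fits_of_par hv') g hw).trans (A.comp_congr _ rfl hr _ hw')
    · have n₁ : (⟨w.1, q⟩ : Q.occ.Pt (n + 1)) ≠ ⟨w.1, r⟩ := fun e => hq (eq_of_heq (Sigma.mk.inj e).2)
      have n₂ : Q.repl.pR n.le_succ (srcPt u j) ⟨w.1, q⟩ f ≠ Q.repl.pR n.le_succ (srcPt u j) ⟨w.1, r⟩ f :=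
        fun h => n₁ (pR_injective (p := ⟨w.1, q⟩) (p' := ⟨w.1, r⟩) rfl h)
      exact (pL_cR_cR (R := Q.repl) n.lt_succ_self (Q.repl.pR n.le_succ (srcPt u j) ⟨w.1, r⟩ f) _
        (Q.repl.pR n.le_succ (srcPt u j) ⟨w.1, q⟩ f) v.1 hu hu (fits_of_par hv') g rfl rfl
        (fun e => hq' (eq_of_heq (Sigma.mk.inj e).2)) n₂ hw).trans
        (cR_congr _ (pL_pR_pR (srcPt u j) ⟨w.1, r⟩ ⟨w.1, q⟩ f f v.1 g (fits_of_par hv) rfl n₁ f' rfl n₂) rfl _ hw')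
    · exact (pL_cR_cL_of_eq (R := Q.repl) n.lt_succ_self (Q.repl.pR n.le_succ (srcPt u j) ⟨w.1, r⟩ f)
        ⟨u.1, q⟩ rfl rfl v.1 hu hu (fits_of_par hv') g rfl (fun e => hq' (eq_of_heq (Sigma.mk.inj e).2)) hw).trans
        (cL_congr _ rfl hr _ hw')
    · exact (pR_cR' (R := Q.repl) n.lt_succ_self (P := Q.repl.pR n.le_succ (srcPt u j) ⟨w.1, r⟩ f) ⟨v.1, p⟩
        hu (fits_of_par hv') g hw).trans
        (cR_congr _ (pR_pR (srcPt u j) ⟨w.1, r⟩ f ⟨v.1, p⟩ g (fits_of_par hv) f') rfl _ hw')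

theorem isMultitopicSet_of_isFreeOn (A : ManyToOneComputad.{u}) (Q : A.Parametrization)
    (hfree : ∀ n, ((A.multitopicData Q).mc n).IsFreeOn ((A.multitopicData Q).indet (n + 1))) :
    (A.multitopicData Q).IsMultitopicSet where
  indet_zero := by
    ext x
    simp only [Set.mem_univ, iff_true]
    change x.1 ∈ A.indet 0
    rw [A.indet_zero]; trivial
  isMulticategory := isMulticategory_mc A Q
  isFreeOn := hfree
  isOccSystem := isOccSystem A Q
  d_one x := Subtype.ext (A.d_one _ _)
  c_one x := Subtype.ext (Subtype.ext (A.c_one _ _))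
  d_d {n} u := Subtype.ext ((A.d_d n.le_succ (n + 1).le_succ u.1).trans
    (A.d_c n.lt_succ_self (n + 1).le_succ u.1).symm)
  c_d {n} u := Subtype.ext (Subtype.ext ((A.c_d n.lt_succ_self (n + 1).le_succ u.1).trans
    (A.c_c n.le_succ (n + 1).le_succ u.1).symm))
  d_comp := ⟨replacement A Q, fun {n} u r v h h' =>
    ⟨Subtype.ext (Q.repl.d_placed u.1 r v.1 (cod_eq_lb h)).symm,
      fun q hq => same_occ (srcPt_inl u v r h q hq (fits_of_par h') rfl),
      fun p => same_occ (srcPt_inr u v r h p (fits_of_par h'))⟩⟩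
  c_comp u r v h := Subtype.ext (Subtype.ext (Q.repl.c_placed u.1 r v.1 (cod_eq_lb h)))

end ManyToOneComputad

namespace Computad.OccSystem.Replacement

variable {A : Computad.{u}} {O : A.OccSystem}

/-- The cells that are obtained by top-dimensional composition from the identities and from the cells
`b □_r x` for indeterminates `x`. -/
inductive Placed (R : O.Replacement) {n : ℕ} : A.C (n + 1) → Prop
  | one (b : A.C n) : Placed R (A.one (n + 1) n.le_succ b)
  | rp (P : O.Pt n) (x : A.C (n + 1)) (hx : x ∈ A.indet (n + 1)) (h : A.c n n.le_succ x = lb P) :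
      Placed R (R.rp n.le_succ P x (fits_of_c_eq h))
  | comp (a b : A.C (n + 1)) (h : A.d n n.le_succ a = A.c n n.le_succ b) : Placed R a → Placed R b →
      Placed R (A.comp n n.lt_succ_self a b h)

namespace Placed

variable {R : O.Replacement} {n k : ℕ} (hk : k < n) (hk' : k < n + 1)
include hk

theorem whisker_right {a : A.C (n + 1)} (ha : Placed R a) (s : A.C n)
    (h : A.d k hk'.le a = A.c k hk'.le (A.one (n + 1) n.le_succ s)) :
    Placed R (A.comp k hk' a (A.one (n + 1) n.le_succ s) h) := by
  have hs : A.c k hk'.le (A.one (n + 1) n.le_succ s) = A.c k hk.le s := A.c_one_of_le hk.le _ s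
  induction ha with
  | one b =>
    have h' : A.d k hk.le b = A.c k hk.le s := (A.d_one_of_le hk.le _ b).symm.trans (h.trans hs)
    rw [A.one_comp_one hk n.le_succ b s h' h]
    exact .one _
  | rp P x hx e =>
    have h' : A.d k hk.le P.1 = A.c k hk.le s :=
      ((R.d_rep n.le_succ P.1 P.2 x (fits_of_c_eq e) k hk).symm.trans h).trans hs
    rw [← rp_cL (R := R) (h := n.le_succ) hk P s x h' (fits_to_cL (fits_of_c_eq e)) (fits_of_c_eq e) h]
    exact .rp (O.cL hk P s h') x hx (e.trans (lb_cL hk P s h').symm)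
  | comp a b e _ _ iha ihb =>
    have ha : A.d k hk'.le a = A.c k hk'.le (A.one (n + 1) n.le_succ s) := by
      rw [← A.d_d hk.le n.le_succ, e, A.d_c hk, ← h, ← A.d_d hk.le n.le_succ (A.comp _ _ _ _ _),
        A.d_comp, A.d_d]
    have hb : A.d k hk'.le b = A.c k hk'.le (A.one (n + 1) n.le_succ s) := by
      rw [← A.d_d hk.le n.le_succ, ← A.d_comp n.lt_succ_self a b e, A.d_d, h]
    rw [← A.comp_whisker_right hk hk' a b s ha hb]
    · exact .comp _ _ _ (iha ha) (ihb hb)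
    · rw [A.d_comp_of_lt hk' hk n.le_succ _ _ ha (A.composable_d hk n.le_succ ha),
        A.c_comp_of_lt hk' hk n.le_succ _ _ hb (A.composable_c hk n.le_succ hb)]
      exact A.comp_congr hk e ((A.d_one _ _).trans (A.c_one _ _).symm) _ _

theorem whisker_left {a : A.C (n + 1)} (ha : Placed R a) (s : A.C n)
    (h : A.d k hk'.le (A.one (n + 1) n.le_succ s) = A.c k hk'.le a) :
    Placed R (A.comp k hk' (A.one (n + 1) n.le_succ s) a h) := by
  have hs : A.d k hk'.le (A.one (n + 1) n.le_succ s) = A.d k hk.le s := A.d_one_of_le hk.le _ s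
  induction ha with
  | one b =>
    have h' : A.d k hk.le s = A.c k hk.le b := hs.symm.trans (h.trans (A.c_one_of_le hk.le _ b))
    rw [A.one_comp_one hk n.le_succ s b h' h]
    exact .one _
  | rp P x hx e =>
    have h' : A.d k hk.le s = A.c k hk.le P.1 :=
      (hs.symm.trans h).trans (R.c_rep n.le_succ P.1 P.2 x (fits_of_c_eq e) k hk)
    rw [← rp_cR (R := R) (h := n.le_succ) hk P s x h' (fits_to_cR (fits_of_c_eq e)) (fits_of_c_eq e) h]
    exact .rp (O.cR hk s P h') x hx (e.trans (lb_cR hk s P h').symm)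
  | comp a b e _ _ iha ihb =>
    have ha : A.d k hk'.le (A.one (n + 1) n.le_succ s) = A.c k hk'.le a := by
      rw [← A.c_c hk.le n.le_succ, ← A.c_comp n.lt_succ_self a b e, A.c_c, h]
    have hb : A.d k hk'.le (A.one (n + 1) n.le_succ s) = A.c k hk'.le b := by
      rw [ha, ← A.c_d hk n.le_succ, e, A.c_c]
    rw [← A.comp_whisker_left hk hk' s a b ha hb]
    · exact .comp _ _ _ (iha ha) (ihb hb)
    · rw [A.d_comp_of_lt hk' hk n.le_succ _ _ ha (A.composable_d hk n.le_succ ha),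
        A.c_comp_of_lt hk' hk n.le_succ _ _ hb (A.composable_c hk n.le_succ hb)]
      exact A.comp_congr hk ((A.d_one _ _).trans (A.c_one _ _).symm) e _ _

end Placed
end Computad.OccSystem.Replacement

namespace ManyToOneComputad

open Computad Computad.OccSystem Computad.OccSystem.Replacement

variable {A : ManyToOneComputad.{u}}

theorem placed_cell {O : A.toComputad.OccSystem} (R : O.Replacement) {n : ℕ} (u : A.C (n + 1)) :
    Placed R u := by
  refine (A.free n).induction (Placed R) (fun x hx => ?_) (fun a => .one a) (fun k hk u v h hu hv => ?_) u
  · have hc := A.cod_indet n x hx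
    obtain ⟨r, -, -⟩ := (O.occ_indet _ hc).1
    have h : A.c n n.le_succ x = lb (⟨_, r⟩ : O.Pt n) := (lb_of_indet (P := ⟨_, r⟩) hc).symm
    have := Placed.rp (R := R) ⟨_, r⟩ x hx h
    rwa [rp_indet (R := R) (P := ⟨_, r⟩) hc] at this
  · rcases Nat.lt_succ_iff_lt_or_eq.1 hk with hk' | rfl
    · have h₁ : A.d k hk.le u = A.c k hk.le (A.one (n + 1) n.le_succ (A.c n n.le_succ v)) := by
        rw [A.c_one_of_le hk'.le, A.c_c, h]
      have h₂ : A.d k hk.le (A.one (n + 1) n.le_succ (A.d n n.le_succ u)) = A.c k hk.le v := by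
        rw [A.d_one_of_le hk'.le, A.d_d, h]
      rw [← A.whisker_comp_whisker hk' hk u v rfl rfl h₁ h₂]
      · exact .comp _ _ _ (hu.whisker_right hk' hk _ h₁) (hv.whisker_left hk' hk _ h₂)
      · rw [A.d_comp_of_lt hk hk' n.le_succ _ _ h₁ (A.composable_d hk' n.le_succ h₁),
          A.c_comp_of_lt hk hk' n.le_succ _ _ h₂ (A.composable_c hk' n.le_succ h₂)]
        exact A.comp_congr hk' (A.c_one _ _ |>.symm) (A.d_one _ _) _ _
    · exact .comp _ _ _ hu hv

variable {Q : A.Parametrization}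

/-- Every many-to-one cell is obtained from an identity by placed composition with indeterminates. -/
theorem arrow_induction {n : ℕ} (p : (A.multitopicData Q).P (n + 1) → Prop)
    (hone : ∀ x, p ((A.multitopicData Q).one x))
    (hcomp : ∀ u r v h, v ∈ (A.multitopicData Q).indet (n + 1) → p u → p ((A.multitopicData Q).comp u r v h))
    (u : (A.multitopicData Q).P (n + 1)) : p u := by
  have hp : ∀ {a b : (A.multitopicData Q).P (n + 1)}, a.1 = b.1 → p a → p b := fun e h =>
    Subtype.ext e ▸ h
  have key : ∀ {w : A.C (n + 1)}, Placed Q.repl w → ∀ (u : (A.multitopicData Q).P (n + 1))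
      (h : A.d n n.le_succ u.1 = A.c n n.le_succ w) (hm), p u →
      p ⟨A.comp n n.lt_succ_self u.1 w h, hm⟩ := by
    intro w hw
    induction hw with
    | one b =>
      intro u h hm hu
      exact hp (A.comp_one _ _ _ _).symm hu
    | rp P x hx e =>
      intro u h hm hu
      have hP : P.1 = A.d n n.le_succ u.1 := by
        exact (h.trans ((Q.repl.c_rep_succ _ _ _ _).trans (rp_lb (R := Q.repl) P _ e _))).symm
      obtain ⟨b, r⟩ := P
      cases hP
      have := hcomp u r ⟨x, A.cod_indet n x hx⟩ (Subtype.ext (Subtype.ext e)) hx hu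
      exact this
    | comp a b e _ _ iha ihb =>
      intro u h hm hu
      have ha : A.d n n.le_succ u.1 = A.c n n.le_succ a := h.trans (A.c_comp _ _ _ _)
      have hb : A.d n n.le_succ (A.comp n n.lt_succ_self u.1 a ha) = A.c n n.le_succ b := by
        rw [A.d_comp, e]
      have hma : A.IsManyToOne (A.comp n n.lt_succ_self u.1 a ha) := by
        change A.c n n.le_succ _ ∈ A.indet n
        rw [A.c_comp]; exact u.2
      have hmb : A.IsManyToOne (A.comp n n.lt_succ_self _ b hb) := by
        change A.c n n.le_succ _ ∈ A.indet n
        rw [A.c_comp]; exact hma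
      exact hp (A.assoc _ _ _ _ _ _ _ _) (ihb ⟨_, hma⟩ hb hmb (iha u ha hma hu))
  have h : A.d n n.le_succ (A.one (n + 1) n.le_succ (A.c n n.le_succ u.1)) = A.c n n.le_succ u.1 :=
    A.d_one _ _
  have hm : A.IsManyToOne (A.comp n n.lt_succ_self _ u.1 h) := by
    rw [A.one_comp]; exact u.2
  exact hp (A.one_comp _ _ _ _)
    (key (placed_cell Q.repl u.1) ((A.multitopicData Q).one ((A.multitopicData Q).c u)) h hm (hone _))

end ManyToOneComputad

namespace MultiCatData

variable {N : MultiCatData.{u}}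

theorem IsMulticategory.exists_elim (hN : N.IsMulticategory) (u : N.Arr) (r) (v) (h) {Y : Type*}
    (f : ∀ q : N.Pos u, q ≠ r → Y) (g : N.Pos v → Y) :
    ∃ ℓ : N.Pos (N.comp u r v h) → Y, (∀ q hq, ℓ (N.inl u r v h q hq) = f q hq) ∧
      ∀ p, ℓ (N.inr u r v h p) = g p := by
  let e := Equiv.ofBijective _ (hN.bijective u r v h)
  refine ⟨fun s => Sum.elim (fun q => f q.1 q.2) g (e.symm s), fun q hq => ?_, fun p => ?_⟩
  · have : e.symm (N.inl u r v h q hq) = Sum.inl ⟨q, hq⟩ := e.symm_apply_eq.2 rfl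
    simp only [this, Sum.elim_inl]
  · have : e.symm (N.inr u r v h p) = Sum.inr p := e.symm_apply_eq.2 rfl
    simp only [this, Sum.elim_inr]

theorem IsMulticategory.pos_cases (hN : N.IsMulticategory) {u : N.Arr} {r} {v} {h}
    (s : N.Pos (N.comp u r v h)) :
    (∃ q hq, s = N.inl u r v h q hq) ∨ ∃ p, s = N.inr u r v h p := by
  obtain ⟨q | p, rfl⟩ := (hN.bijective u r v h).2 s
  · exact Or.inl ⟨q.1, q.2, rfl⟩
  · exact Or.inr ⟨p, rfl⟩

theorem IsMulticategory.inl_ne (hN : N.IsMulticategory) {u : N.Arr} {r} {v} {h} {q q' : N.Pos u} {hq hq'}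
    (e : q ≠ q') : N.inl u r v h q hq ≠ N.inl u r v h q' hq' := fun e' => e (by
  have := @(hN.bijective u r v h).1 (Sum.inl ⟨q, hq⟩) (Sum.inl ⟨q', hq'⟩) e'
  exact congrArg Subtype.val (Sum.inl.inj this))

theorem IsMulticategory.inl_ne_inr (hN : N.IsMulticategory) {u : N.Arr} {r} {v} {h} {q : N.Pos u} {hq p} :
    N.inl u r v h q hq ≠ N.inr u r v h p := fun e' => by
  have := @(hN.bijective u r v h).1 (Sum.inl ⟨q, hq⟩) (Sum.inr p) e'
  cases this

/-- Arrows whose positions are labelled by addresses. -/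
abbrev Labelled (N : MultiCatData.{u}) := Σ a : N.Arr, (N.Pos a → List ℕ)

theorem Labelled.exists_of_eq (t : N.Labelled) {b : N.Arr} (e : t.1 = b) :
    ∃ ℓ : N.Pos b → List ℕ, t = ⟨b, ℓ⟩ := by
  subst e; exact ⟨_, rfl⟩

theorem Labelled.label_eq {a b : N.Arr} {ℓ : N.Pos a → List ℕ} {ℓ' : N.Pos b → List ℕ}
    (e : (⟨a, ℓ⟩ : N.Labelled) = ⟨b, ℓ'⟩) {p : N.Pos a} {q : N.Pos b} (h : Same N.Pos p q) : ℓ' q = ℓ p := by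
  cases e; obtain rfl := eq_of_heq (Sigma.mk.inj h).2; rfl

variable {I : Type*} (φ : I → N.Arr) (e : ∀ i, N.Pos (φ i) → ℕ)

/-- `t` is the result of grafting the arrow `φ z.2` at the position of `s` with the address `z.1`. -/
def Graft (z : List ℕ × I) (s t : N.Labelled) : Prop :=
  ∃ (r : N.Pos s.1) (h : N.tgt (φ z.2) = N.ty (N.src s.1 r))
    (ℓ : N.Pos (N.comp s.1 r (φ z.2) h) → List ℕ), s.2 r = z.1 ∧ t = ⟨_, ℓ⟩ ∧
    (∀ q hq, ℓ (N.inl s.1 r (φ z.2) h q hq) = s.2 q) ∧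
    ∀ p, ℓ (N.inr s.1 r (φ z.2) h p) = z.1 ++ [e z.2 p]

/-- Labelled arrows that are built from an identity by successive graftings, the last of which is the
first one in the list. -/
inductive Built (y : N.Obj) : List (List ℕ × I) → N.Labelled → Prop
  | nil : Built y [] ⟨N.one y, fun _ => []⟩
  | cons (z : List ℕ × I) (l : List (List ℕ × I)) (s t : N.Labelled) : Built y l s → Graft φ e z s t →
      Built y (z :: l) t

variable {φ e}

theorem exists_graft (hN : N.IsMulticategory) (i : I) (s : N.Labelled) (r : N.Pos s.1)
    (h : N.tgt (φ i) = N.ty (N.src s.1 r)) : ∃ ℓ, Graft φ e (s.2 r, i) s ⟨N.comp s.1 r (φ i) h, ℓ⟩ ∧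
      (∀ q hq, ℓ (N.inl s.1 r (φ i) h q hq) = s.2 q) ∧
      ∀ p, ℓ (N.inr s.1 r (φ i) h p) = s.2 r ++ [e i p] := by
  obtain ⟨ℓ, h₁, h₂⟩ := hN.exists_elim s.1 r (φ i) h (fun q _ => s.2 q) (fun p => s.2 r ++ [e i p])
  exact ⟨ℓ, ⟨r, h, ℓ, rfl, rfl, h₁, h₂⟩, h₁, h₂⟩

theorem Built.prefix_free (hN : N.IsMulticategory) (he : ∀ i, Function.Injective (e i)) {y : N.Obj}
    {l : List (List ℕ × I)} {s : N.Labelled} (hs : Built φ e y l s) :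
    (∀ q q', s.2 q <+: s.2 q' → q = q') ∧ ∀ q, ∀ z ∈ l, ¬ s.2 q <+: z.1 := by
  induction hs with
  | nil =>
    refine ⟨fun q q' _ => ?_, fun q z hz => (List.not_mem_nil hz).elim⟩
    obtain ⟨_, -, h⟩ := hN.pos_one y
    exact (h q trivial).trans (h q' trivial).symm
  | cons z l s t _ hg ih =>
    obtain ⟨ih₁, ih₂⟩ := ih
    obtain ⟨r, h, ℓ, hr, rfl, h₁, h₂⟩ := hg
    rw [← hr] at h₂
    have not_pre : ∀ q, q ≠ r → ∀ i, ¬ s.2 q <+: s.2 r ++ [i] := fun q hq i hp => by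
      rcases List.prefix_concat_iff.1 hp with h' | h'
      · exact hq (ih₁ _ _ ⟨[i], h'.symm⟩ |>.symm)
      · exact hq (ih₁ _ _ h')
    refine ⟨fun q q' hp => ?_, fun q z' hz' hp => ?_⟩
    · rcases hN.pos_cases q with ⟨q, hq, rfl⟩ | ⟨p, rfl⟩ <;>
        rcases hN.pos_cases q' with ⟨q', hq', rfl⟩ | ⟨p', rfl⟩ <;> simp only [h₁, h₂] at hp
      · obtain rfl := ih₁ _ _ hp; rfl
      · exact (not_pre q hq _ hp).elim
      · exact (hq' (ih₁ _ _ ((List.prefix_append _ _).trans hp)).symm).elim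
      · rw [List.prefix_append_right_inj, List.prefix_cons_iff] at hp
        have := he _ (by simpa using hp)
        rw [this]
    · rcases List.mem_cons.1 hz' with rfl | hz'
      · rcases hN.pos_cases q with ⟨q, hq, rfl⟩ | ⟨p, rfl⟩ <;> simp only [h₁, h₂] at hp
        · rw [← hr] at hp; exact hq (ih₁ _ _ hp)
        · rw [← hr] at hp
          have := hp.length_le
          simp at this
      · rcases hN.pos_cases q with ⟨q, hq, rfl⟩ | ⟨p, rfl⟩ <;> simp only [h₁, h₂] at hp
        · exact ih₂ _ _ hz' hp
        · exact ih₂ _ _ hz' ((List.prefix_append _ _).trans hp)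

theorem Graft.unique (hN : N.IsMulticategory) {z : List ℕ × I} {s t t' : N.Labelled}
    (hs : Function.Injective s.2) (h : Graft φ e z s t) (h' : Graft φ e z s t') : t = t' := by
  obtain ⟨r, h, ℓ, hr, rfl, h₁, h₂⟩ := h
  obtain ⟨r', h', ℓ', hr', rfl, h₁', h₂'⟩ := h'
  obtain rfl := hs (hr.trans hr'.symm)
  congr 1
  funext q
  rcases hN.pos_cases q with ⟨q, hq, rfl⟩ | ⟨p, rfl⟩
  · rw [h₁, h₁']
  · rw [h₂, h₂']

theorem Graft.swap (hN : N.IsMulticategory) {z z' : List ℕ × I} {s t v : N.Labelled}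
    (hz : ¬ z.1 <+: z'.1) (h : Graft φ e z s t) (h' : Graft φ e z' t v) :
    ∃ t', Graft φ e z' s t' ∧ Graft φ e z t' v := by
  obtain ⟨r, h, ℓ, hr, rfl, h₁, h₂⟩ := h
  obtain ⟨q, h', m, hq, rfl, h₁', h₂'⟩ := h'
  rcases hN.pos_cases q with ⟨q, hqr, rfl⟩ | ⟨p, rfl⟩
  · have hw : N.tgt (φ z'.2) = N.ty (N.src s.1 q) := h'.trans (congrArg _ (hN.src_inl _ _ _ _ _ _))
    have hv' : N.tgt (φ z.2) = N.ty (N.src (N.comp s.1 q (φ z'.2) hw) (N.inl _ _ _ hw r hqr.symm)) :=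
      h.trans (congrArg _ (hN.src_inl _ _ _ _ _ _).symm)
    obtain ⟨c₁, c₂, c₃, c₄⟩ := hN.comm s.1 r q hqr hqr.symm (φ z.2) (φ z'.2) h hw h' hv'
    have hq' : s.2 q = z'.1 := (h₁ q hqr).symm.trans hq
    obtain ⟨ℓ', g, g₁, g₂⟩ := exists_graft (φ := φ) (e := e) hN z'.2 s q hw
    rw [hq'] at g g₂
    refine ⟨_, g, ?_⟩
    obtain ⟨m', hm⟩ := Labelled.exists_of_eq ⟨_, m⟩ c₁
    refine ⟨N.inl s.1 q (φ z'.2) hw r hqr.symm, hv', m', (g₁ _ _).trans hr, hm, fun p hp => ?_, fun p => ?_⟩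
    · rcases hN.pos_cases p with ⟨p, hpq, rfl⟩ | ⟨p, rfl⟩
      · have hpr : p ≠ r := by rintro rfl; exact hp rfl
        refine (Labelled.label_eq hm (c₂ p hpr hpq (hN.inl_ne hpq) hp)).trans ?_
        exact (h₁' _ _).trans ((h₁ _ _).trans (g₁ _ _).symm)
      · refine (Labelled.label_eq hm (c₄ p hp)).trans ((h₂' _).trans (g₂ _).symm)
    · exact (Labelled.label_eq hm (c₃ p hN.inl_ne_inr.symm)).trans ((h₁' _ _).trans (h₂ _))
  · exact (hz ⟨_, ((h₂ p).symm.trans hq)⟩).elim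

theorem Built.move (hN : N.IsMulticategory) {y : N.Obj} {z : List ℕ × I} {l₂ : List (List ℕ × I)} :
    ∀ {l₁ : List (List ℕ × I)} {t : N.Labelled}, (∀ z' ∈ l₁, ¬ z.1 <+: z'.1) →
      Built φ e y (l₁ ++ z :: l₂) t → ∃ s, Built φ e y (l₁ ++ l₂) s ∧ Graft φ e z s t
  | [], t, _, .cons _ _ s _ hs hg => ⟨s, hs, hg⟩
  | z' :: l₁, t, hz, .cons _ _ s _ hs hg => by
    obtain ⟨s', hs', hg'⟩ := Built.move hN (fun z hz' => hz z (List.mem_cons_of_mem _ hz')) hs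
    obtain ⟨t', h₁, h₂⟩ := hg'.swap hN (hz z' List.mem_cons_self) hg
    exact ⟨t', .cons _ _ _ _ hs' h₁, h₂⟩

theorem Built.unique (hN : N.IsMulticategory) (he : ∀ i, Function.Injective (e i)) {y : N.Obj}
    {l : List (List ℕ × I)} {s : N.Labelled} (hs : Built φ e y l s) :
    ∀ {l' : List (List ℕ × I)} {s' : N.Labelled}, l.Perm l' → l.Nodup → Built φ e y l' s' → s = s' := by
  induction hs with
  | nil =>
    intro l' s' hp _ hs'
    obtain rfl := hp.nil_eq
    cases hs'; rfl
  | cons z l s t hs hg ih =>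
    intro l' t' hp hn ht'
    obtain ⟨l₁, l₂, rfl⟩ := List.append_of_mem (hp.subset List.mem_cons_self)
    have hp' : l.Perm (l₁ ++ l₂) := (hp.trans List.perm_middle).cons_inv
    obtain ⟨r, h, ℓ, hr, -⟩ := id hg
    obtain ⟨s', hs', hg'⟩ := ht'.move hN fun z' hz' hz => by
      have := (hs.prefix_free hN he).2 r z' (hp'.symm.subset (List.mem_append_left _ hz'))
      exact this (hr ▸ hz)
    obtain rfl := ih hp' (List.nodup_cons.1 hn).2 hs'
    exact hg.unique hN (fun q q' h => (hs.prefix_free hN he).1 q q' (h ▸ List.prefix_rfl)) hg'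

end MultiCatData

namespace MultiCatData

section congruence

variable {N : MultiCatData.{u}} {u u' v v' : N.Arr} {r : N.Pos u} {r' : N.Pos u'}

theorem comp_congr (hr : Same N.Pos r r') (hv : v = v') (h) (h') :
    N.comp u r v h = N.comp u' r' v' h' := by
  cases hr; cases hv; rfl

theorem inl_congr {q : N.Pos u} {q' : N.Pos u'} (hr : Same N.Pos r r') (hq : Same N.Pos q q')
    (hv : v = v') (h) (h') (n) (n') : Same N.Pos (N.inl u r v h q n) (N.inl u' r' v' h' q' n') := by
  cases hr; cases hv
  obtain rfl := eq_of_heq (Sigma.mk.inj hq).2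
  rfl

theorem inr_congr {p : N.Pos v} {p' : N.Pos v'} (hr : Same N.Pos r r') (hp : Same N.Pos p p') (h) (h') :
    Same N.Pos (N.inr u r v h p) (N.inr u' r' v' h' p') := by
  cases hr; cases hp; rfl

theorem IsMulticategory.same_one (hN : N.IsMulticategory) {x y : N.Obj} (e : x = y) (p : N.Pos (N.one x))
    (q : N.Pos (N.one y)) : Same N.Pos p q := by
  subst e
  obtain ⟨_, -, h⟩ := hN.pos_one x
  rw [h p trivial, h q trivial]
  rfl

theorem sigma_ext {X : Type*} {a b : N.Arr} (e : a = b) {π : X → N.Pos a} {ρ : X → N.Pos b}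
    (h : ∀ x, Same N.Pos (π x) (ρ x)) : (⟨a, π⟩ : Σ a, X → N.Pos a) = ⟨b, ρ⟩ := by
  subst e
  congr 1
  funext x
  exact eq_of_heq (Sigma.mk.inj (h x)).2

end congruence

theorem Hom.ext_of {M N : MultiCatData.{u}} {χ χ' : Hom M N} (ho : χ.obj = χ'.obj)
    (ht : χ.tyMap = χ'.tyMap)
    (h : ∀ u, (⟨χ.arr u, χ.pos u⟩ : Σ a, M.Pos u → N.Pos a) = ⟨χ'.arr u, χ'.pos u⟩) : χ = χ' := by
  obtain ⟨o, t, a, p, hom⟩ := χ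
  obtain ⟨o', t', a', p', hom'⟩ := χ'
  obtain rfl : o = o' := ho
  obtain rfl : t = t' := ht
  obtain rfl : a = a' := funext fun u => congrArg Sigma.fst (h u)
  obtain rfl : p = p' := funext fun u => eq_of_heq (Sigma.mk.inj (h u)).2
  rfl

/-- A description of the arrows generated by `J` as trees, with nodes in `J` and addresses for the nodes
and the leaves. -/
structure TreeData (M : MultiCatData.{u}) (J : Set M.Arr) where
  nodes : M.Arr → Set (List ℕ × M.Arr)
  leaf : ∀ u, M.Pos u → List ℕ
  enc : ∀ u, M.Pos u → ℕ
  enc_injective : ∀ u, Function.Injective (enc u)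
  nodes_one : ∀ x, nodes (M.one x) = ∅
  leaf_one : ∀ x p, leaf (M.one x) p = []
  nodes_comp : ∀ u r f h, f ∈ J → nodes (M.comp u r f h) = insert (leaf u r, f) (nodes u)
  leaf_inl : ∀ u r f h q hq, f ∈ J → leaf _ (M.inl u r f h q hq) = leaf u q
  leaf_inr : ∀ u r f h p, f ∈ J → leaf _ (M.inr u r f h p) = leaf u r ++ [enc f p]

namespace TreeData

variable {M N : MultiCatData.{u}} {J : Set M.Arr} (D : M.TreeData J) (go : M.Obj → N.Obj)
  (gt : M.Ty → N.Ty) (φ : J → N.Arr) (e : ∀ f : J, N.Pos (φ f) → ℕ)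

/-- `a` is the image of `u`, for the bijection `π` between the sources. -/
def Traced (u : M.Arr) (a : N.Arr) (π : M.Pos u → N.Pos a) : Prop :=
  ∃ (y : M.Obj) (l : List (List ℕ × J)) (ℓ : N.Pos a → List ℕ), M.tgt u = M.ty y ∧
    Built φ e (go y) l ⟨a, ℓ⟩ ∧ l.Nodup ∧ (∀ z : List ℕ × J, z ∈ l ↔ (z.1, z.2.1) ∈ D.nodes u) ∧
    (∀ p, ℓ (π p) = D.leaf u p) ∧ Function.Bijective π ∧ (∀ p, N.src a (π p) = go (M.src u p)) ∧
    N.tgt a = gt (M.tgt u)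

variable {D go gt φ e}

theorem Traced.unique (hN : N.IsMulticategory) (hty : Function.Injective M.ty)
    (he : ∀ i, Function.Injective (e i)) {u : M.Arr} {a a' π π'} (h : D.Traced go gt φ e u a π)
    (h' : D.Traced go gt φ e u a' π') : (⟨a, π⟩ : Σ a, M.Pos u → N.Pos a) = ⟨a', π'⟩ := by
  obtain ⟨y, l, ℓ, hy, hb, hn, hl, hp, -⟩ := h
  obtain ⟨y', l', ℓ', hy', hb', hn', hl', hp', -⟩ := h'
  obtain rfl := hty (hy.symm.trans hy')
  have hll : l.Perm l' := (List.perm_ext_iff_of_nodup hn hn').2 fun z => (hl z).trans (hl' z).symm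
  cases hb.unique hN he hll hn hb'
  congr 1
  funext p
  have := (hb.prefix_free hN he).1 (π p) (π' p)
  exact this (by change ℓ _ <+: ℓ _; rw [hp, hp'])

theorem traced_one (hM : M.IsMulticategory) (hN : N.IsMulticategory)
    (hgt : ∀ x, N.ty (go x) = gt (M.ty x)) (x : M.Obj) :
    ∃ π, D.Traced go gt φ e (M.one x) (N.one (go x)) π := by
  obtain ⟨p, -, hp⟩ := hN.pos_one (go x)
  obtain ⟨q, -, hq⟩ := hM.pos_one x
  refine ⟨fun _ => p, x, [], _, hM.tgt_one x, .nil, List.nodup_nil, fun z => ?_, fun q => (D.leaf_one x q).symm,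
    ⟨fun a b _ => (hq a trivial).trans (hq b trivial).symm, fun s => ⟨q, (hp s trivial).symm⟩⟩,
    fun q => (hN.src_one _ _).trans (congrArg go (hM.src_one x q).symm), ?_⟩
  · rw [D.nodes_one]; simp
  · rw [hN.tgt_one, hM.tgt_one, hgt]

theorem Traced.comp (hM : M.IsMulticategory) (hN : N.IsMulticategory)
    (he : ∀ i, Function.Injective (e i)) {θ : ∀ f : J, M.Pos f.1 → N.Pos (φ f)}
    (hθ : ∀ f, Function.Bijective (θ f)) (heθ : ∀ f p, e f (θ f p) = D.enc f.1 p)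
    (hsrc : ∀ f p, N.src (φ f) (θ f p) = go (M.src f.1 p)) {u : M.Arr} {a π}
    (hu : D.Traced go gt φ e u a π) (r : M.Pos u) (f : J) (h : M.tgt f.1 = M.ty (M.src u r))
    (h' : N.tgt (φ f) = N.ty (N.src a (π r))) :
    ∃ π', D.Traced go gt φ e (M.comp u r f.1 h) (N.comp a (π r) (φ f) h') π' ∧
      (∀ q hq hq', π' (M.inl u r f.1 h q hq) = N.inl a (π r) (φ f) h' (π q) hq') ∧
      ∀ p, π' (M.inr u r f.1 h p) = N.inr a (π r) (φ f) h' (θ f p) := by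
  obtain ⟨y, l, ℓ, hy, hb, hn, hl, hp, hπ, hs, ht⟩ := hu
  obtain ⟨π', h₁, h₂⟩ := hM.exists_elim u r f.1 h
    (fun q hq => N.inl a (π r) (φ f) h' (π q) (hπ.1.ne hq)) (fun p => N.inr a (π r) (φ f) h' (θ f p))
  obtain ⟨m, hg, m₁, m₂⟩ := exists_graft (φ := φ) (e := e) hN f ⟨a, ℓ⟩ (π r) h'
  dsimp only at hg m₁ m₂
  refine ⟨π', ⟨y, _, m, (hM.tgt_comp _ _ _ _).trans hy, .cons _ _ _ _ hb hg, ?_, fun z => ?_, fun s => ?_,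
    ⟨fun s s' hss => ?_, fun s => ?_⟩, fun s => ?_, ?_⟩, fun q hq hq' => h₁ q hq, h₂⟩
  · refine List.nodup_cons.2 ⟨fun hz => (hb.prefix_free hN he).2 (π r) _ hz List.prefix_rfl, hn⟩
  · rw [D.nodes_comp _ _ _ _ f.2, List.mem_cons, hl, hp, Set.mem_insert_iff]
    refine or_congr ⟨fun e => by rw [e], fun e => ?_⟩ Iff.rfl
    obtain ⟨e₁, e₂⟩ := Prod.mk.inj e
    exact Prod.ext e₁ (Subtype.ext e₂)
  · rcases hM.pos_cases s with ⟨q, hq, rfl⟩ | ⟨p, rfl⟩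
    · rw [h₁, m₁, D.leaf_inl _ _ _ _ _ _ f.2, hp]
    · rw [h₂, m₂, D.leaf_inr _ _ _ _ _ f.2, hp, heθ]
  · rcases hM.pos_cases s with ⟨q, hq, rfl⟩ | ⟨p, rfl⟩ <;>
      rcases hM.pos_cases s' with ⟨q', hq', rfl⟩ | ⟨p', rfl⟩ <;> simp only [h₁, h₂] at hss
    · by_contra hne
      exact hN.inl_ne (hπ.1.ne fun e => hne (by subst e; rfl)) hss
    · exact (hN.inl_ne_inr hss).elim
    · exact (hN.inl_ne_inr hss.symm).elim
    · have := @(hN.bijective a (π r) (φ f) h').1 (Sum.inr (θ f p)) (Sum.inr (θ f p')) hss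
      rw [(hθ f).1 (Sum.inr.inj this)]
  · rcases hN.pos_cases s with ⟨q, hq, rfl⟩ | ⟨p, rfl⟩
    · obtain ⟨q, rfl⟩ := hπ.2 q
      exact ⟨_, h₁ q fun e => hq (congrArg π e)⟩
    · obtain ⟨p, rfl⟩ := (hθ f).2 p
      exact ⟨_, h₂ p⟩
  · rcases hM.pos_cases s with ⟨q, hq, rfl⟩ | ⟨p, rfl⟩
    · rw [h₁, hN.src_inl, hM.src_inl, hs]
    · rw [h₂, hN.src_inr, hM.src_inr, hsrc]
  · rw [hN.tgt_comp, hM.tgt_comp, ht]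

/-- A multicategory whose arrows are trees with nodes in `J` is freely generated by `J`. -/
theorem isFreeOn (D : M.TreeData J) (hM : M.IsMulticategory) (hty : Function.Injective M.ty)
    (hJ : ∀ p : M.Arr → Prop, (∀ x, p (M.one x)) →
      (∀ u r f h, f ∈ J → p u → p (M.comp u r f h)) → ∀ u, p u) : M.IsFreeOn J := by
  intro N hN go gt hgo φ θ hθ hsrc htgt
  let e : ∀ f : J, N.Pos (φ f) → ℕ := fun f p => D.enc f.1 ((Equiv.ofBijective _ (hθ f)).symm p)
  have he : ∀ f, Function.Injective (e f) := fun f =>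
    (D.enc_injective f.1).comp (Equiv.injective _)
  have heθ : ∀ f p, e f (θ f p) = D.enc f.1 p := fun f p =>
    congrArg _ ((Equiv.ofBijective _ (hθ f)).symm_apply_apply p)
  have hcomp : ∀ {u : M.Arr} {a π}, D.Traced go gt φ e u a π → ∀ {r : M.Pos u} {f : J},
      M.tgt f.1 = M.ty (M.src u r) → N.tgt (φ f) = N.ty (N.src a (π r)) := by
    rintro u a π ⟨y, l, ℓ, -, -, -, -, -, -, hs, -⟩ r f h
    rw [htgt, h, hs, hgo]
  have ex : ∀ u, ∃ a π, D.Traced go gt φ e u a π := hJ _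
    (fun x => ⟨_, traced_one hM hN hgo x⟩) fun u r f h hf ⟨a, π, hu⟩ => by
      obtain ⟨π', h', -⟩ := hu.comp hM hN he hθ heθ hsrc r ⟨f, hf⟩ h (hcomp hu h)
      exact ⟨_, π', h'⟩
  choose arr pos tr using ex
  have hbij : ∀ u, Function.Bijective (pos u) := fun u => by
    obtain ⟨y, l, ℓ, -, -, -, -, -, h, -⟩ := tr u; exact h
  have hs : ∀ u p, N.src (arr u) (pos u p) = go (M.src u p) := fun u => by
    obtain ⟨y, l, ℓ, -, -, -, -, -, -, h, -⟩ := tr u; exact h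
  have ht : ∀ u, N.tgt (arr u) = gt (M.tgt u) := fun u => by
    obtain ⟨y, l, ℓ, -, -, -, -, -, -, -, h⟩ := tr u; exact h
  have hobj : ∀ u, ∃ x, M.tgt u = M.ty x := fun u => by
    obtain ⟨y, l, ℓ, h, -⟩ := tr u; exact ⟨y, h⟩
  have map : ∀ {u v : M.Arr} {p : M.Pos u} {q : M.Pos v}, Same M.Pos p q → Same N.Pos (pos u p) (pos v q) :=
    fun h => h.map arr pos
  have hone : ∀ x, arr (M.one x) = N.one (go x) := fun x => by
    obtain ⟨π, h⟩ := traced_one (D := D) (φ := φ) (e := e) hM hN hgo x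
    exact congrArg Sigma.fst ((tr _).unique hN hty he h)
  have hgen : ∀ u r (f : J) h h', arr (M.comp u r f.1 h) = N.comp (arr u) (pos u r) (φ f) h' ∧
      (∀ q hq hq', Same N.Pos (pos _ (M.inl u r f.1 h q hq)) (N.inl (arr u) (pos u r) (φ f) h' (pos u q) hq')) ∧
      ∀ p, Same N.Pos (pos _ (M.inr u r f.1 h p)) (N.inr (arr u) (pos u r) (φ f) h' (θ f p)) := by
    intro u r f h h'
    obtain ⟨π, h₀, h₁, h₂⟩ := (tr u).comp hM hN he hθ heθ hsrc r f h h'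
    have key := (tr _).unique hN hty he h₀
    have hp : ∀ s, Same N.Pos (pos _ s) (π s) := fun s =>
      congrArg (fun z : Σ a, M.Pos (M.comp u r f.1 h) → N.Pos a => (⟨z.1, z.2 s⟩ : Sigma N.Pos)) key
    exact ⟨congrArg Sigma.fst key, fun q hq hq' => h₁ q hq hq' ▸ hp _, fun p => h₂ p ▸ hp _⟩
  have hmem : ∀ f : J, arr f.1 = φ f ∧ ∀ p, Same N.Pos (pos f.1 p) (θ f p) := by
    intro f
    obtain ⟨x, hx⟩ := hobj f.1
    obtain ⟨r, -⟩ := hM.pos_one x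
    have h : M.tgt f.1 = M.ty (M.src (M.one x) r) := by rw [hx, hM.src_one]
    obtain ⟨m₁, m₂⟩ := hM.one_comp x r f.1 h
    obtain ⟨g₁, -, g₂⟩ := hgen (M.one x) r f h (hcomp (tr _) h)
    obtain ⟨r', -⟩ := hN.pos_one (go x)
    have h' : N.tgt (φ f) = N.ty (N.src (N.one (go x)) r') := by rw [htgt, hN.src_one, hgo, hx]
    obtain ⟨n₁, n₂⟩ := hN.one_comp (go x) r' (φ f) h'
    have hr : Same N.Pos (pos (M.one x) r) r' := by
      have : ∀ {a : N.Arr} (_ : a = N.one (go x)) (p : N.Pos a), Same N.Pos p r' := by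
        rintro _ rfl p; exact hN.same_one rfl p r'
      exact this (hone x) _
    exact ⟨(congrArg arr m₁).symm.trans (g₁.trans ((comp_congr hr rfl _ _).trans n₁)), fun p =>
      (map (m₂ p).symm).trans ((g₂ p).trans ((inr_congr hr rfl _ _).trans (n₂ _)))⟩
  have hgen' : ∀ v u r h h', arr (M.comp u r v h) = N.comp (arr u) (pos u r) (arr v) h' ∧
      (∀ q hq hq', Same N.Pos (pos _ (M.inl u r v h q hq)) (N.inl (arr u) (pos u r) (arr v) h' (pos u q) hq')) ∧
      ∀ p, Same N.Pos (pos _ (M.inr u r v h p)) (N.inr (arr u) (pos u r) (arr v) h' (pos v p)) := by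
    refine hJ _ (fun x => ?_) (fun w q f hw hf ih => ?_)
    · intro u r h h'
      obtain rfl : x = M.src u r := hty ((hM.tgt_one x).symm.trans h)
      have e₁ : arr (M.one (M.src u r)) = N.one (N.src (arr u) (pos u r)) := by rw [hone, hs]
      obtain ⟨m₁, m₂, m₃⟩ := hM.comp_one u r h
      obtain ⟨n₁, n₂, n₃⟩ := hN.comp_one (arr u) (pos u r) (e₁ ▸ h')
      refine ⟨(congrArg arr m₁).trans (n₁.symm.trans (comp_congr rfl e₁.symm _ _)), fun q hq hq' => ?_,
        fun p => ?_⟩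
      · exact (map (m₂ q hq)).trans ((n₂ _ hq').symm.trans (inl_congr rfl rfl e₁.symm _ _ _ _))
      · obtain ⟨p', -⟩ := hN.pos_one (N.src (arr u) (pos u r))
        refine (map (m₃ p)).trans ((n₃ p').symm.trans (inr_congr rfl ?_ _ _))
        have : ∀ {a : N.Arr} (_ : a = N.one (N.src (arr u) (pos u r))) (p : N.Pos a), Same N.Pos p' p := by
          rintro _ rfl p; exact hN.same_one rfl p' p
        exact this e₁ _
    · intro u r h h'
      have hv : M.tgt w = M.ty (M.src u r) := (hM.tgt_comp _ _ _ _).symm.trans h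
      have hw' : M.tgt f = M.ty (M.src _ (M.inr u r w hv q)) := by rw [hM.src_inr, hw]
      obtain ⟨m₁, m₂, m₃, m₄⟩ := hM.assoc u r w q f hv hw hw' h
      have nv : N.tgt (arr w) = N.ty (N.src (arr u) (pos u r)) := by rw [ht, hv, hs, hgo]
      have nw : N.tgt (φ ⟨f, hf⟩) = N.ty (N.src (arr w) (pos w q)) := by rw [htgt, hw, hs, hgo]
      have nw' : N.tgt (φ ⟨f, hf⟩) = N.ty (N.src _ (N.inr _ _ _ nv (pos w q))) := by rw [hN.src_inr, nw]
      have nh : N.tgt (N.comp (arr w) (pos w q) (φ ⟨f, hf⟩) nw) = N.ty (N.src (arr u) (pos u r)) := by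
        rw [hN.tgt_comp, nv]
      obtain ⟨n₁, n₂, n₃, n₄⟩ := hN.assoc (arr u) (pos u r) (arr w) (pos w q) (φ ⟨f, hf⟩) nv nw nw' nh
      obtain ⟨i₁, i₂, i₃⟩ := ih u r hv nv
      have cw : N.tgt (φ ⟨f, hf⟩) = N.ty (N.src _ (pos _ (M.inr u r w hv q))) := by rw [htgt, hw', hs, hgo]
      obtain ⟨a₁, a₂, a₃⟩ := hgen (M.comp u r w hv) (M.inr u r w hv q) ⟨f, hf⟩ hw' cw
      obtain ⟨b₁, b₂, b₃⟩ := hgen w q ⟨f, hf⟩ hw nw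
      refine ⟨(congrArg arr m₁).symm.trans (a₁.trans ((comp_congr (i₃ q) rfl _ _).trans
        (n₁.trans (comp_congr rfl b₁.symm _ _)))), fun p hp hp' => ?_, fun s => ?_⟩
      · have c₁ : M.inl u r w hv p hp ≠ M.inr u r w hv q := hM.inl_ne_inr
        exact (map (m₂ p hp c₁)).symm.trans ((a₂ _ c₁ ((hbij _).1.ne c₁)).trans
          ((inl_congr (i₃ q) (i₂ p hp hp') rfl _ _ _ hN.inl_ne_inr).trans
          ((n₂ _ hp' _).trans (inl_congr rfl rfl b₁.symm _ _ _ _))))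
      · rcases hM.pos_cases s with ⟨p, hp, rfl⟩ | ⟨p, rfl⟩
        · have c₁ : M.inr u r w hv p ≠ M.inr u r w hv q := fun e =>
            hp (Sum.inr.inj (@(hM.bijective u r w hv).1 (Sum.inr p) (Sum.inr q) e))
          have c₂ : N.inr _ _ _ nv (pos w p) ≠ N.inr _ _ _ nv (pos w q) := fun e =>
            (hbij w).1.ne hp (Sum.inr.inj (@(hN.bijective _ _ _ nv).1 (Sum.inr _) (Sum.inr _) e))
          exact (map (m₃ p hp c₁)).symm.trans ((a₂ _ c₁ ((hbij _).1.ne c₁)).trans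
            ((inl_congr (i₃ q) (i₃ p) rfl _ _ _ c₂).trans
            ((n₃ _ ((hbij w).1.ne hp) _).trans (inr_congr rfl (b₂ p hp _).symm _ _))))
        · exact (map (m₄ p)).symm.trans ((a₃ p).trans ((inr_congr (i₃ q) rfl _ _).trans
            ((n₄ _).trans (inr_congr rfl (b₃ p).symm _ _))))
  refine ⟨⟨go, gt, arr, pos, hgo, hbij, hs, ht, hone, fun u r v h h' => (hgen' v u r h h').1,
    fun u r v h h' => (hgen' v u r h h').2.1, fun u r v h h' => (hgen' v u r h h').2.2⟩, ⟨rfl, rfl, hmem⟩, ?_⟩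
  rintro ⟨o, t, arr', pos', hom⟩ ⟨rfl, rfl, hmem'⟩
  refine Hom.ext_of rfl rfl (hJ _ (fun x => ?_) fun u r f h hf ih => ?_)
  · have e₁ : arr' (M.one x) = arr (M.one x) := (hom.map_one x).trans (hone x).symm
    have : ∀ {a b : N.Arr} (_ : a = N.one (o x)) (_ : b = N.one (o x)) (p : N.Pos a) (q : N.Pos b),
        Same N.Pos p q := by
      rintro _ _ rfl rfl p q; exact hN.same_one rfl p q
    exact sigma_ext e₁ fun p => this (hom.map_one x) (hone x) _ _
  · have hp : ∀ p, Same N.Pos (pos' u p) (pos u p) := fun p =>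
      congrArg (fun z : Σ a, M.Pos u → N.Pos a => (⟨z.1, z.2 p⟩ : Sigma N.Pos)) ih
    obtain ⟨f₁, f₂⟩ := hmem' ⟨f, hf⟩
    have c : N.tgt (φ ⟨f, hf⟩) = N.ty (N.src (arr u) (pos u r)) := hcomp (tr _) h
    have c' : N.tgt (arr' f) = N.ty (N.src (arr' u) (pos' u r)) := by
      rw [hom.tgt_arr, h, hom.src_pos, hom.ty_obj]
    obtain ⟨g₁, g₂, g₃⟩ := hgen u r ⟨f, hf⟩ h c
    refine sigma_ext ((hom.map_comp u r f h c').trans ((comp_congr (hp r) f₁ _ _).trans g₁.symm)) fun s => ?_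
    rcases hM.pos_cases s with ⟨q, hq, rfl⟩ | ⟨p, rfl⟩
    · exact (hom.pos_inl u r f h c' q hq ((hom.bijective u).1.ne hq)).trans
        ((inl_congr (hp r) (hp q) f₁ _ _ _ _).trans (g₂ q hq ((hbij u).1.ne hq)).symm)
    · exact (hom.pos_inr u r f h c' p).trans ((inr_congr (hp r) (f₂ p) _ _).trans (g₃ p).symm)

end TreeData

end MultiCatData

namespace Computad

namespace OccSystem

variable {A : Computad.{u}} (O : A.OccSystem)

theorem exists_enc {n : ℕ} (u : A.C n) : ∃ f : O.Occ u → ℕ, Function.Injective f :=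
  have := O.finite_occ u
  (Countable.exists_injective_nat _)

/-- A numbering of the occurrences in each cell. -/
noncomputable def enc {n : ℕ} (P : O.Pt n) : ℕ := (O.exists_enc P.1).choose P.2

variable {O}

theorem enc_injective {n : ℕ} {P Q : O.Pt n} (h : P.1 = Q.1) (e : O.enc P = O.enc Q) : P = Q := by
  obtain ⟨a, p⟩ := P
  obtain ⟨b, q⟩ := Q
  cases h
  exact congrArg _ ((O.exists_enc a).choose_spec e)

theorem enc_inj {n : ℕ} {u : A.C n} {p q : O.Occ u} (e : O.enc ⟨u, p⟩ = O.enc ⟨u, q⟩) : p = q :=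
  (O.exists_enc u).choose_spec e

variable (O)

open Classical in
noncomputable def decode {n : ℕ} (u : A.C n) {Y : Type*} (y : Y) (f : O.Occ u → Y) (a : ℕ) : Y :=
  if h : ∃ p : O.Occ u, O.enc ⟨u, p⟩ = a then f h.choose else y

theorem decode_enc {n : ℕ} (u : A.C n) {Y : Type*} (y : Y) (f : O.Occ u → Y) (p : O.Occ u) :
    O.decode u y f (O.enc ⟨u, p⟩) = f p := by
  have h : ∃ q : O.Occ u, O.enc ⟨u, q⟩ = O.enc ⟨u, p⟩ := ⟨p, rfl⟩
  rw [decode, dif_pos h]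
  exact congrArg f (enc_inj h.choose_spec)

/-- The numbers of the occurrences are codes for them. -/
noncomputable def coding (n : ℕ) : A.Coding n ℕ where
  occ u := {a | ∃ p : O.Occ u, O.enc ⟨u, p⟩ = a}
  finite u := by
    have := O.finite_occ u
    exact Set.finite_range fun p : O.Occ u => O.enc ⟨u, p⟩
  lab u a := O.decode u u (O.lab u) a
  lab_mem := by
    rintro u _ ⟨p, rfl⟩
    rw [decode_enc]; exact O.lab_mem _ _
  inl hk u v h := O.decode u 0 fun p => O.enc ⟨_, O.occL hk u v h p⟩
  inr hk u v h := O.decode v 0 fun p => O.enc ⟨_, O.occR hk u v h p⟩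
  mem_comp hk u v h a := by
    constructor
    · rintro ⟨p, rfl⟩
      rcases occ_cases hk h p with ⟨s, rfl⟩ | ⟨s, rfl⟩
      · exact Or.inl ⟨_, ⟨s, rfl⟩, O.decode_enc _ _ _ _⟩
      · exact Or.inr ⟨_, ⟨s, rfl⟩, O.decode_enc _ _ _ _⟩
    · rintro (⟨_, ⟨s, rfl⟩, rfl⟩ | ⟨_, ⟨s, rfl⟩, rfl⟩)
      · exact ⟨O.occL hk u v h s, (O.decode_enc u 0 (fun p => O.enc ⟨_, O.occL hk u v h p⟩) s).symm⟩
      · exact ⟨O.occR hk u v h s, (O.decode_enc v 0 (fun p => O.enc ⟨_, O.occR hk u v h p⟩) s).symm⟩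
  inl_inj := by
    rintro k hk u v h _ ⟨p, rfl⟩ _ ⟨q, rfl⟩ e
    rw [decode_enc, decode_enc] at e
    rw [occL_injective hk u v h (enc_inj e)]
  inr_inj := by
    rintro k hk u v h _ ⟨p, rfl⟩ _ ⟨q, rfl⟩ e
    rw [decode_enc, decode_enc] at e
    rw [occR_injective hk u v h (enc_inj e)]
  inl_ne_inr := by
    rintro k hk u v h _ ⟨p, rfl⟩ _ ⟨q, rfl⟩ e
    rw [decode_enc, decode_enc] at e
    exact occL_ne_occR hk u v h p q (enc_inj e)
  lab_inl := by
    rintro k hk u v h _ ⟨p, rfl⟩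
    rw [decode_enc, decode_enc, decode_enc]; exact O.lab_occL _ _ _ _ _
  lab_inr := by
    rintro k hk u v h _ ⟨p, rfl⟩
    rw [decode_enc, decode_enc, decode_enc]; exact O.lab_occR _ _ _ _ _
  occ_indet x hx := by
    obtain ⟨p, -, hp⟩ := (O.occ_indet x hx).1
    refine ⟨O.enc ⟨x, p⟩, ?_, (O.decode_enc _ _ _ _).trans ((O.occ_indet x hx).2 p)⟩
    ext a
    exact ⟨fun ⟨q, hq⟩ => by rw [← hq, hp q trivial]; rfl, fun h => ⟨p, h.symm⟩⟩
  occ_one hm a := by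
    rw [Set.eq_empty_iff_forall_notMem]
    rintro _ ⟨p, -⟩
    exact (occ_one_isEmpty hm a).false p
  assoc hk t s w h₁ h₂ h₃ h₄ := by
    refine ⟨?_, ?_, ?_⟩ <;> rintro _ ⟨p, rfl⟩ <;> simp only [decode_enc]
    · exact congrArg O.enc ((O.assoc hk t s w h₁ h₂ h₃ h₄).1 p)
    · exact congrArg O.enc ((O.assoc hk t s w h₁ h₂ h₃ h₄).2.1 p)
    · exact congrArg O.enc ((O.assoc hk t s w h₁ h₂ h₃ h₄).2.2 p)
  exchange hl hk hlk t t' s s' h₁ h₂ h₃ h₄ h₅ h₆ := by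
    refine ⟨?_, ?_, ?_, ?_⟩ <;> rintro _ ⟨p, rfl⟩ <;> simp only [decode_enc]
    · exact congrArg O.enc ((O.exchange hl hk hlk t t' s s' h₁ h₂ h₃ h₄ h₅ h₆).1 p)
    · exact congrArg O.enc ((O.exchange hl hk hlk t t' s s' h₁ h₂ h₃ h₄ h₅ h₆).2.1 p)
    · exact congrArg O.enc ((O.exchange hl hk hlk t t' s s' h₁ h₂ h₃ h₄ h₅ h₆).2.2.1 p)
    · exact congrArg O.enc ((O.exchange hl hk hlk t t' s s' h₁ h₂ h₃ h₄ h₅ h₆).2.2.2 p)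
  one_comp hk b t h := by
    rintro _ ⟨p, rfl⟩
    rw [decode_enc]; exact congrArg O.enc (O.one_comp hk b t h p)
  comp_one hk a t h := by
    rintro _ ⟨p, rfl⟩
    rw [decode_enc]; exact congrArg O.enc (O.comp_one hk a t h p)

variable {O}

theorem coding_inl {n k : ℕ} (hk : k < n) (P : O.Pt n) (v) (h) :
    (O.coding n).inl hk P.1 v h (O.enc P) = O.enc (O.cL hk P v h) :=
  O.decode_enc P.1 _ (fun p => O.enc ⟨_, O.occL hk P.1 v h p⟩) P.2

theorem coding_inr {n k : ℕ} (hk : k < n) (u) (P : O.Pt n) (h) :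
    (O.coding n).inr hk u P.1 h (O.enc P) = O.enc (O.cR hk u P h) :=
  O.decode_enc P.1 _ (fun p => O.enc ⟨_, O.occR hk u P.1 h p⟩) P.2

variable (O)

open Coding

/-- A system of forests for the `(n+1)`-cells. -/
structure ForestSystem (n : ℕ) where
  F : A.C (n + 1) → Forest ℕ (A.C (n + 1))
  good : ∀ u, (O.coding n).Good u (F u)
  indet : ∀ x ∈ A.indet (n + 1), F x = (O.coding n).corolla x
  one : ∀ a, F (A.one (n + 1) n.le_succ a) = (O.coding n).trivialForest a
  comp : ∀ {k : ℕ} (hk : k < n + 1) (u v) (h), F (A.comp k hk u v h) =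
    (O.coding n).forestComp hk u v h (F u) (F v)

namespace ForestSystem

variable {O} {n : ℕ} (T : O.ForestSystem n)

theorem mem_comp_left {k : ℕ} (hk : k < n) {u v : A.C (n + 1)} (h) {S P : O.Pt n}
    (hS : S.1 = A.d n n.le_succ u) (hP : P.1 = A.c n n.le_succ u) {q}
    (hm : (Sum.inl (O.enc S), (O.enc P, q)) ∈ T.F u) {s t : A.C n} (hs : A.d n n.le_succ v = s)
    (ht : A.c n n.le_succ v = t) (h₁) (h₂) :
    (Sum.inl (O.enc (O.cL hk S s h₁)), (O.enc (O.cL hk P t h₂), q)) ∈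
      T.F (A.comp k (hk.trans n.lt_succ_self) u v h) := by
  subst hs ht
  obtain ⟨_, S⟩ := S
  obtain ⟨_, P⟩ := P
  cases hS; cases hP
  rw [T.comp, forestComp, dif_pos hk]
  exact Or.inl (mem_push_inl.2 ⟨_, _, _, hm, (coding_inl hk ⟨_, S⟩ _ _).symm,
    Prod.ext (coding_inl hk ⟨_, P⟩ _ _).symm rfl⟩)

theorem mem_comp_right {k : ℕ} (hk : k < n) {u v : A.C (n + 1)} (h) {S P : O.Pt n}
    (hS : S.1 = A.d n n.le_succ v) (hP : P.1 = A.c n n.le_succ v) {q}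
    (hm : (Sum.inl (O.enc S), (O.enc P, q)) ∈ T.F v) {s t : A.C n} (hs : A.d n n.le_succ u = s)
    (ht : A.c n n.le_succ u = t) (h₁) (h₂) :
    (Sum.inl (O.enc (O.cR hk s S h₁)), (O.enc (O.cR hk t P h₂), q)) ∈
      T.F (A.comp k (hk.trans n.lt_succ_self) u v h) := by
  subst hs ht
  obtain ⟨_, S⟩ := S
  obtain ⟨_, P⟩ := P
  cases hS; cases hP
  rw [T.comp, forestComp, dif_pos hk]
  exact Or.inr (mem_push_inl.2 ⟨_, _, _, hm, (coding_inr hk _ ⟨_, S⟩ _).symm,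
    Prod.ext (coding_inr hk _ ⟨_, P⟩ _).symm rfl⟩)

theorem mem_one (P : O.Pt n) :
    (Sum.inl (O.enc P), (O.enc P, [])) ∈ T.F (A.one (n + 1) n.le_succ P.1) := by
  rw [T.one]
  exact ⟨_, ⟨P.2, rfl⟩, rfl⟩

theorem node_one {a : A.C n} {y z} : ¬ (Sum.inr y, z) ∈ T.F (A.one (n + 1) n.le_succ a) := by
  rw [T.one]
  rintro ⟨s, -, e⟩
  cases e

variable {R : O.Replacement}

theorem c_rp_eq {P : O.Pt n} {x : A.C (n + 1)} (hc : A.c n n.le_succ x = lb P) :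
    A.c n n.le_succ (R.rp n.le_succ P x (fits_of_c_eq hc)) = P.1 :=
  (R.c_rep_succ _ _ _ _).trans (Replacement.rp_lb P _ hc _)

theorem node_rp {x : A.C (n + 1)} (hx : x ∈ A.indet (n + 1)) (P : O.Pt n) : ∀ (hc : A.c n n.le_succ x = lb P)
    {y z}, (Sum.inr y, z) ∈ T.F (R.rp n.le_succ P x (fits_of_c_eq hc)) ↔ y = x ∧ z = (O.enc P, []) := by
  induction P using pt_induction with
  | hx P hP =>
    intro hc y z
    rw [Replacement.rp_indet hP, T.indet x hx]
    have hPx : P.1 = A.c n n.le_succ x := (lb_of_indet hP).symm.trans hc.symm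
    obtain ⟨_, p⟩ := P
    cases hPx
    constructor
    · rintro ⟨⟨p', hp⟩, ⟨e, e'⟩ | ⟨s, -, e, -⟩⟩
      · cases e
        obtain rfl := occ_indet_subsingleton hP p' p
        exact ⟨rfl, Prod.ext hp.symm e'⟩
      · cases e
    · rintro ⟨rfl, rfl⟩
      exact ⟨⟨p, rfl⟩, Or.inl ⟨rfl, rfl⟩⟩
  | hL k hk P s h ih =>
    intro hc y z
    have hc' := hc.trans (lb_cL hk P s h)
    have hw := Replacement.rp_comp_L (R := R) hk h (h := n.le_succ) (fits_of_c_eq hc')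
    rw [Replacement.rp_cL hk P s x h _ (fits_of_c_eq hc') hw, T.comp, forestComp, dif_pos hk, mem_juxt_inr]
    have key : (O.coding n).inl hk _ _ (A.composable_c hk n.le_succ hw) (O.enc P) = O.enc (O.cL hk P s h) := by
      rw [(O.coding n).inl_congr hk (c_rp_eq hc') (A.c_one n.le_succ s) _ h]
      exact coding_inl hk P s h
    constructor
    · rintro (⟨b, hb, rfl⟩ | ⟨b, hb, rfl⟩)
      · obtain ⟨rfl, rfl⟩ := (ih hc').1 hb
        exact ⟨rfl, Prod.ext key rfl⟩
      · exact (T.node_one hb).elim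
    · rintro ⟨rfl, rfl⟩
      exact Or.inl ⟨_, (ih hc').2 ⟨rfl, rfl⟩, Prod.ext key.symm rfl⟩
  | hR k hk s P h ih =>
    intro hc y z
    have hc' := hc.trans (lb_cR hk s P h)
    have hw := Replacement.rp_comp_R (R := R) hk h (h := n.le_succ) (fits_of_c_eq hc')
    rw [Replacement.rp_cR hk P s x h _ (fits_of_c_eq hc') hw, T.comp, forestComp, dif_pos hk, mem_juxt_inr]
    have key : (O.coding n).inr hk _ _ (A.composable_c hk n.le_succ hw) (O.enc P) = O.enc (O.cR hk s P h) := by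
      rw [(O.coding n).inr_congr hk (A.c_one n.le_succ s) (c_rp_eq hc') _ h]
      exact coding_inr hk s P h
    constructor
    · rintro (⟨b, hb, rfl⟩ | ⟨b, hb, rfl⟩)
      · exact (T.node_one hb).elim
      · obtain ⟨rfl, rfl⟩ := (ih hc').1 hb
        exact ⟨rfl, Prod.ext key rfl⟩
    · rintro ⟨rfl, rfl⟩
      exact Or.inr ⟨_, (ih hc').2 ⟨rfl, rfl⟩, Prod.ext key.symm rfl⟩

theorem leaf_pR {x : A.C (n + 1)} (hx : x ∈ A.indet (n + 1)) (p : O.Pt n) (hp : p.1 = A.d n n.le_succ x)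
    (P : O.Pt n) : ∀ (hc : A.c n n.le_succ x = lb P) (hv : A.Fits le_rfl p.1 (lb P)),
    (Sum.inl (O.enc (R.pR le_rfl P p hv)), (O.enc P, [O.enc p])) ∈
      T.F (R.rp n.le_succ P x (fits_of_c_eq hc)) := by
  induction P using pt_induction with
  | hx P hP =>
    intro hc hv
    rw [Replacement.rp_indet hP, Replacement.pR_indet hP, T.indet x hx]
    have hPx : P.1 = A.c n n.le_succ x := (lb_of_indet hP).symm.trans hc.symm
    obtain ⟨_, P⟩ := P
    obtain ⟨_, p⟩ := p
    cases hPx; cases hp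
    exact ⟨⟨P, rfl⟩, Or.inr ⟨_, ⟨p, rfl⟩, rfl, rfl⟩⟩
  | hL k hk P s h ih =>
    intro hc hv
    have hc' := hc.trans (lb_cL hk P s h)
    have hv' := Replacement.fits_cL hk hv
    have hw := Replacement.rp_comp_L (R := R) hk h (h := n.le_succ) (fits_of_c_eq hc')
    rw [Replacement.rp_cL hk P s x h _ (fits_of_c_eq hc') hw,
      Replacement.pR_cL' hk p h hv hv' (Replacement.rp_comp_L' hk h hv')]
    refine T.mem_comp_left hk hw ?_ (c_rp_eq hc').symm (ih hc' hv') (A.d_one _ _) (A.c_one _ _) _ _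
    exact (Replacement.rp_congr rfl hp _ _).trans (R.d_rep_succ _ _ _ _).symm
  | hR k hk s P h ih =>
    intro hc hv
    have hc' := hc.trans (lb_cR hk s P h)
    have hv' := Replacement.fits_cR hk hv
    have hw := Replacement.rp_comp_R (R := R) hk h (h := n.le_succ) (fits_of_c_eq hc')
    rw [Replacement.rp_cR hk P s x h _ (fits_of_c_eq hc') hw,
      Replacement.pR_cR' hk p h hv hv' (Replacement.rp_comp_R' hk h hv')]
    refine T.mem_comp_right hk hw ?_ (c_rp_eq hc').symm (ih hc' hv') (A.d_one _ _) (A.c_one _ _) _ _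
    exact (Replacement.rp_congr rfl hp _ _).trans (R.d_rep_succ _ _ _ _).symm

theorem leaf_pL {x : A.C (n + 1)} (P Q : O.Pt n) (e : Q.1 = P.1) (ne : Q ≠ P) :
    ∀ (hc : A.c n n.le_succ x = lb P) (hv : A.Fits le_rfl (A.d n n.le_succ x) (lb P)),
    (Sum.inl (O.enc (R.pL P Q _ hv e ne)), (O.enc Q, [])) ∈ T.F (R.rp n.le_succ P x (fits_of_c_eq hc)) := by
  refine pair_induction (fun P Q => ∀ (e : Q.1 = P.1) (ne : Q ≠ P) (hc : A.c n n.le_succ x = lb P)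
    (hv : A.Fits le_rfl (A.d n n.le_succ x) (lb P)),
    (Sum.inl (O.enc (R.pL P Q _ hv e ne)), (O.enc Q, [])) ∈ T.F (R.rp n.le_succ P x (fits_of_c_eq hc)))
    ?_ ?_ ?_ ?_ P Q e ne e ne
  · intro k hk P Q s h h' e ne ih e' ne' hc hv
    have hc' := hc.trans (lb_cL hk P s h)
    have hv' := Replacement.fits_cL hk hv
    have hw := Replacement.rp_comp_L (R := R) hk h (h := n.le_succ) (fits_of_c_eq hc')
    rw [Replacement.rp_cL hk P s x h _ (fits_of_c_eq hc') hw,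
      Replacement.pL_cL_cL hk P s Q _ h h' hv hv' e' e ne' ne (Replacement.rp_comp_L' hk h hv')]
    exact T.mem_comp_left hk hw (R.d_rep_succ _ _ _ _).symm (e.trans (c_rp_eq hc').symm) (ih e ne hc' hv')
      (A.d_one _ _) (A.c_one _ _) _ _
  · intro k hk s P Q h h' e ne ih e' ne' hc hv
    have hc' := hc.trans (lb_cR hk s P h)
    have hv' := Replacement.fits_cR hk hv
    have hw := Replacement.rp_comp_R (R := R) hk h (h := n.le_succ) (fits_of_c_eq hc')
    rw [Replacement.rp_cR hk P s x h _ (fits_of_c_eq hc') hw,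
      Replacement.pL_cR_cR hk P s Q _ h h' hv hv' e' e ne' ne (Replacement.rp_comp_R' hk h hv')]
    exact T.mem_comp_right hk hw (R.d_rep_succ _ _ _ _).symm (e.trans (c_rp_eq hc').symm) (ih e ne hc' hv')
      (A.d_one _ _) (A.c_one _ _) _ _
  · intro k hk P Q h e ne hc hv
    have hc' := hc.trans (lb_cL hk P Q.1 h)
    have hv' := Replacement.fits_cL hk hv
    have hw := Replacement.rp_comp_L (R := R) hk h (h := n.le_succ) (fits_of_c_eq hc')
    rw [Replacement.rp_cL hk P Q.1 x h _ (fits_of_c_eq hc') hw,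
      Replacement.pL_cL_cR hk P Q _ h h hv hv' e ne (Replacement.rp_comp_L' hk h hv')]
    exact T.mem_comp_right hk hw (A.d_one _ _).symm (A.c_one _ _).symm (T.mem_one Q)
      (R.d_rep_succ _ _ _ _) (c_rp_eq hc') _ _
  · intro k hk P Q h e ne hc hv
    have hc' := hc.trans (lb_cR hk Q.1 P h)
    have hv' := Replacement.fits_cR hk hv
    have hw := Replacement.rp_comp_R (R := R) hk h (h := n.le_succ) (fits_of_c_eq hc')
    rw [Replacement.rp_cR hk P Q.1 x h _ (fits_of_c_eq hc') hw,
      Replacement.pL_cR_cL hk P Q _ h h hv hv' e ne (Replacement.rp_comp_R' hk h hv')]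
    exact T.mem_comp_left hk hw (A.d_one _ _).symm (A.c_one _ _).symm (T.mem_one Q)
      (R.d_rep_succ _ _ _ _) (c_rp_eq hc') _ _

end ForestSystem

end OccSystem

end Computad

namespace ManyToOneComputad

open Computad Computad.OccSystem Computad.OccSystem.Replacement

variable {A : ManyToOneComputad.{u}} {Q : A.Parametrization} {n : ℕ}

theorem nonempty_forestSystem (A : ManyToOneComputad.{u}) (O : A.toComputad.OccSystem) (n : ℕ) :
    Nonempty (O.ForestSystem n) := by
  obtain ⟨F, h₁, h₂, h₃, h₄⟩ := (O.coding n).exists_forest (A.cod_indet n)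
  exact ⟨⟨F, h₁, h₂, h₃, h₄⟩⟩

theorem mem_leaf (T : Q.occ.ForestSystem n) (u : (A.multitopicData Q).P (n + 1)) (r) :
    (Sum.inl (Q.occ.enc (srcPt u r)), Coding.leaf (T.F u.1) (Q.occ.enc (srcPt u r))) ∈ T.F u.1 :=
  Coding.leaf_mem' (T.good u.1) ⟨r, rfl⟩

theorem forest_comp (T : Q.occ.ForestSystem n) (u v : (A.multitopicData Q).P (n + 1)) (r) (h) :
    T.F ((A.multitopicData Q).comp u r v h).1 = Coding.graft (T.F u.1)
      (T.F (Q.repl.rp n.le_succ (srcPt u r) v.1 (fits_of_c_eq (cod_eq_lb h)))) :=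
  (T.comp n.lt_succ_self _ _ (rp_composable' u v r (cod_eq_lb h))).trans (dif_neg (lt_irrefl n))

/-- The many-to-one cells as trees. -/
noncomputable def treeData (T : Q.occ.ForestSystem n) :
    ((A.multitopicData Q).mc n).TreeData ((A.multitopicData Q).indet (n + 1)) where
  nodes u := {z | ∃ s, (Sum.inr z.2.1, (s, z.1)) ∈ T.F u.1}
  leaf u p := (Coding.leaf (T.F u.1) (Q.occ.enc (srcPt u p))).2
  enc u p := Q.occ.enc (srcPt u p)
  enc_injective u p q e := eq_of_heq (Sigma.mk.inj (enc_injective (P := srcPt u p) (Q := srcPt u q) rfl e)).2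
  nodes_one x := Set.eq_empty_iff_forall_notMem.2 fun z ⟨s, h⟩ => T.node_one h
  leaf_one x p := by
    have h := T.mem_one (srcPt ((A.multitopicData Q).one x) p)
    have e : (srcPt ((A.multitopicData Q).one x) p).1 = x.1.1 := A.d_one _ _
    rw [e] at h
    exact congrArg Prod.snd (Coding.leaf_eq (T.good _) h)
  nodes_comp u r f h hf := by
    ext ⟨q, y⟩
    have key := fun (y : A.C (n + 1)) z => T.node_rp (R := Q.repl) (x := f.1) hf (srcPt u r) (cod_eq_lb h)
      (y := y) (z := z)
    have hF := forest_comp T u f r h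
    change (∃ s, (Sum.inr y.1, (s, q)) ∈ T.F ((A.multitopicData Q).comp u r f h).1) ↔
      (q, y) = ((Coding.leaf (T.F u.1) (Q.occ.enc (srcPt u r))).2, f) ∨
      ∃ s, (Sum.inr y.1, (s, q)) ∈ T.F u.1
    rw [hF]
    constructor
    · rintro ⟨s, ⟨x, -, hm⟩ | ⟨t, p, r', q', h₁, h₂, h₃⟩⟩
      · exact Or.inr ⟨s, hm⟩
      · obtain ⟨e₁, e₂⟩ := (key _ _).1 h₁
        cases e₂
        obtain ⟨-, e₃⟩ := Prod.mk.inj h₃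
        have := Coding.leaf_eq (T.good u.1) h₂
        refine Or.inl (Prod.ext ?_ (Subtype.ext e₁))
        exact (e₃.trans (List.append_nil _)).trans (congrArg Prod.snd this).symm
    · rintro (e | ⟨s, hm⟩)
      · cases e
        exact ⟨_, Or.inr ⟨_, _, _, _, (key _ _).2 ⟨rfl, rfl⟩, mem_leaf T u r,
          Prod.ext rfl (List.append_nil _).symm⟩⟩
      · exact ⟨s, Or.inl ⟨_, rfl, hm⟩⟩
  leaf_inl u r f h q hq hf :=
    (congrArg (fun P => (Coding.leaf (T.F ((A.multitopicData Q).comp u r f h).1) (Q.occ.enc P)).2)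
      (srcPt_inl u f r h q hq (fits_of_c_eq (cod_eq_lb h)).d rfl)).trans
    (congrArg Prod.snd (Coding.leaf_eq (T.good _) ((forest_comp T u f r h).symm.subset
      (Or.inr ⟨_, _, _, _, T.leaf_pL (R := Q.repl) (srcPt u r) (srcPt u q) rfl (srcPt_ne hq)
        (cod_eq_lb h) _, mem_leaf T u q, Prod.ext rfl (List.append_nil _).symm⟩))))
  leaf_inr u r f h p hf :=
    (congrArg (fun P => (Coding.leaf (T.F ((A.multitopicData Q).comp u r f h).1) (Q.occ.enc P)).2)
      (srcPt_inr u f r h p (fits_of_c_eq (cod_eq_lb h)).d)).trans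
    (congrArg Prod.snd (Coding.leaf_eq (T.good _) ((forest_comp T u f r h).symm.subset
      (Or.inr ⟨_, _, _, _, T.leaf_pR (R := Q.repl) (x := f.1) hf (srcPt f p) rfl (srcPt u r)
        (cod_eq_lb h) _, mem_leaf T u r, rfl⟩))))

theorem isFreeOn_mc (A : ManyToOneComputad.{u}) (Q : A.Parametrization) (n : ℕ) :
    ((A.multitopicData Q).mc n).IsFreeOn ((A.multitopicData Q).indet (n + 1)) := by
  obtain ⟨T⟩ := A.nonempty_forestSystem Q.occ n
  exact (treeData T).isFreeOn (A.isMulticategory_mc Q n) Function.injective_id fun p h₁ h₂ =>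
    arrow_induction p h₁ fun u r v h hv hu => h₂ u r v h hv hu

theorem isMultitopicSet (A : ManyToOneComputad.{u}) (Q : A.Parametrization) :
    (A.multitopicData Q).IsMultitopicSet :=
  isMultitopicSet_of_isFreeOn A Q (A.isFreeOn_mc Q)

end ManyToOneComputad

namespace Computad

open OccSystem

variable {A B : Computad.{u}} {n m : ℕ}

/-- Maps of `n`-cells that preserve composition, identities and indeterminates. -/
structure PreservesComp (f : A.C n → B.C n) : Prop where
  composable : ∀ {k : ℕ} (hk : k < n) {u v : A.C n}, A.d k hk.le u = A.c k hk.le v →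
    B.d k hk.le (f u) = B.c k hk.le (f v)
  comp : ∀ {k : ℕ} (hk : k < n) (u v : A.C n) (h) (h'), f (A.comp k hk u v h) = B.comp k hk (f u) (f v) h'
  one : ∀ {k : ℕ} (hk : k < n) (b : A.C k), ∃ b', f (A.one n hk.le b) = B.one n hk.le b'
  indet : ∀ x ∈ A.indet n, f x ∈ B.indet n

/-- Maps of occurrences that are compatible with composition. -/
structure OccMap (O : A.OccSystem) (O' : B.OccSystem) (f : A.C n → B.C n) where
  W : O.Pt n → O'.Pt n
  fst : ∀ P, (W P).1 = f P.1
  map_cL : ∀ {k : ℕ} (hk : k < n) (P : O.Pt n) (v) (h) (h'), W (O.cL hk P v h) = O'.cL hk (W P) (f v) h'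
  map_cR : ∀ {k : ℕ} (hk : k < n) (u) (P : O.Pt n) (h) (h'), W (O.cR hk u P h) = O'.cR hk (f u) (W P) h'

namespace PreservesComp

/-- Occurrences in the values of a map `f` as labels. -/
def labelData (O' : B.OccSystem) {f : A.C (n + 1) → B.C (n + 1)} (hf : PreservesComp f) : A.LabelData n where
  Y := O'.Pt (n + 1)
  ok u y := y.1 = f u
  L {k} hk u v h y hy := O'.cL hk y (f v) ((congrArg (B.d k hk.le) hy).trans (hf.composable hk h))
  R {k} hk u v h y hy := O'.cR hk (f u) y ((hf.composable hk h).trans (congrArg (B.c k hk.le) hy.symm))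
  ok_L hk u v h y hy := (B.comp_congr hk hy rfl _ (hf.composable hk h)).trans (hf.comp hk u v h _).symm
  ok_R hk u v h y hy := (B.comp_congr hk rfl hy _ (hf.composable hk h)).trans (hf.comp hk u v h _).symm
  LL hk t s w h₁ h₂ h₃ h₄ y hy hy' := by
    obtain ⟨_, y⟩ := y
    cases hy
    have e := hf.comp hk s w h₃ (hf.composable hk h₃)
    have h₄' := (hf.composable hk h₄).trans (congrArg _ e)
    exact (cL_cL hk _ _ _ _ _ _ h₄').trans (cL_congr hk rfl e.symm _ _)
  LR hk t s w h₁ h₂ h₃ h₄ y hy hy' hy'' := by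
    obtain ⟨_, y⟩ := y
    cases hy
    exact cL_cR hk _ _ _ _ _ _ _
  RR hk t s w h₁ h₂ h₃ h₄ y hy hy' := by
    obtain ⟨_, y⟩ := y
    cases hy
    have e := hf.comp hk t s h₁ (hf.composable hk h₁)
    have h₂' := (congrArg _ e.symm).trans (hf.composable hk h₂)
    exact (cR_congr hk rfl e _ h₂').trans (cR_comp hk _ _ _ _ _ _ _)
  X₁ hl hk hlk t t' s s' h₁ h₂ h₃ h₄ h₅ h₆ y hy hy' hy'' := by
    obtain ⟨_, y⟩ := y
    cases hy
    have e := hf.comp hk s s' h₂ (hf.composable hk h₂)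
    have e' := hf.comp hl t' s' h₅ (hf.composable hl h₅)
    exact (cL_congr hl rfl e _ ((congrArg (B.d _ hl.le) hy').trans ((hf.composable hl h₃).trans (congrArg _ e)))).trans
      ((exch_LL hk hl hlk _ _ _ _ _ _ _ _ _
        ((congrArg (B.d _ hk.le) hy'').trans ((hf.composable hk h₆).trans (congrArg _ e')))).trans
        (cL_congr hk rfl e'.symm _ _))
  X₂ hl hk hlk t t' s s' h₁ h₂ h₃ h₄ h₅ h₆ y hy hy' hy'' := by
    obtain ⟨_, y⟩ := y
    cases hy
    have e := hf.comp hk s s' h₂ (hf.composable hk h₂)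
    have e' := hf.comp hl t s h₄ (hf.composable hl h₄)
    exact (cL_congr hl rfl e _ ((congrArg (B.d _ hl.le) hy').trans ((hf.composable hl h₃).trans (congrArg _ e)))).trans
      ((exch_LR hk hl hlk _ _ _ _ _ _ _ _ _
        ((congrArg _ e'.symm).trans ((hf.composable hk h₆).trans (congrArg (B.c _ hk.le) hy''.symm)))).trans
        (cR_congr hk rfl e'.symm _ _))
  X₃ hl hk hlk t t' s s' h₁ h₂ h₃ h₄ h₅ h₆ y hy hy' hy'' := by
    obtain ⟨_, y⟩ := y
    cases hy
    have e := hf.comp hk t t' h₁ (hf.composable hk h₁)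
    have e' := hf.comp hl t' s' h₅ (hf.composable hl h₅)
    exact (cR_congr hl rfl e _ ((congrArg _ e.symm).trans ((hf.composable hl h₃).trans
        (congrArg (B.c _ hl.le) hy'.symm)))).trans
      ((exch_RL hk hl hlk _ _ _ _ _ _ _ _ _
        ((congrArg (B.d _ hk.le) hy'').trans ((hf.composable hk h₆).trans (congrArg _ e')))).trans
        (cL_congr hk rfl e'.symm _ _))
  X₄ hl hk hlk t t' s s' h₁ h₂ h₃ h₄ h₅ h₆ y hy hy' hy'' := by
    obtain ⟨_, y⟩ := y
    cases hy
    have e := hf.comp hk t t' h₁ (hf.composable hk h₁)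
    have e' := hf.comp hl t s h₄ (hf.composable hl h₄)
    exact (cR_congr hl rfl e _ ((congrArg _ e.symm).trans ((hf.composable hl h₃).trans
        (congrArg (B.c _ hl.le) hy'.symm)))).trans
      ((exch_RR hk hl hlk _ _ _ _ _ _ _ _ _
        ((congrArg _ e'.symm).trans ((hf.composable hk h₆).trans (congrArg (B.c _ hk.le) hy''.symm)))).trans
        (cR_congr hk rfl e'.symm _ _))
  one_R hk b t h y hy := by
    obtain ⟨b', e⟩ := hf.one hk b
    exact cR_one hk e y _
  L_one hk b t h y hy := by
    obtain ⟨b', e⟩ := hf.one hk b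
    exact cL_one hk e y _

theorem nonempty_occMap (O : A.OccSystem) (O' : B.OccSystem) {f : A.C n → B.C n} (hf : PreservesComp f) :
    Nonempty (OccMap O O' f) := by
  have hocc : ∀ x ∈ A.indet n, ∃ y : O'.Pt n, y.1 = f x := fun x hx => by
    obtain ⟨r, -, -⟩ := (O'.occ_indet _ (hf.indet x hx)).1
    exact ⟨⟨_, r⟩, rfl⟩
  cases n with
  | zero =>
    have h : ∀ P : O.Pt 0, P.1 ∈ A.indet 0 := fun P => by rw [A.indet_zero]; trivial
    choose W hW using hocc
    exact ⟨⟨fun P => W P.1 (h P), fun P => hW _ _, fun hk => (Nat.not_lt_zero _ hk).elim,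
      fun hk => (Nat.not_lt_zero _ hk).elim⟩⟩
  | succ n =>
    choose W hW using hocc
    obtain ⟨e, he, -, h₂, h₃⟩ := (hf.labelData O').exists_labelling O W hW
    exact ⟨⟨fun P => e P.1 P.2, fun P => he _ _, fun hk P v h h' => h₂ hk _ _ _ _,
      fun hk u P h h' => h₃ hk _ _ _ _⟩⟩

end PreservesComp

theorem OccSystem.pt_eq_of_indet {O : A.OccSystem} {S T : O.Pt n} (hS : S.1 ∈ A.indet n) (e : S.1 = T.1) : S = T := by
  obtain ⟨_, p⟩ := S
  obtain ⟨_, q⟩ := T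
  cases e
  rw [occ_indet_subsingleton hS p q]

namespace OccMap

variable {O : A.OccSystem} {O' : B.OccSystem} {f : A.C n → B.C n} {g : A.C m → B.C m}
  (W : OccMap O O' f) (V : OccMap O O' g)

section

variable {k : ℕ} (hk : k < n) (hf : PreservesComp f)
include hf

theorem composable_L {P : O.Pt n} {v} (h : A.d k hk.le P.1 = A.c k hk.le v) :
    B.d k hk.le (W.W P).1 = B.c k hk.le (f v) :=
  (congrArg (B.d k hk.le) (W.fst P)).trans (hf.composable hk h)

theorem composable_R {u} {P : O.Pt n} (h : A.d k hk.le u = A.c k hk.le P.1) :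
    B.d k hk.le (f u) = B.c k hk.le (W.W P).1 :=
  (hf.composable hk h).trans (congrArg (B.c k hk.le) (W.fst P).symm)

end

theorem fst_indet (hf : PreservesComp f) {P : O.Pt n} (h : P.1 ∈ A.indet n) : (W.W P).1 ∈ B.indet n :=
  (W.fst P).symm ▸ hf.indet _ h

theorem lb_map (hf : PreservesComp f) (P : O.Pt n) : lb (W.W P) = f (lb P) := by
  induction P using pt_induction with
  | hx P hP => rw [lb_of_indet hP, lb_of_indet (W.fst_indet hf hP), W.fst]
  | hL k hk P s h ih =>
    rw [W.map_cL hk P s h (W.composable_L hk hf h), lb_cL, lb_cL, ih]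
  | hR k hk s P h ih =>
    rw [W.map_cR hk s P h (W.composable_R hk hf h), lb_cR, lb_cR, ih]

theorem injective (hf : PreservesComp f) {P Q : O.Pt n} (e : Q.1 = P.1) (h : W.W Q = W.W P) : Q = P := by
  by_contra ne
  revert h
  refine pair_induction (fun P Q => W.W Q ≠ W.W P) ?_ ?_ ?_ ?_ P Q e ne
  · intro k hk P Q s h h' e ne ih e'
    rw [W.map_cL hk Q s h' (W.composable_L hk hf h'), W.map_cL hk P s h (W.composable_L hk hf h)] at e'
    exact ih (cL_injective hk ((W.fst Q).trans ((congrArg f e).trans (W.fst P).symm)) e')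
  · intro k hk s P Q h h' e ne ih e'
    rw [W.map_cR hk s Q h' (W.composable_R hk hf h'), W.map_cR hk s P h (W.composable_R hk hf h)] at e'
    exact ih (cR_injective hk ((W.fst Q).trans ((congrArg f e).trans (W.fst P).symm)) e')
  · intro k hk P Q h e
    rw [W.map_cR hk P.1 Q h (W.composable_R hk hf h), W.map_cL hk P Q.1 h (W.composable_L hk hf h)] at e
    exact Replacement.cL_ne_cR_of_eq hk _ _ (W.fst P) (W.fst Q) _ _ e.symm
  · intro k hk P Q h e
    rw [W.map_cR hk Q.1 P h (W.composable_R hk hf h), W.map_cL hk Q P.1 h (W.composable_L hk hf h)] at e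
    exact Replacement.cL_ne_cR_of_eq hk _ _ (W.fst Q) (W.fst P) _ _ e

theorem surjective (hf : PreservesComp f) (u : A.C n) : ∀ T : O'.Pt n, T.1 = f u →
    ∃ P : O.Pt n, P.1 = u ∧ W.W P = T := by
  refine A.cell_induction (fun u => ∀ T : O'.Pt n, T.1 = f u → ∃ P : O.Pt n, P.1 = u ∧ W.W P = T)
    (fun x hx T hT => ?_) ?_ (fun k hk u v h hu hv T hT => ?_) u
  · obtain ⟨r, -, -⟩ := (O.occ_indet x hx).1
    exact ⟨⟨x, r⟩, rfl, pt_eq_of_indet (W.fst_indet hf hx) ((W.fst _).trans hT.symm)⟩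
  · rintro m rfl a ⟨_, p⟩ hT
    obtain ⟨b, e⟩ := hf.one m.lt_succ_self a
    cases hT.trans e
    exact ((occ_one_isEmpty m.lt_succ_self b).false p).elim
  · have h' := hf.composable hk h
    rcases pt_cases hk h' T (hT.trans (hf.comp hk u v h h')) with ⟨S, e, rfl⟩ | ⟨S, e, rfl⟩
    · obtain ⟨P, rfl, rfl⟩ := hu S e
      exact ⟨O.cL hk P v h, rfl, W.map_cL hk P v h _⟩
    · obtain ⟨P, rfl, rfl⟩ := hv S e
      exact ⟨O.cR hk u P h, rfl, W.map_cR hk u P h _⟩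

section rp

variable {W V} (R : O.Replacement) (R' : O'.Replacement) {h : n ≤ m} (hf : PreservesComp f)
  (hg : PreservesComp g) (hone : ∀ s, g (A.one m h s) = B.one m h (f s))
include hf hg hone

theorem map_rp (P : O.Pt n) : ∀ (v : A.C m) (hv) (hv'), g (R.rp h P v hv) = R'.rp h (W.W P) (g v) hv' := by
  induction P using pt_induction with
  | hx P hP =>
    intro v hv hv'
    rw [Replacement.rp_indet hP, Replacement.rp_indet (W.fst_indet hf hP)]
  | hL k hk P s h₁ ih =>
    intro v hv hv'
    have c := W.composable_L hk hf h₁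
    have e := W.map_cL hk P s h₁ c
    have hv₁ : B.Fits h (g v) (lb (O'.cL hk (W.W P) (f s) c)) := e ▸ hv'
    have hw := Replacement.rp_comp_L (R := R) hk h₁ (Replacement.fits_cL hk hv)
    have hw' := Replacement.rp_comp_L (R := R') hk c (Replacement.fits_cL hk hv₁)
    rw [Replacement.rp_congr e rfl hv' hv₁, Replacement.rp_cL hk P s v h₁ hv (Replacement.fits_cL hk hv) hw,
      Replacement.rp_cL hk _ _ _ c hv₁ (Replacement.fits_cL hk hv₁) hw', hg.comp (hk.trans_le h) _ _ _ (hg.composable (hk.trans_le h) hw)]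
    exact B.comp_congr _ (ih v _ _) (hone s) _ _
  | hR k hk s P h₁ ih =>
    intro v hv hv'
    have c := W.composable_R hk hf h₁
    have e := W.map_cR hk s P h₁ c
    have hv₁ : B.Fits h (g v) (lb (O'.cR hk (f s) (W.W P) c)) := e ▸ hv'
    have hw := Replacement.rp_comp_R (R := R) hk h₁ (Replacement.fits_cR hk hv)
    have hw' := Replacement.rp_comp_R (R := R') hk c (Replacement.fits_cR hk hv₁)
    rw [Replacement.rp_congr e rfl hv' hv₁, Replacement.rp_cR hk P s v h₁ hv (Replacement.fits_cR hk hv) hw,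
      Replacement.rp_cR hk _ _ _ c hv₁ (Replacement.fits_cR hk hv₁) hw', hg.comp (hk.trans_le h) _ _ _ (hg.composable (hk.trans_le h) hw)]
    exact B.comp_congr _ (hone s) (ih v _ _) _ _

theorem map_pR (P : O.Pt n) : ∀ (p : O.Pt m) (hv) (hv'), V.W (R.pR h P p hv) = R'.pR h (W.W P) (V.W p) hv' := by
  induction P using pt_induction with
  | hx P hP =>
    intro v hv hv'
    rw [Replacement.pR_indet hP, Replacement.pR_indet (W.fst_indet hf hP)]
  | hL k hk P s h₁ ih =>
    intro p hv hv'
    have c := W.composable_L hk hf h₁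
    have e := W.map_cL hk P s h₁ c
    have hv₁ : B.Fits h (V.W p).1 (lb (O'.cL hk (W.W P) (f s) c)) := e ▸ hv'
    have hw := Replacement.rp_comp_L (R := R) hk h₁ (Replacement.fits_cL hk hv)
    have hw' := Replacement.rp_comp_L (R := R') hk c (Replacement.fits_cL hk hv₁)
    rw [Replacement.pR_congr e rfl hv' hv₁, Replacement.pR_cL hk P s p h₁ hv (Replacement.fits_cL hk hv) hw,
      Replacement.pR_cL hk _ _ _ c hv₁ (Replacement.fits_cL hk hv₁) hw']
    exact (V.map_cL _ _ _ _ (V.composable_L (hk.trans_le h) hg (P := R.pR h P p _) hw)).trans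
      (cL_congr _ (ih p _ _) (hone s) _ _)
  | hR k hk s P h₁ ih =>
    intro p hv hv'
    have c := W.composable_R hk hf h₁
    have e := W.map_cR hk s P h₁ c
    have hv₁ : B.Fits h (V.W p).1 (lb (O'.cR hk (f s) (W.W P) c)) := e ▸ hv'
    have hw := Replacement.rp_comp_R (R := R) hk h₁ (Replacement.fits_cR hk hv)
    have hw' := Replacement.rp_comp_R (R := R') hk c (Replacement.fits_cR hk hv₁)
    rw [Replacement.pR_congr e rfl hv' hv₁, Replacement.pR_cR hk P s p h₁ hv (Replacement.fits_cR hk hv) hw,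
      Replacement.pR_cR hk _ _ _ c hv₁ (Replacement.fits_cR hk hv₁) hw']
    exact (V.map_cR _ _ _ _ (V.composable_R (hk.trans_le h) hg (P := R.pR h P p _) hw)).trans
      (cR_congr _ (ih p _ _) (hone s) _ _)

end rp

theorem map_pL {W : OccMap O O' f} (R : O.Replacement) (R' : O'.Replacement) (hf : PreservesComp f)
    (hrp : ∀ P v hv hv', f (R.rp le_rfl P v hv) = R'.rp le_rfl (W.W P) (f v) hv')
    (P Q : O.Pt n) (e : Q.1 = P.1) (ne : Q ≠ P) (v : A.C n) (hv) (hv') (e') (ne') :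
    W.W (R.pL P Q v hv e ne) = R'.pL (W.W P) (W.W Q) (f v) hv' e' ne' := by
  have he : ∀ {P Q : O.Pt n}, Q.1 = P.1 → (W.W Q).1 = (W.W P).1 := fun {P Q} e =>
    (W.fst Q).trans ((congrArg f e).trans (W.fst P).symm)
  have hne : ∀ {P Q : O.Pt n}, Q.1 = P.1 → Q ≠ P → W.W Q ≠ W.W P := fun e ne h => ne (W.injective hf e h)
  refine pair_induction (fun P Q => ∀ (e : Q.1 = P.1) (ne : Q ≠ P) hv hv' e' ne',
    W.W (R.pL P Q v hv e ne) = R'.pL (W.W P) (W.W Q) (f v) hv' e' ne') ?_ ?_ ?_ ?_ P Q e ne e ne hv hv' e' ne'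
  · intro k hk P Q s h₁ h₂ e ne ih e₁ ne₁ hv hv' e₂ ne₂
    have c := W.composable_L hk hf h₁
    have c' := W.composable_L hk hf h₂
    have eP := W.map_cL hk P s h₁ c
    have eQ := W.map_cL hk Q s h₂ c'
    have hv₁ : B.Fits le_rfl (f v) (lb (O'.cL hk (W.W P) (f s) c)) := eP ▸ hv'
    have hw := Replacement.rp_comp_L' (R := R) hk h₁ (Replacement.fits_cL hk hv)
    have hw' := Replacement.rp_comp_L' (R := R') hk c (Replacement.fits_cL hk hv₁)
    have en : O'.cL hk (W.W Q) (f s) c' ≠ O'.cL hk (W.W P) (f s) c := eP ▸ eQ ▸ ne₂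
    have ee : (O'.cL hk (W.W Q) (f s) c').1 = (O'.cL hk (W.W P) (f s) c).1 := eP ▸ eQ ▸ e₂
    rw [Replacement.pL_cL_cL hk P s Q v h₁ h₂ hv (Replacement.fits_cL hk hv) e₁ e ne₁ ne hw,
      Replacement.pL_congr eP eQ rfl hv' hv₁ e₂ ee ne₂ en,
      Replacement.pL_cL_cL hk _ _ _ _ c c' hv₁ (Replacement.fits_cL hk hv₁) ee (he e) en (hne e ne) hw']
    exact (W.map_cL hk _ s hw (W.composable_L hk hf (P := R.pL P Q v _ e ne) hw)).trans
      (cL_congr hk (ih e ne _ _ _ _) rfl _ _)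
  · intro k hk s P Q h₁ h₂ e ne ih e₁ ne₁ hv hv' e₂ ne₂
    have c := W.composable_R hk hf h₁
    have c' := W.composable_R hk hf h₂
    have eP := W.map_cR hk s P h₁ c
    have eQ := W.map_cR hk s Q h₂ c'
    have hv₁ : B.Fits le_rfl (f v) (lb (O'.cR hk (f s) (W.W P) c)) := eP ▸ hv'
    have hw := Replacement.rp_comp_R' (R := R) hk h₁ (Replacement.fits_cR hk hv)
    have hw' := Replacement.rp_comp_R' (R := R') hk c (Replacement.fits_cR hk hv₁)
    have en : O'.cR hk (f s) (W.W Q) c' ≠ O'.cR hk (f s) (W.W P) c := eP ▸ eQ ▸ ne₂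
    have ee : (O'.cR hk (f s) (W.W Q) c').1 = (O'.cR hk (f s) (W.W P) c).1 := eP ▸ eQ ▸ e₂
    rw [Replacement.pL_cR_cR hk P s Q v h₁ h₂ hv (Replacement.fits_cR hk hv) e₁ e ne₁ ne hw,
      Replacement.pL_congr eP eQ rfl hv' hv₁ e₂ ee ne₂ en,
      Replacement.pL_cR_cR hk _ _ _ _ c c' hv₁ (Replacement.fits_cR hk hv₁) ee (he e) en (hne e ne) hw']
    exact (W.map_cR hk s _ hw (W.composable_R hk hf (P := R.pL P Q v _ e ne) hw)).trans
      (cR_congr hk (ih e ne _ _ _ _) rfl _ _)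
  · intro k hk P Q h e₁ ne₁ hv hv' e₂ ne₂
    have c := W.composable_L hk hf h
    have c' := W.composable_R hk hf h
    have eP := W.map_cL hk P Q.1 h c
    have eQ := W.map_cR hk P.1 Q h c'
    have hv₁ : B.Fits le_rfl (f v) (lb (O'.cL hk (W.W P) (f Q.1) c)) := eP ▸ hv'
    have hw := Replacement.rp_comp_L' (R := R) hk h (Replacement.fits_cL hk hv)
    have hw' := (Replacement.rp_comp_L' (R := R') hk c (Replacement.fits_cL hk hv₁)).trans
      (congrArg (B.c k hk.le) (W.fst Q).symm)
    have en : O'.cR hk (f P.1) (W.W Q) c' ≠ O'.cL hk (W.W P) (f Q.1) c := eP ▸ eQ ▸ ne₂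
    have ee : (O'.cR hk (f P.1) (W.W Q) c').1 = (O'.cL hk (W.W P) (f Q.1) c).1 := eP ▸ eQ ▸ e₂
    rw [Replacement.pL_cL_cR hk P Q v h h hv (Replacement.fits_cL hk hv) e₁ ne₁ hw,
      Replacement.pL_congr eP eQ rfl hv' hv₁ e₂ ee ne₂ en,
      Replacement.pL_cL_cR_of_eq hk _ _ (W.fst P) (W.fst Q) _ c c' hv₁ (Replacement.fits_cL hk hv₁) ee en hw']
    exact (W.map_cR hk _ Q hw (W.composable_R hk hf hw)).trans (cR_congr hk rfl (hrp _ _ _ _) _ _)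
  · intro k hk P Q h e₁ ne₁ hv hv' e₂ ne₂
    have c := W.composable_R hk hf h
    have c' := W.composable_L hk hf h
    have eP := W.map_cR hk Q.1 P h c
    have eQ := W.map_cL hk Q P.1 h c'
    have hv₁ : B.Fits le_rfl (f v) (lb (O'.cR hk (f Q.1) (W.W P) c)) := eP ▸ hv'
    have hw := Replacement.rp_comp_R' (R := R) hk h (Replacement.fits_cR hk hv)
    have hw' := (congrArg (B.d k hk.le) (W.fst Q)).trans
      (Replacement.rp_comp_R' (R := R') hk c (Replacement.fits_cR hk hv₁))
    have en : O'.cL hk (W.W Q) (f P.1) c' ≠ O'.cR hk (f Q.1) (W.W P) c := eP ▸ eQ ▸ ne₂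
    have ee : (O'.cL hk (W.W Q) (f P.1) c').1 = (O'.cR hk (f Q.1) (W.W P) c).1 := eP ▸ eQ ▸ e₂
    rw [Replacement.pL_cR_cL hk P Q v h h hv (Replacement.fits_cR hk hv) e₁ ne₁ hw,
      Replacement.pL_congr eP eQ rfl hv' hv₁ e₂ ee ne₂ en,
      Replacement.pL_cR_cL_of_eq hk _ _ (W.fst P) (W.fst Q) _ c c' hv₁ (Replacement.fits_cR hk hv₁) ee en hw']
    exact (W.map_cL hk Q _ hw (W.composable_L hk hf hw)).trans (cL_congr hk rfl (hrp _ _ _ _) _ _)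

end OccMap

end Computad

namespace Computad

variable {A B : Computad.{u}}

theorem preservesComp_trunc {N n : ℕ} (T : OmegaCat.TruncFunctor A.toOmegaCat B.toOmegaCat N) (hn : n ≤ N)
    (hi : ∀ x ∈ A.indet n, T.map hn x ∈ B.indet n) : PreservesComp (A := A) (B := B) (T.map hn) where
  composable {k} hk {u v} h := (T.map_d hn hk.le u).symm.trans ((congrArg _ h).trans (T.map_c hn hk.le v))
  comp hk u v h h' := T.map_comp hn hk u v h h'
  one hk b := ⟨_, T.map_one hn hk.le b⟩
  indet := hi

theorem OccSystem.exists_mk {O : A.OccSystem} {n : ℕ} (P : O.Pt n) {u : A.C n} (e : P.1 = u) :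
    ∃ p : O.Occ u, (⟨u, p⟩ : O.Pt n) = P := by
  subst e; exact ⟨P.2, rfl⟩

end Computad

namespace ManyToOneComputad

open Computad Computad.OccSystem Computad.OccSystem.Replacement

variable {A B : ManyToOneComputad.{u}}

/-- Compatible maps of cells and occurrences in two consecutive dimensions. -/
structure StageMap (Q : A.Parametrization) (Q' : B.Parametrization) (n : ℕ) where
  f : A.C n → B.C n
  g : A.C (n + 1) → B.C (n + 1)
  hf : PreservesComp (A := A.toComputad) (B := B.toComputad) f
  hg : PreservesComp (A := A.toComputad) (B := B.toComputad) g
  map_d : ∀ u, f (A.d n n.le_succ u) = B.d n n.le_succ (g u)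
  map_c : ∀ u, f (A.c n n.le_succ u) = B.c n n.le_succ (g u)
  map_one : ∀ a, g (A.one (n + 1) n.le_succ a) = B.one (n + 1) n.le_succ (f a)
  W : OccMap Q.occ Q'.occ f
  V : OccMap Q.occ Q'.occ g

namespace StageMap

variable {Q : A.Parametrization} {Q' : B.Parametrization} {n : ℕ} (S : StageMap Q Q' n)

theorem c_eq_lb {P : Q.occ.Pt n} {v : A.C (n + 1)} (h : A.c n n.le_succ v = lb P) :
    B.c n n.le_succ (S.g v) = lb (S.W.W P) :=
  (S.map_c v).symm.trans ((congrArg S.f h).trans (S.W.lb_map S.hf P).symm)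

section

variable {u v : (A.multitopicData Q).P (n + 1)} {u' v' : (B.multitopicData Q').P (n + 1)}
  (hu : u'.1 = S.g u.1) (hv : v'.1 = S.g v.1) {r r'} (hr : srcPt u' r' = S.W.W (srcPt u r)) (h)
  (h' : (B.multitopicData Q').c v' = (B.multitopicData Q').lab ((B.multitopicData Q').d u') r')
include hv hr

theorem rp_eq (h : A.c n n.le_succ v.1 = lb (srcPt u r)) : Q'.repl.rp n.le_succ (srcPt u' r') v'.1 (fits_of_c_eq (cod_eq_lb h')) =
    S.g (Q.repl.rp n.le_succ (srcPt u r) v.1 (fits_of_c_eq h)) := by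
  have hc := S.c_eq_lb h
  exact (rp_congr hr hv _ (fits_of_c_eq hc)).trans
    (OccMap.map_rp (W := S.W) Q.repl Q'.repl S.hf S.hg S.map_one _ _ _ _).symm

omit hv in
theorem pR_eq (h : A.c n n.le_succ v.1 = lb (srcPt u r)) {p p'} (hp : (⟨v'.1, p'⟩ : Q'.occ.Pt (n + 1)) = S.V.W ⟨v.1, p⟩) :
    Q'.repl.pR n.le_succ (srcPt u' r') ⟨v'.1, p'⟩ (fits_of_c_eq (cod_eq_lb h')) =
    S.V.W (Q.repl.pR n.le_succ (srcPt u r) ⟨v.1, p⟩ (fits_of_c_eq h)) := by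
  have hc : B.c n n.le_succ (S.V.W ⟨v.1, p⟩).1 = lb (S.W.W (srcPt u r)) :=
    (congrArg (B.c n n.le_succ) (S.V.fst _)).trans (S.c_eq_lb h)
  exact (pR_congr hr hp _ (fits_of_c_eq hc)).trans
    (OccMap.map_pR (W := S.W) (V := S.V) Q.repl Q'.repl S.hf S.hg S.map_one _ _ _ _).symm

include hu

theorem comp_eq : ((B.multitopicData Q').comp u' r' v' h').1 = S.g ((A.multitopicData Q).comp u r v h).1 := by
  have hc := S.hg.composable n.lt_succ_self (rp_composable' u v r (cod_eq_lb h))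
  exact (B.comp_congr _ hu (S.rp_eq hv hr h' (cod_eq_lb h)) _ hc).trans
    (S.hg.comp n.lt_succ_self _ _ (rp_composable' u v r (cod_eq_lb h)) hc).symm

omit hu in
theorem occL_eq {p p'} (hp : (⟨u'.1, p'⟩ : Q'.occ.Pt (n + 1)) = S.V.W ⟨u.1, p⟩) :
    (⟨_, (B.multitopicData Q').occL u' r' v' h' p'⟩ : Q'.occ.Pt (n + 1)) =
      S.V.W ⟨_, (A.multitopicData Q).occL u r v h p⟩ := by
  have hc := rp_composable' u v r (cod_eq_lb h)
  have hc' := S.V.composable_L n.lt_succ_self S.hg (P := ⟨u.1, p⟩) hc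
  exact (cL_congr _ hp (S.rp_eq hv hr h' (cod_eq_lb h)) (rp_composable' u' v' r' (cod_eq_lb h')) hc').trans
    (S.V.map_cL n.lt_succ_self ⟨u.1, p⟩ _ hc hc').symm

omit hv in
theorem occR_eq {p p'} (hp : (⟨v'.1, p'⟩ : Q'.occ.Pt (n + 1)) = S.V.W ⟨v.1, p⟩) :
    (⟨_, (B.multitopicData Q').occR u' r' v' h' p'⟩ : Q'.occ.Pt (n + 1)) =
      S.V.W ⟨_, (A.multitopicData Q).occR u r v h p⟩ := by
  have hc := rp_composable' u v r (cod_eq_lb h)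
  have hc' := S.V.composable_R n.lt_succ_self S.hg
    (P := Q.repl.pR n.le_succ (srcPt u r) ⟨v.1, p⟩ (fits_of_c_eq (cod_eq_lb h))) hc
  exact (cR_congr _ (S.pR_eq hr h' (cod_eq_lb h) hp) hu (rp_composable' u' v' r' (cod_eq_lb h')) hc').trans
    (S.V.map_cR n.lt_succ_self u.1 (Q.repl.pR n.le_succ (srcPt u r) ⟨v.1, p⟩ (fits_of_c_eq (cod_eq_lb h))) hc hc').symm

omit hu

theorem inl_eq {q q'} (hq) (hq') (he : srcPt u' q' = S.W.W (srcPt u q)) :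
    srcPt _ ((B.multitopicData Q').inl u' r' v' h' q' hq') =
      S.W.W (srcPt _ ((A.multitopicData Q).inl u r v h q hq)) := by
  have hd : B.d n n.le_succ v'.1 = S.f (A.d n n.le_succ v.1) :=
    (congrArg (B.d n n.le_succ) hv).trans (S.map_d _).symm
  have hrp := fun P v hv hv' => OccMap.map_rp (W := S.W) Q.repl Q'.repl (h := le_rfl) S.hf S.hf
    (fun s => (congrArg S.f (A.one_self s)).trans (B.one_self _).symm) P v hv hv'
  have f' := (fits_of_c_eq (cod_eq_lb h')).d
  have f₁ : B.Fits le_rfl (S.f (A.d n n.le_succ v.1)) (lb (S.W.W (srcPt u r))) := hd ▸ hr ▸ f'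
  have e₁ : (S.W.W (srcPt u q)).1 = (S.W.W (srcPt u r)).1 := (S.W.fst _).trans (S.W.fst (srcPt u r)).symm
  have n₁ : S.W.W (srcPt u q) ≠ S.W.W (srcPt u r) := hr ▸ he ▸ srcPt_ne hq'
  exact (srcPt_inl u' v' r' h' q' hq' f' rfl).trans ((pL_congr hr he hd _ f₁ _ e₁ _ n₁).trans
    ((OccMap.map_pL (W := S.W) Q.repl Q'.repl S.hf hrp (srcPt u r) (srcPt u q) rfl (srcPt_ne hq) _ _ f₁ e₁ n₁).symm.trans
    (congrArg S.W.W (srcPt_inl u v r h q hq (fits_of_c_eq (cod_eq_lb h)).d rfl).symm)))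

omit hv in
theorem inr_eq {p p'} (hp : srcPt v' p' = S.W.W (srcPt v p)) :
    srcPt _ ((B.multitopicData Q').inr u' r' v' h' p') =
      S.W.W (srcPt _ ((A.multitopicData Q).inr u r v h p)) := by
  have f' := (fits_of_c_eq (cod_eq_lb h')).d
  have f₁ : B.Fits le_rfl (S.W.W (srcPt v p)).1 (lb (S.W.W (srcPt u r))) := hp ▸ hr ▸ f'
  exact (srcPt_inr u' v' r' h' p' f').trans ((pR_congr hr hp _ f₁).trans
    ((OccMap.map_pR (W := S.W) (V := S.W) Q.repl Q'.repl (h := le_rfl) S.hf S.hf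
      (fun s => (congrArg S.f (A.one_self s)).trans (B.one_self _).symm) (srcPt u r) (srcPt v p)
      (fits_of_c_eq (cod_eq_lb h)).d f₁).symm.trans
    (congrArg S.W.W (srcPt_inr u v r h p (fits_of_c_eq (cod_eq_lb h)).d).symm)))

end

end StageMap

variable (Q : A.Parametrization) (Q' : B.Parametrization)

theorem preservesComp_map (F : A ⟶ B) (n : ℕ) : PreservesComp (A := A.toComputad) (B := B.toComputad)
    (fun u : A.C n => F.map u) where
  composable {k} hk {u v} h := (F.map_d hk.le u).symm.trans ((congrArg F.map h).trans (F.map_c hk.le v))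
  comp hk u v h h' := F.map_comp hk u v h h'
  one hk b := ⟨_, F.map_one hk.le b⟩
  indet := F.map_indet

noncomputable def occMap (F : A ⟶ B) (n : ℕ) : OccMap Q.occ Q'.occ (fun u : A.C n => F.map u) :=
  ((preservesComp_map F n).nonempty_occMap _ _).some

/-- The effect of a computad functor in two consecutive dimensions. -/
noncomputable def stage (F : A ⟶ B) (n : ℕ) : StageMap Q Q' n where
  f u := F.map u
  g u := F.map u
  hf := preservesComp_map F n
  hg := preservesComp_map F (n + 1)
  map_d u := F.map_d _ u
  map_c u := F.map_c _ u
  map_one a := F.map_one _ a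
  W := occMap Q Q' F n
  V := occMap Q Q' F (n + 1)

theorem isMorphism_restrict (F : A ⟶ B) : MultitopicData.IsMorphism
    (S := A.multitopicData Q) (T := B.multitopicData Q') (restrict F) := by
  have hω : ∀ {n : ℕ} (u : (A.multitopicData Q).P n) (p : Q.occ.Occ u.1), ∃ q : Q'.occ.Occ (F.map u.1),
      (⟨_, q⟩ : Q'.occ.Pt n) = (occMap Q Q' F n).W ⟨u.1, p⟩ := fun u p => exists_mk _ ((occMap Q Q' F _).fst _)
  have hθ : ∀ {n : ℕ} (u : (A.multitopicData Q).P (n + 1)) (p : Q.occ.Occ (A.d n n.le_succ u.1)),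
      ∃ q : Q'.occ.Occ (B.d n n.le_succ (F.map u.1)),
      (⟨_, q⟩ : Q'.occ.Pt n) = (occMap Q Q' F n).W (srcPt u p) := fun u p =>
    exists_mk _ (((occMap Q Q' F _).fst _).trans (F.map_d _ _))
  choose ω ω_eq using @hω
  choose θ θ_eq using @hθ
  have bij : ∀ {n : ℕ} (a : A.C n) (b : B.C n) (e : b = F.map a) (χ : Q.occ.Occ a → Q'.occ.Occ b),
      (∀ p, (⟨b, χ p⟩ : Q'.occ.Pt n) = (occMap Q Q' F n).W ⟨a, p⟩) → Function.Bijective χ := by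
    intro n a b e χ hχ
    refine ⟨fun p q h => ?_, fun t => ?_⟩
    · have := (occMap Q Q' F n).injective (preservesComp_map F n) (P := ⟨a, q⟩) (Q := ⟨a, p⟩) rfl
        ((hχ p).symm.trans ((congrArg _ h).trans (hχ q)))
      exact eq_of_heq (Sigma.mk.inj this).2
    · obtain ⟨⟨_, p⟩, rfl, h⟩ := (occMap Q Q' F n).surjective (preservesComp_map F n) a ⟨b, t⟩ e
      exact ⟨p, eq_of_heq (Sigma.mk.inj ((hχ p).trans h)).2⟩
  have lab : ∀ {n : ℕ} {P : Q.occ.Pt n} {P' : Q'.occ.Pt n}, P' = (occMap Q Q' F n).W P → lb P' = F.map (lb P) := by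
    rintro n P _ rfl
    exact (occMap Q Q' F n).lb_map (preservesComp_map F n) P
  have comp_eq := fun {n : ℕ} {u v : (A.multitopicData Q).P (n + 1)} {r} h h' =>
    (stage Q Q' F n).comp_eq (u := u) (v := v) (r := r) (u' := restrict F (n + 1) u) (v' := restrict F (n + 1) v)
      (r' := θ u r) rfl rfl (θ_eq u r) h h'
  refine ⟨fun u => ω u, fun u => θ u, ⟨fun n x hx => F.map_indet _ hx, fun n => ?_, fun u => ?_, fun u => ?_,
    fun u r => ?_, fun u => ?_, fun u r => ?_, fun u r v h h' p => ?_, fun u r v h h' p => ?_⟩⟩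
  · refine ⟨fun _ => rfl, fun u => ?_, fun u p => ?_, fun u => ?_, fun x => ?_, fun u r v h h' => ?_,
      fun u r v h h' q hq hq' => ?_, fun u r v h h' p => ?_⟩
    · exact bij _ _ (F.map_d _ _).symm _ (θ_eq u)
    · exact Subtype.ext (Subtype.ext (lab (θ_eq u p)))
    · exact Subtype.ext (Subtype.ext (F.map_c _ _).symm)
    · exact Subtype.ext (F.map_one _ _)
    · exact Subtype.ext (comp_eq h h').symm
    · exact same_pos (comp_eq h h').symm ((θ_eq _ _).trans
        ((stage Q Q' F n).inl_eq (u' := restrict F (n + 1) u) (v' := restrict F (n + 1) v) (r' := θ u r) (q' := θ u q) rfl (θ_eq u r) h h' hq hq' (θ_eq u q)).symm)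
    · exact same_pos (comp_eq h h').symm ((θ_eq _ _).trans
        ((stage Q Q' F n).inr_eq (u' := restrict F (n + 1) u) (v' := restrict F (n + 1) v) (r' := θ u r) (p' := θ v p) (θ_eq u r) h h' (θ_eq v p)).symm)
  · exact Subtype.ext (F.map_d _ _).symm
  · exact (Subtype.ext (F.map_c _ _).symm)
  · exact same_occ ((θ_eq u r).trans (ω_eq _ r).symm)
  · exact bij _ _ rfl _ (ω_eq u)
  · exact Subtype.ext (lab (ω_eq u r))
  · exact same_occ ((ω_eq _ _).trans ((stage Q Q' F _).occL_eq (u' := restrict F (_ + 1) u) (v' := restrict F (_ + 1) v) (r' := θ u r) (p' := ω u p) rfl (θ_eq u r) h h' (ω_eq u p)).symm)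
  · exact same_occ ((ω_eq _ _).trans ((stage Q Q' F _).occR_eq (u' := restrict F (_ + 1) u) (v' := restrict F (_ + 1) v) (r' := θ u r) (p' := ω v p) rfl (θ_eq u r) h h' (ω_eq v p)).symm)

end ManyToOneComputad

namespace OmegaCat

/-- The restriction of an `ω`-functor to a truncation. -/
def Functor.trunc {A B : OmegaCat.{u}} (F : OmegaCat.Functor A B) (N : ℕ) : TruncFunctor A B N where
  map _ u := F.map u
  map_d _ hk u := F.map_d hk u
  map_c _ hk u := F.map_c hk u
  map_one _ h u := F.map_one h u
  map_comp _ hk u v h h' := F.map_comp hk u v h h'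

end OmegaCat

theorem Computad.truncFunctor_map_eq {A : Computad.{u}} {X : OmegaCat.{u}} {N N' : ℕ}
    (T : OmegaCat.TruncFunctor A.toOmegaCat X N) (T' : OmegaCat.TruncFunctor A.toOmegaCat X N')
    (hi : ∀ (n : ℕ) (hn : n ≤ N) (hn' : n ≤ N'), ∀ x ∈ A.indet n, T.map hn x = T'.map hn' x) :
    ∀ (n : ℕ) (hn : n ≤ N) (hn' : n ≤ N') (u : A.C n), T.map hn u = T'.map hn' u := by
  intro n
  induction n with
  | zero => exact fun hn hn' u => hi 0 hn hn' u (by rw [A.indet_zero]; trivial)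
  | succ n ih =>
    intro hn hn' u
    refine A.cell_induction (fun u => T.map hn u = T'.map hn' u) (hi _ hn hn') ?_
      (fun k hk u v h hu hv => ?_) u
    · rintro m e a
      obtain rfl : m = n := Nat.succ.inj e
      exact (T.map_one hn m.le_succ a).trans
        ((congrArg _ (ih (m.le_succ.trans hn) (m.le_succ.trans hn') a)).trans (T'.map_one hn' m.le_succ a).symm)
    · have c : X.d k hk.le (T.map hn u) = X.c k hk.le (T.map hn v) :=
        (T.map_d hn hk.le u).symm.trans ((congrArg _ h).trans (T.map_c hn hk.le v))
      have c' : X.d k hk.le (T'.map hn' u) = X.c k hk.le (T'.map hn' v) :=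
        (T'.map_d hn' hk.le u).symm.trans ((congrArg _ h).trans (T'.map_c hn' hk.le v))
      exact (T.map_comp hn hk u v h c).trans ((X.comp_congr hk hu hv c c').trans (T'.map_comp hn' hk u v h c').symm)

namespace ManyToOneComputad

open Computad Computad.OccSystem MultitopicData

variable {A B : ManyToOneComputad.{u}}

theorem restrict_injective {F G : A ⟶ B} (h : restrict F = restrict G) : F = G := by
  have key : ∀ (n : ℕ) (u : A.C n), F.map u = G.map u := fun n u =>
    A.truncFunctor_map_eq (F.toFunctor.trunc n) (G.toFunctor.trunc n)
      (fun m _ _ x hx => congrArg Subtype.val (congrFun (congrFun h m) ⟨x, A.isManyToOne_of_indet x hx⟩))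
      n le_rfl le_rfl u
  exact ComputadFunctor.ext (funext fun n => funext fun u => key n u)

variable {Q : A.Parametrization} {Q' : B.Parametrization}

/-- The functor `T` on a truncation agrees with `φ` on the indeterminates. -/
def AgreesOnIndets (φ : ∀ n, (A.multitopicData Q).P n → (B.multitopicData Q').P n) {N : ℕ}
    (T : OmegaCat.TruncFunctor A.toOmegaCat B.toOmegaCat N) : Prop :=
  ∀ (n : ℕ) (hn : n ≤ N) (x : A.C n) (hx : x ∈ A.indet n), T.map hn x = (φ n ⟨x, A.isManyToOne_of_indet x hx⟩).1

/-- A functor on a truncation in two consecutive dimensions. -/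
noncomputable def truncStage {N n : ℕ} (T : OmegaCat.TruncFunctor A.toOmegaCat B.toOmegaCat N) (hn : n + 1 ≤ N)
    (hf : PreservesComp (A := A.toComputad) (B := B.toComputad) (T.map (n.le_succ.trans hn)))
    (hg : PreservesComp (A := A.toComputad) (B := B.toComputad) (T.map hn))
    (V : OccMap Q.occ Q'.occ (T.map hn)) : StageMap Q Q' n where
  f := T.map (n.le_succ.trans hn)
  g := T.map hn
  hf := hf
  hg := hg
  map_d u := T.map_d hn _ u
  map_c u := T.map_c hn _ u
  map_one a := T.map_one hn _ a
  W := (hf.nonempty_occMap _ _).some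
  V := V

section

variable {φ : ∀ n, (A.multitopicData Q).P n → (B.multitopicData Q').P n}
  {ω : ∀ {n : ℕ} (u : (A.multitopicData Q).P n), (A.multitopicData Q).Occ u → (B.multitopicData Q').Occ (φ n u)}
  {θ : ∀ {n : ℕ} (u : (A.multitopicData Q).P (n + 1)), (A.multitopicData Q).Occ ((A.multitopicData Q).d u) →
    (B.multitopicData Q').Occ ((B.multitopicData Q').d (φ (n + 1) u))}
  (H : IsMorphismWith φ ω θ)
include H

theorem AgreesOnIndets.agrees {N : ℕ} {T : OmegaCat.TruncFunctor A.toOmegaCat B.toOmegaCat N}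
    (hT : AgreesOnIndets φ T) : ∀ (n : ℕ) (hn : n ≤ N) (V : OccMap Q.occ Q'.occ (T.map hn))
      (u : (A.multitopicData Q).P n), (φ n u).1 = T.map hn u.1 ∧
        ∀ p : Q.occ.Occ u.1, (⟨(φ n u).1, ω u p⟩ : Q'.occ.Pt n) = V.W ⟨u.1, p⟩ := by
  have hp : ∀ {n : ℕ} (hn : n ≤ N), PreservesComp (A := A.toComputad) (B := B.toComputad) (T.map hn) :=
    fun {n} hn => preservesComp_trunc (A := A.toComputad) (B := B.toComputad) T hn
      fun x hx => hT n hn x hx ▸ H.map_indet n ⟨x, A.isManyToOne_of_indet x hx⟩ hx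
  have same : ∀ {n : ℕ} {a b : (B.multitopicData Q').P n} {p : (B.multitopicData Q').Occ a}
      {q : (B.multitopicData Q').Occ b}, Same (B.multitopicData Q').Occ p q →
      (⟨a.1, p⟩ : Q'.occ.Pt n) = ⟨b.1, q⟩ := fun h =>
    congrArg (fun s : Sigma (B.multitopicData Q').Occ => (⟨s.1.1, s.2⟩ : Q'.occ.Pt _)) h
  have base : ∀ {n : ℕ} (hn : n ≤ N) (V : OccMap Q.occ Q'.occ (T.map hn)) (u : (A.multitopicData Q).P n),
      u.1 ∈ A.indet n → (φ n u).1 = T.map hn u.1 ∧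
        ∀ p : Q.occ.Occ u.1, (⟨(φ n u).1, ω u p⟩ : Q'.occ.Pt n) = V.W ⟨u.1, p⟩ := fun {n} hn V u hu =>
    ⟨(hT n hn u.1 hu).symm, fun p => pt_eq_of_indet (H.map_indet n u hu)
      ((hT n hn u.1 hu).symm.trans (V.fst ⟨u.1, p⟩).symm)⟩
  intro n
  induction n with
  | zero => exact fun hn V u => base hn V u (by rw [A.indet_zero]; trivial)
  | succ n ih =>
    intro hn V
    let S := truncStage T hn (hp _) (hp hn) V
    have ihS := ih (n.le_succ.trans hn) S.W
    refine arrow_induction _ (fun x => ⟨?_, fun p => ?_⟩) fun u r v h hv hu => ?_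
    · exact (congrArg Subtype.val ((H.isHom n).map_one x)).trans
        ((congrArg (B.one (n + 1) n.le_succ) (ihS x.1).1).trans (T.map_one hn n.le_succ x.1.1).symm)
    · exact ((isOccSystem A Q).occ_one x).false p |>.elim
    · have hv := base hn V v hv
      have hr : srcPt (φ (n + 1) u) (θ u r) = S.W.W (srcPt u r) :=
        (same (a := (B.multitopicData Q').d (φ (n + 1) u)) (H.theta_eq u r)).trans
          ((ihS ((A.multitopicData Q).d u)).2 r)
      have h' : (B.multitopicData Q').c (φ (n + 1) v) = (B.multitopicData Q').lab _ (θ u r) :=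
        Subtype.ext ((H.map_c v).trans ((congrArg (fun x => φ n x.1) h).trans
          (congrArg Subtype.val ((H.isHom n).src_pos u r)).symm))
      refine ⟨(congrArg Subtype.val ((H.isHom n).map_comp u r v h h')).trans
        (S.comp_eq hu.1 hv.1 hr h h'), fun p => ?_⟩
      obtain ⟨p | p, rfl⟩ := ((isOccSystem A Q).bijective u r v h).2 p
      · exact (same (H.map_occL u r v h h' p)).trans (S.occL_eq hv.1 hr h h' (hu.2 p))
      · exact (same (H.map_occR u r v h h' p)).trans (S.occR_eq hu.1 hr h h' (hv.2 p))

theorem AgreesOnIndets.map_eq {N : ℕ} {T : OmegaCat.TruncFunctor A.toOmegaCat B.toOmegaCat N}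
    (hT : AgreesOnIndets φ T) {n : ℕ} (hn : n ≤ N) (u : (A.multitopicData Q).P n) :
    T.map hn u.1 = (φ n u).1 := by
  have hp : PreservesComp (A := A.toComputad) (B := B.toComputad) (T.map hn) :=
    preservesComp_trunc (A := A.toComputad) (B := B.toComputad) T hn
      fun x hx => hT n hn x hx ▸ H.map_indet n ⟨x, A.isManyToOne_of_indet x hx⟩ hx
  exact (hT.agrees H n hn (hp.nonempty_occMap _ _).some u).1.symm

theorem exists_agreesOnIndets (N : ℕ) :
    ∃ T : OmegaCat.TruncFunctor A.toOmegaCat B.toOmegaCat N, AgreesOnIndets φ T := by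
  induction N with
  | zero =>
    refine ⟨⟨fun {n} hn u => match n, hn, u with | 0, _, u => (φ 0 ⟨u, trivial⟩).1, ?_, ?_, ?_, ?_⟩, ?_⟩
    · intro n k hn hk u
      obtain rfl := Nat.le_zero.1 hn
      obtain rfl := Nat.le_zero.1 hk
      rw [A.d_self, B.d_self]
    · intro n k hn hk u
      obtain rfl := Nat.le_zero.1 hn
      obtain rfl := Nat.le_zero.1 hk
      rw [A.c_self, B.c_self]
    · intro n m hm h u
      obtain rfl := Nat.le_zero.1 hm
      obtain rfl := Nat.le_zero.1 h
      rw [A.one_self, B.one_self]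
    · intro n k hn hk
      omega
    · intro n hn x hx
      obtain rfl := Nat.le_zero.1 hn
      rfl
  | succ N ih =>
    obtain ⟨T, hT⟩ := ih
    obtain ⟨T', ⟨h₁, h₂⟩, -⟩ := A.free N B.toOmegaCat T
      (fun x => (φ (N + 1) ⟨x.1, A.isManyToOne_of_indet _ x.2⟩).1)
      (fun x => (congrArg Subtype.val (H.map_d ⟨x.1, A.isManyToOne_of_indet _ x.2⟩)).trans
        (hT.map_eq H le_rfl ((A.multitopicData Q).d ⟨x.1, A.isManyToOne_of_indet _ x.2⟩)).symm)
      (fun x => (congrArg Subtype.val (H.map_c ⟨x.1, A.isManyToOne_of_indet _ x.2⟩)).trans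
        (hT.map_eq H le_rfl ((A.multitopicData Q).c ⟨x.1, A.isManyToOne_of_indet _ x.2⟩).1).symm)
    refine ⟨T', fun n hn x hx => ?_⟩
    rcases hn.lt_or_eq with h | rfl
    · exact (h₁ (Nat.lt_succ_iff.1 h) x).trans (hT _ _ x hx)
    · exact h₂ ⟨x, hx⟩

theorem exists_restrict_eq : ∃ F : A ⟶ B, restrict F = φ := by
  choose T hT using exists_agreesOnIndets H
  have eq : ∀ {n N : ℕ} (hn : n ≤ N) (u : A.C n), (T n).map le_rfl u = (T N).map hn u := fun {n N} hn u =>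
    A.truncFunctor_map_eq (T n) (T N) (fun m h h' x hx => (hT n m h x hx).trans (hT N m h' x hx).symm)
      n le_rfl hn u
  refine ⟨⟨⟨fun {n} u => (T n).map le_rfl u, fun {n k} hk u => ?_, fun {n k} hk u => ?_, fun {n m} hm u => ?_,
    fun {n k} hk u v h h' => (T n).map_comp le_rfl hk u v h h'⟩, fun {n} x hx => ?_⟩, ?_⟩
  · exact (eq hk _).trans ((T n).map_d le_rfl hk u)
  · exact (eq hk _).trans ((T n).map_c le_rfl hk u)
  · exact ((T m).map_one le_rfl hm u).trans (congrArg _ (eq hm u).symm)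
  · exact Set.mem_of_eq_of_mem (hT n n le_rfl x hx) (H.map_indet n ⟨x, A.isManyToOne_of_indet x hx⟩ hx)
  · exact funext fun n => funext fun u => Subtype.ext ((hT n).map_eq H le_rfl u)

end

end ManyToOneComputad

theorem theoremL :
    (∀ A : ManyToOneComputad.{u}, Nonempty A.Parametrization) ∧
    ∀ Q : (∀ A : ManyToOneComputad.{u}, A.Parametrization),
      ∃ (hobj : ∀ A : ManyToOneComputad.{u}, (A.multitopicData (Q A)).IsMultitopicSet)
        (hmap : ∀ {A B : ManyToOneComputad.{u}} (F : A ⟶ B), MultitopicData.IsMorphism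
          (S := A.multitopicData (Q A)) (T := B.multitopicData (Q B))
          (ManyToOneComputad.restrict F)),
        (multitopicFunctor Q hobj hmap).Full ∧ (multitopicFunctor Q hobj hmap).Faithful := by
  refine ⟨fun A => A.nonempty_parametrization, fun Q => ⟨fun A => A.isMultitopicSet (Q A),
    fun F => ManyToOneComputad.isMorphism_restrict _ _ F, ⟨fun {A B} φ => ?_⟩,
    ⟨fun {A B F G} h => ManyToOneComputad.restrict_injective (congrArg Subtype.val h)⟩⟩⟩
  obtain ⟨φ, ω, θ, H⟩ := φ
  obtain ⟨F, rfl⟩ := ManyToOneComputad.exists_restrict_eq H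
  exact ⟨F, rfl⟩
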